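/- Let $r\ge 1$, $\delta\ge 0$, let $\alpha_1,\dots,\alpha_r\in\mathbb R$ satisfy $|\alpha_1|>\dots>|\alpha_r|>0$ and $\alpha_1>0$, and for $1\le i\le r$ let $(L_i(N))_{N\ge1}$ be integers with $L_i(N)\ge N$ such that $L_i(N)/N$ converges as $N\to\infty$. For $l\ge1$ put $\kappa_l(N)=\delta\,\mathbf 1_{l=2}+\sum_{i=1}^r\alpha_i^{\,l}\,L_i(N)/N$ and assume $\kappa_l(N)\ge0$ for all $N,l\ge1$. Let $V_N(z)=\frac1z+\sum_{l\ge1}\kappa_l(N)z^{l-1}$, and let $z_c(N)$ be the unique zero of $V_N'$ in $(0,1/\alpha_1)$. Let $X(N)$ be the random variable with values in $\{-1,0,1,\dots\}$ and $$\mathbb P(X(N)=-1)=\frac1{z_c(N)V_N(z_c(N))},\qquad \mathbb P(X(N)=l)=\frac{\kappa_{l+1}(N)z_c(N)^l}{V_N(z_c(N))}\quad(l\ge0).$$ For integers $x,y\ge0$ and $L\ge1$, let $(W(t))_{t=0}^{L}$ be the random walk with i.i.d. increments distributed as $X(N)$, started at $W(0)=x$ and conditioned on $W(L)=y$ and $W(t)\ge0$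 for all $0\le t\le L$ (assuming that this event has positive probability). Then there are constants $C,c>0$, depending only on $\delta$, the $\alpha_i$ and the sequences $L_i(\cdot)$, such that the following holds for all $N\ge1$, all $x,y,L$ as above, all $k\ge1$, all integer intervals $[\![X_i,Y_i]\!]\subset[\![0,L]\!]$ $(1\le i\le k)$ with $Y_i-X_i\ge1$ that are pairwise disjoint except possibly at endpoints (that is, $Y_i\le X_j$ or $Y_j\le X_i$ for $i\ne j$), and all integers $a_1,\dots,a_k\ge1$. With $V_i=W(X_i)-\min_{[\![X_i,Y_i]\!]}W+1$ and $a=a_1+\dots+a_k$, $$\mathbb E\Big[\prod_{i=1}^k\frac{V_i^{a_i}}{a_i!}\Big]<C^a\log(\max(a,2))^a\Big(a^{-a/2}L^{a/2}+a^{-a}\max(x-y,0)^a\Big),$$ and for all $h>0$ $$\mathbb E\Big[\prod_{i=1}^k\frac{V_i^{a_i}}{a_i!}\big(\mathbf 1_{\max W>\max(x,y)+h\sqrt L}+\mathbf 1_{\min W<\min(x,y)-h\sqrt L}\big)\Big]<C^a\log(\max(a,2))^a\Big(a^{-a/2}L^{a/2}+a^{-a}\big(\max(x-y,0)+h\sqrt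 L\big)^a\Big)e^{-ch^2}.$$ -/

import Mathlib

namespace WalkBridge

/-- The finite-`N` free cumulants
`κ_l(N) = δ 1_{l = 2} + ∑ i, α_i ^ l * L_i(N) / N` (meant for `l ≥ 1`). -/
noncomputable def kappa {K : ℕ} (δ : ℝ) (α : Fin K → ℝ) (Lag : Fin K → ℕ → ℕ)
    (N l : ℕ) : ℝ :=
  (if l = 2 then δ else 0) + ∑ i, α i ^ l * ((Lag i N : ℝ) / N)

/-- The Voiculescu transform `V(z) = 1 / z + ∑_{l ≥ 1} κ_l z ^ (l - 1)`. -/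
noncomputable def voiculescu (κ : ℕ → ℝ) (z : ℝ) : ℝ :=
  1 / z + ∑' l : ℕ, κ (l + 1) * z ^ l

/-- `z` is the critical point of `V` in `(0, r)`, `r` being the radius of convergence. -/
def IsCriticalPoint (κ : ℕ → ℝ) (r z : ℝ) : Prop :=
  0 < z ∧ z < r ∧ deriv (voiculescu κ) z = 0

/-- The law of one increment:
`P(-1) = 1 / (V(z) z)` and `P(l) = κ_{l+1} z ^ l / V(z)` for `l ≥ 0`. -/
noncomputable def stepProb (κ : ℕ → ℝ) (z : ℝ) (l : ℤ) : ℝ :=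
  if l = -1 then 1 / (voiculescu κ z * z)
  else if 0 ≤ l then κ (l.toNat + 1) * z ^ l.toNat / voiculescu κ z
  else 0

/-- Integer paths of length `L` from `x` to `y` that stay nonnegative and whose increments
are at least `-1`. -/
def bridgeSet (x y L : ℕ) : Set (Fin (L + 1) → ℤ) :=
  {W | W 0 = x ∧ W (Fin.last L) = y ∧ (∀ t, 0 ≤ W t) ∧
    ∀ t : Fin L, -1 ≤ W t.succ - W t.castSucc}

theorem bridgeSet_finite (x y L : ℕ) : (bridgeSet x y L).Finite := by
  refine (Set.Finite.pi' (fun _ : Fin (L + 1) => Set.finite_Icc (0 : ℤ) (y + L))).subset ?_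
  rintro W ⟨-, hy, h0, hs⟩ t
  refine ⟨h0 t, ?_⟩
  have key : W t ≤ y + L - (t : ℕ) := by
    induction t using Fin.reverseInduction with
    | last => simp [hy]
    | cast i ih =>
      have := hs i
      simp only [Fin.val_succ, Fin.val_castSucc] at ih ⊢
      push_cast at ih
      linarith
  have : (0 : ℤ) ≤ (t : ℕ) := by positivity
  linarith

/-- The finite set of nonnegative walk bridges from `x` to `y` of length `L`. -/
noncomputable def bridges (x y L : ℕ) : Finset (Fin (L + 1) → ℤ) :=
  (bridgeSet_finite x y L).toFinset

/-- The weight of a path: the product of the probabilities of its increments. -/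
noncomputable def weight (κ : ℕ → ℝ) (z : ℝ) {L : ℕ} (W : Fin (L + 1) → ℤ) : ℝ :=
  ∏ t : Fin L, stepProb κ z (W t.succ - W t.castSucc)

/-- The partition function of the nonnegative walk bridges from `x` to `y` of length `L`. -/
noncomputable def partitionFn (κ : ℕ → ℝ) (z : ℝ) (x y L : ℕ) : ℝ :=
  ∑ W ∈ bridges x y L, weight κ z W

/-- The expectation of `f` under the random walk with independent increments of law
`stepProb κ z`, started at `x`, conditioned to be at `y` at time `L` and to stay nonnegative. -/
noncomputable def bridgeExp (κ : ℕ → ℝ) (z : ℝ) (x y L : ℕ)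
    (f : (Fin (L + 1) → ℤ) → ℝ) : ℝ :=
  (∑ W ∈ bridges x y L, weight κ z W * f W) / partitionFn κ z x y L

/-- `V = W(X) - min_{⟦X, Y⟧} W + 1` (the infimum is over a finite set, nonempty if `X ≤ Y`). -/
noncomputable def depth {L : ℕ} (W : Fin (L + 1) → ℤ) (X Y : Fin (L + 1)) : ℤ :=
  W X - sInf (W '' Set.Icc X Y) + 1

/-- `max W` over the whole time interval. -/
noncomputable def walkMax {L : ℕ} (W : Fin (L + 1) → ℤ) : ℤ :=
  Finset.univ.sup' Finset.univ_nonempty W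

/-- `min W` over the whole time interval. -/
noncomputable def walkMin {L : ℕ} (W : Fin (L + 1) → ℤ) : ℤ :=
  Finset.univ.inf' Finset.univ_nonempty W

open Classical in
/-- The indicator of a proposition, as a real number. -/
noncomputable def ind (p : Prop) : ℝ := if p then 1 else 0

end WalkBridge

/-! Between fixed end points the law of the walk is insensitive to exponential tilting: the sum of
the steps of a bridge is determined by its end points, so replacing `z` by another parameter
multiplies the weights of all bridges by one constant. Dividing `κ_l` by `α_1 ^ l` leaves weights
that equal one at `l = 0`, are bounded, and are at least `1 / 2` from some index on, uniformly in
`N`, because the term of `α_1` dominates (`exists_wt`). Everything is proved for such weights `k`,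
with the tilt `q` chosen afresh according to the slope of the bridge.

The core is `exists_bounds`. For `0 ≤ λ ≤ c` the exponential moment of `λ` times the sum of the
descents over disjoint intervals is at most `D ^ (r + 1) * exp (D (λ² L + λ (x - y)⁺))`, `r` being
the number of intervals, and an excursion by `h √L` beyond both end points has probability at most
`D exp (-c h²)`. The moments follow from `V ^ a / a! ≤ λ ^ (-a) exp (λ V)` with `λ` of order `min
(√(a / L)) (a / (x - y)⁺)`. This gives the bound without a logarithm; since `log (max a 2) ≥ 1 / 2`,
the logarithm is absorbed by the constant. The second estimate combines the moments for doubled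
exponents with the excursion bound.

Three ranges of slope are treated. For central slopes the tilt whose mean step is the slope stays in
a compact set, so that a uniform local limit theorem (`exists_local_limit`) and uniform exponential
moments hold (`exists_good`). A bridge has probability at least `c / √L` times the probabilities
that the walk from `x` and the reversed walk from `y` survive for `L / 4` steps
(`exists_bridge_ge`): by the Harris inequality, both climb to height of order `√L` above the chord
while surviving, and up there the positivity constraint is harmless. The matching upper bound holds
for functionals of one half of the bridge, so these reduce to the walk conditioned only to survive
(`exists_functional_le`). There, Harris removes the conditioning for functionals of the favourable
monotonicity, and a first passage argument handles the running maximum in the other direction. The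
decomposition `descent_le` writes all descents in these terms.

For steep and flat bridges cruder bounds, lossy by `exp (D √L)`, suffice. The bridge probability is
bounded below by letting a strongly drifting walk run freely and correcting its end point with one
jump. For steep bridges the loss is absorbed by `λ √L ≤ 1 + λ² L`; for flat bridges the term `(x -
y)⁺` already has order `L`. In the excursion bound the loss is harmless because only `h ≤ √L`
matters, and then `h √L ≥ h²`. -/

namespace WalkBridge

open scoped ENNReal

/-! ### Expectations over independent identically distributed sequences -/

/-- The expectation of `F` over lists of `n` independent entries of law `p`. -/
noncomputable def Ex (p : ℕ → ℝ≥0∞) : ℕ → (List ℕ → ℝ≥0∞) → ℝ≥0∞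
  | 0, F => F []
  | n + 1, F => ∑' s, p s * Ex p n (fun l => F (s :: l))

open Classical in
/-- The indicator of a proposition, as an extended nonnegative real. -/
noncomputable def one (P : Prop) : ℝ≥0∞ := if P then 1 else 0

theorem one_true {P : Prop} (h : P) : one P = 1 := by simp [one, h]

theorem one_false {P : Prop} (h : ¬ P) : one P = 0 := by simp [one, h]

theorem one_le (P : Prop) : one P ≤ 1 := by unfold one; split_ifs <;> simp

theorem one_mono {P Q : Prop} (h : P → Q) : one P ≤ one Q := by
  by_cases hP : P
  · rw [one_true hP, one_true (h hP)]
  · rw [one_false hP]; exact zero_le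

theorem one_congr {P Q : Prop} (h : P ↔ Q) : one P = one Q :=
  le_antisymm (one_mono h.1) (one_mono h.2)

theorem one_and (P Q : Prop) : one (P ∧ Q) = one P * one Q := by
  by_cases hP : P <;> by_cases hQ : Q <;> simp [one, hP, hQ]

theorem one_or_le (P Q : Prop) : one (P ∨ Q) ≤ one P + one Q := by
  by_cases hP : P <;> by_cases hQ : Q <;> simp [one, hP, hQ]

theorem one_add_one_not (P : Prop) : one P + one (¬ P) = 1 := by
  by_cases hP : P <;> simp [one, hP]

section Basic

variable (p : ℕ → ℝ≥0∞)

theorem Ex_mono {n : ℕ} {F G : List ℕ → ℝ≥0∞} (h : ∀ l, l.length = n → F l ≤ G l) :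
    Ex p n F ≤ Ex p n G := by
  induction n generalizing F G with
  | zero => exact h [] rfl
  | succ n ih =>
    refine ENNReal.tsum_le_tsum fun s => ?_
    gcongr
    exact ih fun l hl => h _ (by simp [hl])

theorem Ex_congr {n : ℕ} {F G : List ℕ → ℝ≥0∞} (h : ∀ l, l.length = n → F l = G l) :
    Ex p n F = Ex p n G :=
  le_antisymm (Ex_mono p fun l hl => (h l hl).le) (Ex_mono p fun l hl => (h l hl).ge)

theorem Ex_add (n : ℕ) (F G : List ℕ → ℝ≥0∞) :
    Ex p n (fun l => F l + G l) = Ex p n F + Ex p n G := by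
  induction n generalizing F G with
  | zero => rfl
  | succ n ih => simp only [Ex, ih, mul_add, ENNReal.tsum_add]

theorem Ex_const_mul (n : ℕ) (c : ℝ≥0∞) (F : List ℕ → ℝ≥0∞) :
    Ex p n (fun l => c * F l) = c * Ex p n F := by
  induction n generalizing F with
  | zero => rfl
  | succ n ih =>
    simp only [Ex, ih, ← ENNReal.tsum_mul_left]
    exact tsum_congr fun s => by ring

theorem Ex_mul_const (n : ℕ) (c : ℝ≥0∞) (F : List ℕ → ℝ≥0∞) :
    Ex p n (fun l => F l * c) = Ex p n F * c := by
  simp only [mul_comm _ c, Ex_const_mul]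

theorem Ex_tsum {ι : Type*} (n : ℕ) (F : ι → List ℕ → ℝ≥0∞) :
    Ex p n (fun l => ∑' i, F i l) = ∑' i, Ex p n (F i) := by
  induction n generalizing F with
  | zero => rfl
  | succ n ih =>
    simp only [Ex, ih, ← ENNReal.tsum_mul_left]
    exact ENNReal.tsum_comm

theorem Ex_const (hp : ∑' s, p s = 1) (n : ℕ) (c : ℝ≥0∞) : Ex p n (fun _ => c) = c := by
  induction n with
  | zero => rfl
  | succ n ih => simp only [Ex, ih, ENNReal.tsum_mul_right, hp, one_mul]

theorem Ex_append (m n : ℕ) (F : List ℕ → ℝ≥0∞) :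
    Ex p (m + n) F = Ex p m (fun l => Ex p n (fun l' => F (l ++ l'))) := by
  induction m generalizing F with
  | zero => simp [Ex]
  | succ m ih =>
    rw [Nat.add_right_comm]
    simp only [Ex, ih, List.cons_append]

theorem Ex_snoc (n : ℕ) (F : List ℕ → ℝ≥0∞) :
    Ex p (n + 1) F = ∑' s, p s * Ex p n (fun l => F (l ++ [s])) := by
  rw [Ex_append]
  simp only [Ex]
  rw [Ex_tsum]
  simp only [Ex_const_mul]

theorem Ex_reverse (n : ℕ) (F : List ℕ → ℝ≥0∞) :
    Ex p n (fun l => F l.reverse) = Ex p n F := by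
  induction n generalizing F with
  | zero => rfl
  | succ n ih =>
    rw [Ex_snoc]
    simp only [Ex, List.reverse_append, List.reverse_cons, List.reverse_nil, List.nil_append,
      List.singleton_append]
    exact tsum_congr fun s => by rw [ih fun l => F (s :: l)]

theorem Ex_one_le (hp : ∑' s, p s = 1) (n : ℕ) (P : List ℕ → Prop) :
    Ex p n (fun l => one (P l)) ≤ 1 :=
  (Ex_mono p fun _ _ => one_le _).trans (Ex_const p hp n 1).le

theorem Ex_one_not (hp : ∑' s, p s = 1) (n : ℕ) (P : List ℕ → Prop) :
    Ex p n (fun l => one (P l)) + Ex p n (fun l => one (¬ P l)) = 1 := by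
  rw [← Ex_add]
  simp only [one_add_one_not]
  exact Ex_const p hp n 1

end Basic

/-! ### The Harris inequality -/

/-- Chebyshev's sum inequality: average `(f s - f t) * (g s - g t) ≤ 0` over two independent copies.
The pointwise inequality is stated without subtraction, as the values lie in `ℝ≥0∞`. -/
theorem tsum_mul_mul_le (p f g : ℕ → ℝ≥0∞) (hp : ∑' s, p s = 1) (hf : Monotone f)
    (hg : Antitone g) :
    ∑' s, p s * (f s * g s) ≤ (∑' s, p s * f s) * ∑' s, p s * g s := by
  -- With the larger values written as `a + e` and `b + e'`, the two sides differ by `e * e'`.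
  have rearr : ∀ a e b e' : ℝ≥0∞, a * (b + e') + (a + e) * b ≤ a * b + (a + e) * (b + e') := by
    intro a e b e'
    calc a * (b + e') + (a + e) * b ≤ a * (b + e') + (a + e) * b + e * e' := le_self_add
      _ = _ := by ring
  have key : ∀ s t, f s * g s + f t * g t ≤ f s * g t + f t * g s := by
    intro s t
    rcases le_total s t with h | h
    · obtain ⟨e, he⟩ := exists_add_of_le (hf h)
      obtain ⟨e', he'⟩ := exists_add_of_le (hg h)
      rw [he, he']
      exact rearr _ _ _ _
    · obtain ⟨e, he⟩ := exists_add_of_le (hf h)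
      obtain ⟨e', he'⟩ := exists_add_of_le (hg h)
      rw [he, he', add_comm, add_comm ((f t + e) * _)]
      exact rearr _ _ _ _
  have h2 : 2 * ∑' s, p s * (f s * g s) ≤ 2 * ((∑' s, p s * f s) * ∑' s, p s * g s) := by
    calc 2 * ∑' s, p s * (f s * g s)
        = ∑' s, ∑' t, p s * p t * (f s * g s + f t * g t) := by
          simp only [mul_add, ENNReal.tsum_add]
          rw [two_mul]
          congr 1
          · refine tsum_congr fun s => ?_
            rw [ENNReal.tsum_mul_right, ENNReal.tsum_mul_left, hp, mul_one]
          · simp only [mul_assoc, ENNReal.tsum_mul_left]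
            rw [ENNReal.tsum_mul_right, hp, one_mul]
      _ ≤ ∑' s, ∑' t, p s * p t * (f s * g t + f t * g s) := by
          refine ENNReal.tsum_le_tsum fun s => ENNReal.tsum_le_tsum fun t => ?_
          exact mul_le_mul_right (key s t) _
      _ = _ := by
          simp only [mul_add, ENNReal.tsum_add]
          rw [two_mul]
          congr 1
          · rw [← ENNReal.tsum_mul_right]
            refine tsum_congr fun s => ?_
            rw [← ENNReal.tsum_mul_left]
            exact tsum_congr fun t => by ring
          · rw [ENNReal.tsum_comm, ← ENNReal.tsum_mul_right]
            refine tsum_congr fun s => ?_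
            rw [← ENNReal.tsum_mul_left]
            exact tsum_congr fun t => by ring
  exact (ENNReal.mul_le_mul_iff_right (by simp) (by simp)).1 h2

/-- Monotonicity with respect to the entrywise order on lists. -/
def MonoL (F : List ℕ → ℝ≥0∞) : Prop := ∀ l l', List.Forall₂ (· ≤ ·) l l' → F l ≤ F l'

/-- Antitonicity with respect to the entrywise order on lists. -/
def AntiL (F : List ℕ → ℝ≥0∞) : Prop := ∀ l l', List.Forall₂ (· ≤ ·) l l' → F l' ≤ F l

theorem forall₂_le_refl (l : List ℕ) : List.Forall₂ (· ≤ ·) l l :=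
  List.forall₂_same.2 fun _ _ => le_rfl

/-- Increasing and decreasing functions of independent variables are negatively correlated. -/
theorem Ex_mul_le {p : ℕ → ℝ≥0∞} (hp : ∑' s, p s = 1) (n : ℕ) {F G : List ℕ → ℝ≥0∞}
    (hF : MonoL F) (hG : AntiL G) :
    Ex p n (fun l => F l * G l) ≤ Ex p n F * Ex p n G := by
  induction n generalizing F G with
  | zero => exact le_rfl
  | succ n ih =>
    simp only [Ex]
    calc _ ≤ ∑' s, p s * (Ex p n (fun l => F (s :: l)) * Ex p n (fun l => G (s :: l))) := by
          refine ENNReal.tsum_le_tsum fun s => ?_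
          gcongr
          exact ih (fun l l' h => hF _ _ (.cons le_rfl h)) (fun l l' h => hG _ _ (.cons le_rfl h))
      _ ≤ _ := by
          -- The expectations over the tail are monotone, respectively antitone, functions of the
          -- head, so the one-variable inequality applies.
          refine tsum_mul_mul_le p _ _ hp ?_ ?_
          · exact fun s t h => Ex_mono p fun l _ => hF _ _ (.cons h (forall₂_le_refl l))
          · exact fun s t h => Ex_mono p fun l _ => hG _ _ (.cons h (forall₂_le_refl l))

/-- Negative correlation of `P` with the complement of `Q` is positive correlation of `P` with `Q`:
subtract from `E 1_P`, everything being finite. -/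
theorem Ex_one_mul_one_ge_of {p : ℕ → ℝ≥0∞} (hp : ∑' s, p s = 1) (n : ℕ) {P Q : List ℕ → Prop}
    (h1 : Ex p n (fun l => one (P l) * one (¬ Q l))
      ≤ Ex p n (fun l => one (P l)) * Ex p n (fun l => one (¬ Q l))) :
    Ex p n (fun l => one (P l)) * Ex p n (fun l => one (Q l))
      ≤ Ex p n (fun l => one (P l ∧ Q l)) := by
  have h2 := Ex_one_not p hp n Q
  set a := Ex p n (fun l => one (P l))
  set b := Ex p n (fun l => one (Q l))
  have h3 : a = Ex p n (fun l => one (P l ∧ Q l)) + Ex p n (fun l => one (P l) * one (¬ Q l)) := by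
    rw [← Ex_add]
    refine Ex_congr p fun l _ => ?_
    rw [one_and, ← mul_add, one_add_one_not, mul_one]
  have ha : a ≠ ∞ := ((Ex_one_le p hp n P).trans_lt (by simp)).ne
  have hb' : Ex p n (fun l => one (¬ Q l)) ≠ ∞ := ((Ex_one_le p hp n _).trans_lt (by simp)).ne
  have h4 : a * b + a * Ex p n (fun l => one (¬ Q l))
      ≤ Ex p n (fun l => one (P l ∧ Q l)) + a * Ex p n (fun l => one (¬ Q l)) := by
    rw [← mul_add, h2, mul_one]
    calc a = _ := h3
      _ ≤ _ := by gcongr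
  exact (ENNReal.add_le_add_iff_right (ENNReal.mul_ne_top ha hb')).1 h4

/-- Increasing events are positively correlated. -/
theorem Ex_one_mul_one_ge {p : ℕ → ℝ≥0∞} (hp : ∑' s, p s = 1) (n : ℕ) {P Q : List ℕ → Prop}
    (hP : ∀ l l', List.Forall₂ (· ≤ ·) l l' → P l → P l')
    (hQ : ∀ l l', List.Forall₂ (· ≤ ·) l l' → Q l → Q l') :
    Ex p n (fun l => one (P l)) * Ex p n (fun l => one (Q l))
      ≤ Ex p n (fun l => one (P l ∧ Q l)) :=
  Ex_one_mul_one_ge_of hp n <| Ex_mul_le hp n (fun l l' h => one_mono (hP l l' h))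
    (fun l l' h => one_mono fun h1 h2 => h1 (hQ l l' h h2))

/-- Decreasing events are positively correlated. -/
theorem Ex_one_mul_one_ge_anti {p : ℕ → ℝ≥0∞} (hp : ∑' s, p s = 1) (n : ℕ) {P Q : List ℕ → Prop}
    (hP : ∀ l l', List.Forall₂ (· ≤ ·) l l' → P l' → P l)
    (hQ : ∀ l l', List.Forall₂ (· ≤ ·) l l' → Q l' → Q l) :
    Ex p n (fun l => one (P l)) * Ex p n (fun l => one (Q l))
      ≤ Ex p n (fun l => one (P l ∧ Q l)) := by
  refine Ex_one_mul_one_ge_of hp n ?_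
  simp only [mul_comm (one (P _))]
  rw [mul_comm (Ex p n _)]
  exact Ex_mul_le hp n (fun l l' h => one_mono fun h1 h2 => h1 (hQ l l' h h2))
    (fun l l' h => one_mono (hP l l' h))

theorem Ex_finset_sum (p : ℕ → ℝ≥0∞) {ι : Type*} (n : ℕ) (S : Finset ι)
    (F : ι → List ℕ → ℝ≥0∞) :
    Ex p n (fun l => ∑ i ∈ S, F i l) = ∑ i ∈ S, Ex p n (F i) := by
  induction n generalizing F with
  | zero => rfl
  | succ n ih =>
    simp only [Ex, ih fun i l => F i (_ :: l), Finset.mul_sum]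
    exact Summable.tsum_finsetSum fun _ _ => ENNReal.summable

/-! ### Independence of disjoint blocks -/

/-- The entries of `l` with indices in `[X, Y)`. -/
def block (X Y : ℕ) (l : List ℕ) : List ℕ := (l.drop X).take (Y - X)

theorem block_cons_succ (X Y s : ℕ) (l : List ℕ) :
    block (X + 1) Y (s :: l) = block X (Y - 1) l := by
  simp [block, Nat.sub_sub, Nat.add_comm]

theorem block_cons_zero (Y s : ℕ) (l : List ℕ) (hY : 0 < Y) :
    block 0 Y (s :: l) = s :: block 0 (Y - 1) l := by
  obtain ⟨Y, rfl⟩ : ∃ Z, Y = Z + 1 := ⟨Y - 1, by omega⟩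
  simp [block]

theorem block_empty (X Y : ℕ) (l : List ℕ) (h : Y ≤ X) : block X Y l = [] := by
  simp [block, Nat.sub_eq_zero_of_le h]

/-- Induction on the number of entries: the head belongs to at most one nonempty block. Integrating
it out shifts all intervals by one, and truncated subtraction keeps intervals starting at `0` in
place. -/
theorem Ex_prod_block {p : ℕ → ℝ≥0∞} (hp : ∑' s, p s = 1) {ι : Type*} [DecidableEq ι]
    (S : Finset ι) (n : ℕ)
    (X Y : ι → ℕ) (hXY : ∀ i ∈ S, X i ≤ Y i) (hYn : ∀ i ∈ S, Y i ≤ n)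
    (hdisj : ∀ i ∈ S, ∀ j ∈ S, i ≠ j → Y i ≤ X j ∨ Y j ≤ X i) (F : ι → List ℕ → ℝ≥0∞) :
    Ex p n (fun l => ∏ i ∈ S, F i (block (X i) (Y i) l)) = ∏ i ∈ S, Ex p (Y i - X i) (F i) := by
  induction n generalizing X Y F with
  | zero =>
    simp only [Ex]
    refine Finset.prod_congr rfl fun i hi => ?_
    have := hYn i hi
    rw [block_empty _ _ _ (by omega), show Y i - X i = 0 by omega]
    rfl
  | succ n ih =>
    simp only [Ex]
    have hX' : ∀ i ∈ S, X i - 1 ≤ Y i - 1 := fun i hi => Nat.sub_le_sub_right (hXY i hi) 1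
    have hY' : ∀ i ∈ S, Y i - 1 ≤ n := fun i hi => by have := hYn i hi; omega
    have hd' : ∀ i ∈ S, ∀ j ∈ S, i ≠ j → Y i - 1 ≤ X j - 1 ∨ Y j - 1 ≤ X i - 1 := by
      intro i hi j hj hij
      have := hdisj i hi j hj hij
      omega
    by_cases hz : ∃ i ∈ S, X i = 0 ∧ 0 < Y i
    · obtain ⟨i, hi, hXi, hYi⟩ := hz
      have hother : ∀ j ∈ S.erase i, ∀ s l,
          block (X j) (Y j) (s :: l) = block (X j - 1) (Y j - 1) l := by
        intro j hj s l
        rw [Finset.mem_erase] at hj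
        have := hdisj i hi j hj.2 (Ne.symm hj.1)
        have hxy := hXY j hj.2
        rcases Nat.eq_zero_or_pos (X j) with h0 | h0
        · rw [block_empty _ _ _ (by omega), block_empty _ _ _ (by omega)]
        · obtain ⟨x, hx⟩ : ∃ x, X j = x + 1 := ⟨X j - 1, by omega⟩
          rw [hx, block_cons_succ]
          rfl
      have hlen : ∀ j ∈ S.erase i, Y j - 1 - (X j - 1) = Y j - X j := by
        intro j hj
        rw [Finset.mem_erase] at hj
        have := hdisj i hi j hj.2 (Ne.symm hj.1)
        have hxy := hXY j hj.2
        omega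
      have hstep : ∀ s, Ex p n (fun l => ∏ j ∈ S, F j (block (X j) (Y j) (s :: l)))
          = Ex p (Y i - 1) (fun l => F i (s :: l)) * ∏ j ∈ S.erase i, Ex p (Y j - X j) (F j) := by
        intro s
        -- The block that contains the head absorbs it into its functional; the other blocks do not
        -- see it.
        have := ih (fun j => X j - 1) (fun j => Y j - 1) hX' hY' hd'
          (fun j l => if j = i then F i (s :: l) else F j l)
        rw [← Finset.mul_prod_erase S _ hi] at this
        simp only [if_true, hXi, Nat.zero_sub, Nat.sub_zero] at this
        calc _ = Ex p n (fun l => ∏ j ∈ S, if j = i then F i (s :: block (X j - 1) (Y j - 1) l)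
              else F j (block (X j - 1) (Y j - 1) l)) := by
              refine Ex_congr p fun l _ => Finset.prod_congr rfl fun j hj => ?_
              by_cases hji : j = i
              · subst hji
                rw [if_pos rfl, hXi, block_cons_zero _ _ _ hYi]
              · rw [if_neg hji, hother j (Finset.mem_erase.2 ⟨hji, hj⟩)]
          _ = _ := this
          _ = _ := by
              congr 1
              refine Finset.prod_congr rfl fun j hj => ?_
              rw [hlen j hj]
              congr 1
              funext l
              rw [if_neg (Finset.mem_erase.1 hj).1]
      simp only [hstep, ← mul_assoc, ENNReal.tsum_mul_right]
      rw [← Finset.mul_prod_erase S _ hi, hXi, Nat.sub_zero]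
      obtain ⟨Z, hZ⟩ : ∃ Z, Y i = Z + 1 := ⟨Y i - 1, by omega⟩
      simp only [hZ, Ex, Nat.add_sub_cancel]
    · push Not at hz
      have hother : ∀ j ∈ S, ∀ s l,
          block (X j) (Y j) (s :: l) = block (X j - 1) (Y j - 1) l := by
        intro j hj s l
        have hxy := hXY j hj
        rcases Nat.eq_zero_or_pos (X j) with h0 | h0
        · have := hz j hj h0
          rw [block_empty _ _ _ (by omega), block_empty _ _ _ (by omega)]
        · obtain ⟨x, hx⟩ : ∃ x, X j = x + 1 := ⟨X j - 1, by omega⟩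
          rw [hx, block_cons_succ]
          rfl
      have hstep : ∀ s, Ex p n (fun l => ∏ j ∈ S, F j (block (X j) (Y j) (s :: l)))
          = ∏ j ∈ S, Ex p (Y j - X j) (F j) := by
        intro s
        have := ih (fun j => X j - 1) (fun j => Y j - 1) hX' hY' hd' F
        calc _ = _ := Ex_congr p fun l _ => Finset.prod_congr rfl fun j hj => by
                rw [hother j hj]
          _ = _ := this
          _ = _ := Finset.prod_congr rfl fun j hj => by
                have hxy := hXY j hj
                have := hz j hj
                rw [show Y j - 1 - (X j - 1) = Y j - X j by omega]
      simp only [hstep, ENNReal.tsum_mul_right, hp, one_mul]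

/-- Disjoint intervals in `[0, n)` have total length at most `n`. -/
theorem sum_length_le {ι : Type*} [DecidableEq ι] (S : Finset ι) (n : ℕ) (X Y : ι → ℕ)
    (hYn : ∀ i ∈ S, Y i ≤ n)
    (hdisj : ∀ i ∈ S, ∀ j ∈ S, i ≠ j → Y i ≤ X j ∨ Y j ≤ X i) :
    ∑ i ∈ S, (Y i - X i) ≤ n := by
  have h : (S.biUnion fun i => Finset.Ico (X i) (Y i)).card = ∑ i ∈ S, (Y i - X i) := by
    rw [Finset.card_biUnion]
    · simp
    · intro i hi j hj hij
      rw [Function.onFun, Finset.disjoint_left]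
      intro t ht ht'
      rw [Finset.mem_Ico] at ht ht'
      have := hdisj i hi j hj hij
      omega
  rw [← h]
  calc _ ≤ (Finset.range n).card := Finset.card_le_card fun t ht => by
          rw [Finset.mem_biUnion] at ht
          obtain ⟨i, hi, ht⟩ := ht
          rw [Finset.mem_Ico] at ht
          exact Finset.mem_range.2 (ht.2.trans_le (hYn i hi))
    _ = n := Finset.card_range n

/-! ### Walks and their running maxima -/

theorem Ex_cons (p : ℕ → ℝ≥0∞) (n : ℕ) (F : List ℕ → ℝ≥0∞) :
    Ex p (n + 1) F = Ex p n (fun l => ∑' s, p s * F (s :: l)) := by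
  rw [Ex_tsum]
  simp only [Ex, Ex_const_mul]

theorem Ex_comm (p : ℕ → ℝ≥0∞) (m n : ℕ) (F : List ℕ → List ℕ → ℝ≥0∞) :
    Ex p m (fun l => Ex p n (fun l' => F l l')) = Ex p n (fun l' => Ex p m (fun l => F l l')) := by
  induction m generalizing F with
  | zero => rfl
  | succ m ih =>
    simp only [Ex, ih fun l l' => F (_ :: l) l']
    rw [Ex_tsum]
    simp only [Ex_const_mul]

/-- The displacement of the walk with steps `f s`. -/
def hsum (f : ℕ → ℤ) (l : List ℕ) : ℤ := (l.map f).sum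

@[simp] theorem hsum_nil (f : ℕ → ℤ) : hsum f [] = 0 := rfl

@[simp] theorem hsum_cons (f : ℕ → ℤ) (s : ℕ) (l : List ℕ) :
    hsum f (s :: l) = f s + hsum f l := by simp [hsum]

@[simp] theorem hsum_append (f : ℕ → ℤ) (l l' : List ℕ) :
    hsum f (l ++ l') = hsum f l + hsum f l' := by simp [hsum]

@[simp] theorem hsum_reverse (f : ℕ → ℤ) (l : List ℕ) : hsum f l.reverse = hsum f l := by
  simp [hsum, List.sum_reverse]

@[simp] theorem hsum_neg (f : ℕ → ℤ) (l : List ℕ) : hsum (-f) l = -hsum f l := by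
  induction l with
  | nil => rfl
  | cons s l ih => simp [ih]; ring

/-- The walk with steps `f s` started at `x` stays nonnegative. -/
def Surv (f : ℕ → ℤ) (x : ℤ) : List ℕ → Prop
  | [] => 0 ≤ x
  | s :: l => 0 ≤ x ∧ Surv f (x + f s) l

theorem Surv.nonneg {f : ℕ → ℤ} {x : ℤ} {l : List ℕ} (h : Surv f x l) : 0 ≤ x := by
  cases l with
  | nil => exact h
  | cons s l => exact h.1

theorem surv_append (f : ℕ → ℤ) (x : ℤ) (l l' : List ℕ) :
    Surv f x (l ++ l') ↔ Surv f x l ∧ Surv f (x + hsum f l) l' := by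
  induction l generalizing x with
  | nil =>
    simp only [List.nil_append, hsum_nil, add_zero, Surv]
    exact ⟨fun h => ⟨h.nonneg, h⟩, fun h => h.2⟩
  | cons s l ih =>
    simp only [List.cons_append, Surv, ih, hsum_cons, and_assoc, add_assoc]

/-- Read backwards from its end point, the walk has the negated steps and visits the same positions.
This makes each estimate for the start of a bridge usable at its end. -/
theorem surv_reverse (f : ℕ → ℤ) (x : ℤ) (l : List ℕ) :
    Surv f x l ↔ Surv (-f) (x + hsum f l) l.reverse := by
  induction l generalizing x with
  | nil => simp [Surv]
  | cons s l ih =>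
    rw [List.reverse_cons, surv_append, hsum_cons, ← add_assoc, ← ih]
    simp only [Surv, hsum_neg, hsum_reverse, Pi.neg_apply]
    have h1 : x + f s + hsum f l + -hsum f l = x + f s := by ring
    have h2 : x + f s + -f s = x := by ring
    rw [h1, h2]
    exact ⟨fun h => ⟨h.2, h.2.nonneg, h.1⟩, fun h => ⟨h.2.2, h.1⟩⟩

theorem surv_mono {f : ℕ → ℤ} (hf : Monotone f) {l l' : List ℕ}
    (h : List.Forall₂ (· ≤ ·) l l') {x x' : ℤ} (hx : x ≤ x') (hs : Surv f x l) : Surv f x' l' := by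
  induction h generalizing x x' with
  | nil => exact le_trans hs hx
  | cons h _ ih => exact ⟨hs.1.trans hx, ih (add_le_add hx (hf h)) hs.2⟩

theorem surv_anti {f : ℕ → ℤ} (hf : Antitone f) {l l' : List ℕ}
    (h : List.Forall₂ (· ≤ ·) l l') {x x' : ℤ} (hx : x' ≤ x) (hs : Surv f x' l') : Surv f x l := by
  induction h generalizing x x' with
  | nil => exact le_trans hs hx
  | cons h _ ih => exact ⟨hs.1.trans hx, ih (add_le_add hx (hf h)) hs.2⟩

/-- The running maximum of the walk with real steps `g s` started at `0`. -/
noncomputable def Mx (g : ℕ → ℝ) : List ℕ → ℝ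
  | [] => 0
  | s :: l => max 0 (g s + Mx g l)

theorem Mx_nonneg (g : ℕ → ℝ) (l : List ℕ) : 0 ≤ Mx g l := by
  cases l with
  | nil => exact le_rfl
  | cons s l => exact le_max_left _ _

theorem sum_le_Mx (g : ℕ → ℝ) (l l' : List ℕ) : (l.map g).sum ≤ Mx g (l ++ l') := by
  induction l with
  | nil => simpa using Mx_nonneg g l'
  | cons s l ih =>
    simp only [List.map_cons, List.sum_cons, List.cons_append, Mx]
    exact le_max_of_le_right (by linarith)

theorem Mx_mono {g : ℕ → ℝ} (hg : Monotone g) {l l' : List ℕ}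
    (h : List.Forall₂ (· ≤ ·) l l') : Mx g l ≤ Mx g l' := by
  induction h with
  | nil => exact le_rfl
  | cons h _ ih => exact max_le_max le_rfl (add_le_add (hg h) ih)

theorem Mx_anti {g : ℕ → ℝ} (hg : Antitone g) {l l' : List ℕ}
    (h : List.Forall₂ (· ≤ ·) l l') : Mx g l' ≤ Mx g l := by
  induction h with
  | nil => exact le_rfl
  | cons h _ ih => exact max_le_max le_rfl (add_le_add (hg h) ih)

/-- The centered steps. -/
noncomputable def cen (f : ℕ → ℤ) (β : ℝ) (s : ℕ) : ℝ := f s - β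

theorem cen_neg (f : ℕ → ℤ) (β : ℝ) : cen (-f) (-β) = fun s => -cen f β s := by
  funext s
  simp [cen]
  ring

theorem sum_cen (f : ℕ → ℤ) (β : ℝ) (l : List ℕ) :
    (l.map (cen f β)).sum = hsum f l - l.length * β := by
  induction l with
  | nil => simp
  | cons s l ih =>
    simp only [List.map_cons, List.sum_cons, ih, cen, hsum_cons, List.length_cons]
    push_cast
    ring

/-- A walk that starts high above zero relative to its drift and becomes negative deviates a lot. -/
theorem lt_Mx_of_not_surv (f : ℕ → ℤ) (β : ℝ) {H : ℝ} {x : ℤ} {l : List ℕ}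
    (hx : ∀ j : ℕ, j ≤ l.length → H ≤ x + j * β) (h : ¬ Surv f x l) :
    H < Mx (fun s => -cen f β s) l := by
  induction l generalizing x H with
  | nil =>
    have h0 := hx 0 le_rfl
    simp only [Surv, not_le] at h
    have : (x : ℝ) < 0 := by exact_mod_cast h
    simp only [Nat.cast_zero, zero_mul, add_zero] at h0
    simp only [Mx]
    linarith
  | cons s l ih =>
    by_cases h0 : 0 ≤ x
    · have h1 : ¬ Surv f (x + f s) l := fun h1 => h ⟨h0, h1⟩
      -- After one step both the position and the margin above the drift line move by the centered
      -- step, so the hypothesis is preserved.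
      have := ih (H := H + cen f β s) (x := x + f s) (fun j hj => by
        have := hx (j + 1) (by simpa using hj)
        simp only [cen]
        push_cast at this ⊢
        linarith) h1
      exact lt_max_of_lt_right (by linarith)
    · have h0' := hx 0 (Nat.zero_le _)
      have : (x : ℝ) < 0 := by exact_mod_cast not_le.1 h0
      simp only [Nat.cast_zero, zero_mul, add_zero] at h0'
      exact lt_of_lt_of_le (by linarith) (Mx_nonneg _ _)

/-! ### Exponential moments -/

theorem Ex_exp_sum (p : ℕ → ℝ≥0∞) (g : ℕ → ℝ) (lam : ℝ) (n : ℕ) :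
    Ex p n (fun l => ENNReal.ofReal (Real.exp (lam * (l.map g).sum)))
      = (∑' s, p s * ENNReal.ofReal (Real.exp (lam * g s))) ^ n := by
  induction n with
  | zero => simp [Ex]
  | succ n ih =>
    simp only [Ex, List.map_cons, List.sum_cons, mul_add, Real.exp_add]
    rw [pow_succ, ← ih, mul_comm, ← ENNReal.tsum_mul_right]
    refine tsum_congr fun s => ?_
    rw [mul_assoc, ← Ex_const_mul p n (ENNReal.ofReal _)]
    simp only [ENNReal.ofReal_mul (Real.exp_nonneg (lam * g s))]

/-- Since `|max 0 u| ≤ |u|` and `cosh` is even and increasing in the modulus, the truncation at zero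
in the recursion for the maximum can be dropped. Each step then costs a factor `R`, and no maximal
inequality is needed. -/
theorem Ex_cosh_Mx_le {p : ℕ → ℝ≥0∞} {g : ℕ → ℝ} {lam : ℝ} {R : ℝ≥0∞}
    (h1 : ∑' s, p s * ENNReal.ofReal (Real.exp (lam * g s)) ≤ R)
    (h2 : ∑' s, p s * ENNReal.ofReal (Real.exp (-lam * g s)) ≤ R) (n : ℕ) :
    Ex p n (fun l => ENNReal.ofReal (Real.cosh (lam * Mx g l))) ≤ R ^ n := by
  induction n with
  | zero => simp [Ex, Mx]
  | succ n ih =>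
    rw [Ex_cons]
    calc _ ≤ Ex p n (fun l => R * ENNReal.ofReal (Real.cosh (lam * Mx g l))) := by
          refine Ex_mono p fun l _ => ?_
          set M := Mx g l
          have hle : ∀ s, Real.cosh (lam * Mx g (s :: l)) ≤
              Real.exp (lam * g s) * (Real.exp (lam * M) / 2)
                + Real.exp (-lam * g s) * (Real.exp (-(lam * M)) / 2) := by
            intro s
            have h3 : Real.cosh (lam * Mx g (s :: l)) ≤ Real.cosh (lam * (g s + M)) := by
              rw [Real.cosh_le_cosh, abs_mul, abs_mul]
              refine mul_le_mul_of_nonneg_left ?_ (abs_nonneg _)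
              simp only [Mx]
              rw [abs_of_nonneg (le_max_left _ _)]
              exact max_le (abs_nonneg _) (le_abs_self _)
            refine h3.trans (le_of_eq ?_)
            rw [Real.cosh_eq, mul_add, neg_add, Real.exp_add, Real.exp_add, neg_mul]
            ring
          calc _ ≤ ∑' s, (p s * ENNReal.ofReal (Real.exp (lam * g s))
                    * ENNReal.ofReal (Real.exp (lam * M) / 2)
                  + p s * ENNReal.ofReal (Real.exp (-lam * g s))
                    * ENNReal.ofReal (Real.exp (-(lam * M)) / 2)) := by
                refine ENNReal.tsum_le_tsum fun s => ?_
                rw [mul_assoc, mul_assoc, ← mul_add]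
                gcongr
                rw [← ENNReal.ofReal_mul (Real.exp_nonneg _),
                  ← ENNReal.ofReal_mul (Real.exp_nonneg _), ← ENNReal.ofReal_add
                  (by positivity) (by positivity)]
                exact ENNReal.ofReal_le_ofReal (hle s)
            _ ≤ R * ENNReal.ofReal (Real.exp (lam * M) / 2)
                + R * ENNReal.ofReal (Real.exp (-(lam * M)) / 2) := by
                rw [ENNReal.tsum_add, ENNReal.tsum_mul_right, ENNReal.tsum_mul_right]
                gcongr
            _ = R * ENNReal.ofReal (Real.cosh (lam * M)) := by
                rw [← mul_add, ← ENNReal.ofReal_add (by positivity) (by positivity), Real.cosh_eq]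
                congr 2
                ring
      _ ≤ R ^ (n + 1) := by
          rw [Ex_const_mul, pow_succ, mul_comm]
          gcongr

theorem Ex_exp_Mx_le {p : ℕ → ℝ≥0∞} {g : ℕ → ℝ} {lam : ℝ} {R : ℝ≥0∞}
    (h1 : ∑' s, p s * ENNReal.ofReal (Real.exp (lam * g s)) ≤ R)
    (h2 : ∑' s, p s * ENNReal.ofReal (Real.exp (-lam * g s)) ≤ R) (n : ℕ) :
    Ex p n (fun l => ENNReal.ofReal (Real.exp (lam * Mx g l))) ≤ 2 * R ^ n := by
  calc _ ≤ Ex p n (fun l => 2 * ENNReal.ofReal (Real.cosh (lam * Mx g l))) := by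
        refine Ex_mono p fun l _ => ?_
        rw [← ENNReal.ofReal_ofNat, ← ENNReal.ofReal_mul (by norm_num)]
        refine ENNReal.ofReal_le_ofReal ?_
        rw [Real.cosh_eq]
        have := Real.exp_nonneg (-(lam * Mx g l))
        linarith
    _ ≤ _ := by
        rw [Ex_const_mul]
        gcongr
        exact Ex_cosh_Mx_le h1 h2 n

/-- With strongly negative drift the running maximum has exponential moments uniformly in time. -/
theorem Ex_exp_Mx_le_two {p : ℕ → ℝ≥0∞} (hp : ∑' s, p s = 1) {g : ℕ → ℝ} {lam : ℝ}
    (h1 : ∑' s, p s * ENNReal.ofReal (Real.exp (lam * g s)) ≤ 2⁻¹) (n : ℕ) :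
    Ex p n (fun l => ENNReal.ofReal (Real.exp (lam * Mx g l))) ≤ 2 := by
  induction n with
  | zero => simp [Ex, Mx]
  | succ n ih =>
    simp only [Ex]
    -- `exp (max 0 u) ≤ 1 + exp u` turns the recursion into `m ↦ 1 + m / 2`, which preserves the
    -- bound `m ≤ 2`.
    calc _ ≤ ∑' s, (p s + p s * ENNReal.ofReal (Real.exp (lam * g s)) *
              Ex p n (fun l => ENNReal.ofReal (Real.exp (lam * Mx g l)))) := by
          refine ENNReal.tsum_le_tsum fun s => ?_
          rw [mul_assoc, ← Ex_const_mul p n (ENNReal.ofReal _)]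
          nth_rewrite 2 [← mul_one (p s)]
          rw [← mul_add, ← Ex_const p hp n 1, ← Ex_add]
          refine mul_le_mul_right (Ex_mono p fun l _ => ?_) _
          rw [← ENNReal.ofReal_mul (Real.exp_nonneg _), ← Real.exp_add, ← mul_add]
          nth_rewrite 1 [← ENNReal.ofReal_one]
          rw [← ENNReal.ofReal_add zero_le_one (Real.exp_nonneg _)]
          refine ENNReal.ofReal_le_ofReal ?_
          simp only [Mx]
          rcases max_cases 0 (g s + Mx g l) with ⟨h, _⟩ | ⟨h, _⟩
          · rw [h, mul_zero, Real.exp_zero]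
            linarith [Real.exp_nonneg (lam * (g s + Mx g l))]
          · rw [h]
            linarith
      _ ≤ 1 + 2⁻¹ * 2 := by
          rw [ENNReal.tsum_add, ENNReal.tsum_mul_right, hp]
          gcongr
      _ = 2 := by
          rw [ENNReal.inv_mul_cancel (by simp) (by simp)]
          norm_num

/-- Markov's inequality for exponential functions. -/
theorem one_le_exp_mul_exp {lam T M : ℝ} (hl : 0 ≤ lam) :
    one (T ≤ M) ≤ ENNReal.ofReal (Real.exp (-(lam * T))) * ENNReal.ofReal (Real.exp (lam * M)) := by
  by_cases h : T ≤ M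
  · rw [one_true h, ← ENNReal.ofReal_mul (Real.exp_nonneg _), ← Real.exp_add,
      ← ENNReal.ofReal_one]
    refine ENNReal.ofReal_le_ofReal (Real.one_le_exp ?_)
    nlinarith
  · rw [one_false h]
    exact zero_le

theorem Ex_one_le_exp {p : ℕ → ℝ≥0∞} {n : ℕ} {M : List ℕ → ℝ} {lam T : ℝ} (hl : 0 ≤ lam)
    {K : ℝ≥0∞} (h : Ex p n (fun l => ENNReal.ofReal (Real.exp (lam * M l))) ≤ K) :
    Ex p n (fun l => one (T ≤ M l)) ≤ ENNReal.ofReal (Real.exp (-(lam * T))) * K :=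
  calc _ ≤ Ex p n (fun l => ENNReal.ofReal (Real.exp (-(lam * T)))
            * ENNReal.ofReal (Real.exp (lam * M l))) :=
        Ex_mono p fun _ _ => one_le_exp_mul_exp hl
    _ ≤ _ := by
        rw [Ex_const_mul]
        gcongr

/-! ### Nonnegative bridges of walks with well behaved steps -/

/-- The walk with steps `f s` from `x` stays nonnegative and ends at `y`. -/
def Br (f : ℕ → ℤ) (x y : ℤ) (l : List ℕ) : Prop := Surv f x l ∧ x + hsum f l = y

/-- The probability that the walk stays nonnegative for `n` steps. -/
noncomputable def Ps (p : ℕ → ℝ≥0∞) (f : ℕ → ℤ) (x : ℤ) (n : ℕ) : ℝ≥0∞ :=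
  Ex p n (fun l => one (Surv f x l))

/-- The probability that the walk stays nonnegative for `n` steps and ends at `y`. -/
noncomputable def Pb (p : ℕ → ℝ≥0∞) (f : ℕ → ℤ) (n : ℕ) (x y : ℤ) : ℝ≥0∞ :=
  Ex p n (fun l => one (Br f x y l))

theorem br_reverse (f : ℕ → ℤ) (x y : ℤ) (l : List ℕ) :
    Br f x y l ↔ Br (-f) y x l.reverse := by
  unfold Br
  rw [surv_reverse, hsum_neg, hsum_reverse]
  constructor
  · rintro ⟨h1, rfl⟩
    exact ⟨h1, by ring⟩
  · rintro ⟨h1, h2⟩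
    have : x + hsum f l = y := by omega
    exact ⟨this ▸ h1, this⟩

theorem Pb_reverse (p : ℕ → ℝ≥0∞) (f : ℕ → ℤ) (n : ℕ) (x y : ℤ) :
    Pb p f n x y = Pb p (-f) n y x := by
  unfold Pb
  rw [← Ex_reverse p n (fun l => one (Br (-f) y x l))]
  exact Ex_congr p fun l _ => one_congr (br_reverse f x y l)

theorem Pb_succ (p : ℕ → ℝ≥0∞) (f : ℕ → ℤ) (n : ℕ) {x : ℤ} (y : ℤ) (hx : 0 ≤ x) :
    Pb p f (n + 1) x y = ∑' s, p s * Pb p f n (x + f s) y := by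
  unfold Pb
  simp only [Ex]
  refine tsum_congr fun s => ?_
  congr 1
  refine Ex_congr p fun l _ => one_congr ?_
  simp [Br, Surv, hx, add_assoc]

theorem Ps_succ (p : ℕ → ℝ≥0∞) (f : ℕ → ℤ) (n : ℕ) {x : ℤ} (hx : 0 ≤ x) :
    Ps p f x (n + 1) = ∑' s, p s * Ps p f (x + f s) n := by
  unfold Ps
  simp only [Ex]
  refine tsum_congr fun s => ?_
  congr 1
  refine Ex_congr p fun l _ => one_congr ?_
  simp [Surv, hx]

theorem Ps_anti {p : ℕ → ℝ≥0∞} (hp : ∑' s, p s = 1) (f : ℕ → ℤ) (x : ℤ) {m n : ℕ} (h : m ≤ n) :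
    Ps p f x n ≤ Ps p f x m := by
  obtain ⟨k, rfl⟩ := Nat.exists_eq_add_of_le h
  unfold Ps
  rw [Ex_append]
  refine Ex_mono p fun l _ => ?_
  calc _ ≤ Ex p k (fun _ => one (Surv f x l)) :=
        Ex_mono p fun l' _ => one_mono fun h => ((surv_append _ _ _ _).1 h).1
    _ = _ := Ex_const p hp _ _

/-- Uniform control of a step law: drift `β`, exponential moments, overshoots, concentration. -/
structure Good (p : ℕ → ℝ≥0∞) (f : ℕ → ℤ) (β lam0 C Co CU : ℝ) : Prop where
  sum_eq_one : ∑' s, p s = 1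
  mgf : ∀ lam, |lam| ≤ lam0 →
    ∑' s, p s * ENNReal.ofReal (Real.exp (lam * cen f β s)) ≤ ENNReal.ofReal (Real.exp (C * lam ^ 2))
  -- Given that the centered step passes a level `t`, its excess has a bounded exponential moment
  -- whatever `t` is: a substitute for the lack of memory of the geometric law.
  overshoot : ∀ t, 0 < t →
    ∑' s, p s * (one (t ≤ cen f β s) * ENNReal.ofReal (Real.exp (lam0 * (cen f β s - t))))
      ≤ ENNReal.ofReal Co * ∑' s, p s * one (t ≤ cen f β s)
  conc : ∀ n : ℕ, 1 ≤ n → ∀ d : ℤ,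
    Ex p n (fun l => one (hsum f l = d)) ≤ ENNReal.ofReal (CU / √n)

section

variable {p : ℕ → ℝ≥0∞} {f : ℕ → ℤ} {β lam0 C Co CU : ℝ}

theorem Good.exp_Mx (hG : Good p f β lam0 C Co CU) {lam : ℝ} (hl : |lam| ≤ lam0) (n : ℕ) :
    Ex p n (fun l => ENNReal.ofReal (Real.exp (lam * Mx (cen f β) l)))
      ≤ ENNReal.ofReal (2 * Real.exp (C * lam ^ 2 * n)) := by
  refine (Ex_exp_Mx_le (hG.mgf lam hl) ?_ n).trans ?_
  · have := hG.mgf (-lam) (by rwa [abs_neg])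
    rwa [neg_sq] at this
  · rw [ENNReal.ofReal_mul (by norm_num), ← ENNReal.ofReal_pow (Real.exp_nonneg _), ← Real.exp_nat_mul]
    rw [mul_comm (n : ℝ)]
    simp

theorem Good.exp_Mx_neg (hG : Good p f β lam0 C Co CU) {lam : ℝ} (hl : |lam| ≤ lam0) (n : ℕ) :
    Ex p n (fun l => ENNReal.ofReal (Real.exp (lam * Mx (fun s => -cen f β s) l)))
      ≤ ENNReal.ofReal (2 * Real.exp (C * lam ^ 2 * n)) := by
  refine (Ex_exp_Mx_le (R := ENNReal.ofReal (Real.exp (C * lam ^ 2))) ?_ ?_ n).trans ?_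
  · have := hG.mgf (-lam) (by rwa [abs_neg])
    rw [neg_sq] at this
    simpa only [mul_neg, neg_mul] using this
  · simpa only [mul_neg, neg_mul, neg_neg] using hG.mgf lam hl
  · rw [ENNReal.ofReal_mul (by norm_num), ← ENNReal.ofReal_pow (Real.exp_nonneg _), ← Real.exp_nat_mul]
    rw [mul_comm (n : ℝ)]
    simp

/-- Conditioning on survival does not spoil exponential moments of the running maximum. -/
theorem Good.exp_max_surv (hG : Good p f β lam0 C Co CU) (hC : 0 ≤ C) (hCo : 1 ≤ Co) {N : ℕ} {H lam : ℝ}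
    (hl : 0 ≤ lam) (hl0 : lam ≤ lam0)
    (hH : ∀ n ≤ N, Ex p n (fun l => one (H ≤ Mx (fun s => -cen f β s) l)) ≤ 2⁻¹)
    (n : ℕ) (hn : n ≤ N) (x : ℤ) (a : ℝ) (ha : a < H)
    (hx : ∀ j : ℕ, j ≤ n → a ≤ x + j * β) :
    Ex p n (fun l => ENNReal.ofReal (Real.exp (lam * max H (a + Mx (cen f β) l))) * one (Surv f x l))
      ≤ ENNReal.ofReal (4 * Co * Real.exp (lam * H + C * lam ^ 2 * N)) * Ps p f x n := by
  have hK : Real.exp (lam * H) ≤ 4 * Co * Real.exp (lam * H + C * lam ^ 2 * N) := by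
    have : Real.exp (lam * H) ≤ Real.exp (lam * H + C * lam ^ 2 * N) :=
      Real.exp_le_exp.2 (by have : 0 ≤ C * lam ^ 2 * N := by positivity
                            linarith)
    nlinarith [Real.exp_pos (lam * H)]
  induction n generalizing x a with
  | zero =>
    simp only [Ex, Ps, Mx, add_zero, max_eq_left ha.le]
    gcongr
  | succ n ih =>
    by_cases h0 : 0 ≤ x
    swap
    · have : ∀ l, one (Surv f x l) = 0 := fun l => one_false fun h => h0 h.nonneg
      simp [this, Ex_const p hG.sum_eq_one]
    rw [Ps_succ p f n h0]
    simp only [Ex]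
    -- Here `a` is the current centered height, still below `H`. The walk is followed until its
    -- centered height passes `H`; one step does so exactly when it is at least `t`.
    set t := H - a with ht
    have ht0 : 0 < t := by linarith
    set D := ENNReal.ofReal (4 * Co * Real.exp (lam * H + C * lam ^ 2 * N)) with hD
    -- Without a crossing the induction hypothesis applies. At a crossing survival is dropped; what
    -- remains is the overshoot and an unconditioned maximum.
    have hterm : ∀ s, Ex p n (fun l => ENNReal.ofReal (Real.exp (lam * max H (a + Mx (cen f β) (s :: l))))
          * one (Surv f x (s :: l))) ≤ one (¬ t ≤ cen f β s) * (D * Ps p f (x + f s) n)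
        + ENNReal.ofReal (2 * Real.exp (lam * H + C * lam ^ 2 * N))
          * (one (t ≤ cen f β s) * ENNReal.ofReal (Real.exp (lam0 * (cen f β s - t)))) := by
      intro s
      have hmx : ∀ l, max H (a + Mx (cen f β) (s :: l)) = max H (a + cen f β s + Mx (cen f β) l) := by
        intro l
        simp only [Mx]
        rw [← max_add_add_left, add_zero, ← max_assoc, max_eq_left ha.le, add_assoc]
      by_cases hs : t ≤ cen f β s
      · rw [one_true hs, one_false (not_not.2 hs), zero_mul, zero_add, one_mul,
          ← ENNReal.ofReal_mul (by positivity)]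
        have hge : H ≤ a + cen f β s := by linarith
        calc _ ≤ Ex p n (fun l => ENNReal.ofReal (Real.exp (lam * (a + cen f β s)))
                * ENNReal.ofReal (Real.exp (lam * Mx (cen f β) l))) := by
              refine Ex_mono p fun l _ => ?_
              rw [hmx, max_eq_right (by linarith [Mx_nonneg (cen f β) l]), mul_add, Real.exp_add,
                ENNReal.ofReal_mul (Real.exp_nonneg _)]
              exact mul_le_of_le_one_right' (one_le _)
          _ ≤ ENNReal.ofReal (Real.exp (lam * (a + cen f β s)))
                * ENNReal.ofReal (2 * Real.exp (C * lam ^ 2 * n)) := by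
              rw [Ex_const_mul]
              gcongr
              exact hG.exp_Mx (by rwa [abs_of_nonneg hl]) n
          _ ≤ _ := by
              rw [← ENNReal.ofReal_mul (Real.exp_nonneg _)]
              refine ENNReal.ofReal_le_ofReal ?_
              rw [mul_left_comm, mul_assoc 2, ← Real.exp_add, ← Real.exp_add]
              refine mul_le_mul_of_nonneg_left (Real.exp_le_exp.2 ?_) (by norm_num)
              have h1 : C * lam ^ 2 * n ≤ C * lam ^ 2 * N := by
                refine mul_le_mul_of_nonneg_left ?_ (by positivity)
                exact_mod_cast (Nat.le_succ n).trans hn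
              have h2 : lam * (cen f β s - t) ≤ lam0 * (cen f β s - t) :=
                mul_le_mul_of_nonneg_right hl0 (by linarith)
              rw [ht] at h2 ⊢
              nlinarith
      · rw [one_false hs, one_true hs, zero_mul, mul_zero, add_zero, one_mul]
        refine le_trans (Ex_mono p fun l _ => ?_) (ih (by omega) (x + f s) (a + cen f β s)
          (by linarith [not_le.1 hs]) fun j hj => ?_)
        · rw [hmx]
          gcongr
          exact one_mono fun h => h.2
        · have := hx (j + 1) (by omega)
          simp only [cen]
          push_cast at this ⊢
          linarith
    -- After the crossing the walk is at least `H` above the level needed, so it survives with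
    -- probability at least one half. This pays for the survival dropped in `hterm`.
    have hsv : ∀ s, t ≤ cen f β s → 2⁻¹ ≤ Ps p f (x + f s) n := by
      intro s hs
      have h1 : Ex p n (fun l => one (¬ Surv f (x + f s) l)) ≤ 2⁻¹ := by
        refine le_trans (Ex_mono p fun l hl => one_mono fun h => ?_) (hH n (by omega))
        refine (lt_Mx_of_not_surv f β (fun j hj => ?_) h).le
        have := hx (j + 1) (by omega)
        simp only [cen] at hs
        push_cast at this ⊢
        linarith
      have h2 := Ex_one_not p hG.sum_eq_one n (fun l => Surv f (x + f s) l)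
      by_contra h3
      have h4 : Ps p f (x + f s) n < 2⁻¹ := not_le.1 h3
      have h5 := ENNReal.add_lt_add_of_lt_of_le (h1.trans_lt (by simp)).ne h4 h1
      unfold Ps at h5
      rw [h2, ENNReal.inv_two_add_inv_two] at h5
      exact lt_irrefl _ h5
    calc _ ≤ ∑' s, (p s * (one (¬ t ≤ cen f β s) * (D * Ps p f (x + f s) n))
        + ENNReal.ofReal (2 * Real.exp (lam * H + C * lam ^ 2 * N))
          * (p s * (one (t ≤ cen f β s) * ENNReal.ofReal (Real.exp (lam0 * (cen f β s - t)))))) := by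
          refine ENNReal.tsum_le_tsum fun s => ?_
          rw [mul_left_comm (ENNReal.ofReal _) (p s), ← mul_add]
          gcongr
          exact hterm s
      _ ≤ ∑' s, (p s * (one (¬ t ≤ cen f β s) * (D * Ps p f (x + f s) n)))
          + ∑' s, p s * (one (t ≤ cen f β s) * (D * Ps p f (x + f s) n)) := by
          rw [ENNReal.tsum_add]
          refine add_le_add le_rfl ?_
          rw [ENNReal.tsum_mul_left]
          calc _ ≤ ENNReal.ofReal (2 * Real.exp (lam * H + C * lam ^ 2 * N))
                * (ENNReal.ofReal Co * ∑' s, p s * one (t ≤ cen f β s)) := by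
                gcongr
                exact hG.overshoot t ht0
            _ = ∑' s, p s * (one (t ≤ cen f β s) * (D * 2⁻¹)) := by
                -- The factor `4 Co` is made of the `2` from the exponential moment of the maximum,
                -- the overshoot constant `Co`, and the `2` lost through survival.
                have hD2 : D * 2⁻¹ = ENNReal.ofReal (2 * Real.exp (lam * H + C * lam ^ 2 * N))
                    * ENNReal.ofReal Co := by
                  have : (2⁻¹ : ℝ≥0∞) = ENNReal.ofReal 2⁻¹ := by
                    rw [ENNReal.ofReal_inv_of_pos (by norm_num)]; simp
                  rw [this, hD, ← ENNReal.ofReal_mul (by positivity),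
                    ← ENNReal.ofReal_mul (by positivity)]
                  congr 1
                  ring
                rw [hD2]
                simp only [← mul_assoc, ENNReal.tsum_mul_right]
                ring
            _ ≤ _ := by
                refine ENNReal.tsum_le_tsum fun s => ?_
                by_cases hs : t ≤ cen f β s
                · gcongr
                  exact hsv s hs
                · simp [one_false hs]
      _ = _ := by
          rw [← ENNReal.tsum_add, ← ENNReal.tsum_mul_left]
          refine tsum_congr fun s => ?_
          rw [← mul_add, ← add_mul, add_comm (one _), one_add_one_not, one_mul]
          ring

/-- With probability at least one half the overshoot is bounded. -/
theorem Good.overshoot_bounded (hG : Good p f β lam0 C Co CU)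
    (hl0 : 0 < lam0) {K : ℝ} (hK : 2 * Co ≤ Real.exp (lam0 * K)) {t : ℝ} (ht : 0 < t) :
    ∑' s, p s * one (t ≤ cen f β s)
      ≤ 2 * ∑' s, p s * one (t ≤ cen f β s ∧ cen f β s ≤ t + K) := by
  set A := ∑' s, p s * one (t ≤ cen f β s)
  set B := ∑' s, p s * one (t ≤ cen f β s ∧ cen f β s ≤ t + K)
  have hA : A ≤ 1 := by
    rw [← hG.sum_eq_one]
    exact ENNReal.tsum_le_tsum fun s => mul_le_of_le_one_right' (one_le _)
  -- Markov's inequality for the overshoot beyond `K`; its bound `Co exp (-lam0 K)` is at most one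
  -- half by the choice of `K`.
  have h1 : A ≤ B + 2⁻¹ * A := by
    calc A ≤ ∑' s, (p s * one (t ≤ cen f β s ∧ cen f β s ≤ t + K)
          + ENNReal.ofReal (Real.exp (-(lam0 * K))) * (p s * (one (t ≤ cen f β s)
            * ENNReal.ofReal (Real.exp (lam0 * (cen f β s - t)))))) := by
          refine ENNReal.tsum_le_tsum fun s => ?_
          rw [mul_left_comm (ENNReal.ofReal _) (p s), ← mul_add]
          gcongr
          by_cases hs : t ≤ cen f β s
          · by_cases hs' : cen f β s ≤ t + K
            · rw [one_true hs, one_true ⟨hs, hs'⟩]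
              exact le_self_add
            · rw [one_true hs, one_mul, ← ENNReal.ofReal_mul (Real.exp_nonneg _), ← Real.exp_add]
              refine le_add_left ?_
              rw [ENNReal.one_le_ofReal]
              refine Real.one_le_exp ?_
              nlinarith [not_le.1 hs']
          · rw [one_false hs]
            exact zero_le
      _ ≤ B + ENNReal.ofReal (Real.exp (-(lam0 * K))) * (ENNReal.ofReal Co * A) := by
          rw [ENNReal.tsum_add, ENNReal.tsum_mul_left]
          gcongr
          exact hG.overshoot t ht
      _ ≤ B + 2⁻¹ * A := by
          rw [← mul_assoc, ← ENNReal.ofReal_mul (Real.exp_nonneg _)]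
          gcongr
          have : (2⁻¹ : ℝ≥0∞) = ENNReal.ofReal 2⁻¹ := by
            rw [ENNReal.ofReal_inv_of_pos (by norm_num)]; simp
          rw [this]
          refine ENNReal.ofReal_le_ofReal ?_
          rw [Real.exp_neg, inv_mul_le_iff₀ (Real.exp_pos _)]
          linarith
  have h2 : 2⁻¹ * A + 2⁻¹ * A ≤ B + 2⁻¹ * A := by
    rwa [← add_mul, ENNReal.inv_two_add_inv_two, one_mul]
  have h3 : 2⁻¹ * A ≤ B := by
    refine (ENNReal.add_le_add_iff_right ?_).1 h2
    exact ENNReal.mul_ne_top (by simp) (hA.trans_lt (by simp)).ne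
  calc A = 2 * (2⁻¹ * A) := by rw [← mul_assoc, ENNReal.mul_inv_cancel (by simp) (by simp), one_mul]
    _ ≤ _ := by gcongr

/-- A lower bound for bridges from the first passage above a level. -/
theorem Good.bridge_ge_of_hit (hG : Good p f β lam0 C Co CU)
    (hl0 : 0 < lam0) {K : ℝ} (hK : 2 * Co ≤ Real.exp (lam0 * K)) {H : ℝ} {r : ℕ} {y : ℤ}
    {g : ℝ≥0∞} (n : ℕ) (x : ℤ) (a : ℝ) (ha : a < H)
    (hg : ∀ n' ≤ n, ∀ (w : ℤ) (a' : ℝ), H ≤ a' → a' ≤ H + K →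
      (w : ℝ) = x - a + (n - n') * β + a' → g ≤ Pb p f (n' + r) w y) :
    2⁻¹ * g * Ex p n (fun l => one (Surv f x l ∧ H ≤ a + Mx (cen f β) l)) ≤ Pb p f (n + r) x y := by
  induction n generalizing x a with
  | zero =>
    simp only [Ex, Mx, add_zero]
    rw [one_false fun h => absurd h.2 (not_le.2 ha), mul_zero]
    exact zero_le
  | succ n ih =>
    by_cases h0 : 0 ≤ x
    swap
    · have : ∀ l, one (Surv f x l ∧ H ≤ a + Mx (cen f β) l) = 0 :=
        fun l => one_false fun h => h0 h.1.nonneg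
      simp [this, Ex_const p hG.sum_eq_one]
    rw [Nat.add_right_comm, Pb_succ p f _ y h0]
    simp only [Ex]
    set t := H - a with ht
    have ht0 : 0 < t := by linarith
    -- Steps that stay below the level use induction. Steps that cross it with overshoot at most `K`
    -- use `g`; larger overshoots are discarded at the price of the factor `2⁻¹`.
    have hA : ∀ s, ¬ t ≤ cen f β s →
        2⁻¹ * g * Ex p n (fun l => one (Surv f x (s :: l) ∧ H ≤ a + Mx (cen f β) (s :: l)))
          ≤ Pb p f (n + r) (x + f s) y := by
      intro s hs
      refine le_trans ?_ (ih (x + f s) (a + cen f β s) (by linarith [not_le.1 hs]) ?_)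
      · gcongr 2⁻¹ * g * ?_
        refine Ex_mono p fun l _ => one_mono fun h => ⟨h.1.2, ?_⟩
        have := h.2
        simp only [Mx] at this
        rw [← max_add_add_left, add_zero, le_max_iff] at this
        rcases this with h | h
        · linarith
        · linarith
      · intro n' hn' w a' h1 h2 h3
        refine hg n' (by omega) w a' h1 h2 ?_
        rw [h3]
        simp only [cen]
        push_cast
        ring
    have hB : ∀ s, (t ≤ cen f β s ∧ cen f β s ≤ t + K) → g ≤ Pb p f (n + r) (x + f s) y := by
      intro s hs
      refine hg n (by omega) (x + f s) (a + cen f β s) (by linarith) (by linarith) ?_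
      simp only [cen]
      push_cast
      ring
    calc _ = ∑' s, p s * (2⁻¹ * g * Ex p n (fun l => one (Surv f x (s :: l) ∧
            H ≤ a + Mx (cen f β) (s :: l)))) := by
          rw [← ENNReal.tsum_mul_left]
          exact tsum_congr fun s => by ring
      _ ≤ ∑' s, (p s * (one (¬ t ≤ cen f β s) * Pb p f (n + r) (x + f s) y)
            + 2⁻¹ * g * (p s * one (t ≤ cen f β s))) := by
          refine ENNReal.tsum_le_tsum fun s => ?_
          rw [mul_left_comm (2⁻¹ * g) (p s), ← mul_add]
          gcongr
          by_cases hs : t ≤ cen f β s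
          · rw [one_true hs]
            refine le_add_left ?_
            gcongr
            exact Ex_one_le p hG.sum_eq_one _ _
          · rw [one_true hs, one_mul]
            exact le_add_right (hA s hs)
      _ ≤ ∑' s, p s * (one (¬ t ≤ cen f β s) * Pb p f (n + r) (x + f s) y)
            + ∑' s, p s * (one (t ≤ cen f β s) * Pb p f (n + r) (x + f s) y) := by
          rw [ENNReal.tsum_add, ENNReal.tsum_mul_left]
          refine add_le_add le_rfl ?_
          calc _ ≤ 2⁻¹ * g * (2 * ∑' s, p s * one (t ≤ cen f β s ∧ cen f β s ≤ t + K)) := by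
                gcongr
                exact hG.overshoot_bounded hl0 hK ht0
            _ = ∑' s, p s * (one (t ≤ cen f β s ∧ cen f β s ≤ t + K) * g) := by
                simp only [← mul_assoc, ENNReal.tsum_mul_right]
                rw [mul_comm 2⁻¹ g, mul_assoc g, ENNReal.inv_mul_cancel (by simp) (by simp)]
                ring
            _ ≤ _ := by
                refine ENNReal.tsum_le_tsum fun s => ?_
                gcongr p s * ?_
                by_cases hs : t ≤ cen f β s ∧ cen f β s ≤ t + K
                · rw [one_true hs, one_true hs.1, one_mul, one_mul]
                  exact hB s hs
                · rw [one_false hs, zero_mul]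
                  exact zero_le
      _ = _ := by
          rw [← ENNReal.tsum_add]
          refine tsum_congr fun s => ?_
          rw [← mul_add, ← add_mul, add_comm (one _), one_add_one_not, one_mul]

/-- A bridge high above zero stays nonnegative, up to an explicit error. -/
theorem Good.free_le_bridge (hG : Good p f β lam0 C Co CU) {r₁ r₂ : ℕ} (hr₁ : 1 ≤ r₁)
    (hr₂ : 1 ≤ r₂) {H : ℝ} {w w' : ℤ} (h₁ : ∀ j : ℕ, j ≤ r₁ → H ≤ w + j * β)
    (h₂ : ∀ j : ℕ, j ≤ r₂ → H ≤ w' + j * (-β)) :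
    Ex p (r₁ + r₂) (fun l => one (hsum f l = w' - w)) ≤ Pb p f (r₁ + r₂) w w'
      + (Ex p r₁ (fun l => one (H ≤ Mx (fun s => -cen f β s) l)) * ENNReal.ofReal (CU / √r₂)
      + Ex p r₂ (fun l => one (H ≤ Mx (cen f β) l)) * ENNReal.ofReal (CU / √r₁)) := by
  unfold Pb
  -- A free bridge that fails to survive fails in the first piece, or in the second piece read
  -- backwards. Given the piece that fails, the other one has a prescribed displacement, which
  -- yields the factor `CU / √r`.
  have hpt : ∀ l l' : List ℕ, l.length = r₁ → l'.length = r₂ →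
      one (hsum f (l ++ l') = w' - w) ≤ one (Br f w w' (l ++ l'))
        + (one (H ≤ Mx (fun s => -cen f β s) l) * one (hsum f l' = w' - w - hsum f l)
        + one (H ≤ Mx (cen f β) l'.reverse) * one (hsum f l = w' - w - hsum f l')) := by
    intro l l' hl hl'
    by_cases h : hsum f (l ++ l') = w' - w
    swap
    · rw [one_false h]; exact zero_le
    have hh := h
    rw [hsum_append] at hh
    rw [one_true h, one_true (show hsum f l' = w' - w - hsum f l by omega),
      one_true (show hsum f l = w' - w - hsum f l' by omega), mul_one, mul_one]
    by_cases hs : Surv f w (l ++ l')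
    · rw [one_true (show Br f w w' (l ++ l') from ⟨hs, by omega⟩)]
      exact le_self_add
    · refine le_add_left ?_
      rw [surv_append, not_and_or] at hs
      rcases hs with hs | hs
      · have := lt_Mx_of_not_surv f β (H := H) (by rwa [hl]) hs
        rw [one_true this.le]
        exact le_self_add
      · rw [surv_reverse] at hs
        have h3 : w + hsum f l + hsum f l' = w' := by omega
        rw [h3] at hs
        have := lt_Mx_of_not_surv (-f) (-β) (H := H) (by simpa [hl'] using h₂) hs
        rw [cen_neg] at this
        simp only [neg_neg] at this
        rw [one_true this.le]
        exact le_add_left le_rfl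
  rw [Ex_append, Ex_append]
  calc _ ≤ Ex p r₁ (fun l => Ex p r₂ (fun l' => one (Br f w w' (l ++ l'))
        + (one (H ≤ Mx (fun s => -cen f β s) l) * one (hsum f l' = w' - w - hsum f l)
        + one (H ≤ Mx (cen f β) l'.reverse) * one (hsum f l = w' - w - hsum f l')))) :=
        Ex_mono p fun l hl => Ex_mono p fun l' hl' => hpt l l' hl hl'
    _ ≤ _ := by
        simp only [Ex_add]
        refine add_le_add le_rfl (add_le_add ?_ ?_)
        · rw [← Ex_mul_const]
          refine Ex_mono p fun l _ => ?_
          rw [Ex_const_mul]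
          gcongr
          exact hG.conc r₂ hr₂ _
        · rw [Ex_comm, ← Ex_mul_const, ← Ex_reverse p r₂ (fun l => one _ * ENNReal.ofReal _)]
          refine Ex_mono p fun l _ => ?_
          rw [Ex_const_mul]
          gcongr
          exact hG.conc r₁ hr₁ _

/-- Functionals of an initial piece of a bridge are controlled by the surviving walk. -/
theorem Good.bridge_functional_le (hG : Good p f β lam0 C Co CU) {n r m : ℕ} (hr : 1 ≤ r)
    (x y : ℤ) (F : List ℕ → ℝ≥0∞) :
    Ex p (n + (r + m)) (fun l => F (l.take n) * one (Br f x y l))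
      ≤ Ex p n (fun l => F l * one (Surv f x l)) * (ENNReal.ofReal (CU / √r) * Ps p (-f) y m) := by
  rw [Ex_append, ← Ex_mul_const]
  refine Ex_mono p fun l hl => ?_
  rw [Ex_append]
  -- Of the middle piece only its displacement is kept, and this is determined by the outer pieces.
  -- The last piece, read backwards from `y`, survives.
  calc _ ≤ Ex p r (fun l₂ => Ex p m (fun l₃ => F l * one (Surv f x l) *
        (one (hsum f l₂ = y - x - hsum f l - hsum f l₃) * one (Surv (-f) y l₃.reverse)))) := by
        refine Ex_mono p fun l₂ _ => Ex_mono p fun l₃ _ => ?_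
        rw [List.take_left' hl, mul_assoc]
        gcongr
        rw [← one_and, ← one_and]
        refine one_mono fun h => ?_
        obtain ⟨h1, h2⟩ := h
        rw [surv_append, surv_append] at h1
        have h3 := h1.2.2
        rw [surv_reverse] at h3
        simp only [hsum_append] at h2
        have h4 : x + hsum f l + hsum f l₂ + hsum f l₃ = y := by omega
        rw [h4] at h3
        exact ⟨h1.1, by omega, h3⟩
    _ ≤ _ := by
        rw [Ex_comm]
        simp only [Ex_const_mul, Ex_mul_const]
        gcongr
        unfold Ps
        rw [← Ex_const_mul, ← Ex_reverse p m]
        refine Ex_mono p fun l₃ _ => ?_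
        gcongr
        · exact hG.conc r hr _
        · rw [List.reverse_reverse]

end

/-! ### A lower bound for the probability of a nonnegative bridge -/

/-- A local lower bound at the centre of the law. -/
def Low (p : ℕ → ℝ≥0∞) (f : ℕ → ℤ) (β A c : ℝ) (n₀ : ℕ) : Prop :=
  ∀ n : ℕ, n₀ ≤ n → ∀ d : ℤ, |(d : ℝ) - n * β| ≤ A * √n →
    ENNReal.ofReal (c / √n) ≤ Ex p n (fun l => one (hsum f l = d))

theorem Low.neg {p : ℕ → ℝ≥0∞} {f : ℕ → ℤ} {β A c : ℝ} {n₀ : ℕ} (h : Low p f β A c n₀) :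
    Low p (-f) (-β) A c n₀ := by
  intro n hn d hd
  refine (h n hn (-d) ?_).trans (le_of_eq (Ex_congr p fun l _ => one_congr ?_))
  · rw [← abs_neg]
    convert hd using 2
    push_cast
    ring
  · rw [hsum_neg]
    omega

theorem natSqrt_ge (n : ℕ) : √(n : ℝ) ≤ 2 * Nat.sqrt n := by
  rcases Nat.eq_zero_or_pos n with rfl | hn
  · simp
  have h1 : n < (Nat.sqrt n + 1) * (Nat.sqrt n + 1) := Nat.lt_succ_sqrt n
  have h2 : 1 ≤ Nat.sqrt n := Nat.sqrt_pos.2 hn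
  rw [Real.sqrt_le_left (by positivity)]
  have : n ≤ (2 * Nat.sqrt n) ^ 2 := by nlinarith
  exact_mod_cast this

/-- Add the local lower bounds, each of order `1 / √n`, over the `⌊√n⌋` integer end points just
above the level `H`. -/
theorem Low.hit {p : ℕ → ℝ≥0∞} {f : ℕ → ℤ} {β A c : ℝ} {n₀ : ℕ} (h : Low p f β A c n₀)
    (hc : 0 ≤ c) {n : ℕ} (hn : n₀ ≤ n) (hn1 : 1 ≤ n) {H : ℝ} (hH0 : 0 ≤ H)
    (hH : H + √n ≤ A * √n) :
    ENNReal.ofReal (c / 2) ≤ Ex p n (fun l => one (H ≤ Mx (cen f β) l)) := by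
  have hs : (0 : ℝ) < √n := Real.sqrt_pos.2 (by exact_mod_cast hn1)
  -- The targets `d₀ + i` with `i < ⌊√n⌋` have centered height between `H` and `H + √n`, hence lie
  -- in the window of `Low`.
  set d₀ : ℤ := ⌈n * β + H⌉ with hd₀
  have hd1 : n * β + H ≤ d₀ := Int.le_ceil _
  have hd2 : (d₀ : ℝ) < n * β + H + 1 := Int.ceil_lt_add_one _
  have hsq : ((Nat.sqrt n : ℕ) : ℝ) ≤ √n := Real.nat_sqrt_le_real_sqrt
  calc ENNReal.ofReal (c / 2) ≤ ∑ i ∈ Finset.range (Nat.sqrt n), ENNReal.ofReal (c / √n) := by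
        rw [Finset.sum_const, Finset.card_range, nsmul_eq_mul, ← ENNReal.ofReal_natCast,
          ← ENNReal.ofReal_mul (by positivity)]
        refine ENNReal.ofReal_le_ofReal ?_
        have := natSqrt_ge n
        rw [mul_div_assoc', le_div_iff₀ hs]
        nlinarith
    _ ≤ ∑ i ∈ Finset.range (Nat.sqrt n), Ex p n (fun l => one (hsum f l = d₀ + i)) := by
        refine Finset.sum_le_sum fun i hi => h n hn _ ?_
        have hi' : (i : ℝ) + 1 ≤ √n := by
          refine le_trans ?_ hsq
          exact_mod_cast Finset.mem_range.1 hi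
        have hi0 : (0 : ℝ) ≤ i := by positivity
        push_cast
        rw [abs_le]
        constructor <;> nlinarith
    _ = Ex p n (fun l => ∑ i ∈ Finset.range (Nat.sqrt n), one (hsum f l = d₀ + i)) :=
        (Ex_finset_sum p n _ _).symm
    _ ≤ _ := by
        refine Ex_mono p fun l hl => ?_
        by_cases hex : ∃ i ∈ Finset.range (Nat.sqrt n), hsum f l = d₀ + i
        · obtain ⟨i, hi, hli⟩ := hex
          rw [Finset.sum_eq_single_of_mem i hi fun j _ hj => one_false fun h2 => hj (by omega)]
          refine one_mono fun _ => ?_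
          have h1 := sum_le_Mx (cen f β) l []
          rw [List.append_nil, sum_cen, hl, hli] at h1
          push_cast at h1
          have hi0 : (0 : ℝ) ≤ i := by positivity
          linarith
        · push Not at hex
          rw [Finset.sum_eq_zero fun i hi => one_false (hex i hi)]
          exact zero_le

/-- Both events are increasing in the steps when `f` is monotone and decreasing when `f` is
antitone, so the Harris inequality applies. The second case serves the reversed walk. -/
theorem surv_and_hit_ge {p : ℕ → ℝ≥0∞} (hp : ∑' s, p s = 1) {f : ℕ → ℤ} {β H : ℝ}
    (hf : Monotone f ∨ Antitone f) (n : ℕ) (x : ℤ) :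
    Ps p f x n * Ex p n (fun l => one (H ≤ Mx (cen f β) l))
      ≤ Ex p n (fun l => one (Surv f x l ∧ H ≤ Mx (cen f β) l)) := by
  rcases hf with hf | hf
  · have hg : Monotone (cen f β) := fun s t h => by
      simp only [cen]
      have : (f s : ℝ) ≤ f t := by exact_mod_cast hf h
      linarith
    exact Ex_one_mul_one_ge hp n (fun l l' h => surv_mono hf h le_rfl)
      (fun l l' h h1 => h1.trans (Mx_mono hg h))
  · have hg : Antitone (cen f β) := fun s t h => by
      simp only [cen]
      have : (f t : ℝ) ≤ f s := by exact_mod_cast hf h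
      linarith
    exact Ex_one_mul_one_ge_anti hp n (fun l l' h => surv_anti hf h le_rfl)
      (fun l l' h h1 => h1.trans (Mx_anti hg h))

theorem line_nonneg {x y β : ℝ} {L t : ℝ} (hx : 0 ≤ x) (hy : 0 ≤ y) (h : y - x = L * β)
    (ht0 : 0 ≤ t) (ht : t ≤ L) : 0 ≤ x + t * β := by
  rcases le_total 0 β with hb | hb
  · positivity
  · nlinarith

section

variable {p : ℕ → ℝ≥0∞} {f : ℕ → ℤ} {β lam0 C Co CU : ℝ}

/-- Large deviations of the running maximum on the diffusive scale. -/
theorem Good.prob_Mx_ge (hG : Good p f β lam0 C Co CU) (hC : 0 ≤ C) {L n : ℕ} (hL : 1 ≤ L)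
    (hn : n ≤ L) (hlam : 1 ≤ lam0 * √L) (C₁ : ℝ) :
    Ex p n (fun l => one (C₁ * √L ≤ Mx (cen f β) l)) ≤ ENNReal.ofReal (2 * Real.exp (C - C₁)) ∧
    Ex p n (fun l => one (C₁ * √L ≤ Mx (fun s => -cen f β s) l))
      ≤ ENNReal.ofReal (2 * Real.exp (C - C₁)) := by
  have hL0 : (0 : ℝ) < L := by exact_mod_cast hL
  have hs : 0 < √(L : ℝ) := Real.sqrt_pos.2 hL0
  -- The exponent `λ = 1 / √L` makes the variance term `C λ² n` at most `C`.
  have hl : |1 / √(L : ℝ)| ≤ lam0 := by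
    rw [abs_of_nonneg (by positivity), div_le_iff₀ hs]
    exact hlam
  have hle : ENNReal.ofReal (Real.exp (-(1 / √(L : ℝ) * (C₁ * √L))))
      * ENNReal.ofReal (2 * Real.exp (C * (1 / √(L : ℝ)) ^ 2 * n))
      ≤ ENNReal.ofReal (2 * Real.exp (C - C₁)) := by
    rw [← ENNReal.ofReal_mul (Real.exp_nonneg _)]
    refine ENNReal.ofReal_le_ofReal ?_
    rw [mul_left_comm, ← Real.exp_add]
    refine mul_le_mul_of_nonneg_left (Real.exp_le_exp.2 ?_) (by norm_num)
    have h1 : 1 / √(L : ℝ) * (C₁ * √L) = C₁ := by field_simp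
    have h2 : C * (1 / √(L : ℝ)) ^ 2 * n ≤ C := by
      rw [div_pow, Real.sq_sqrt hL0.le, one_pow, mul_assoc]
      refine mul_le_of_le_one_right hC ?_
      rw [one_div, inv_mul_le_iff₀ hL0, mul_one]
      exact_mod_cast hn
    rw [h1]
    linarith
  exact ⟨(Ex_one_le_exp (by positivity) (hG.exp_Mx hl n)).trans hle,
    (Ex_one_le_exp (by positivity) (hG.exp_Mx_neg hl n)).trans hle⟩

/-- In the bulk the bridge probability is comparable with the free one. -/
theorem Good.middle_ge (hG : Good p f β lam0 C Co CU) (hC : 0 ≤ C) (hCU : 0 ≤ CU) {K cc : ℝ} {nc : ℕ}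
    (hcc : 0 < cc) (hlow : Low p f β K cc nc) (hK : 0 ≤ K) {C₁ : ℝ}
    (hC₁ : 12 * CU * Real.exp (C - C₁) ≤ cc / 2) {L R : ℕ} (hL : 16 ≤ L) (hRL : R ≤ L)
    (hLR : L ≤ 2 * R) (hnc : nc ≤ R) (hlam : 1 ≤ lam0 * √L) {w w' : ℤ}
    (hw : |(w' : ℝ) - w - R * β| ≤ K) (h₁ : ∀ j : ℕ, j ≤ R → C₁ * √L ≤ w + j * β)
    (h₂ : ∀ j : ℕ, j ≤ R → C₁ * √L ≤ w' + j * (-β)) :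
    ENNReal.ofReal (cc / 2 / √L) ≤ Pb p f R w w' := by
  have hL0 : (0 : ℝ) < L := by exact_mod_cast (by omega : 0 < L)
  have hs : 0 < √(L : ℝ) := Real.sqrt_pos.2 hL0
  -- Both pieces have length at least `L / 8`, so each concentration factor is at most `3 CU / √L`.
  -- The two errors add up to at most `12 CU exp (C - C₁) / √L`, half of the free lower bound.
  obtain ⟨r₁, r₂, hr, hr₁, hr₂⟩ : ∃ r₁ r₂, R = r₁ + r₂ ∧ L ≤ 8 * r₁ ∧ L ≤ 8 * r₂ :=
    ⟨R / 2, R - R / 2, by omega, by omega, by omega⟩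
  subst hr
  have hR0 : (1 : ℝ) ≤ ((r₁ + r₂ : ℕ) : ℝ) := by exact_mod_cast (by omega : 1 ≤ r₁ + r₂)
  have h := hG.free_le_bridge (r₁ := r₁) (r₂ := r₂) (by omega) (by omega) (H := C₁ * √L) (w := w) (w' := w')
    (fun j hj => h₁ j (by omega)) (fun j hj => h₂ j (by omega))
  have hfree := hlow (r₁ + r₂) hnc (w' - w) (by
    push_cast at hw ⊢
    refine hw.trans ?_
    refine le_mul_of_one_le_right hK ?_
    rw [Real.one_le_sqrt]
    exact_mod_cast hR0)
  have hr : ∀ r : ℕ, L ≤ 8 * r → CU / √r ≤ 3 * CU / √L := by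
    intro r hr
    have hr0 : (0 : ℝ) < r := by exact_mod_cast (by omega : 0 < r)
    rw [div_le_div_iff₀ (Real.sqrt_pos.2 hr0) hs]
    have : √(L : ℝ) ≤ 3 * √r := by
      rw [Real.sqrt_le_left (by positivity), mul_pow, Real.sq_sqrt hr0.le]
      have : (L : ℝ) ≤ 8 * r := by exact_mod_cast hr
      linarith
    nlinarith
  have herr : Ex p r₁ (fun l => one (C₁ * √L ≤ Mx (fun s => -cen f β s) l)) * ENNReal.ofReal (CU / √r₂)
      + Ex p r₂ (fun l => one (C₁ * √L ≤ Mx (cen f β) l)) * ENNReal.ofReal (CU / √r₁)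
      ≤ ENNReal.ofReal (cc / 2 / √L) := by
    calc _ ≤ ENNReal.ofReal (2 * Real.exp (C - C₁)) * ENNReal.ofReal (3 * CU / √L)
          + ENNReal.ofReal (2 * Real.exp (C - C₁)) * ENNReal.ofReal (3 * CU / √L) := by
          exact add_le_add
            (mul_le_mul' (hG.prob_Mx_ge hC (by omega) (by omega) hlam C₁).2
              (ENNReal.ofReal_le_ofReal (hr r₂ hr₂)))
            (mul_le_mul' (hG.prob_Mx_ge hC (by omega) (by omega) hlam C₁).1
              (ENNReal.ofReal_le_ofReal (hr r₁ hr₁)))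
      _ ≤ _ := by
          rw [← ENNReal.ofReal_mul (by positivity), ← ENNReal.ofReal_add (by positivity) (by positivity)]
          refine ENNReal.ofReal_le_ofReal ?_
          have : 2 * Real.exp (C - C₁) * (3 * CU / √L) + 2 * Real.exp (C - C₁) * (3 * CU / √L)
              = 12 * CU * Real.exp (C - C₁) / √L := by ring
          rw [this]
          gcongr
  have hlow' : ENNReal.ofReal (cc / 2 / √L) + ENNReal.ofReal (cc / 2 / √L)
      ≤ Pb p f (r₁ + r₂) w w' + ENNReal.ofReal (cc / 2 / √L) := by
    calc _ = ENNReal.ofReal (cc / √L) := by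
          rw [← ENNReal.ofReal_add (by positivity) (by positivity)]
          congr 1
          ring
      _ ≤ ENNReal.ofReal (cc / √((r₁ + r₂ : ℕ) : ℝ)) := by
          refine ENNReal.ofReal_le_ofReal ?_
          gcongr
      _ ≤ _ := hfree.trans (h.trans (by gcongr))
  exact (ENNReal.add_le_add_iff_right ENNReal.ofReal_ne_top).1 hlow'

end

/-- Let the walk from `x` and the reversed walk from `y` each rise to height of order `√L` above the
chord within `L / 4` steps; given survival this has probability bounded below. The bridge left in
between is so high that its probability is comparable with the free one, of order `1 / √L`. -/
theorem exists_bridge_ge {lam0 C Co CU : ℝ} (hlam0 : 0 < lam0) (hC : 0 ≤ C) (hCo : 1 ≤ Co)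
    (hCU : 0 ≤ CU) (cL : ℝ → ℝ) (nL : ℝ → ℕ) (hcL : ∀ A, 0 < cL A) :
    ∃ c > 0, ∃ L₀ : ℕ, ∀ (p : ℕ → ℝ≥0∞) (f : ℕ → ℤ) (β : ℝ), Good p f β lam0 C Co CU →
      Good p (-f) (-β) lam0 C Co CU → (∀ A, Low p f β A (cL A) (nL A)) →
      (Monotone f ∨ Antitone f) → ∀ L ≥ L₀, ∀ x y : ℤ, 0 ≤ x → 0 ≤ y → (y : ℝ) - x = L * β →
      ENNReal.ofReal (c / √L) * (Ps p f x (L / 4) * Ps p (-f) y (L / 4)) ≤ Pb p f L x y := by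
  -- The overshoot allowed at both passages, with `exp (lam0 * K) = 2 * Co`.
  set K := Real.log (2 * Co) / lam0 with hKdef
  have hK0 : 0 ≤ K := div_nonneg (Real.log_nonneg (by linarith)) hlam0.le
  have hK : 2 * Co ≤ Real.exp (lam0 * K) := by
    rw [hKdef, mul_div_cancel₀ _ hlam0.ne', Real.exp_log (by linarith)]
  set cc := cL K with hcc
  have hcc0 : 0 < cc := hcL K
  -- Large enough for the error in the bulk to be at most half of the free probability, by `exp u ≥
  -- u + 1`.
  set C₁ := C + 24 * CU / cc + 1 with hC₁def
  have hC₁pos : 0 < C₁ := by positivity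
  have hC₁ : 12 * CU * Real.exp (C - C₁) ≤ cc / 2 := by
    have h1 : Real.exp (C - C₁) ≤ 1 / (24 * CU / cc + 1) := by
      have : C - C₁ = -(24 * CU / cc + 1) := by rw [hC₁def]; ring
      rw [this, Real.exp_neg, one_div]
      exact inv_anti₀ (by positivity) (by linarith [Real.add_one_le_exp (24 * CU / cc + 1)])
    have h2 : 12 * CU * (1 / (24 * CU / cc + 1)) ≤ cc / 2 := by
      rw [mul_one_div, div_le_iff₀ (by positivity)]
      have : cc / 2 * (24 * CU / cc + 1) = 12 * CU + cc / 2 := by field_simp; ring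
      rw [this]
      linarith
    exact (mul_le_mul_of_nonneg_left h1 (by positivity)).trans h2
  -- The height `H = C₁ √L` must be reached within `m = L / 4` steps; since `√L ≤ 3 √m`, the window
  -- `A √m` contains `H + √m`.
  set A := 3 * C₁ + 1 with hA
  set cA := cL A with hcA
  have hcA0 : 0 < cA := hcL A
  refine ⟨cc / 2 * (cA / 4) * (cA / 4), by positivity,
    16 + 2 * nL K + 4 * nL A + ⌈1 / lam0 ^ 2⌉₊, ?_⟩
  intro p f β hG hG' hlow hf L hL x y hx hy hxy
  have hL0 : (0 : ℝ) < L := by exact_mod_cast (by omega : 0 < L)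
  have hs : 0 < √(L : ℝ) := Real.sqrt_pos.2 hL0
  have hlam : 1 ≤ lam0 * √L := by
    have h1 : 1 / lam0 ^ 2 ≤ L := by
      refine (Nat.le_ceil _).trans ?_
      exact_mod_cast (by omega : ⌈1 / lam0 ^ 2⌉₊ ≤ L)
    have h2 : 1 / lam0 ≤ √L := by
      refine Real.le_sqrt_of_sq_le ?_
      rwa [div_pow, one_pow]
    rwa [div_le_iff₀' hlam0] at h2
  set m := L / 4 with hm
  have hm0 : (0 : ℝ) < m := by exact_mod_cast (by omega : 0 < m)
  have hsm : √(L : ℝ) ≤ 3 * √m := by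
    rw [Real.sqrt_le_left (by positivity), mul_pow, Real.sq_sqrt hm0.le]
    have : (L : ℝ) ≤ 9 * m := by exact_mod_cast (by omega : L ≤ 9 * m)
    linarith
  set H := C₁ * √L with hH
  have hH0 : 0 < H := by positivity
  have hHA : H + √m ≤ A * √m := by
    rw [hH, hA]
    nlinarith [Real.sqrt_nonneg (m : ℝ)]
  have hit : ENNReal.ofReal (cA / 2) ≤ Ex p m (fun l => one (H ≤ Mx (cen f β) l)) :=
    (hlow A).hit hcA0.le (by omega) (by omega) hH0.le hHA
  have hit' : ENNReal.ofReal (cA / 2) ≤ Ex p m (fun l => one (H ≤ Mx (cen (-f) (-β)) l)) :=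
    (hlow A).neg.hit hcA0.le (by omega) (by omega) hH0.le hHA
  have hxR : (0 : ℝ) ≤ x := by exact_mod_cast hx
  have hyR : (0 : ℝ) ≤ y := by exact_mod_cast hy
  have hline : ∀ t : ℝ, 0 ≤ t → t ≤ L → 0 ≤ x + t * β := fun t => line_nonneg hxR hyR hxy
  have hf' : Monotone (-f) ∨ Antitone (-f) := hf.symm.imp (fun h => h.neg) (fun h => h.neg)
  set g := ENNReal.ofReal (cc / 2 / √L) with hg
  have h2half : (2⁻¹ : ℝ≥0∞) = ENNReal.ofReal 2⁻¹ := by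
    rw [ENNReal.ofReal_inv_of_pos (by norm_num)]; simp
  -- With the forward walk stopped at its passage, at `w`, the walk is run backwards from `y` until
  -- it passes height `H` as well; the bulk estimate joins the two positions.
  have stage2 : ∀ n' ≤ m, ∀ (w : ℤ) (a' : ℝ), H ≤ a' → a' ≤ H + K →
      (w : ℝ) = x - 0 + (m - n') * β + a' →
      2⁻¹ * g * (Ps p (-f) y m * ENNReal.ofReal (cA / 2)) ≤ Pb p f (n' + (L - m)) w y := by
    intro n' hn' w a' ha1 ha2 hw
    rw [Pb_reverse, show n' + (L - m) = m + (n' + (L - m) - m) by omega]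
    refine le_trans ?_ (hG'.bridge_ge_of_hit hlam0 hK (g := g) (H := H) m y 0 hH0 ?_)
    · gcongr 2⁻¹ * g * ?_
      simp only [zero_add]
      refine le_trans ?_ (surv_and_hit_ge hG.sum_eq_one hf' m y)
      gcongr
    · intro n'' hn'' w' a'' hb1 hb2 hw'
      rw [← Pb_reverse]
      have hn'R : (n' : ℝ) ≤ m := by exact_mod_cast hn'
      have hn''R : (n'' : ℝ) ≤ m := by exact_mod_cast hn''
      have hmL : (4 : ℝ) * m ≤ L := by exact_mod_cast (by omega : 4 * m ≤ L)
      have hcast : ((n'' + (n' + (L - m) - m) : ℕ) : ℝ) = n'' + n' + L - 2 * m := by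
        rw [Nat.cast_add, Nat.cast_sub (by omega), Nat.cast_add, Nat.cast_sub (by omega)]
        ring
      refine hG.middle_ge hC hCU hcc0 (hlow K) hK0 hC₁ (L := L) (by omega) (by omega) (by omega)
        (by omega) hlam ?_ ?_ ?_
      · rw [hcast, hw, hw']
        -- Both heights above the chord lie in `[H, H + K]`, so the remaining displacement is within
        -- `K` of its mean.
        have : (y : ℝ) - 0 + (m - n'') * -β + a'' - (x - 0 + (m - n') * β + a')
            - (n'' + n' + L - 2 * m) * β = a'' - a' := by linear_combination hxy
        rw [this, abs_le]
        constructor <;> linarith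
      · intro j hj
        have hjR : (j : ℝ) ≤ n'' + n' + L - 2 * m := by
          rw [← hcast]
          exact_mod_cast hj
        have := hline (m - n' + j) (by linarith [(Nat.cast_nonneg j : (0 : ℝ) ≤ j)]) (by linarith)
        rw [hw]
        linarith
      · intro j hj
        have hjR : (j : ℝ) ≤ n'' + n' + L - 2 * m := by
          rw [← hcast]
          exact_mod_cast hj
        have := hline (L - (m - n'') - j) (by linarith) (by linarith [(Nat.cast_nonneg j : (0 : ℝ) ≤ j)])
        rw [hw']
        linarith
  have stage1 := hG.bridge_ge_of_hit hlam0 hK (H := H) (r := L - m) (y := y) m x 0 hH0 stage2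
  rw [show m + (L - m) = L by omega] at stage1
  simp only [zero_add] at stage1
  refine le_trans ?_ stage1
  calc _ = 2⁻¹ * (2⁻¹ * g * (Ps p (-f) y m * ENNReal.ofReal (cA / 2)))
        * (Ps p f x m * ENNReal.ofReal (cA / 2)) := by
        have : ENNReal.ofReal (cc / 2 * (cA / 4) * (cA / 4) / √L)
            = 2⁻¹ * 2⁻¹ * g * ENNReal.ofReal (cA / 2) * ENNReal.ofReal (cA / 2) := by
          rw [hg, h2half, ← ENNReal.ofReal_mul (by positivity), ← ENNReal.ofReal_mul (by positivity),
            ← ENNReal.ofReal_mul (by positivity), ← ENNReal.ofReal_mul (by positivity)]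
          congr 1
          ring
        rw [this]
        ring
    _ ≤ _ := by
        gcongr
        refine le_trans ?_ (surv_and_hit_ge hG.sum_eq_one hf m x)
        gcongr

/-! ### Functionals of bridges with moderate slope -/

/-- The upper bound for functionals of an initial piece and the lower bound for the bridge contain
the same survival probabilities and the same order `1 / √L`. In the quotient both cancel, and only
the walk conditioned to survive on the initial piece remains. -/
theorem exists_functional_le {lam0 C Co CU : ℝ} (hlam0 : 0 < lam0) (hC : 0 ≤ C) (hCo : 1 ≤ Co)
    (hCU : 0 ≤ CU) (cL : ℝ → ℝ) (nL : ℝ → ℕ) (hcL : ∀ A, 0 < cL A) :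
    ∃ D ≥ 0, ∃ L₀ : ℕ, ∀ (p : ℕ → ℝ≥0∞) (f : ℕ → ℤ) (β : ℝ), Good p f β lam0 C Co CU →
      Good p (-f) (-β) lam0 C Co CU → (∀ A, Low p f β A (cL A) (nL A)) →
      (Monotone f ∨ Antitone f) → ∀ L ≥ L₀, ∀ x y : ℤ, 0 ≤ x → 0 ≤ y → (y : ℝ) - x = L * β →
      ∀ n : ℕ, L / 4 ≤ n → n ≤ L / 2 + 1 → ∀ (F : List ℕ → ℝ≥0∞) (κ : ℝ≥0∞),
      Ex p n (fun l => F l * one (Surv f x l)) ≤ κ * Ps p f x n →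
      Ex p L (fun l => F (l.take n) * one (Br f x y l)) ≤ ENNReal.ofReal D * κ * Pb p f L x y := by
  obtain ⟨c, hc, L₀, h⟩ := exists_bridge_ge hlam0 hC hCo hCU cL nL hcL
  refine ⟨3 * CU / c, by positivity, L₀ + 32, ?_⟩
  intro p f β hG hG' hlow hf L hL x y hx hy hxy n hn hn' F κ hF
  have hb := h p f β hG hG' hlow hf L (by omega) x y hx hy hxy
  have hL0 : (0 : ℝ) < L := by exact_mod_cast (by omega : 0 < L)
  have hs : 0 < √(L : ℝ) := Real.sqrt_pos.2 hL0
  obtain ⟨r, hr⟩ : ∃ r, L = n + (r + L / 4) := ⟨L - n - L / 4, by omega⟩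
  have hr0 : (0 : ℝ) < r := by exact_mod_cast (by omega : 0 < r)
  have hCr : CU / √r ≤ 3 * CU / c * (c / √L) := by
    rw [div_mul_div_cancel₀ hc.ne', div_le_div_iff₀ (Real.sqrt_pos.2 hr0) hs]
    have : √(L : ℝ) ≤ 3 * √r := by
      rw [Real.sqrt_le_left (by positivity), mul_pow, Real.sq_sqrt hr0.le]
      have : (L : ℝ) ≤ 9 * r := by exact_mod_cast (by omega : L ≤ 9 * r)
      linarith
    nlinarith
  calc Ex p L (fun l => F (l.take n) * one (Br f x y l))
      ≤ Ex p n (fun l => F l * one (Surv f x l))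
        * (ENNReal.ofReal (CU / √r) * Ps p (-f) y (L / 4)) := by
        have := hG.bridge_functional_le (n := n) (r := r) (m := L / 4) (by omega) x y F
        rwa [← hr] at this
    _ ≤ (κ * Ps p f x (L / 4)) * (ENNReal.ofReal (3 * CU / c * (c / √L)) * Ps p (-f) y (L / 4)) := by
        gcongr
        exact hF.trans (by gcongr; exact Ps_anti hG.sum_eq_one f x hn)
    _ = ENNReal.ofReal (3 * CU / c) * κ *
        (ENNReal.ofReal (c / √L) * (Ps p f x (L / 4) * Ps p (-f) y (L / 4))) := by
        rw [ENNReal.ofReal_mul (by positivity)]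
        ring
    _ ≤ _ := by gcongr

/-- Exponential moments of the running maxima over disjoint blocks. -/
theorem Ex_exp_blocks_le {p : ℕ → ℝ≥0∞} (hp : ∑' s, p s = 1) {h : ℕ → ℝ} {lam C : ℝ} (hC : 0 ≤ C)
    (hh : ∀ n, Ex p n (fun l => ENNReal.ofReal (Real.exp (lam * Mx h l)))
      ≤ ENNReal.ofReal (2 * Real.exp (C * lam ^ 2 * n)))
    {k : ℕ} (n : ℕ) (X Y : Fin k → ℕ) (hXY : ∀ i, X i ≤ Y i) (hYn : ∀ i, Y i ≤ n)
    (hdisj : ∀ i j, i ≠ j → Y i ≤ X j ∨ Y j ≤ X i) :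
    Ex p n (fun l => ENNReal.ofReal (Real.exp (lam * ∑ i, Mx h (block (X i) (Y i) l))))
      ≤ ENNReal.ofReal (2 ^ k * Real.exp (C * lam ^ 2 * n)) := by
  calc _ = Ex p n (fun l => ∏ i, ENNReal.ofReal (Real.exp (lam * Mx h (block (X i) (Y i) l)))) := by
        refine Ex_congr p fun l _ => ?_
        rw [Finset.mul_sum, Real.exp_sum, ENNReal.ofReal_prod_of_nonneg fun _ _ => Real.exp_nonneg _]
    _ = ∏ i, Ex p (Y i - X i) (fun l => ENNReal.ofReal (Real.exp (lam * Mx h l))) :=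
        Ex_prod_block hp Finset.univ n X Y (fun i _ => hXY i) (fun i _ => hYn i)
          (fun i _ j _ => hdisj i j) (fun _ l => ENNReal.ofReal (Real.exp (lam * Mx h l)))
    _ ≤ ∏ i, ENNReal.ofReal (2 * Real.exp (C * lam ^ 2 * (Y i - X i : ℕ))) :=
        Finset.prod_le_prod' fun i _ => hh _
    _ ≤ _ := by
        rw [← ENNReal.ofReal_prod_of_nonneg fun _ _ => by positivity, Finset.prod_mul_distrib,
          Finset.prod_const, Finset.card_univ, Fintype.card_fin, ← Real.exp_sum, ← Finset.mul_sum]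
        refine ENNReal.ofReal_le_ofReal ?_
        gcongr
        have := sum_length_le Finset.univ n X Y (fun i _ => hYn i) (fun i _ j _ => hdisj i j)
        exact_mod_cast this

/-- Exponential moments of the sum over a fixed set of indices. -/
theorem Ex_exp_subset_le {p : ℕ → ℝ≥0∞} (hp : ∑' s, p s = 1) {h : ℕ → ℝ} {lam C : ℝ} (hC : 0 ≤ C)
    (hh : ∑' s, p s * ENNReal.ofReal (Real.exp (lam * h s)) ≤ ENNReal.ofReal (Real.exp (C * lam ^ 2)))
    (n : ℕ) (U : Finset ℕ) (hU : ∀ j ∈ U, j < n) :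
    Ex p n (fun l => ENNReal.ofReal (Real.exp (lam * ∑ j ∈ U, ((block j (j + 1) l).map h).sum)))
      ≤ ENNReal.ofReal (Real.exp (C * lam ^ 2 * n)) := by
  calc _ = Ex p n (fun l => ∏ j ∈ U,
          ENNReal.ofReal (Real.exp (lam * ((block j (j + 1) l).map h).sum))) := by
        refine Ex_congr p fun l _ => ?_
        rw [Finset.mul_sum, Real.exp_sum, ENNReal.ofReal_prod_of_nonneg fun _ _ => Real.exp_nonneg _]
    _ = ∏ j ∈ U, Ex p (j + 1 - j) (fun l => ENNReal.ofReal (Real.exp (lam * (l.map h).sum))) :=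
        Ex_prod_block hp U n (fun j => j) (fun j => j + 1) (fun j _ => Nat.le_succ j) hU
          (fun i _ j _ hij => by omega)
          (fun _ l => ENNReal.ofReal (Real.exp (lam * (l.map h).sum)))
    _ ≤ ∏ j ∈ U, ENNReal.ofReal (Real.exp (C * lam ^ 2)) := by
        refine Finset.prod_le_prod' fun j _ => ?_
        rw [Ex_exp_sum, Nat.add_sub_cancel_left, pow_one]
        exact hh
    _ ≤ _ := by
        rw [Finset.prod_const, ← ENNReal.ofReal_pow (Real.exp_nonneg _), ← Real.exp_nat_mul,
          mul_comm]
        refine ENNReal.ofReal_le_ofReal (Real.exp_le_exp.2 ?_)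
        have : U.card ≤ n := by
          calc U.card ≤ (Finset.range n).card :=
                Finset.card_le_card fun j hj => Finset.mem_range.2 (hU j hj)
            _ = n := Finset.card_range n
        gcongr

/-! ### Sums over index intervals and the decomposition of the descents -/

theorem forall₂_block {l l' : List ℕ} (h : List.Forall₂ (· ≤ ·) l l') (X Y : ℕ) :
    List.Forall₂ (· ≤ ·) (block X Y l) (block X Y l') :=
  List.forall₂_take _ (List.forall₂_drop _ h)

theorem sum_map_mono {g : ℕ → ℝ} (hg : Monotone g) {l l' : List ℕ}
    (h : List.Forall₂ (· ≤ ·) l l') : (l.map g).sum ≤ (l'.map g).sum := by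
  induction h with
  | nil => exact le_rfl
  | cons h _ ih =>
    simp only [List.map_cons, List.sum_cons]
    exact add_le_add (hg h) ih

/-- The value of `g` at the `j`-th entry of `l`. -/
noncomputable def entry (g : ℕ → ℝ) (l : List ℕ) (j : ℕ) : ℝ := (l.map g).getD j 0

theorem sum_block (g : ℕ → ℝ) (l : List ℕ) (X Y : ℕ) :
    ((block X Y l).map g).sum = ∑ j ∈ Finset.Ico X Y, entry g l j := by
  induction l generalizing X Y with
  | nil => simp [block, entry]
  | cons s l ih =>
    rcases Nat.lt_or_ge X Y with hXY | hXY
    swap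
    · rw [block_empty _ _ _ hXY, Finset.Ico_eq_empty (by omega)]
      simp
    obtain ⟨Z, rfl⟩ : ∃ Z, Y = Z + 1 := ⟨Y - 1, by omega⟩
    cases X with
    | zero =>
      rw [block_cons_zero _ _ _ hXY, Finset.sum_Ico_eq_sum_range, Nat.sub_zero,
        Finset.sum_range_succ', List.map_cons, List.sum_cons, ih, Finset.sum_Ico_eq_sum_range]
      simp [entry, add_comm]
    | succ X =>
      rw [block_cons_succ, ih, Nat.add_sub_cancel, ← Finset.sum_Ico_add' _ X Z 1]
      simp [entry]

theorem sum_eq_sum_entry (g : ℕ → ℝ) (l : List ℕ) :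
    (l.map g).sum = ∑ j ∈ Finset.range l.length, entry g l j := by
  have := sum_block g l 0 l.length
  simpa [block] using this

theorem entry_take {g : ℕ → ℝ} {l : List ℕ} {n j : ℕ} (h : j < n) :
    entry g (l.take n) j = entry g l j := by
  simp [entry, h]

theorem entry_reverse {g : ℕ → ℝ} {l : List ℕ} {j : ℕ} (h : j < l.length) :
    entry g l.reverse j = entry g l (l.length - 1 - j) := by
  simp only [entry, List.map_reverse, List.getD_eq_getElem?_getD]
  rw [List.getElem?_reverse (by simpa using h), List.length_map]

theorem sum_Ico_entry_reverse {g : ℕ → ℝ} {l : List ℕ} {X Y : ℕ} (h : Y ≤ l.length) :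
    ∑ j ∈ Finset.Ico (l.length - Y) (l.length - X), entry g l.reverse j
      = ∑ j ∈ Finset.Ico X Y, entry g l j := by
  refine Finset.sum_bij' (fun j _ => l.length - 1 - j) (fun j _ => l.length - 1 - j) ?_ ?_ ?_ ?_ ?_
  · intro j hj
    simp only [Finset.mem_Ico] at hj ⊢
    omega
  · intro j hj
    simp only [Finset.mem_Ico] at hj ⊢
    omega
  · intro j hj
    simp only [Finset.mem_Ico] at hj ⊢
    omega
  · intro j hj
    simp only [Finset.mem_Ico] at hj ⊢
    omega
  · intro j hj
    simp only [Finset.mem_Ico] at hj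
    exact entry_reverse (by omega)

theorem sum_Ico_le_Mx {g : ℕ → ℝ} {l : List ℕ} {X T Y : ℕ} (hXT : X ≤ T) (hTY : T ≤ Y) :
    ∑ j ∈ Finset.Ico X T, entry g l j ≤ Mx g (block X Y l) := by
  rw [← sum_block]
  have : block X Y l = block X T l ++ (block X Y l).drop (T - X) := by
    have h : block X T l = (block X Y l).take (T - X) := by
      rw [block, block, List.take_take, min_eq_left (by omega)]
    rw [h, List.take_append_drop]
  rw [this]
  exact sum_le_Mx g _ _

/-- The descents of a bridge decompose into four terms, two for each half. -/
theorem descent_le (g : ℕ → ℝ) {L n : ℕ} (hn : n ≤ L) {l : List ℕ} (hl : l.length = L) {k : ℕ}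
    (X Y T : Fin k → ℕ) (hXT : ∀ i, X i ≤ T i) (hTY : ∀ i, T i ≤ Y i) (hYL : ∀ i, Y i ≤ L)
    (hdisj : ∀ i j, i ≠ j → Y i ≤ X j ∨ Y j ≤ X i) :
    ∑ i, -((block (X i) (T i) l).map g).sum
      ≤ ∑ i, Mx (fun s => -g s) (block (min (X i) n) (min (Y i) n) (l.take n))
        + Mx (fun s => -g s) (l.reverse.take (L - n))
        + ∑ i, Mx g (block (L - max (Y i) n) (L - max (X i) n) (l.reverse.take (L - n)))
        + ∑ j ∈ Finset.range (L - n) \ Finset.univ.biUnion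
            (fun i => Finset.Ico (L - max (Y i) n) (L - max (X i) n)),
          ((block j (j + 1) (l.reverse.take (L - n))).map g).sum := by
  -- In the first half a descent is at most the maximum of the negated steps, a decreasing function
  -- of the steps, as needed for Harris against forward survival. In the second half, where
  -- increasing functions are needed, the descent over `[X, T)` is rewritten as the sum over `[T,
  -- Y)` minus the sum over `[X, Y)`. Together, the negative terms equal the sum outside the
  -- intervals minus the sum over the whole second half. Only the latter has the wrong monotonicity;
  -- it is bounded by a running maximum.
  set e := entry g l with he
  set l' := l.reverse.take (L - n) with hl'
  have hl'len : l'.length = L - n := by simp [hl', hl]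
  have hneg : ∀ (q : List ℕ) j, entry (fun s => -g s) q j = -entry g q j := by
    intro q j
    simp only [entry, List.getD_eq_getElem?_getD, List.getElem?_map]
    cases q[j]? <;> simp
  have he' : ∀ j, j < L - n → entry g l' j = entry g l.reverse j := fun j hj => entry_take hj
  have hrev : ∀ a b, n ≤ a → b ≤ L → ∑ j ∈ Finset.Ico (L - b) (L - a), entry g l' j
      = ∑ j ∈ Finset.Ico a b, e j := by
    intro a b ha hb
    rw [← sum_Ico_entry_reverse (g := g) (l := l) (X := a) (Y := b) (by omega), hl]
    refine Finset.sum_congr rfl fun j hj => he' j ?_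
    rw [Finset.mem_Ico] at hj
    omega
  have hsplit : ∀ a b, a ≤ b → ∑ j ∈ Finset.Ico a b, e j
      = ∑ j ∈ Finset.Ico (min a n) (min b n), e j + ∑ j ∈ Finset.Ico (max a n) (max b n), e j := by
    intro a b hab
    rcases le_total b n with h1 | h1
    · rw [min_eq_left h1, min_eq_left (hab.trans h1), max_eq_right h1, max_eq_right (hab.trans h1)]
      simp
    · rcases le_total a n with h2 | h2
      · rw [min_eq_right h1, min_eq_left h2, max_eq_left h1, max_eq_right h2,
          Finset.sum_Ico_consecutive _ h2 h1]
      · rw [min_eq_right h1, min_eq_right h2, max_eq_left h1, max_eq_left h2]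
        simp
  -- first half
  have hA : ∀ i, -∑ j ∈ Finset.Ico (min (X i) n) (min (T i) n), e j
      ≤ Mx (fun s => -g s) (block (min (X i) n) (min (Y i) n) (l.take n)) := by
    intro i
    refine le_trans (le_of_eq ?_) (sum_Ico_le_Mx (T := min (T i) n)
      (min_le_min_right _ (hXT i)) (min_le_min_right _ (hTY i)))
    rw [← Finset.sum_neg_distrib]
    refine Finset.sum_congr rfl fun j hj => ?_
    rw [Finset.mem_Ico] at hj
    rw [hneg, entry_take (by omega)]
  -- second half
  have hB : -∑ j ∈ Finset.Ico n L, e j ≤ Mx (fun s => -g s) l' := by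
    have := sum_le_Mx (fun s => -g s) l' []
    rw [List.append_nil, sum_eq_sum_entry, hl'len] at this
    refine le_trans (le_of_eq ?_) this
    rw [← hrev n L le_rfl le_rfl, Nat.sub_self, ← Finset.range_eq_Ico, ← Finset.sum_neg_distrib]
    exact Finset.sum_congr rfl fun j _ => (hneg _ _).symm
  have hC : ∀ i, ∑ j ∈ Finset.Ico (max (T i) n) (max (Y i) n), e j
      ≤ Mx g (block (L - max (Y i) n) (L - max (X i) n) l') := by
    intro i
    rw [← hrev _ _ (le_max_right _ _) (max_le (hYL i) hn)]
    refine sum_Ico_le_Mx ?_ ?_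
    · have := hTY i; omega
    · have := hXT i; omega
  have hD : ∑ j ∈ Finset.range (L - n) \ Finset.univ.biUnion
            (fun i => Finset.Ico (L - max (Y i) n) (L - max (X i) n)),
          ((block j (j + 1) l').map g).sum
      = ∑ j ∈ Finset.Ico n L, e j - ∑ i, ∑ j ∈ Finset.Ico (max (X i) n) (max (Y i) n), e j := by
    have h1 : ∀ j, ((block j (j + 1) l').map g).sum = entry g l' j := by
      intro j
      rw [sum_block]
      simp
    simp only [h1]
    rw [eq_sub_iff_add_eq]
    have h2 : ∑ i, ∑ j ∈ Finset.Ico (max (X i) n) (max (Y i) n), e j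
        = ∑ j ∈ Finset.univ.biUnion (fun i => Finset.Ico (L - max (Y i) n) (L - max (X i) n)),
          entry g l' j := by
      rw [Finset.sum_biUnion]
      · exact Finset.sum_congr rfl fun i _ =>
          (hrev _ _ (le_max_right _ _) (max_le (hYL i) hn)).symm
      · intro i _ j _ hij
        rw [Function.onFun, Finset.disjoint_left]
        intro t ht ht'
        rw [Finset.mem_Ico] at ht ht'
        have := hdisj i j hij
        omega
    rw [h2, Finset.sum_sdiff, ← hrev n L le_rfl le_rfl, Nat.sub_self, Finset.range_eq_Ico]
    intro t ht
    rw [Finset.mem_biUnion] at ht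
    obtain ⟨i, _, ht⟩ := ht
    rw [Finset.mem_Ico] at ht
    rw [Finset.mem_range]
    omega
  have hmain : ∑ i, -((block (X i) (T i) l).map g).sum
      = ∑ i, -∑ j ∈ Finset.Ico (min (X i) n) (min (T i) n), e j + -∑ j ∈ Finset.Ico n L, e j
        + ∑ i, ∑ j ∈ Finset.Ico (max (T i) n) (max (Y i) n), e j
        + (∑ j ∈ Finset.Ico n L, e j - ∑ i, ∑ j ∈ Finset.Ico (max (X i) n) (max (Y i) n), e j) := by
    have h1 : ∀ i, -((block (X i) (T i) l).map g).sum
        = -∑ j ∈ Finset.Ico (min (X i) n) (min (T i) n), e j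
          + ∑ j ∈ Finset.Ico (max (T i) n) (max (Y i) n), e j
          - ∑ j ∈ Finset.Ico (max (X i) n) (max (Y i) n), e j := by
      intro i
      rw [sum_block, hsplit _ _ (hXT i), ← Finset.sum_Ico_consecutive e
        (max_le_max_right n (hXT i)) (max_le_max_right n (hTY i))]
      ring
    simp only [h1, Finset.sum_sub_distrib, Finset.sum_add_distrib]
    ring
  rw [hmain, hD]
  gcongr
  · exact hA _
  · exact hC _

theorem exp_add_le (u v : ℝ) : Real.exp (u + v) ≤ Real.exp (2 * u) + Real.exp (2 * v) := by
  rw [Real.exp_add, two_mul, two_mul, Real.exp_add, Real.exp_add]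
  nlinarith [sq_nonneg (Real.exp u - Real.exp v), sq_nonneg (Real.exp u + Real.exp v)]

theorem exp_add₄_le (a b c d : ℝ) : Real.exp (a + b + c + d)
    ≤ Real.exp (4 * a) + Real.exp (4 * b) + Real.exp (4 * c) + Real.exp (4 * d) := by
  have h1 := exp_add_le (a + b) (c + d)
  have h2 := exp_add_le (2 * a) (2 * b)
  have h3 := exp_add_le (2 * c) (2 * d)
  have e1 : 2 * (2 * a) = 4 * a := by ring
  have e2 : 2 * (2 * b) = 4 * b := by ring
  have e3 : 2 * (2 * c) = 4 * c := by ring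
  have e4 : 2 * (2 * d) = 4 * d := by ring
  rw [e1, e2, ← mul_add] at h2
  rw [e3, e4, ← mul_add] at h3
  have e5 : a + b + c + d = a + b + (c + d) := by ring
  rw [e5]
  linarith

theorem block_length {X T L : ℕ} {l : List ℕ} (hl : l.length = L) (hT : T ≤ L) :
    (block X T l).length = T - X := by
  simp only [block, List.length_take, List.length_drop, hl]
  omega

set_option maxHeartbeats 1000000 in
/-- Exponential estimates for bridges of moderate slope: descents over disjoint intervals and
deviations from the chord. -/
theorem exists_central {lam0 C Co CU : ℝ} (hlam0 : 0 < lam0) (hC : 0 ≤ C) (hCo : 1 ≤ Co)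
    (hCU : 0 ≤ CU) (cL : ℝ → ℝ) (nL : ℝ → ℕ) (hcL : ∀ A, 0 < cL A) :
    ∃ D ≥ 0, ∃ lam₁ > 0, ∃ L₀ : ℕ, ∀ (p : ℕ → ℝ≥0∞) (f : ℕ → ℤ) (β : ℝ),
      Good p f β lam0 C Co CU →
      Good p (-f) (-β) lam0 C Co CU → (∀ A, Low p f β A (cL A) (nL A)) →
      Monotone f → ∀ L ≥ L₀, ∀ x y : ℤ, 0 ≤ x → 0 ≤ y → (y : ℝ) - x = L * β →
      ∀ lam : ℝ, 0 ≤ lam → lam ≤ lam₁ →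
      (∀ (k : ℕ) (X Y : Fin k → ℕ) (T : List ℕ → Fin k → ℕ), (∀ l i, X i ≤ T l i) →
        (∀ l i, T l i ≤ Y i) → (∀ i, Y i ≤ L) → (∀ i j, i ≠ j → Y i ≤ X j ∨ Y j ≤ X i) →
        Ex p L (fun l => ENNReal.ofReal (Real.exp (lam * ∑ i, -(hsum f (block (X i) (T l i) l) : ℝ)))
          * one (Br f x y l))
          ≤ ENNReal.ofReal (D * 2 ^ k * Real.exp (D * (1 + lam ^ 2 * L) + lam * max (x - y : ℝ) 0))
            * Pb p f L x y) ∧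
      (∀ Δ : ℝ, Ex p L (fun l => one (∃ t ≤ L, Δ ≤ |(hsum f (l.take t) : ℝ) - t * β|)
          * one (Br f x y l))
          ≤ ENNReal.ofReal (D * Real.exp (D * (1 + lam ^ 2 * L) - lam * Δ)) * Pb p f L x y) := by
  obtain ⟨D₀, hD₀, L₀, hfun⟩ := exists_functional_le hlam0 hC hCo hCU cL nL hcL
  -- Then a downward deviation by `C₁ √L` has probability at most `2 exp (-2) ≤ 1 / 2`, as
  -- `exp_max_surv` requires.
  set C₁ := C + 2 with hC₁
  have hhalf : 2 * Real.exp (C - C₁) ≤ 2⁻¹ := by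
    have h1 : C - C₁ = -2 := by rw [hC₁]; ring
    have h2 : (4 : ℝ) ≤ Real.exp 2 := by
      have := Real.add_one_le_exp (1 : ℝ)
      have h3 : Real.exp 2 = Real.exp 1 * Real.exp 1 := by rw [← Real.exp_add]; norm_num
      rw [h3]; nlinarith
    rw [h1, Real.exp_neg]
    have := inv_anti₀ (by norm_num) h2
    linarith
  set E := C + C₁ with hE
  have hE0 : 0 ≤ E := by positivity
  -- The first entry collects four terms with constant `4 * Co * D₀` each; the second reflects `(4
  -- λ)² = 16 λ²`.
  refine ⟨max (16 * D₀ * Co) (16 * E), by positivity, lam0 / 4, by positivity,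
    L₀ + 8 + ⌈1 / lam0 ^ 2⌉₊, ?_⟩
  intro p f β hG hG' hlow hf L hL x y hx hy hxy lam hlam hlam1
  have hp := hG.sum_eq_one
  have hL0 : (0 : ℝ) < L := by exact_mod_cast (by omega : 0 < L)
  have hs : 0 < √(L : ℝ) := Real.sqrt_pos.2 hL0
  have hlamL : 1 ≤ lam0 * √L := by
    have h1 : 1 / lam0 ^ 2 ≤ L := by
      refine (Nat.le_ceil _).trans ?_
      exact_mod_cast (by omega : ⌈1 / lam0 ^ 2⌉₊ ≤ L)
    have h2 : 1 / lam0 ≤ √L := by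
      refine Real.le_sqrt_of_sq_le ?_
      rwa [div_pow, one_pow]
    rwa [div_le_iff₀' hlam0] at h2
  set n := L / 2 with hn
  have hnL : n ≤ L := by omega
  set D := max (16 * D₀ * Co) (16 * E) with hD
  have hxR : (0 : ℝ) ≤ x := by exact_mod_cast hx
  have hyR : (0 : ℝ) ≤ y := by exact_mod_cast hy
  have hf' : Antitone (-f) := hf.neg
  set g := cen f β with hg
  have hgm : Monotone g := fun s t h => by
    simp only [hg, cen]
    have : (f s : ℝ) ≤ f t := by exact_mod_cast hf h
    linarith
  have hga : Antitone (fun s => -g s) := fun s t h => neg_le_neg (hgm h)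
  have hg' : cen (-f) (-β) = fun s => -g s := cen_neg f β
  -- transfer to the two halves
  have fwd : ∀ (F : List ℕ → ℝ≥0∞) (κ : ℝ≥0∞),
      Ex p n (fun l => F l * one (Surv f x l)) ≤ κ * Ps p f x n →
      Ex p L (fun l => F (l.take n) * one (Br f x y l)) ≤ ENNReal.ofReal D₀ * κ * Pb p f L x y :=
    hfun p f β hG hG' hlow (Or.inl hf) L (by omega) x y hx hy hxy n (by omega) (by omega)
  have bwd : ∀ (F : List ℕ → ℝ≥0∞) (κ : ℝ≥0∞),
      Ex p (L - n) (fun l => F l * one (Surv (-f) y l)) ≤ κ * Ps p (-f) y (L - n) →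
      Ex p L (fun l => F (l.reverse.take (L - n)) * one (Br f x y l))
        ≤ ENNReal.ofReal D₀ * κ * Pb p f L x y := by
    intro F κ h
    rw [Pb_reverse]
    refine le_trans (le_of_eq ?_) (hfun p (-f) (-β) hG' (by simpa using hG)
      (fun A => (hlow A).neg) (Or.inr hf') L (by omega) y x hy hx (by linarith) (L - n) (by omega)
      (by omega) F κ h)
    rw [← Ex_reverse p L (fun l => F (l.take (L - n)) * one (Br (-f) y x l))]
    exact Ex_congr p fun l _ => by rw [one_congr (br_reverse f x y l)]
  -- the basic exponential bound
  set κ : ℝ → ℕ → ℝ := fun mu k => 4 * Co * 2 ^ k * Real.exp (E * (1 + mu ^ 2 * L)) with hκ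
  have hκ1 : ∀ (mu : ℝ) (k m : ℕ), m ≤ L → 2 ^ k * Real.exp (C * mu ^ 2 * m) ≤ κ mu k := by
    intro mu k m hm
    simp only [hκ]
    have h1 : Real.exp (C * mu ^ 2 * m) ≤ Real.exp (E * (1 + mu ^ 2 * L)) := by
      refine Real.exp_le_exp.2 ?_
      have h2 : C * (mu ^ 2 * m) ≤ E * (mu ^ 2 * L) := by
        have : (m : ℝ) ≤ L := by exact_mod_cast hm
        gcongr
        rw [hE]; linarith
      nlinarith
    calc 2 ^ k * Real.exp (C * mu ^ 2 * m) ≤ 2 ^ k * Real.exp (E * (1 + mu ^ 2 * L)) := by gcongr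
      _ ≤ 4 * Co * (2 ^ k * Real.exp (E * (1 + mu ^ 2 * L))) :=
          le_mul_of_one_le_left (by positivity) (by linarith)
      _ = _ := by ring
  -- The maximum in the direction favoured by survival is out of reach of Harris; the first passage
  -- argument is used from centered height `0`, the chord being nonnegative.
  have hmax : ∀ (q : ℕ → ℤ) (b : ℝ) (w : ℤ), Good p q b lam0 C Co CU →
      (∀ j : ℕ, j ≤ L → (0 : ℝ) ≤ w + j * b) → ∀ m : ℕ, m ≤ L → ∀ mu : ℝ, 0 ≤ mu → mu ≤ lam0 →
      Ex p m (fun l => ENNReal.ofReal (Real.exp (mu * Mx (cen q b) l)) * one (Surv q w l))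
        ≤ ENNReal.ofReal (κ mu 0) * Ps p q w m := by
    intro q b w hq hw m hm mu hmu hmu0
    have := hq.exp_max_surv hC hCo (N := L) (H := C₁ * √L) hmu hmu0 (fun n' hn' => by
      refine ((hq.prob_Mx_ge hC (by omega) hn' hlamL C₁).2).trans ?_
      rw [show (2⁻¹ : ℝ≥0∞) = ENNReal.ofReal 2⁻¹ by
        rw [ENNReal.ofReal_inv_of_pos (by norm_num)]; simp]
      exact ENNReal.ofReal_le_ofReal hhalf) m hm w 0 (by positivity) (fun j hj => hw j (by omega))
    refine le_trans (Ex_mono p fun l _ => ?_) (this.trans ?_)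
    · gcongr
      rw [zero_add]
      exact le_max_right _ _
    · gcongr
      simp only [hκ, pow_zero, mul_one]
      gcongr
      have h1 : mu * √L ≤ 1 + mu ^ 2 * L := by
        have : mu ^ 2 * L = (mu * √L) ^ 2 := by rw [mul_pow, Real.sq_sqrt hL0.le]
        rw [this]
        nlinarith [sq_nonneg (mu * √L - 1), sq_nonneg (mu * √L)]
      have h2 : C₁ * (mu * √L) ≤ C₁ * (1 + mu ^ 2 * L) :=
        mul_le_mul_of_nonneg_left h1 (by positivity)
      rw [hE]
      nlinarith
  have hlineF : ∀ j : ℕ, j ≤ L → (0 : ℝ) ≤ x + j * β := fun j hj =>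
    line_nonneg hxR hyR hxy (by positivity) (by exact_mod_cast hj)
  have hlineB : ∀ j : ℕ, j ≤ L → (0 : ℝ) ≤ y + j * (-β) := fun j hj =>
    line_nonneg (L := L) hyR hxR (by linarith) (by positivity) (by exact_mod_cast hj)
  -- Forward survival is increasing in the steps and backward survival is decreasing. Conditioning
  -- on them does not raise the expectation of functionals with the opposite monotonicity.
  have harF : ∀ (F : List ℕ → ℝ≥0∞) (κ' : ℝ), AntiL F → Ex p n F ≤ ENNReal.ofReal κ' →
      Ex p n (fun l => F l * one (Surv f x l)) ≤ ENNReal.ofReal κ' * Ps p f x n := by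
    intro F κ' hF hle
    simp only [mul_comm (F _)]
    refine (Ex_mul_le hp n (fun l l' h => one_mono fun h1 => surv_mono hf h le_rfl h1) hF).trans ?_
    rw [mul_comm]
    exact mul_le_mul' hle le_rfl
  have harB : ∀ (F : List ℕ → ℝ≥0∞) (κ' : ℝ), MonoL F → Ex p (L - n) F ≤ ENNReal.ofReal κ' →
      Ex p (L - n) (fun l => F l * one (Surv (-f) y l)) ≤ ENNReal.ofReal κ' * Ps p (-f) y (L - n) := by
    intro F κ' hF hle
    refine (Ex_mul_le hp _ hF (fun l l' h => one_mono fun h1 => surv_anti hf' h le_rfl h1)).trans ?_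
    exact mul_le_mul' hle le_rfl
  have hDκ : ∀ (k : ℕ) (mu : ℝ), mu ^ 2 ≤ 16 * lam ^ 2 →
      4 * (D₀ * κ mu k) ≤ D * 2 ^ k * Real.exp (D * (1 + lam ^ 2 * L)) := by
    intro k mu hmu
    simp only [hκ]
    have h1 : Real.exp (E * (1 + mu ^ 2 * L)) ≤ Real.exp (D * (1 + lam ^ 2 * L)) := by
      refine Real.exp_le_exp.2 ?_
      calc E * (1 + mu ^ 2 * L) ≤ E * (16 * (1 + lam ^ 2 * L)) := by
            refine mul_le_mul_of_nonneg_left ?_ hE0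
            nlinarith
        _ = 16 * E * (1 + lam ^ 2 * L) := by ring
        _ ≤ _ := by
            refine mul_le_mul_of_nonneg_right (le_max_right _ _) (by positivity)
    calc _ = 16 * D₀ * Co * 2 ^ k * Real.exp (E * (1 + mu ^ 2 * L)) := by ring
      _ ≤ _ := by
        gcongr
        exact le_max_left _ _
  have hPbound : ∀ (P : ℝ≥0∞) (k : ℕ) (mu : ℝ),
      P ≤ ENNReal.ofReal D₀ * ENNReal.ofReal (κ mu k) * Pb p f L x y →
      P ≤ ENNReal.ofReal (D₀ * κ mu k) * Pb p f L x y := by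
    intro P k mu h
    rwa [ENNReal.ofReal_mul hD₀]
  have hmono2 : ∀ mu : ℝ, 0 ≤ mu → ∀ {a b : ℝ}, a ≤ b →
      ENNReal.ofReal (Real.exp (mu * a)) ≤ ENNReal.ofReal (Real.exp (mu * b)) := by
    intro mu hmu a b hab
    exact ENNReal.ofReal_le_ofReal (Real.exp_le_exp.2 (mul_le_mul_of_nonneg_left hab hmu))
  have sum4 : ∀ (A B Γ Δ : ℝ≥0∞) (k : ℕ) (mu : ℝ), mu ^ 2 ≤ 16 * lam ^ 2 →
      A ≤ ENNReal.ofReal (D₀ * κ mu k) * Pb p f L x y →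
      B ≤ ENNReal.ofReal (D₀ * κ mu k) * Pb p f L x y →
      Γ ≤ ENNReal.ofReal (D₀ * κ mu k) * Pb p f L x y →
      Δ ≤ ENNReal.ofReal (D₀ * κ mu k) * Pb p f L x y →
      A + B + Γ + Δ ≤ ENNReal.ofReal (D * 2 ^ k * Real.exp (D * (1 + lam ^ 2 * L))) * Pb p f L x y := by
    intro A B Γ Δ k mu hmu hA hB hΓ hΔ
    calc A + B + Γ + Δ ≤ ENNReal.ofReal (D₀ * κ mu k) * Pb p f L x y
          + ENNReal.ofReal (D₀ * κ mu k) * Pb p f L x y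
          + ENNReal.ofReal (D₀ * κ mu k) * Pb p f L x y
          + ENNReal.ofReal (D₀ * κ mu k) * Pb p f L x y := by gcongr
      _ = ENNReal.ofReal (4 * (D₀ * κ mu k)) * Pb p f L x y := by
          rw [ENNReal.ofReal_mul (p := 4) (by norm_num), ENNReal.ofReal_ofNat]
          ring
      _ ≤ _ := by
          exact mul_le_mul' (ENNReal.ofReal_le_ofReal (hDκ k mu hmu)) le_rfl
  refine ⟨?_, ?_⟩
  · intro k X Y T hXT hTY hYL hdisj
    have hXY : ∀ i, X i ≤ Y i := fun i => (hXT [] i).trans (hTY [] i)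
    -- The exponential of a sum of four terms is at most the sum of the exponentials of four times
    -- each term.
    set mu := 4 * lam with hmu
    have hmu0 : 0 ≤ mu := by positivity
    have hmu1 : mu ≤ lam0 := by rw [hmu]; linarith
    have hmuabs : |mu| ≤ lam0 := by rwa [abs_of_nonneg hmu0]
    set X₁ : Fin k → ℕ := fun i => min (X i) n
    set Y₁ : Fin k → ℕ := fun i => min (Y i) n
    set X₂ : Fin k → ℕ := fun i => L - max (Y i) n
    set Y₂ : Fin k → ℕ := fun i => L - max (X i) n
    set U := Finset.range (L - n) \ Finset.univ.biUnion (fun i => Finset.Ico (X₂ i) (Y₂ i)) with hU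
    have hκ0 : κ mu 0 ≤ κ mu k := by
      simp only [hκ]
      have : (1 : ℝ) ≤ 2 ^ k := one_le_pow₀ (by norm_num)
      rw [pow_zero]
      gcongr
    have tA := hPbound _ k mu (fwd (fun l => ENNReal.ofReal (Real.exp (mu * ∑ i, Mx (fun s => -g s)
        (block (X₁ i) (Y₁ i) l)))) (ENNReal.ofReal (κ mu k)) (harF _ _
        (fun l l' h => hmono2 mu hmu0 (Finset.sum_le_sum fun i _ => Mx_anti hga (forall₂_block h _ _)))
        ((Ex_exp_blocks_le hp hC (hG.exp_Mx_neg hmuabs) n X₁ Y₁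
          (fun i => min_le_min_right _ (hXY i)) (fun i => min_le_right _ _)
          (fun i j hij => by
            simp only [X₁, Y₁]
            have := hdisj i j hij
            omega)).trans (ENNReal.ofReal_le_ofReal (hκ1 mu k n hnL)))))
    have tB := hPbound _ k mu (bwd (fun l => ENNReal.ofReal (Real.exp (mu * Mx (fun s => -g s) l)))
        (ENNReal.ofReal (κ mu k)) (by
          have := hmax (-f) (-β) y hG' hlineB (L - n) (Nat.sub_le _ _) mu hmu0 hmu1
          rw [hg'] at this
          refine this.trans ?_
          gcongr))
    have tC := hPbound _ k mu (bwd (fun l => ENNReal.ofReal (Real.exp (mu * ∑ i, Mx g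
        (block (X₂ i) (Y₂ i) l)))) (ENNReal.ofReal (κ mu k)) (harB _ _
        (fun l l' h => hmono2 mu hmu0 (Finset.sum_le_sum fun i _ => Mx_mono hgm (forall₂_block h _ _)))
        ((Ex_exp_blocks_le hp hC (hG.exp_Mx hmuabs) (L - n) X₂ Y₂
          (fun i => Nat.sub_le_sub_left (max_le_max_right _ (hXY i)) _)
          (fun i => Nat.sub_le_sub_left (le_max_right _ _) _)
          (fun i j hij => by
            simp only [X₂, Y₂]
            have := hdisj i j hij
            omega)).trans (ENNReal.ofReal_le_ofReal (hκ1 mu k _ (Nat.sub_le _ _))))))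
    have tD := hPbound _ k mu (bwd (fun l => ENNReal.ofReal (Real.exp (mu * ∑ j ∈ U,
        ((block j (j + 1) l).map g).sum))) (ENNReal.ofReal (κ mu k)) (harB _ _
        (fun l l' h => hmono2 mu hmu0 (Finset.sum_le_sum fun j _ =>
          sum_map_mono hgm (forall₂_block h _ _)))
        ((Ex_exp_subset_le hp hC (hG.mgf mu hmuabs) (L - n) U (fun j hj => by
          rw [hU, Finset.mem_sdiff, Finset.mem_range] at hj
          exact hj.1)).trans (ENNReal.ofReal_le_ofReal (by
            refine le_trans ?_ (hκ1 mu k _ (Nat.sub_le L n))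
            exact le_mul_of_one_le_left (Real.exp_nonneg _) (one_le_pow₀ (by norm_num)))))))
    have htotal := sum4 _ _ _ _ k mu (by rw [hmu]; nlinarith) tA tB tC tD
    rw [← Ex_add, ← Ex_add, ← Ex_add] at htotal
    rw [Real.exp_add, ← mul_assoc, mul_comm (D * 2 ^ k * _), ENNReal.ofReal_mul (Real.exp_nonneg _),
      mul_assoc]
    refine le_trans ?_ (mul_le_mul_right htotal _)
    rw [← Ex_const_mul]
    refine Ex_mono p fun l hl => ?_
    rw [← add_mul, ← add_mul, ← add_mul, ← mul_assoc]
    refine mul_le_mul' ?_ le_rfl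
    rw [← ENNReal.ofReal_add (by positivity) (by positivity),
      ← ENNReal.ofReal_add (by positivity) (by positivity),
      ← ENNReal.ofReal_add (by positivity) (by positivity), ← ENNReal.ofReal_mul (Real.exp_nonneg _)]
    refine ENNReal.ofReal_le_ofReal ?_
    have hdec := descent_le g hnL hl X Y (T l) (hXT l) (hTY l) hYL hdisj
    -- The drift contributes `-β` times a total length between `0` and `L`, hence at most `max (-L
    -- β) 0 = max (x - y) 0`.
    have hdrift : ∑ i, -(hsum f (block (X i) (T l i) l) : ℝ)
        ≤ max (x - y : ℝ) 0 + ∑ i, -((block (X i) (T l i) l).map g).sum := by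
      have h1 : ∀ i, -(hsum f (block (X i) (T l i) l) : ℝ)
          = ((T l i - X i : ℕ) : ℝ) * (-β) + -((block (X i) (T l i) l).map g).sum := by
        intro i
        rw [hg, sum_cen, block_length hl ((hTY l i).trans (hYL i))]
        ring
      simp only [h1, Finset.sum_add_distrib]
      gcongr
      rw [← Finset.sum_mul]
      have h2 : ∑ i, (T l i - X i) ≤ L :=
        sum_length_le Finset.univ L X (T l) (fun i _ => (hTY l i).trans (hYL i))
          (fun i _ j _ hij => (hdisj i j hij).imp (fun h => (hTY l i).trans h)
            (fun h => (hTY l j).trans h))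
      have h3 : (∑ i, ((T l i - X i : ℕ) : ℝ)) ≤ L := by exact_mod_cast h2
      have h4 : (0 : ℝ) ≤ ∑ i, ((T l i - X i : ℕ) : ℝ) := by positivity
      rcases le_total 0 β with hb | hb
      · exact le_max_of_le_right (by nlinarith)
      · exact le_max_of_le_left (by nlinarith)
    calc _ ≤ Real.exp (lam * max (x - y : ℝ) 0 + lam * (∑ i, Mx (fun s => -g s)
            (block (X₁ i) (Y₁ i) (l.take n)) + Mx (fun s => -g s) (l.reverse.take (L - n))
            + ∑ i, Mx g (block (X₂ i) (Y₂ i) (l.reverse.take (L - n)))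
            + ∑ j ∈ U, ((block j (j + 1) (l.reverse.take (L - n))).map g).sum)) := by
          refine Real.exp_le_exp.2 ?_
          rw [← mul_add]
          exact mul_le_mul_of_nonneg_left (by linarith) hlam
      _ ≤ _ := by
          rw [Real.exp_add]
          refine mul_le_mul_of_nonneg_left ?_ (Real.exp_nonneg _)
          rw [mul_add, mul_add, mul_add]
          refine (exp_add₄_le _ _ _ _).trans (le_of_eq ?_)
          simp only [hmu, mul_assoc]
  · intro Δ
    have hlam0' : lam ≤ lam0 := by linarith
    have hlamabs : |lam| ≤ lam0 := by rwa [abs_of_nonneg hlam]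
    have hκ2 : ∀ m : ℕ, m ≤ L → 2 * Real.exp (C * lam ^ 2 * m) ≤ κ lam 0 := by
      intro m hm
      simp only [hκ, pow_zero, mul_one]
      have h3 : Real.exp (C * lam ^ 2 * m) ≤ Real.exp (E * (1 + lam ^ 2 * L)) := by
        refine Real.exp_le_exp.2 ?_
        have h2 : C * (lam ^ 2 * m) ≤ E * (lam ^ 2 * L) := by
          have : (m : ℝ) ≤ L := by exact_mod_cast hm
          gcongr
          rw [hE]; linarith
        nlinarith
      nlinarith [Real.exp_pos (E * (1 + lam ^ 2 * L))]
    have tA := hPbound _ 0 lam (fwd (fun l => ENNReal.ofReal (Real.exp (lam * Mx g l)))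
        (ENNReal.ofReal (κ lam 0)) (hmax f β x hG hlineF n hnL lam hlam hlam0'))
    have tB := hPbound _ 0 lam (fwd (fun l => ENNReal.ofReal (Real.exp (lam * Mx (fun s => -g s) l)))
        (ENNReal.ofReal (κ lam 0)) (harF _ _
          (fun l l' h => hmono2 lam hlam (Mx_anti hga h))
          ((hG.exp_Mx_neg hlamabs n).trans (ENNReal.ofReal_le_ofReal (hκ2 n hnL)))))
    have tC := hPbound _ 0 lam (bwd (fun l => ENNReal.ofReal (Real.exp (lam * Mx (fun s => -g s) l)))
        (ENNReal.ofReal (κ lam 0)) (by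
          have := hmax (-f) (-β) y hG' hlineB (L - n) (Nat.sub_le _ _) lam hlam hlam0'
          rwa [hg'] at this))
    have tD := hPbound _ 0 lam (bwd (fun l => ENNReal.ofReal (Real.exp (lam * Mx g l)))
        (ENNReal.ofReal (κ lam 0)) (harB _ _
          (fun l l' h => hmono2 lam hlam (Mx_mono hgm h))
          ((hG.exp_Mx hlamabs _).trans (ENNReal.ofReal_le_ofReal (hκ2 _ (Nat.sub_le _ _))))))
    have htotal := sum4 _ _ _ _ 0 lam (by nlinarith) tA tB tC tD
    rw [← Ex_add, ← Ex_add, ← Ex_add, pow_zero, mul_one] at htotal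
    rw [sub_eq_add_neg, Real.exp_add, ← mul_assoc, mul_comm (D * _),
      ENNReal.ofReal_mul (Real.exp_nonneg _), mul_assoc]
    refine le_trans ?_ (mul_le_mul_right htotal _)
    rw [← Ex_const_mul]
    refine Ex_mono p fun l hl => ?_
    rw [← add_mul, ← add_mul, ← add_mul, ← mul_assoc]
    by_cases hBr : Br f x y l
    swap
    · rw [one_false hBr]; simp
    refine mul_le_mul' ?_ le_rfl
    by_cases hev : ∃ t ≤ L, Δ ≤ |(hsum f (l.take t) : ℝ) - t * β|
    swap
    · rw [one_false hev]; exact zero_le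
    rw [one_true hev]
    obtain ⟨t, htL, ht⟩ := hev
    have hneg : ∀ (q : List ℕ), (q.map (fun s => -g s)).sum = -(q.map g).sum := by
      intro q
      induction q with
      | nil => simp
      | cons s q ih =>
        simp only [List.map_cons, List.sum_cons, ih]
        ring
    have hlen : (l.take t).length = t := by simp [hl, htL]
    have hval : (hsum f (l.take t) : ℝ) - t * β = ((l.take t).map g).sum := by
      rw [hg, sum_cen, hlen]
    have htot : (l.map g).sum = 0 := by
      have h2 : ((x + hsum f l : ℤ) : ℝ) = y := by exact_mod_cast hBr.2
      push_cast at h2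
      rw [hg, sum_cen, hl]
      linarith
    -- The centered walk of a bridge returns to zero, so a deviation at a time in the second half is
    -- minus the displacement of the reversed walk up to that time.
    have hcase : Δ ≤ Mx g (l.take n) ∨ Δ ≤ Mx (fun s => -g s) (l.take n)
        ∨ Δ ≤ Mx (fun s => -g s) (l.reverse.take (L - n)) ∨ Δ ≤ Mx g (l.reverse.take (L - n)) := by
      rw [hval, le_abs] at ht
      rcases le_total t n with htn | htn
      · have h1 : l.take n = l.take t ++ (l.take n).drop t := by
          conv_lhs => rw [← List.take_append_drop t (l.take n)]
          rw [List.take_take, min_eq_left htn]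
        rcases ht with ht | ht
        · left
          rw [h1]
          exact ht.trans (sum_le_Mx g _ _)
        · right; left
          rw [h1]
          refine le_trans ?_ (sum_le_Mx _ _ _)
          rw [hneg]
          exact ht
      · have h1 : l.reverse.take (L - n) = (l.drop t).reverse
            ++ (l.reverse.take (L - n)).drop (L - t) := by
          conv_lhs => rw [← List.take_append_drop (L - t) (l.reverse.take (L - n))]
          rw [List.take_take, min_eq_left (by omega), List.reverse_drop, hl]
        have h2 : ((l.drop t).reverse.map g).sum = -((l.take t).map g).sum := by
          rw [List.map_reverse, List.sum_reverse]
          have : ((l.take t).map g).sum + ((l.drop t).map g).sum = 0 := by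
            rw [← List.sum_append, ← List.map_append, List.take_append_drop, htot]
          linarith
        right; right
        rcases ht with ht | ht
        · left
          rw [h1]
          refine le_trans ?_ (sum_le_Mx _ _ _)
          rw [hneg, h2, neg_neg]
          exact ht
        · right
          rw [h1]
          refine le_trans ?_ (sum_le_Mx _ _ _)
          rw [h2]
          exact ht
    have key : ∀ M : ℝ, Δ ≤ M → 1 ≤ ENNReal.ofReal (Real.exp (-(lam * Δ)))
        * ENNReal.ofReal (Real.exp (lam * M)) := by
      intro M hM
      have := one_le_exp_mul_exp (lam := lam) (T := Δ) (M := M) hlam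
      rwa [one_true hM] at this
    rcases hcase with h | h | h | h
    · refine (key _ h).trans ?_
      gcongr
      exact le_add_right (le_add_right le_self_add)
    · refine (key _ h).trans ?_
      gcongr
      exact le_add_right (le_add_right (le_add_left le_rfl))
    · refine (key _ h).trans ?_
      gcongr
      exact le_add_right (le_add_left le_rfl)
    · refine (key _ h).trans ?_
      gcongr
      exact le_add_left le_rfl

/-! ### A uniform local limit theorem for laws on the naturals -/

section LocalLimit

open MeasureTheory

/-- The oscillation `exp (i u)`. -/
noncomputable def osc (u : ℝ) : ℂ := Complex.exp (u * Complex.I)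

theorem norm_osc (u : ℝ) : ‖osc u‖ = 1 := Complex.norm_exp_ofReal_mul_I u

theorem osc_add (u v : ℝ) : osc (u + v) = osc u * osc v := by
  simp [osc, add_mul, Complex.exp_add]

theorem continuous_osc : Continuous osc := by unfold osc; fun_prop

/-- The characteristic function of the law `a` centered at `μ`. -/
noncomputable def charFn (a : ℕ → ℝ) (μ t : ℝ) : ℂ := ∑' s, (a s : ℂ) * osc (t * (s - μ))

variable {a : ℕ → ℝ} {μ : ℝ}

theorem hasSum_of_eq {E : Type*} [AddCommMonoid E] [TopologicalSpace E] {f g : ℕ → E} {x : E}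
    (h : HasSum f x) (e : ∀ s, g s = f s) : HasSum g x := by
  rwa [funext e]

theorem norm_mul_osc (ha : ∀ s, 0 ≤ a s) (s : ℕ) (u : ℝ) : ‖(a s : ℂ) * osc u‖ = a s := by
  rw [norm_mul, norm_osc, mul_one, Complex.norm_real, Real.norm_of_nonneg (ha s)]

theorem hasSum_charFn (ha : ∀ s, 0 ≤ a s) (h1 : HasSum a 1) (t : ℝ) :
    HasSum (fun s => (a s : ℂ) * osc (t * (s - μ))) (charFn a μ t) := by
  refine Summable.hasSum (Summable.of_norm ?_)
  simp_rw [norm_mul_osc ha]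
  exact h1.summable

theorem continuous_charFn (ha : ∀ s, 0 ≤ a s) (h1 : HasSum a 1) : Continuous (charFn a μ) := by
  refine continuous_tsum (fun s => ?_) h1.summable fun s t => (norm_mul_osc ha s _).le
  have := continuous_osc
  fun_prop

theorem norm_charFn_le_one (ha : ∀ s, 0 ≤ a s) (h1 : HasSum a 1) (t : ℝ) :
    ‖charFn a μ t‖ ≤ 1 :=
  (hasSum_charFn ha h1 t).norm_le_of_bounded h1 fun s => (norm_mul_osc ha s _).le

theorem norm_osc_add_osc (u v : ℝ) (h : |v - u| ≤ Real.pi) :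
    ‖osc u + osc v‖ ≤ 2 - (v - u) ^ 2 / Real.pi ^ 2 := by
  have hpi := Real.pi_pos
  have e : osc u + osc v = osc ((u + v) / 2) * ((2 * Real.cos ((v - u) / 2) : ℝ) : ℂ) := by
    have h1 : osc u = osc ((u + v) / 2) * osc (-((v - u) / 2)) := by rw [← osc_add]; ring_nf
    have h2 : osc v = osc ((u + v) / 2) * osc ((v - u) / 2) := by rw [← osc_add]; ring_nf
    rw [h1, h2, ← mul_add]
    congr 1
    push_cast
    rw [Complex.two_cos]
    simp only [osc]
    push_cast
    ring_nf
  have hc : Real.cos ((v - u) / 2) ≤ 1 - 2 / Real.pi ^ 2 * ((v - u) / 2) ^ 2 := by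
    refine Real.cos_le_one_sub_mul_cos_sq ?_
    rw [abs_div, abs_of_pos (by norm_num : (0 : ℝ) < 2)]
    linarith [abs_nonneg (v - u)]
  have hc0 : 0 ≤ Real.cos ((v - u) / 2) := by
    rw [abs_le] at h
    exact Real.cos_nonneg_of_mem_Icc ⟨by linarith, by linarith⟩
  rw [e, norm_mul, norm_osc, one_mul, Complex.norm_real, Real.norm_of_nonneg (by linarith)]
  calc 2 * Real.cos ((v - u) / 2) ≤ 2 * (1 - 2 / Real.pi ^ 2 * ((v - u) / 2) ^ 2) := by linarith
    _ = _ := by ring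

/-- Two neighbouring atoms of mass `c` exclude periodicity: their phases differ by `t`, and two unit
vectors at angle `t` have a sum of norm `2 cos (t / 2)`. The remaining mass `1 - 2 c` is estimated
trivially. -/
theorem norm_charFn_le (ha : ∀ s, 0 ≤ a s) (h1 : HasSum a 1) {c : ℝ} (hc : 0 ≤ c) {l₀ : ℕ}
    (hl : c ≤ a l₀) (hl' : c ≤ a (l₀ + 1)) {t : ℝ} (ht : |t| ≤ Real.pi) :
    ‖charFn a μ t‖ ≤ Real.exp (-(c / Real.pi ^ 2) * t ^ 2) := by
  set e : ℕ → ℂ := fun s => osc (t * (s - μ)) with he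
  have hA : HasSum (fun s => if s = l₀ then c else 0) c := hasSum_ite_eq l₀ c
  have hB : HasSum (fun s => if s = l₀ + 1 then c else 0) c := hasSum_ite_eq (l₀ + 1) c
  have hb := (h1.sub hA).sub hB
  have hA' : HasSum (fun s => if s = l₀ then (c : ℂ) * e l₀ else 0) ((c : ℂ) * e l₀) :=
    hasSum_ite_eq l₀ _
  have hB' : HasSum (fun s => if s = l₀ + 1 then (c : ℂ) * e (l₀ + 1) else 0)
      ((c : ℂ) * e (l₀ + 1)) := hasSum_ite_eq (l₀ + 1) _
  have hφ := ((hasSum_charFn (μ := μ) ha h1 t).sub hA').sub hB'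
  have key := hφ.norm_le_of_bounded hb (fun s => by
    have : (a s : ℂ) * osc (t * (s - μ)) - (if s = l₀ then (c : ℂ) * e l₀ else 0)
        - (if s = l₀ + 1 then (c : ℂ) * e (l₀ + 1) else 0)
        = ((a s - (if s = l₀ then c else 0) - (if s = l₀ + 1 then c else 0) : ℝ) : ℂ) * e s := by
      split_ifs with h h' h'
      · omega
      · subst h; simp [he]; ring
      · subst h'; simp [he]; ring
      · simp [he]
    rw [this, norm_mul, norm_osc, mul_one, Complex.norm_real, Real.norm_of_nonneg]
    split_ifs with h h' h'
    · omega
    · subst h; linarith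
    · subst h'; linarith
    · linarith [ha s])
  have h2 : ‖e l₀ + e (l₀ + 1)‖ ≤ 2 - t ^ 2 / Real.pi ^ 2 := by
    have hd : t * (((l₀ + 1 : ℕ) : ℝ) - μ) - t * ((l₀ : ℝ) - μ) = t := by push_cast; ring
    have := norm_osc_add_osc (t * ((l₀ : ℝ) - μ)) (t * (((l₀ + 1 : ℕ) : ℝ) - μ)) (by rwa [hd])
    rwa [hd] at this
  have h3 : ‖charFn a μ t‖ ≤ (1 - c - c) + c * ‖e l₀ + e (l₀ + 1)‖ := by
    have : charFn a μ t = (charFn a μ t - c * e l₀ - c * e (l₀ + 1)) + c * (e l₀ + e (l₀ + 1)) := by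
      ring
    rw [this]
    refine (norm_add_le _ _).trans (add_le_add key ?_)
    rw [norm_mul, Complex.norm_real, Real.norm_of_nonneg hc]
  have h4 : ‖charFn a μ t‖ ≤ 1 - c / Real.pi ^ 2 * t ^ 2 := by
    have := mul_le_mul_of_nonneg_left h2 hc
    calc _ ≤ (1 - c - c) + c * (2 - t ^ 2 / Real.pi ^ 2) := by linarith
      _ = _ := by ring
  refine h4.trans ?_
  have := Real.add_one_le_exp (-(c / Real.pi ^ 2) * t ^ 2)
  linarith

theorem integral_osc_int (d : ℤ) :
    ∫ t in (-Real.pi)..Real.pi, osc (-(t * d)) = if d = 0 then 2 * Real.pi else 0 := by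
  split_ifs with h
  · subst h
    simp [osc]
    ring
  · have h0 : (-(d : ℂ) * Complex.I) ≠ 0 := by simp [h]
    have : ∀ t : ℝ, osc (-(t * d)) = Complex.exp ((-(d : ℂ) * Complex.I) * t) := by
      intro t; simp only [osc]; push_cast; ring_nf
    simp_rw [this]
    rw [integral_exp_mul_complex h0, Complex.ofReal_zero, div_eq_zero_iff]
    left
    rw [sub_eq_zero, Complex.exp_eq_exp_iff_exists_int]
    exact ⟨-d, by push_cast; ring⟩

/-- Fourier inversion on the integers by induction on `n`: both the probability and the integral are
averaged over the position after one more step. The real number `r` mediates between `ℝ≥0∞` and the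
complex integral. -/
theorem exists_inversion (ha : ∀ s, 0 ≤ a s) (h1 : HasSum a 1) (n : ℕ) (d : ℤ) :
    ∃ r : ℝ, 0 ≤ r ∧
      Ex (fun s => ENNReal.ofReal (a s)) n (fun l => one (hsum (fun s => (s : ℤ)) l = d))
        = ENNReal.ofReal r ∧
      ((2 * Real.pi * r : ℝ) : ℂ)
        = ∫ t in (-Real.pi)..Real.pi, charFn a μ t ^ n * osc (-(t * (d - n * μ))) := by
  have hp1 : ∑' s, ENNReal.ofReal (a s) = 1 := by
    rw [← ENNReal.ofReal_tsum_of_nonneg ha h1.summable, h1.tsum_eq, ENNReal.ofReal_one]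
  induction n generalizing d with
  | zero =>
    refine ⟨if d = 0 then 1 else 0, by split_ifs <;> norm_num, ?_, ?_⟩
    · simp only [Ex, hsum_nil, one]
      by_cases h : d = 0 <;> simp [h, eq_comm]
    · have := integral_osc_int d
      simp only [pow_zero, one_mul, Nat.cast_zero, zero_mul, sub_zero]
      rw [this]
      by_cases h : d = 0 <;> simp [h]
  | succ n ih =>
    choose r hr0 hrE hrI using ih
    have hr1 : ∀ e, r e ≤ 1 := fun e => by
      have := Ex_one_le (p := fun s => ENNReal.ofReal (a s)) hp1 n
        (fun l => hsum (fun s => (s : ℤ)) l = e)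
      rw [hrE e, ENNReal.ofReal_le_one] at this
      exact this
    have hs : Summable fun s : ℕ => a s * r (d - s) :=
      Summable.of_nonneg_of_le (fun s => mul_nonneg (ha s) (hr0 _))
        (fun s => mul_le_of_le_one_right (ha s) (hr1 _)) h1.summable
    refine ⟨∑' s : ℕ, a s * r (d - s), tsum_nonneg fun s => mul_nonneg (ha s) (hr0 _), ?_, ?_⟩
    · rw [ENNReal.ofReal_tsum_of_nonneg (fun s => mul_nonneg (ha s) (hr0 _)) hs]
      simp only [Ex]
      refine tsum_congr fun s => ?_
      rw [ENNReal.ofReal_mul (ha s), ← hrE]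
      congr 1
      refine Ex_congr _ fun l _ => one_congr ?_
      rw [hsum_cons]
      constructor <;> intro h <;> linarith
    · have hL : HasSum (fun s : ℕ => ((2 * Real.pi * (a s * r (d - s)) : ℝ) : ℂ))
          ((2 * Real.pi * ∑' s : ℕ, a s * r (d - s) : ℝ) : ℂ) :=
        Complex.hasSum_ofReal.2 (hs.hasSum.mul_left _)
      refine hL.unique ?_
      have hcφ := continuous_charFn (μ := μ) ha h1
      have hco := continuous_osc
      -- One factor `charFn a μ t` is expanded over the new step; the masses `a s` dominate the
      -- series.
      have hI := intervalIntegral.hasSum_integral_of_dominated_convergence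
        (a := -Real.pi) (b := Real.pi) (μ := volume)
        (F := fun (s : ℕ) (t : ℝ) =>
          (a s : ℂ) * (charFn a μ t ^ n * osc (-(t * (((d - s : ℤ) : ℝ) - n * μ)))))
        (f := fun t => charFn a μ t ^ (n + 1) * osc (-(t * (d - (n + 1 : ℕ) * μ))))
        (fun s _ => a s) (fun s => Continuous.aestronglyMeasurable (by fun_prop))
        (fun s => Filter.Eventually.of_forall fun t _ => by
          rw [norm_mul, norm_mul, norm_osc, mul_one, norm_pow, Complex.norm_real,
            Real.norm_of_nonneg (ha s)]
          exact mul_le_of_le_one_right (ha s)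
            (pow_le_one₀ (norm_nonneg _) (norm_charFn_le_one ha h1 t)))
        (Filter.Eventually.of_forall fun t _ => h1.summable)
        (by simp)
        (Filter.Eventually.of_forall fun t _ => by
          have := (hasSum_charFn (μ := μ) ha h1 t).mul_left
            (charFn a μ t ^ n * osc (-(t * (d - (n + 1 : ℕ) * μ))))
          rw [pow_succ, mul_right_comm]
          refine hasSum_of_eq this fun s => ?_
          have e : -(t * (((d - s : ℤ) : ℝ) - n * μ))
              = -(t * (d - (n + 1 : ℕ) * μ)) + t * (s - μ) := by push_cast; ring
          rw [e, osc_add]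
          ring)
      refine hasSum_of_eq hI fun s => ?_
      rw [intervalIntegral.integral_const_mul, ← hrI]
      push_cast
      ring

/-! ### Comparison with the Gaussian law -/

theorem norm_osc_sub_le (u : ℝ) : ‖osc u - 1 - u * Complex.I + u ^ 2 / 2‖ ≤ 4 * |u| ^ 3 := by
  rcases le_or_gt |u| 1 with h | h
  · have hn : ‖(u : ℂ) * Complex.I‖ = |u| := by simp
    have := Complex.exp_bound (x := (u : ℂ) * Complex.I) (by rwa [hn]) (n := 3) (by norm_num)
    rw [hn] at this
    have e : osc u - 1 - u * Complex.I + u ^ 2 / 2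
        = Complex.exp ((u : ℂ) * Complex.I)
          - ∑ m ∈ Finset.range 3, ((u : ℂ) * Complex.I) ^ m / (m.factorial : ℂ) := by
      simp [Finset.sum_range_succ, osc, mul_pow, Nat.factorial]
      ring
    rw [e]
    refine this.trans ?_
    rw [mul_comm]
    refine mul_le_mul_of_nonneg_right ?_ (by positivity)
    norm_num [Nat.factorial]
  · have h1 : ‖osc u - 1 - u * Complex.I + u ^ 2 / 2‖ ≤ 1 + 1 + |u| + |u| ^ 2 / 2 := by
      refine (norm_add_le _ _).trans (add_le_add ((norm_sub_le _ _).trans (add_le_add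
        ((norm_sub_le _ _).trans (add_le_add (norm_osc u).le (by simp))) (by simp))) ?_)
      simp
    refine h1.trans ?_
    have h2 : |u| ≤ |u| ^ 2 := by nlinarith
    have h3 : |u| ^ 2 ≤ |u| ^ 3 := by nlinarith [sq_nonneg u, sq_abs u]
    linarith

theorem abs_exp_neg_sub_le {w : ℝ} (hw : 0 ≤ w) : |Real.exp (-w) - 1 + w| ≤ w ^ 2 := by
  rcases le_or_gt w 1 with h | h
  · have := Real.abs_exp_sub_one_sub_id_le (x := -w) (by rwa [abs_neg, abs_of_nonneg hw])
    simpa using this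
  · have h1 := Real.add_one_le_exp (-w)
    have h2 : Real.exp (-w) ≤ 1 := Real.exp_le_one_iff.2 (by linarith)
    rw [abs_of_nonneg (by linarith)]
    nlinarith

/-- Both functions agree with `1 - v t² / 2` up to `O(|t| ^ 3)`, since the mean is zero. For the
Gaussian the error of order `t ^ 4` is reduced to `|t| ^ 3` by `|t| ≤ π < 4`. -/
theorem norm_charFn_sub_gaussian_le (ha : ∀ s, 0 ≤ a s) (h1 : HasSum a 1)
    (hμ : HasSum (fun s => a s * (s - μ)) 0) {v M : ℝ}
    (hv : HasSum (fun s => a s * ((s : ℝ) - μ) ^ 2) v)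
    (hM : HasSum (fun s => a s * |(s : ℝ) - μ| ^ 3) M) {t : ℝ} (ht : |t| ≤ Real.pi) :
    ‖charFn a μ t - Real.exp (-(v / 2 * t ^ 2))‖ ≤ (4 * M + v ^ 2) * |t| ^ 3 := by
  have hv0 : 0 ≤ v := hv.nonneg fun s => mul_nonneg (ha s) (sq_nonneg _)
  have hA := ((hasSum_charFn (μ := μ) ha h1 t).sub (Complex.hasSum_ofReal.2 h1)).sub
    ((Complex.hasSum_ofReal.2 hμ).mul_left (t * Complex.I))
  have hB := hA.add ((Complex.hasSum_ofReal.2 hv).mul_left ((t : ℂ) ^ 2 / 2))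
  have h2 := hB.norm_le_of_bounded (hM.mul_left (4 * |t| ^ 3)) (fun s => by
    have e : (a s : ℂ) * osc (t * (s - μ)) - (a s : ℂ) - t * Complex.I * ((a s * (s - μ) : ℝ) : ℂ)
        + (t : ℂ) ^ 2 / 2 * ((a s * ((s : ℝ) - μ) ^ 2 : ℝ) : ℂ)
        = a s * (osc (t * (s - μ)) - 1 - (t * (s - μ) : ℝ) * Complex.I
          + ((t * (s - μ) : ℝ) : ℂ) ^ 2 / 2) := by
      push_cast; ring
    rw [e, norm_mul, Complex.norm_real, Real.norm_of_nonneg (ha s)]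
    calc _ ≤ a s * (4 * |t * (s - μ)| ^ 3) :=
          mul_le_mul_of_nonneg_left (norm_osc_sub_le _) (ha s)
      _ = _ := by rw [abs_mul]; ring)
  have h3 := abs_exp_neg_sub_le (w := v / 2 * t ^ 2) (by positivity)
  have e : charFn a μ t - Real.exp (-(v / 2 * t ^ 2))
      = (charFn a μ t - ((1 : ℝ) : ℂ) - t * Complex.I * ((0 : ℝ) : ℂ) + (t : ℂ) ^ 2 / 2 * v)
        - ((Real.exp (-(v / 2 * t ^ 2)) - 1 + v / 2 * t ^ 2 : ℝ) : ℂ) := by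
    push_cast; ring
  rw [e]
  refine (norm_sub_le _ _).trans ?_
  rw [Complex.norm_real, Real.norm_eq_abs]
  have h4 : (v / 2 * t ^ 2) ^ 2 ≤ v ^ 2 * |t| ^ 3 := by
    have : (v / 2 * t ^ 2) ^ 2 = v ^ 2 * |t| ^ 3 * (|t| / 4) := by
      rw [← sq_abs t]; ring
    rw [this]
    refine mul_le_of_le_one_right (by positivity) ?_
    linarith [Real.pi_lt_four]
  calc _ ≤ 4 * |t| ^ 3 * M + v ^ 2 * |t| ^ 3 := add_le_add h2 (h3.trans h4)
    _ = _ := by ring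

theorem norm_pow_sub_pow_le {x y : ℂ} {R : ℝ} (hx : ‖x‖ ≤ R) (hy : ‖y‖ ≤ R) (n : ℕ) :
    ‖x ^ n - y ^ n‖ ≤ n * R ^ (n - 1) * ‖x - y‖ := by
  have hR : 0 ≤ R := (norm_nonneg x).trans hx
  rw [← geom_sum₂_mul, norm_mul]
  refine mul_le_mul_of_nonneg_right ?_ (norm_nonneg _)
  refine (norm_sum_le _ _).trans ?_
  calc _ ≤ ∑ i ∈ Finset.range n, R ^ (n - 1) := by
        refine Finset.sum_le_sum fun i hi => ?_
        rw [norm_mul, norm_pow, norm_pow]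
        calc _ ≤ R ^ i * R ^ (n - 1 - i) := by gcongr
          _ = _ := by rw [← pow_add]; congr 1; have := Finset.mem_range.1 hi; omega
    _ = _ := by simp

theorem cube_mul_exp_le {b : ℝ} (hb : 0 < b) (t : ℝ) :
    |t| ^ 3 * Real.exp (-b * t ^ 2) ≤ 4 / (b * √b) * Real.exp (-(b / 2) * t ^ 2) := by
  have hw : 0 ≤ √b * |t| := by positivity
  set w := √b * |t| with hwd
  have hw2 : w ^ 2 = b * t ^ 2 := by rw [hwd, mul_pow, Real.sq_sqrt hb.le, sq_abs]
  have hw3 : w ^ 3 = b * √b * |t| ^ 3 := by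
    rw [hwd, mul_pow, pow_succ (√b), Real.sq_sqrt hb.le]
  have h1 : w ^ 3 ≤ 4 * Real.exp (w ^ 2 / 2) := by
    have := Real.quadratic_le_exp_of_nonneg (x := w ^ 2 / 2) (by positivity)
    nlinarith [sq_nonneg (w - 1), sq_nonneg (w * (w - 1)), sq_nonneg (w ^ 2)]
  have h2 : Real.exp (-(b / 2) * t ^ 2) = Real.exp (w ^ 2 / 2) * Real.exp (-b * t ^ 2) := by
    rw [← Real.exp_add, hw2]; ring_nf
  rw [h2, ← mul_assoc]
  refine mul_le_mul_of_nonneg_right ?_ (Real.exp_pos _).le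
  rw [div_mul_eq_mul_div, le_div_iff₀ (by positivity)]
  linarith [hw3]

theorem intervalIntegral_gaussian_le {b : ℝ} (hb : 0 < b) :
    ∫ t in (-Real.pi)..Real.pi, Real.exp (-b * t ^ 2) ≤ √(Real.pi / b) := by
  rw [intervalIntegral.integral_of_le (by linarith [Real.pi_pos]), ← integral_gaussian b]
  exact setIntegral_le_integral (integrable_exp_neg_mul_sq hb)
    (Filter.Eventually.of_forall fun t => (Real.exp_pos _).le)

theorem intervalIntegral_norm_le {F : ℝ → ℂ} {K b : ℝ} (hK : 0 ≤ K) (hb : 0 < b)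
    (hF : ∀ t, |t| ≤ Real.pi → ‖F t‖ ≤ K * Real.exp (-b * t ^ 2)) :
    ‖∫ t in (-Real.pi)..Real.pi, F t‖ ≤ K * √(Real.pi / b) := by
  have hpi := Real.pi_pos
  refine (intervalIntegral.norm_integral_le_of_norm_le (g := fun t => K * Real.exp (-b * t ^ 2))
    (by linarith) (Filter.Eventually.of_forall fun t ht => hF t (abs_le.2 ⟨ht.1.le, ht.2⟩))
    (Continuous.intervalIntegrable (by fun_prop) _ _)).trans ?_
  rw [intervalIntegral.integral_const_mul]
  exact mul_le_mul_of_nonneg_left (intervalIntegral_gaussian_le hb) hK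

/-- Outside `[-π, π]` one has `t² ≥ 2`, so half of the exponent already gives `exp (-b t² / 2) ≤ 1 /
b`. The tail is thus smaller than the main term `√(π / b)` by an order `1 / b`. -/
theorem norm_intervalIntegral_gaussian_sub_le {b : ℝ} (hb : 0 < b) (x : ℝ) :
    ‖(∫ t in (-Real.pi)..Real.pi, (Real.exp (-b * t ^ 2) : ℂ) * osc (-(t * x)))
      - (√(Real.pi / b) * Real.exp (-x ^ 2 / (4 * b)) : ℝ)‖ ≤ 1 / b * √(2 * Real.pi / b) := by
  have hpi := Real.pi_pos
  have hfull : ∫ t : ℝ, (Real.exp (-b * t ^ 2) : ℂ) * osc (-(t * x))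
      = (√(Real.pi / b) * Real.exp (-x ^ 2 / (4 * b)) : ℝ) := by
    have := fourierIntegral_gaussian (b := (b : ℂ)) (by simpa using hb) (-x : ℂ)
    rw [show (fun t : ℝ => (Real.exp (-b * t ^ 2) : ℂ) * osc (-(t * x)))
      = fun t : ℝ => Complex.exp (Complex.I * (-x : ℂ) * t) * Complex.exp (-(b : ℂ) * t ^ 2) from ?_,
      this]
    · rw [Complex.ofReal_mul, Real.sqrt_eq_rpow, Complex.ofReal_cpow (by positivity)]
      push_cast
      ring_nf
    · funext t
      simp only [osc]
      push_cast
      rw [mul_comm]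
      congr 2
      ring
  have hint : Integrable (fun t : ℝ => (Real.exp (-b * t ^ 2) : ℂ) * osc (-(t * x))) := by
    refine (integrable_exp_neg_mul_sq hb).mono' (Continuous.aestronglyMeasurable ?_)
      (Filter.Eventually.of_forall fun t => ?_)
    · have := continuous_osc
      fun_prop
    · rw [norm_mul, norm_osc, mul_one, Complex.norm_real, Real.norm_of_nonneg (Real.exp_pos _).le]
  rw [← hfull, intervalIntegral.integral_of_le (by linarith),
    ← integral_add_compl (s := Set.Ioc (-Real.pi) Real.pi) measurableSet_Ioc hint, sub_add_cancel_left,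
    norm_neg]
  have hg : Integrable (fun t : ℝ => 1 / b * Real.exp (-(b / 2) * t ^ 2)) :=
    (integrable_exp_neg_mul_sq (by positivity)).const_mul _
  have h1 : ‖∫ t in (Set.Ioc (-Real.pi) Real.pi)ᶜ, (Real.exp (-b * t ^ 2) : ℂ) * osc (-(t * x))‖
      ≤ ∫ t in (Set.Ioc (-Real.pi) Real.pi)ᶜ, 1 / b * Real.exp (-(b / 2) * t ^ 2) := by
    refine norm_integral_le_of_norm_le hg.integrableOn ?_
    refine (ae_restrict_iff' measurableSet_Ioc.compl).2 (Filter.Eventually.of_forall fun t ht => ?_)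
    rw [norm_mul, norm_osc, mul_one, Complex.norm_real, Real.norm_of_nonneg (Real.exp_pos _).le]
    have ht2 : 2 ≤ t ^ 2 := by
      have h3 := Real.pi_gt_three
      rw [Set.mem_compl_iff, Set.mem_Ioc, not_and_or, not_lt, not_le] at ht
      rcases ht with ht | ht <;> nlinarith
    have e : Real.exp (-b * t ^ 2) = Real.exp (-(b / 2 * t ^ 2)) * Real.exp (-(b / 2) * t ^ 2) := by
      rw [← Real.exp_add]; ring_nf
    rw [e]
    refine mul_le_mul_of_nonneg_right ?_ (Real.exp_pos _).le
    rw [Real.exp_neg, one_div]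
    refine inv_anti₀ hb ?_
    have := Real.add_one_le_exp (b / 2 * t ^ 2)
    nlinarith
  refine h1.trans ((setIntegral_le_integral hg (Filter.Eventually.of_forall fun t => ?_)).trans ?_)
  · show (0 : ℝ) ≤ _
    positivity
  · rw [integral_const_mul, integral_gaussian]
    refine le_of_eq ?_
    congr 2
    field_simp

set_option maxHeartbeats 1000000 in
-- The constants depend only on the mass `c` of two neighbouring atoms and on a bound `M` for the
-- third moment. The upper bound integrates the Gaussian domination of the characteristic function.
-- For the lower bound the error of the Gaussian comparison is `O(1 / n)`, against a main term of
-- order `1 / √n`.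
theorem exists_local_limit {c M : ℝ} (hc : 0 < c) :
    ∃ CU ≥ (0 : ℝ), ∃ cL : ℝ → ℝ, (∀ A, 0 < cL A) ∧ ∃ nL : ℝ → ℕ,
      ∀ (a : ℕ → ℝ) (μ v m : ℝ) (l₀ : ℕ), (∀ s, 0 ≤ a s) → HasSum a 1 →
      HasSum (fun s => a s * (s - μ)) 0 → HasSum (fun s => a s * ((s : ℝ) - μ) ^ 2) v →
      HasSum (fun s => a s * |(s : ℝ) - μ| ^ 3) m → m ≤ M → c ≤ a l₀ → c ≤ a (l₀ + 1) →
      (∀ n : ℕ, 1 ≤ n → ∀ d : ℤ,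
        Ex (fun s => ENNReal.ofReal (a s)) n (fun l => one (hsum (fun s => (s : ℤ)) l = d))
          ≤ ENNReal.ofReal (CU / √n)) ∧
      ∀ A, ∀ n : ℕ, nL A ≤ n → ∀ d : ℤ, |(d : ℝ) - n * μ| ≤ A * √n →
        ENNReal.ofReal (cL A / √n) ≤
          Ex (fun s => ENNReal.ofReal (a s)) n (fun l => one (hsum (fun s => (s : ℤ)) l = d)) := by
  have hpi := Real.pi_pos
  set κ := c / Real.pi ^ 2 with hκ
  have hκ0 : 0 < κ := by positivity
  have hκc : κ ≤ c / 4 := by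
    rw [hκ]
    have : (4 : ℝ) ≤ Real.pi ^ 2 := by nlinarith [Real.pi_gt_three]
    gcongr
  set V := 1 + |M| with hV
  have hV0 : 0 < V := by positivity
  set M' := 4 * |M| + V ^ 2 with hM'
  have hM'0 : 0 ≤ M' := by positivity
  set E := M' * (16 / κ ^ 2 * √(2 * Real.pi)) + 4 / c * √(8 * Real.pi / c) with hE
  have hE0 : 0 ≤ E := by positivity
  -- A lower bound for `√n` times the Gaussian term in the window `|x| ≤ A √n`, from `c / 2 ≤ v ≤
  -- V`. The threshold on `n` chosen below makes the error at most half of it.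
  set c₁ : ℝ → ℝ := fun A => √(2 * Real.pi / V) * Real.exp (-A ^ 2 / c) with hc₁
  have hc₁0 : ∀ A, 0 < c₁ A := fun A => by positivity
  refine ⟨√(Real.pi / κ) / (2 * Real.pi), by positivity, fun A => c₁ A / (4 * Real.pi),
    fun A => div_pos (hc₁0 A) (by positivity), fun A => ⌈(2 * E / c₁ A) ^ 2⌉₊ + 2, ?_⟩
  intro a μ v m l₀ ha h1 hμ hv hm hmM hl hl'
  have hφ : ∀ t, |t| ≤ Real.pi → ‖charFn a μ t‖ ≤ Real.exp (-κ * t ^ 2) := fun t ht => by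
    have := norm_charFn_le (μ := μ) ha h1 hc.le hl hl' ht
    simpa [hκ] using this
  constructor
  · intro n hn d
    have hn0 : (0 : ℝ) < n := by exact_mod_cast hn
    obtain ⟨r, hr0, hrE, hrI⟩ := exists_inversion (μ := μ) ha h1 n d
    rw [hrE]
    refine ENNReal.ofReal_le_ofReal ?_
    have h2 := intervalIntegral_norm_le
      (F := fun t => charFn a μ t ^ n * osc (-(t * (d - n * μ)))) (K := 1) (b := κ * n)
      zero_le_one (by positivity) (fun t ht => by
        rw [norm_mul, norm_osc, mul_one, one_mul, norm_pow]
        calc _ ≤ Real.exp (-κ * t ^ 2) ^ n := pow_le_pow_left₀ (norm_nonneg _) (hφ t ht) n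
          _ = _ := by rw [← Real.exp_nat_mul]; ring_nf)
    rw [← hrI, Complex.norm_real, Real.norm_of_nonneg (by positivity), one_mul,
      ← div_div, Real.sqrt_div (by positivity)] at h2
    rw [div_div, le_div_iff₀ (by positivity)]
    rw [le_div_iff₀ (by positivity)] at h2
    linarith
  · intro A n hn d hd
    replace hn : ⌈(2 * E / c₁ A) ^ 2⌉₊ + 2 ≤ n := hn
    have hn2 : 2 ≤ n := by omega
    have hnR : (2 : ℝ) ≤ n := by exact_mod_cast hn2
    have hn0 : (0 : ℝ) < n := by linarith
    have hnE : (2 * E / c₁ A) ^ 2 ≤ n := by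
      refine (Nat.le_ceil _).trans ?_
      exact_mod_cast (by omega : ⌈(2 * E / c₁ A) ^ 2⌉₊ ≤ n)
    obtain ⟨r, hr0, hrE, hrI⟩ := exists_inversion (μ := μ) ha h1 n d
    rw [hrE]
    refine ENNReal.ofReal_le_ofReal ?_
    have hm0 : 0 ≤ m := hm.nonneg fun s => mul_nonneg (ha s) (by positivity)
    have hmM' : m ≤ |M| := hmM.trans (le_abs_self M)
    -- Two consecutive integers cannot both be close to `μ`: `u² + (u + 1)² ≥ 1 / 2`.
    have hvc : c / 2 ≤ v := by
      have h2 : a l₀ * ((l₀ : ℝ) - μ) ^ 2 + a (l₀ + 1) * (((l₀ + 1 : ℕ) : ℝ) - μ) ^ 2 ≤ v := by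
        have := sum_le_hasSum {l₀, l₀ + 1} (fun s _ => mul_nonneg (ha s) (sq_nonneg _)) hv
        rwa [Finset.sum_pair (by omega)] at this
      have h3 : c * (((l₀ : ℝ) - μ) ^ 2 + ((l₀ : ℝ) + 1 - μ) ^ 2) ≤ v := by
        push_cast at h2
        have := mul_le_mul_of_nonneg_right hl (sq_nonneg ((l₀ : ℝ) - μ))
        have := mul_le_mul_of_nonneg_right hl' (sq_nonneg ((l₀ : ℝ) + 1 - μ))
        linarith
      have h4 : 1 / 2 ≤ ((l₀ : ℝ) - μ) ^ 2 + ((l₀ : ℝ) + 1 - μ) ^ 2 := by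
        nlinarith [sq_nonneg (2 * ((l₀ : ℝ) - μ) + 1)]
      linarith [mul_le_mul_of_nonneg_left h4 hc.le]
    have hv0 : 0 < v := by linarith
    have hvV : v ≤ V := by
      have h2 : v ≤ 1 + m := by
        refine hasSum_le (fun s => ?_) hv (h1.add hm)
        have : ((s : ℝ) - μ) ^ 2 ≤ 1 + |(s : ℝ) - μ| ^ 3 := by
          rw [← sq_abs]
          have h0 := abs_nonneg ((s : ℝ) - μ)
          set u := |(s : ℝ) - μ|
          rcases le_or_gt u 1 with h | h
          · have := pow_le_one₀ (n := 2) h0 h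
            have := pow_nonneg h0 3
            linarith
          · nlinarith [mul_nonneg (sq_nonneg u) (sub_nonneg.2 h.le)]
        have := mul_le_mul_of_nonneg_left this (ha s)
        linarith
      linarith
    set b := n * v / 2 with hb
    have hb0 : 0 < b := by positivity
    have hbn : c / 4 * n ≤ b := by
      have := mul_le_mul_of_nonneg_right hvc hn0.le
      linarith
    set x := (d : ℝ) - n * μ with hx
    -- comparison of the two integrals
    set F : ℝ → ℂ := fun t => charFn a μ t ^ n * osc (-(t * x)) with hF
    set H : ℝ → ℂ := fun t => (Real.exp (-b * t ^ 2) : ℂ) * osc (-(t * x)) with hH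
    have hcF : Continuous F := by
      have := continuous_charFn (μ := μ) ha h1
      have := continuous_osc
      fun_prop
    have hcH : Continuous H := by
      have := continuous_osc
      fun_prop
    have hβ0 : 0 < κ * n / 2 := by positivity
    -- The factors are dominated by `exp (-κ t²)` and differ by `O(|t| ^ 3)`, so the `n`-th powers
    -- differ by at most `n |t| ^ 3 exp (-κ n t² / 2)` up to a constant, whose integral is `O(1 /
    -- n)`.
    have hdiff : ‖∫ t in (-Real.pi)..Real.pi, (F t - H t)‖
        ≤ (n * M' * (4 / (κ * n / 2 * √(κ * n / 2)))) * √(Real.pi / (κ * n / 2 / 2)) := by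
      refine intervalIntegral_norm_le (by positivity) (by positivity) fun t ht => ?_
      have e : F t - H t = (charFn a μ t ^ n - (Real.exp (-(v / 2 * t ^ 2)) : ℂ) ^ n)
          * osc (-(t * x)) := by
        simp only [hF, hH]
        rw [sub_mul]
        congr 2
        rw [← Complex.ofReal_pow, ← Real.exp_nat_mul, hb]
        congr 2
        ring
      rw [e, norm_mul, norm_osc, mul_one]
      have hg : ‖(Real.exp (-(v / 2 * t ^ 2)) : ℂ)‖ ≤ Real.exp (-κ * t ^ 2) := by
        rw [Complex.norm_real, Real.norm_of_nonneg (Real.exp_pos _).le]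
        refine Real.exp_le_exp.2 ?_
        have : κ ≤ v / 2 := by linarith
        have := mul_le_mul_of_nonneg_right this (sq_nonneg t)
        linarith
      have hcmp := norm_charFn_sub_gaussian_le ha h1 hμ hv hm ht
      have hR : Real.exp (-κ * t ^ 2) ^ (n - 1) ≤ Real.exp (-(κ * n / 2) * t ^ 2) := by
        rw [← Real.exp_nat_mul, Nat.cast_sub (by omega)]
        refine Real.exp_le_exp.2 ?_
        have : (n : ℝ) / 2 ≤ n - 1 := by linarith
        have := mul_le_mul_of_nonneg_right this (by positivity : 0 ≤ κ * t ^ 2)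
        push_cast
        linarith
      have hMm : 4 * m + v ^ 2 ≤ M' := by
        have : v ^ 2 ≤ V ^ 2 := by gcongr
        linarith
      calc _ ≤ n * Real.exp (-κ * t ^ 2) ^ (n - 1)
            * ‖charFn a μ t - (Real.exp (-(v / 2 * t ^ 2)) : ℂ)‖ :=
            norm_pow_sub_pow_le (hφ t ht) hg n
        _ ≤ n * Real.exp (-(κ * n / 2) * t ^ 2) * (M' * |t| ^ 3) := by
            gcongr
            exact hcmp.trans (by gcongr)
        _ = n * M' * (|t| ^ 3 * Real.exp (-(κ * n / 2) * t ^ 2)) := by ring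
        _ ≤ n * M' * (4 / (κ * n / 2 * √(κ * n / 2)) * Real.exp (-(κ * n / 2 / 2) * t ^ 2)) :=
            mul_le_mul_of_nonneg_left (cube_mul_exp_le hβ0 t) (by positivity)
        _ = _ := by ring
    have herr1 : (n * M' * (4 / (κ * n / 2 * √(κ * n / 2)))) * √(Real.pi / (κ * n / 2 / 2))
        = M' * (16 / κ ^ 2 * √(2 * Real.pi)) / n := by
      have hB : √(Real.pi / (κ * n / 2 / 2)) = √(2 * Real.pi) / √(κ * n / 2) := by
        rw [← Real.sqrt_div (by positivity)]
        congr 1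
        field_simp
      rw [hB]
      have hsq := Real.mul_self_sqrt hβ0.le
      have hs0 : 0 < √(κ * n / 2) := Real.sqrt_pos.2 hβ0
      calc _ = n * M' * 4 * √(2 * Real.pi) / (κ * n / 2 * (√(κ * n / 2) * √(κ * n / 2))) := by
            field_simp
        _ = _ := by
            rw [hsq]
            field_simp
            ring
    have hgau := norm_intervalIntegral_gaussian_sub_le hb0 x
    have herr2 : 1 / b * √(2 * Real.pi / b) ≤ 4 / c * √(8 * Real.pi / c) / n := by
      have h2 : 1 / b ≤ 4 / c / n := by
        rw [div_div, div_le_div_iff₀ hb0 (by positivity)]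
        linarith
      have h3 : 2 * Real.pi / b ≤ 8 * Real.pi / c := by
        rw [div_le_div_iff₀ hb0 hc]
        have : c / 4 * 1 ≤ c / 4 * n := mul_le_mul_of_nonneg_left (by linarith) (by positivity)
        have := mul_le_mul_of_nonneg_left (this.trans hbn) hpi.le
        linarith
      calc _ ≤ 4 / c / n * √(8 * Real.pi / c) :=
            mul_le_mul h2 (Real.sqrt_le_sqrt h3) (Real.sqrt_nonneg _) (by positivity)
        _ = _ := by ring
    set G := √(Real.pi / b) * Real.exp (-x ^ 2 / (4 * b)) with hG
    have hrG : ‖((2 * Real.pi * r : ℝ) : ℂ) - (G : ℂ)‖ ≤ E / n := by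
      have e : ((2 * Real.pi * r : ℝ) : ℂ) - (G : ℂ)
          = (∫ t in (-Real.pi)..Real.pi, (F t - H t))
            + ((∫ t in (-Real.pi)..Real.pi, H t) - (G : ℂ)) := by
        rw [intervalIntegral.integral_sub (hcF.intervalIntegrable _ _) (hcH.intervalIntegrable _ _),
          hrI]
        ring
      rw [e]
      refine (norm_add_le _ _).trans ((add_le_add (hdiff.trans herr1.le) (hgau.trans herr2)).trans ?_)
      rw [← add_div]
    rw [← Complex.ofReal_sub, Complex.norm_real, Real.norm_eq_abs] at hrG
    have hr2 : G - E / n ≤ 2 * Real.pi * r := by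
      have := (abs_le.1 hrG).1
      linarith
    have hsn : 0 < √(n : ℝ) := Real.sqrt_pos.2 hn0
    have hGc : c₁ A / √n ≤ G := by
      have h2 : √(2 * Real.pi / V) / √n ≤ √(Real.pi / b) := by
        rw [← Real.sqrt_div (by positivity)]
        refine Real.sqrt_le_sqrt ?_
        rw [div_div, hb, div_le_div_iff₀ (by positivity) (by positivity)]
        have := mul_le_mul_of_nonneg_left hvV (by positivity : 0 ≤ Real.pi * n)
        linarith
      have h3 : -A ^ 2 / c ≤ -x ^ 2 / (4 * b) := by
        have hx2 : x ^ 2 ≤ A ^ 2 * n := by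
          have := pow_le_pow_left₀ (abs_nonneg x) hd 2
          rwa [sq_abs, mul_pow, Real.sq_sqrt hn0.le] at this
        rw [neg_div, neg_div, neg_le_neg_iff, div_le_div_iff₀ (by positivity) hc]
        have : c * n ≤ 4 * b := by linarith
        have h5 := mul_le_mul_of_nonneg_right hx2 hc.le
        have h6 := mul_le_mul_of_nonneg_left this (sq_nonneg A)
        linarith
      calc _ = √(2 * Real.pi / V) / √n * Real.exp (-A ^ 2 / c) := by rw [hc₁]; ring
        _ ≤ _ := mul_le_mul h2 (Real.exp_le_exp.2 h3) (Real.exp_pos _).le (Real.sqrt_nonneg _)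
    have hEn : E / n ≤ c₁ A / √n / 2 := by
      have h2 : 2 * E / c₁ A ≤ √n := Real.le_sqrt_of_sq_le hnE
      rw [div_le_iff₀ (hc₁0 A)] at h2
      have h3 : E / n = E / √n / √n := by rw [div_div, Real.mul_self_sqrt hn0.le]
      rw [h3, div_div (c₁ A), mul_comm (√(n : ℝ)) 2, ← div_div, ]
      refine (div_le_div_iff_of_pos_right hsn).2 ?_
      rw [div_le_iff₀ hsn]
      linarith
    rw [div_div, div_le_iff₀ (by positivity)]
    have h4 : c₁ A / √n ≤ 4 * Real.pi * r := by linarith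
    rw [div_le_iff₀ hsn] at h4
    linarith

end LocalLimit

/-! ### Exponentially tilted laws of bounded weights -/

/-- Weights on `ℕ` bounded by `B`, equal to one at zero and at least `1 / 2` from `l₀` on. -/
structure Wt (k : ℕ → ℝ) (B : ℝ) (l₀ : ℕ) : Prop where
  zero : k 0 = 1
  nonneg : ∀ l, 0 ≤ k l
  le : ∀ l, k l ≤ B
  half : ∀ l, l₀ ≤ l → 1 / 2 ≤ k l
  pos : 1 ≤ l₀

/-- The generating function of the weights `k`. -/
noncomputable def gen (k : ℕ → ℝ) (q : ℝ) : ℝ := ∑' s, k s * q ^ s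

/-- The law on `ℕ` proportional to `k s * q ^ s`. -/
noncomputable def law (k : ℕ → ℝ) (q : ℝ) (s : ℕ) : ℝ := k s * q ^ s / gen k q

/-- The law `law k q` has mean `μ`. -/
def IsMean (k : ℕ → ℝ) (q μ : ℝ) : Prop := HasSum (fun s => law k q s * (s - μ)) 0

section

variable {k : ℕ → ℝ} {B : ℝ} {l₀ : ℕ} {q μ : ℝ}

theorem Wt.one_le (h : Wt k B l₀) : 1 ≤ B := h.zero ▸ h.le 0

theorem Wt.summable (h : Wt k B l₀) (hq : 0 ≤ q) (hq1 : q < 1) : Summable fun s => k s * q ^ s :=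
  Summable.of_nonneg_of_le (fun s => mul_nonneg (h.nonneg s) (by positivity))
    (fun s => mul_le_mul_of_nonneg_right (h.le s) (by positivity))
    ((summable_geometric_of_lt_one hq hq1).mul_left B)

theorem Wt.gen_le (h : Wt k B l₀) (hq : 0 ≤ q) (hq1 : q < 1) : gen k q ≤ B * (1 - q)⁻¹ := by
  rw [← tsum_geometric_of_lt_one hq hq1, ← tsum_mul_left]
  exact (h.summable hq hq1).tsum_le_tsum
    (fun s => mul_le_mul_of_nonneg_right (h.le s) (by positivity))
    ((summable_geometric_of_lt_one hq hq1).mul_left B)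

theorem Wt.one_le_gen (h : Wt k B l₀) (hq : 0 ≤ q) (hq1 : q < 1) : 1 ≤ gen k q := by
  have := (h.summable hq hq1).le_tsum 0 (fun s _ => mul_nonneg (h.nonneg s) (by positivity))
  simpa [h.zero, gen] using this

theorem Wt.gen_pos (h : Wt k B l₀) (hq : 0 ≤ q) (hq1 : q < 1) : 0 < gen k q :=
  zero_lt_one.trans_le (h.one_le_gen hq hq1)

theorem Wt.le_gen (h : Wt k B l₀) (hq : 0 ≤ q) (hq1 : q < 1) :
    q ^ l₀ / 2 * (1 - q)⁻¹ ≤ gen k q := by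
  have hs := h.summable hq hq1
  rw [gen, ← hs.sum_add_tsum_nat_add l₀, ← tsum_geometric_of_lt_one hq hq1, ← tsum_mul_left]
  refine le_add_of_nonneg_of_le
    (Finset.sum_nonneg fun s _ => mul_nonneg (h.nonneg s) (by positivity)) ?_
  refine Summable.tsum_le_tsum (fun s => ?_)
    ((summable_geometric_of_lt_one hq hq1).mul_left _) ((summable_nat_add_iff l₀).2 hs)
  have := mul_le_mul_of_nonneg_right (h.half (s + l₀) (by omega)) (by positivity : 0 ≤ q ^ (s + l₀))
  calc _ = 1 / 2 * q ^ (s + l₀) := by rw [pow_add]; ring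
    _ ≤ _ := this

theorem Wt.law_nonneg (h : Wt k B l₀) (hq : 0 ≤ q) (hq1 : q < 1) (s : ℕ) : 0 ≤ law k q s :=
  div_nonneg (mul_nonneg (h.nonneg s) (by positivity)) (h.gen_pos hq hq1).le

theorem Wt.hasSum_law (h : Wt k B l₀) (hq : 0 ≤ q) (hq1 : q < 1) : HasSum (law k q) 1 := by
  have := (h.summable hq hq1).hasSum.div_const (gen k q)
  rwa [← gen, div_self (h.gen_pos hq hq1).ne'] at this

theorem Wt.law_le (h : Wt k B l₀) (hq : 0 ≤ q) (hq1 : q < 1) (s : ℕ) :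
    law k q s ≤ B * q ^ s / gen k q := by
  have := h.gen_pos hq hq1
  have := h.le s
  unfold law
  gcongr

theorem Wt.le_law (h : Wt k B l₀) (hq : 0 ≤ q) (hq1 : q < 1) {s : ℕ} (hs : l₀ ≤ s) :
    1 / 2 * q ^ s / gen k q ≤ law k q s := by
  have := h.gen_pos hq hq1
  have := h.half s hs
  unfold law
  gcongr

theorem Wt.summable_mul (h : Wt k B l₀) (hq : 0 ≤ q) (hq1 : q < 1) :
    Summable fun s : ℕ => s * (k s * q ^ s) := by
  have hn : ‖q‖ < 1 := by rwa [Real.norm_of_nonneg hq]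
  refine Summable.of_nonneg_of_le
    (fun s => mul_nonneg (by positivity) (mul_nonneg (h.nonneg s) (by positivity)))
    (fun s => ?_) ((hasSum_coe_mul_geometric_of_norm_lt_one hn).summable.mul_left B)
  have := mul_le_mul_of_nonneg_right (h.le s) (by positivity : 0 ≤ (s : ℝ) * q ^ s)
  linarith

theorem Wt.tsum_mul_le (h : Wt k B l₀) (hq : 0 ≤ q) (hq1 : q < 1) :
    ∑' s : ℕ, s * (k s * q ^ s) ≤ B * (q / (1 - q) ^ 2) := by
  have hn : ‖q‖ < 1 := by rwa [Real.norm_of_nonneg hq]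
  rw [← tsum_coe_mul_geometric_of_norm_lt_one hn, ← tsum_mul_left]
  refine (h.summable_mul hq hq1).tsum_le_tsum (fun s => ?_)
    ((hasSum_coe_mul_geometric_of_norm_lt_one hn).summable.mul_left B)
  have := mul_le_mul_of_nonneg_right (h.le s) (by positivity : 0 ≤ (s : ℝ) * q ^ s)
  linarith

theorem Wt.le_tsum_mul (h : Wt k B l₀) (hq : 0 ≤ q) (hq1 : q < 1) :
    q ^ l₀ / 2 * (q / (1 - q) ^ 2) ≤ ∑' s : ℕ, s * (k s * q ^ s) := by
  have hn : ‖q‖ < 1 := by rwa [Real.norm_of_nonneg hq]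
  have hs := h.summable_mul hq hq1
  rw [← hs.sum_add_tsum_nat_add l₀, ← tsum_coe_mul_geometric_of_norm_lt_one hn, ← tsum_mul_left]
  refine le_add_of_nonneg_of_le (Finset.sum_nonneg fun s _ =>
    mul_nonneg (by positivity) (mul_nonneg (h.nonneg s) (by positivity))) ?_
  refine Summable.tsum_le_tsum (fun s => ?_)
    ((hasSum_coe_mul_geometric_of_norm_lt_one hn).summable.mul_left _)
    ((summable_nat_add_iff l₀).2 hs)
  have h1 := mul_le_mul_of_nonneg_right (h.half (s + l₀) (by omega))
    (by positivity : 0 ≤ q ^ (s + l₀))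
  calc q ^ l₀ / 2 * (s * q ^ s) = s * (1 / 2 * q ^ (s + l₀)) := by rw [pow_add]; ring
    _ ≤ ((s + l₀ : ℕ) : ℝ) * (k (s + l₀) * q ^ (s + l₀)) := by
        have : (s : ℝ) ≤ ((s + l₀ : ℕ) : ℝ) := by push_cast; linarith [(Nat.cast_nonneg l₀ : (0:ℝ) ≤ l₀)]
        gcongr

theorem Wt.isMean_iff (h : Wt k B l₀) (hq : 0 ≤ q) (hq1 : q < 1) :
    IsMean k q μ ↔ ∑' s : ℕ, s * (k s * q ^ s) = μ * gen k q := by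
  have hg := h.gen_pos hq hq1
  have h1 : HasSum (fun s : ℕ => law k q s * (s - μ))
      ((∑' s : ℕ, s * (k s * q ^ s) - μ * gen k q) / gen k q) := by
    have := ((h.summable_mul hq hq1).hasSum.sub ((h.summable hq hq1).hasSum.mul_left μ)).div_const
      (gen k q)
    refine (hasSum_of_eq this fun s => ?_)
    unfold law
    ring
  constructor
  · intro hm
    have := hm.unique h1
    rw [eq_comm, div_eq_zero_iff] at this
    rcases this with h2 | h2
    · linarith
    · exact absurd h2 hg.ne'
  · intro hm
    rw [hm, sub_self, zero_div] at h1
    exact h1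

/-- The mean is the quotient of a sum comparable with `q / (1 - q) ^ 2` and one comparable with `1 /
(1 - q)`. With `le_mean` this makes `μ` comparable with `(1 - q)⁻¹` when `q` stays away from zero.
-/
theorem Wt.mean_mul_le (h : Wt k B l₀) (hq : 0 < q) (hq1 : q < 1) (hm : IsMean k q μ) :
    μ * q ^ l₀ ≤ 2 * B * (1 - q)⁻¹ := by
  rw [h.isMean_iff hq.le hq1] at hm
  have h1 := h.tsum_mul_le hq.le hq1
  have h2 := h.le_gen hq.le hq1
  have hB := h.one_le
  have hμ : 0 ≤ μ := by
    have h3 := h.le_tsum_mul hq.le hq1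
    have : 0 ≤ μ * gen k q := by rw [← hm]; exact le_trans (by positivity) h3
    exact nonneg_of_mul_nonneg_left this (h.gen_pos hq.le hq1)
  have h3 := mul_le_mul_of_nonneg_left h2 hμ
  have hd : 0 < 1 - q := by linarith
  have h4 : μ * (q ^ l₀ / 2 * (1 - q)⁻¹) ≤ B * (q / (1 - q) ^ 2) := by linarith
  have h5 : μ * q ^ l₀ ≤ 2 * B * (q / (1 - q)) := by
    have := mul_le_mul_of_nonneg_right h4 (by positivity : 0 ≤ 2 * (1 - q))
    calc _ = μ * (q ^ l₀ / 2 * (1 - q)⁻¹) * (2 * (1 - q)) := by field_simp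
      _ ≤ _ := this
      _ = _ := by field_simp
  refine h5.trans ?_
  rw [← one_div]
  gcongr

theorem Wt.le_mean (h : Wt k B l₀) (hq : 0 < q) (hq1 : q < 1) (hm : IsMean k q μ) :
    q ^ (l₀ + 1) * (1 - q)⁻¹ ≤ 2 * B * μ := by
  rw [h.isMean_iff hq.le hq1] at hm
  have h1 := h.le_tsum_mul hq.le hq1
  have h2 := h.gen_le hq.le hq1
  have hB := h.one_le
  have hd : 0 < 1 - q := by linarith
  have hμ : 0 ≤ μ := by
    have : 0 ≤ μ * gen k q := by rw [← hm]; exact le_trans (by positivity) h1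
    exact nonneg_of_mul_nonneg_left this (h.gen_pos hq.le hq1)
  have h3 := mul_le_mul_of_nonneg_left h2 hμ
  have h4 : q ^ l₀ / 2 * (q / (1 - q) ^ 2) ≤ μ * (B * (1 - q)⁻¹) := by linarith
  have := mul_le_mul_of_nonneg_right h4 (by positivity : 0 ≤ 2 * (1 - q))
  calc _ = q ^ l₀ / 2 * (q / (1 - q) ^ 2) * (2 * (1 - q)) := by rw [pow_succ]; field_simp
    _ ≤ _ := this
    _ = _ := by field_simp

theorem Wt.mean_le_mul (h : Wt k B l₀) (hq : 0 < q) (hq1 : q ≤ 1 / 2) (hm : IsMean k q μ) :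
    μ ≤ 4 * B * q := by
  have hq1' : q < 1 := by linarith
  rw [h.isMean_iff hq.le hq1'] at hm
  have h1 := h.tsum_mul_le hq.le hq1'
  have hB := h.one_le
  rcases le_or_gt μ 0 with h0 | h0
  · exact h0.trans (by positivity)
  have h2 := mul_le_mul_of_nonneg_left (h.one_le_gen hq.le hq1') h0.le
  have h3 : q / (1 - q) ^ 2 ≤ 4 * q := by
    rw [div_le_iff₀ (by nlinarith)]
    nlinarith [mul_nonneg hq.le (by nlinarith : 0 ≤ 4 * (1 - q) ^ 2 - 1)]
  calc μ ≤ B * (q / (1 - q) ^ 2) := by linarith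
    _ ≤ B * (4 * q) := by gcongr
    _ = _ := by ring

/-- Intermediate values of the unnormalized centered mean, which is `-t` at `q = 0` and positive
near `q = 1`. -/
theorem Wt.exists_mean (h : Wt k B l₀) {t : ℝ} (ht : 0 < t) :
    ∃ q, 0 < q ∧ q < 1 ∧ IsMean k q t := by
  have hB := h.one_le
  set F : ℝ → ℝ := fun q => ∑' s : ℕ, ((s : ℝ) - t) * (k s * q ^ s) with hF
  have hFe : ∀ q, 0 ≤ q → q < 1 → F q = ∑' s : ℕ, s * (k s * q ^ s) - t * gen k q := by
    intro q hq hq1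
    rw [hF, gen, ← tsum_mul_left, ← (h.summable_mul hq hq1).tsum_sub ((h.summable hq hq1).mul_left t)]
    exact tsum_congr fun s => by ring
  -- a point where `F` is positive
  obtain ⟨q₁, hq₁0, hq₁1, hq₁⟩ : ∃ q₁ : ℝ, 0 < q₁ ∧ q₁ < 1 ∧ 0 < F q₁ := by
    -- At `q = 1 - 1 / R ≥ 1 / 2` the first moment is at least `2 ^ (-(l₀ + 1)) R² / 2`, which
    -- exceeds the bound `t B R` for `t` times the mass.
    set R : ℝ := 2 ^ (l₀ + 1) * (2 * B * t) + 2 with hR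
    have hR2 : 2 ≤ R := by rw [hR]; have : 0 ≤ 2 ^ (l₀ + 1) * (2 * B * t) := by positivity
                           linarith
    have hRi : R⁻¹ ≤ 1 / 2 := by rw [one_div]; exact inv_anti₀ (by norm_num) hR2
    have hRp : 0 < R⁻¹ := by positivity
    refine ⟨1 - R⁻¹, by linarith, by linarith, ?_⟩
    have hq0 : (0 : ℝ) < 1 - R⁻¹ := by linarith
    have hq1 : 1 - R⁻¹ < 1 := by linarith
    rw [hFe _ hq0.le hq1]
    have h1 := h.le_tsum_mul hq0.le hq1
    have h2 := mul_le_mul_of_nonneg_left (h.gen_le hq0.le hq1) ht.le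
    rw [sub_sub_cancel] at h1 h2
    rw [inv_inv] at h2
    have h3 : (1 / 2 : ℝ) ^ (l₀ + 1) ≤ (1 - R⁻¹) ^ (l₀ + 1) := by gcongr; linarith
    have h4 : t * (B * R) < (1 - R⁻¹) ^ l₀ / 2 * ((1 - R⁻¹) / R⁻¹ ^ 2) := by
      have e : (1 - R⁻¹) ^ l₀ / 2 * ((1 - R⁻¹) / R⁻¹ ^ 2) = (1 - R⁻¹) ^ (l₀ + 1) / 2 * R ^ 2 := by
        rw [pow_succ _ l₀]; field_simp
      rw [e]
      calc t * (B * R) < (1 / 2 : ℝ) ^ (l₀ + 1) / 2 * R * R := by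
            rw [← mul_assoc]
            refine mul_lt_mul_of_pos_right ?_ (by linarith)
            rw [hR, mul_add]
            have : (1 / 2 : ℝ) ^ (l₀ + 1) / 2 * (2 ^ (l₀ + 1) * (2 * B * t)) = t * B := by
              rw [one_div, inv_pow]; field_simp
            rw [this]
            have : (0 : ℝ) < (1 / 2 : ℝ) ^ (l₀ + 1) / 2 * 2 := by positivity
            linarith
        _ = (1 / 2 : ℝ) ^ (l₀ + 1) / 2 * R ^ 2 := by ring
        _ ≤ _ := by gcongr
    linarith
  have hcont : ContinuousOn F (Set.Icc 0 q₁) := by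
    have hn : ‖q₁‖ < 1 := by rwa [Real.norm_of_nonneg hq₁0.le]
    refine continuousOn_tsum (u := fun s : ℕ => B * ((s : ℝ) * q₁ ^ s) + t * B * q₁ ^ s)
      (fun s => by fun_prop)
      (((hasSum_coe_mul_geometric_of_norm_lt_one hn).summable.mul_left B).add
        ((summable_geometric_of_lt_one hq₁0.le hq₁1).mul_left _)) fun s q hq => ?_
    rw [norm_mul, norm_mul, norm_pow, Real.norm_of_nonneg (h.nonneg s), Real.norm_of_nonneg hq.1]
    have h1 : ‖(s : ℝ) - t‖ ≤ s + t := by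
      refine (norm_sub_le _ _).trans ?_
      simp [abs_of_pos ht]
    calc _ ≤ (s + t) * (B * q₁ ^ s) := by
          have := h.nonneg s
          have := h.le s
          have := hq.1
          have := hq.2
          gcongr
      _ = _ := by ring
  have hF0 : F 0 < 0 := by
    have : F 0 = -t := by
      rw [hF]
      show ∑' s : ℕ, ((s : ℝ) - t) * (k s * 0 ^ s) = -t
      rw [tsum_eq_single 0 (fun s hs => by simp [hs])]
      simp [h.zero]
    linarith
  obtain ⟨q, hq, hq'⟩ := intermediate_value_Ioo hq₁0.le hcont ⟨hF0, hq₁⟩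
  refine ⟨q, hq.1, hq.2.trans hq₁1, ?_⟩
  rw [h.isMean_iff hq.1.le (hq.2.trans hq₁1)]
  rw [hFe _ hq.1.le (hq.2.trans hq₁1)] at hq'
  linarith

end

/-! ### Exponential moments of the tilted laws -/

theorem exp_le_add_sq_mul_exp (u : ℝ) : Real.exp u ≤ 1 + u + u ^ 2 * Real.exp |u| := by
  have h1 := Real.add_one_le_exp |u|
  rcases le_or_gt |u| 1 with h | h
  · have := (abs_le.1 (Real.abs_exp_sub_one_sub_id_le h)).2
    nlinarith [sq_nonneg u, abs_nonneg u]
  · rcases le_or_gt 0 u with h0 | h0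
    · rw [abs_of_nonneg h0] at h h1 ⊢
      nlinarith [Real.exp_pos u, mul_nonneg (by nlinarith : 0 ≤ u ^ 2 - 1) (Real.exp_pos u).le]
    · rw [abs_of_neg h0] at h h1 ⊢
      have h2 : Real.exp u ≤ 1 := Real.exp_le_one_iff.2 h0.le
      nlinarith [mul_le_mul_of_nonneg_left h1 (sq_nonneg u), sq_nonneg u]

/-- Integrate `exp u ≤ 1 + u + u² exp |u|`: the linear term vanishes by centering, and `1 + Q λ² ≤
exp (Q λ²)`. -/
theorem tsum_exp_le_of_sq {a : ℕ → ℝ} {μ : ℝ} (ha : ∀ s, 0 ≤ a s) (h1 : HasSum a 1)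
    (hμ : HasSum (fun s => a s * (s - μ)) 0) {lam₀ Q : ℝ}
    (hs : Summable fun s => a s * (((s : ℝ) - μ) ^ 2 * Real.exp (lam₀ * |(s : ℝ) - μ|)))
    (hQ : ∑' s, a s * (((s : ℝ) - μ) ^ 2 * Real.exp (lam₀ * |(s : ℝ) - μ|)) ≤ Q)
    {lam : ℝ} (hl : |lam| ≤ lam₀) :
    Summable (fun s => a s * Real.exp (lam * ((s : ℝ) - μ))) ∧
    ∑' s, a s * Real.exp (lam * ((s : ℝ) - μ)) ≤ Real.exp (Q * lam ^ 2) := by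
  have hR := (h1.add (hμ.mul_left lam)).add (hs.hasSum.mul_left (lam ^ 2))
  have hle : ∀ s : ℕ, a s * Real.exp (lam * ((s : ℝ) - μ)) ≤ a s + lam * (a s * (s - μ))
      + lam ^ 2 * (a s * (((s : ℝ) - μ) ^ 2 * Real.exp (lam₀ * |(s : ℝ) - μ|))) := by
    intro s
    have h2 := exp_le_add_sq_mul_exp (lam * ((s : ℝ) - μ))
    have h3 : Real.exp |lam * ((s : ℝ) - μ)| ≤ Real.exp (lam₀ * |(s : ℝ) - μ|) := by
      refine Real.exp_le_exp.2 ?_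
      rw [abs_mul]
      gcongr
    have h4 : Real.exp (lam * ((s : ℝ) - μ)) ≤ 1 + lam * ((s : ℝ) - μ)
        + (lam * ((s : ℝ) - μ)) ^ 2 * Real.exp (lam₀ * |(s : ℝ) - μ|) :=
      h2.trans (by gcongr)
    calc _ ≤ a s * (1 + lam * ((s : ℝ) - μ)
        + (lam * ((s : ℝ) - μ)) ^ 2 * Real.exp (lam₀ * |(s : ℝ) - μ|)) :=
          mul_le_mul_of_nonneg_left h4 (ha s)
      _ = _ := by ring
  have hsum : Summable (fun s => a s * Real.exp (lam * ((s : ℝ) - μ))) :=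
    Summable.of_nonneg_of_le (fun s => mul_nonneg (ha s) (Real.exp_pos _).le) hle hR.summable
  refine ⟨hsum, (hasSum_le hle hsum.hasSum hR).trans ?_⟩
  have := Real.add_one_le_exp (Q * lam ^ 2)
  have := mul_le_mul_of_nonneg_left hQ (sq_nonneg lam)
  linarith

theorem tsum_ofReal_mul_ofReal {a g : ℕ → ℝ} (ha : ∀ s, 0 ≤ a s) (hg : ∀ s, 0 ≤ g s)
    (hs : Summable fun s => a s * g s) :
    ∑' s, ENNReal.ofReal (a s) * ENNReal.ofReal (g s) = ENNReal.ofReal (∑' s, a s * g s) := by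
  rw [ENNReal.ofReal_tsum_of_nonneg (fun s => mul_nonneg (ha s) (hg s)) hs]
  exact tsum_congr fun s => (ENNReal.ofReal_mul (ha s)).symm

section

variable {k : ℕ → ℝ} {B : ℝ} {l₀ : ℕ} {q μ : ℝ}

theorem Wt.mean_nonneg (h : Wt k B l₀) (hq : 0 < q) (hq1 : q < 1) (hm : IsMean k q μ) : 0 ≤ μ := by
  have h1 := h.le_mean hq hq1 hm
  have hB := h.one_le
  have hd : 0 < 1 - q := by linarith
  have : 0 ≤ 2 * B * μ := le_trans (by positivity) h1
  exact nonneg_of_mul_nonneg_right this (by positivity)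

/-- Changing the tilt by a factor `w`. -/
theorem Wt.hasSum_law_mul_pow (h : Wt k B l₀) {w : ℝ} (hw : 0 ≤ w) (hq : 0 ≤ q) (hq1 : q * w < 1) :
    HasSum (fun s => law k q s * w ^ s) (gen k (q * w) / gen k q) := by
  have := (h.summable (mul_nonneg hq hw) hq1).hasSum.div_const (gen k q)
  refine hasSum_of_eq this fun s => ?_
  unfold law
  rw [mul_pow]
  ring

/-- Raising the tilt by `exp (2 λ)` with `λ ≤ (1 - q) / 4` at most halves the distance to `1`. -/
theorem mul_exp_quarter_le {q : ℝ} (hq : 0 ≤ q) :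
    q * Real.exp (2 * ((1 - q) / 4)) ≤ (1 + q) / 2 := by
  set x := (1 - q) / 2 with hx
  have e : 2 * ((1 - q) / 4) = x := by rw [hx]; ring
  have h1 : Real.exp x ≤ 1 / (1 - x) := by
    rw [le_div_iff₀ (by linarith)]
    have h2 := Real.add_one_le_exp (-x)
    have h3 : Real.exp x * Real.exp (-x) = 1 := by rw [← Real.exp_add]; simp
    nlinarith [Real.exp_pos x]
  rw [e]
  calc _ ≤ q * (1 / (1 - x)) := by gcongr
    _ ≤ _ := by
      rw [mul_one_div, div_le_iff₀ (by linarith), hx]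
      nlinarith [sq_nonneg (1 - q)]

/-- For `q` away from zero the steps live on the scale `(1 - q)⁻¹`. On the matching range of `λ` an
exponential moment is a change of tilt, which changes the generating function by a bounded factor
only. -/
theorem exists_mgf_large (B : ℝ) (l₀ : ℕ) {q₀ : ℝ} (hq₀ : 0 < q₀) :
    ∃ C ≥ (0 : ℝ), ∀ k q μ, Wt k B l₀ → q₀ ≤ q → q < 1 → IsMean k q μ →
      ∀ lam, |lam| ≤ (1 - q) / 4 →
      Summable (fun s => law k q s * Real.exp (lam * ((s : ℝ) - μ))) ∧
      ∑' s, law k q s * Real.exp (lam * ((s : ℝ) - μ)) ≤ Real.exp (C * ((1 - q)⁻¹) ^ 2 * lam ^ 2) := by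
  rcases lt_or_ge B 1 with hB | hB
  · exact ⟨0, le_rfl, fun k q μ h => absurd h.one_le (by linarith)⟩
  refine ⟨32 * Real.exp (B / q₀ ^ l₀) * (4 * B / q₀ ^ l₀), by positivity, ?_⟩
  intro k q μ h hq hq1 hm lam hl
  have hq0 : 0 < q := hq₀.trans_le hq
  have hd : 0 < 1 - q := by linarith
  set lam₁ := (1 - q) / 4 with hlam₁
  have hlam₁0 : 0 < lam₁ := by positivity
  have hμ0 := h.mean_nonneg hq0 hq1 hm
  have hqq : q₀ ^ l₀ ≤ q ^ l₀ := by gcongr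
  set w := Real.exp (2 * lam₁) with hw
  have hw0 : 0 < w := Real.exp_pos _
  have hqw : q * w ≤ (1 + q) / 2 := mul_exp_quarter_le hq0.le
  have hqw1 : q * w < 1 := by linarith
  have hsum := h.hasSum_law_mul_pow hw0.le hq0.le hqw1
  have hratio : gen k (q * w) / gen k q ≤ 4 * B / q₀ ^ l₀ := by
    have h1 := h.gen_le (by positivity) hqw1
    have h2 : (1 - q * w)⁻¹ ≤ 2 * (1 - q)⁻¹ := by
      rw [← one_div, ← div_eq_mul_inv, div_le_div_iff₀ (by linarith) hd]
      linarith
    have h3 := h.le_gen hq0.le hq1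
    rw [div_le_div_iff₀ (h.gen_pos hq0.le hq1) (by positivity)]
    have h4 : gen k (q * w) ≤ B * (2 * (1 - q)⁻¹) := h1.trans (by gcongr)
    have h5 : q₀ ^ l₀ / 2 * (1 - q)⁻¹ ≤ gen k q := le_trans (by gcongr) h3
    calc _ ≤ B * (2 * (1 - q)⁻¹) * q₀ ^ l₀ := by gcongr
      _ = 4 * B * (q₀ ^ l₀ / 2 * (1 - q)⁻¹) := by ring
      _ ≤ _ := by gcongr
  have hμe : Real.exp (2 * lam₁ * μ) ≤ Real.exp (B / q₀ ^ l₀) := by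
    refine Real.exp_le_exp.2 ?_
    have h1 := h.mean_mul_le hq0 hq1 hm
    rw [le_div_iff₀ (by positivity), hlam₁]
    have h2 : μ * q₀ ^ l₀ ≤ 2 * B * (1 - q)⁻¹ := le_trans (by gcongr) h1
    have h3 := mul_le_mul_of_nonneg_left h2 (by positivity : 0 ≤ (1 - q) / 2)
    have h4 : (1 - q) / 2 * (2 * B * (1 - q)⁻¹) = B := by field_simp
    linarith
  set K := 2 / lam₁ ^ 2 * Real.exp (2 * lam₁ * μ) with hK
  have hle : ∀ s : ℕ, law k q s * (((s : ℝ) - μ) ^ 2 * Real.exp (lam₁ * |(s : ℝ) - μ|))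
      ≤ K * (law k q s * w ^ s) := by
    intro s
    have hx : 0 ≤ lam₁ * |(s : ℝ) - μ| := by positivity
    have h1 : (lam₁ * |(s : ℝ) - μ|) ^ 2 ≤ 2 * Real.exp (lam₁ * |(s : ℝ) - μ|) := by
      have := Real.quadratic_le_exp_of_nonneg hx
      linarith
    have h2 : ((s : ℝ) - μ) ^ 2 ≤ 2 / lam₁ ^ 2 * Real.exp (lam₁ * |(s : ℝ) - μ|) := by
      rw [div_mul_eq_mul_div, le_div_iff₀ (by positivity)]
      rw [mul_pow, sq_abs] at h1
      linarith
    have h3 : Real.exp (lam₁ * |(s : ℝ) - μ|) * Real.exp (lam₁ * |(s : ℝ) - μ|)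
        ≤ Real.exp (2 * lam₁ * μ) * w ^ s := by
      rw [← Real.exp_add, hw, ← Real.exp_nat_mul, ← Real.exp_add]
      refine Real.exp_le_exp.2 ?_
      have : |(s : ℝ) - μ| ≤ s + μ := by
        rw [abs_le]; constructor <;> linarith [(Nat.cast_nonneg s : (0:ℝ) ≤ s)]
      nlinarith
    calc _ ≤ law k q s * (2 / lam₁ ^ 2 * Real.exp (lam₁ * |(s : ℝ) - μ|)
          * Real.exp (lam₁ * |(s : ℝ) - μ|)) := by
          have := h.law_nonneg hq0.le hq1 s
          gcongr
      _ ≤ law k q s * (2 / lam₁ ^ 2 * (Real.exp (2 * lam₁ * μ) * w ^ s)) := by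
          have := h.law_nonneg hq0.le hq1 s
          rw [mul_assoc (2 / lam₁ ^ 2)]
          gcongr
      _ = _ := by rw [hK]; ring
  have hS : Summable fun s => law k q s * (((s : ℝ) - μ) ^ 2 * Real.exp (lam₁ * |(s : ℝ) - μ|)) :=
    Summable.of_nonneg_of_le (fun s => mul_nonneg (h.law_nonneg hq0.le hq1 s) (by positivity)) hle
      (hsum.summable.mul_left K)
  refine tsum_exp_le_of_sq (h.law_nonneg hq0.le hq1) (h.hasSum_law hq0.le hq1) hm hS ?_ hl
  refine (hasSum_le hle hS.hasSum (hsum.mul_left K)).trans ?_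
  calc _ ≤ 2 / lam₁ ^ 2 * Real.exp (B / q₀ ^ l₀) * (4 * B / q₀ ^ l₀) := by
        rw [hK]
        have := h.gen_pos (by positivity) hqw1
        have := h.gen_pos hq0.le hq1
        gcongr
    _ = _ := by rw [hlam₁]; field_simp; ring

/-- Doubling the tilt multiplies the terms below `l₀` by at most `2 ^ l₀`. The rest is `O(q ^ l₀)`,
and the term at `l₀` is at least `q ^ l₀ / 2`. -/
theorem Wt.tsum_mul_two_le (h : Wt k B l₀) (hq : 0 < q) (hq1 : q ≤ 1 / 4) :
    ∑' s : ℕ, s * (k s * (q * 2) ^ s)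
      ≤ 2 ^ l₀ * (1 + 2 * B * (2 + 2 * l₀)) * ∑' s : ℕ, s * (k s * q ^ s) := by
  have hq1' : q < 1 := by linarith
  have hn : ‖q * 2‖ < 1 := by rw [Real.norm_of_nonneg (by positivity)]; linarith
  have hB := h.one_le
  have hS := h.summable_mul hq.le hq1'
  have hS2 := h.summable_mul (q := q * 2) (by positivity) (by linarith)
  set T := ∑' s : ℕ, s * (k s * q ^ s) with hT
  rw [← hS2.sum_add_tsum_nat_add l₀]
  have h1 : ∑ s ∈ Finset.range l₀, (s : ℝ) * (k s * (q * 2) ^ s) ≤ 2 ^ l₀ * T := by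
    calc _ ≤ ∑ s ∈ Finset.range l₀, 2 ^ l₀ * ((s : ℝ) * (k s * q ^ s)) := by
          refine Finset.sum_le_sum fun s hs => ?_
          have h2 : (2 : ℝ) ^ s ≤ 2 ^ l₀ :=
            pow_le_pow_right₀ (by norm_num) (Finset.mem_range.1 hs).le
          have h3 : 0 ≤ (s : ℝ) * (k s * q ^ s) :=
            mul_nonneg (by positivity) (mul_nonneg (h.nonneg s) (by positivity))
          rw [mul_pow]
          nlinarith [mul_le_mul_of_nonneg_right h2 h3]
      _ ≤ _ := by
          rw [← Finset.mul_sum]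
          refine mul_le_mul_of_nonneg_left (hS.sum_le_tsum _ fun s _ => ?_) (by positivity)
          exact mul_nonneg (by positivity) (mul_nonneg (h.nonneg s) (by positivity))
  have h2 : q ^ l₀ ≤ 2 * T := by
    have h3 := hS.le_tsum l₀ fun s _ =>
      mul_nonneg (by positivity) (mul_nonneg (h.nonneg s) (by positivity))
    have h4 := h.half l₀ le_rfl
    have h5 : (1 : ℝ) ≤ l₀ := by exact_mod_cast h.pos
    have h6 : 1 * (1 / 2 * q ^ l₀) ≤ (l₀ : ℝ) * (k l₀ * q ^ l₀) := by gcongr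
    linarith
  have hT0 : 0 ≤ T := by have := pow_pos hq l₀; linarith
  have h3 : ∑' s : ℕ, ((s + l₀ : ℕ) : ℝ) * (k (s + l₀) * (q * 2) ^ (s + l₀))
      ≤ B * (q * 2) ^ l₀ * (2 + 2 * l₀) := by
    have hg1 := hasSum_coe_mul_geometric_of_norm_lt_one (r := (1 / 2 : ℝ)) (by norm_num)
    have hg2 := (hasSum_geometric_of_lt_one (r := (1 / 2 : ℝ)) (by norm_num) (by norm_num)).mul_left
      (l₀ : ℝ)
    have hg := (hg1.add hg2).mul_left (B * (q * 2) ^ l₀)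
    refine (hasSum_le (fun s => ?_) ((summable_nat_add_iff l₀).2 hS2).hasSum hg).trans (le_of_eq ?_)
    · have h4 : (q * 2) ^ s ≤ (1 / 2 : ℝ) ^ s := by gcongr; linarith
      have h5 := h.le (s + l₀)
      calc _ ≤ ((s + l₀ : ℕ) : ℝ) * (B * ((1 / 2 : ℝ) ^ s * (q * 2) ^ l₀)) := by
            rw [pow_add]
            gcongr
        _ = _ := by push_cast; ring
    · have e1 : (1 / 2 : ℝ) / (1 - 1 / 2) ^ 2 = 2 := by norm_num
      have e2 : (1 - 1 / 2 : ℝ)⁻¹ = 2 := by norm_num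
      rw [e1, e2]
      ring
  have h4 : B * (q * 2) ^ l₀ * (2 + 2 * l₀) ≤ 2 ^ l₀ * (2 * B * (2 + 2 * l₀)) * T := by
    rw [mul_pow]
    have := mul_le_mul_of_nonneg_left h2 (by positivity : 0 ≤ B * 2 ^ l₀ * (2 + 2 * l₀))
    linarith
  have h5 := add_le_add h1 (h3.trans h4)
  linarith

/-- For small `q` the step is mostly zero and its variance is of the order of its mean, as for a
Poisson variable. The factor `μ` in the exponent lets `n` steps fluctuate only by `√(n μ)`. -/
theorem exists_mgf_small (B : ℝ) (l₀ : ℕ) :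
    ∃ C ≥ (0 : ℝ), ∀ k q μ, Wt k B l₀ → 0 < q → q ≤ 1 / 4 → IsMean k q μ →
      ∀ lam, |lam| ≤ 1 / 4 →
      Summable (fun s => law k q s * Real.exp (lam * ((s : ℝ) - μ))) ∧
      ∑' s, law k q s * Real.exp (lam * ((s : ℝ) - μ)) ≤ Real.exp (C * μ * lam ^ 2) := by
  rcases lt_or_ge B 1 with hB | hB
  · exact ⟨0, le_rfl, fun k q μ h => absurd h.one_le (by linarith)⟩
  refine ⟨Real.exp (B / 4) * (8 * (2 ^ l₀ * (1 + 2 * B * (2 + 2 * l₀))) + 2 * B * (2 * B)),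
    by positivity, ?_⟩
  intro k q μ h hq0 hq hm lam hl
  have hq1 : q < 1 := by linarith
  have hμ0 := h.mean_nonneg hq0 hq1 hm
  have hμB : μ ≤ B := by
    have := h.mean_le_mul hq0 (by linarith) hm
    nlinarith
  have hg0 := h.gen_pos hq0.le hq1
  have hsum := h.hasSum_law_mul_pow (w := 2) (by norm_num) hq0.le (by linarith : q * 2 < 1)
  have hsum2 : HasSum (fun s : ℕ => law k q s * (s * 2 ^ s))
      ((∑' s : ℕ, s * (k s * (q * 2) ^ s)) / gen k q) := by
    have := (h.summable_mul (q := q * 2) (by positivity) (by linarith)).hasSum.div_const (gen k q)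
    refine hasSum_of_eq this fun s => ?_
    unfold law
    rw [mul_pow]
    ring
  have hr1 : gen k (q * 2) / gen k q ≤ 2 * B := by
    have h1 := h.gen_le (q := q * 2) (by positivity) (by linarith)
    have h2 : (1 - q * 2)⁻¹ ≤ 2 := by
      rw [inv_le_comm₀ (by linarith) (by norm_num)]
      linarith
    have h3 := h.one_le_gen hq0.le hq1
    have h0 := h.gen_pos (q := q * 2) (by positivity) (by linarith)
    calc _ ≤ gen k (q * 2) := div_le_self h0.le h3
      _ ≤ B * 2 := h1.trans (by gcongr)
      _ = _ := by ring
  have hr2 : (∑' s : ℕ, s * (k s * (q * 2) ^ s)) / gen k q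
      ≤ 2 ^ l₀ * (1 + 2 * B * (2 + 2 * l₀)) * μ := by
    rw [div_le_iff₀ hg0]
    refine (h.tsum_mul_two_le hq0 hq).trans (le_of_eq ?_)
    rw [(h.isMean_iff hq0.le hq1).1 hm]
    ring
  have hR := ((hsum2.mul_left 8).add (hsum.mul_left (2 * μ * B))).mul_left (Real.exp (B / 4))
  have hle : ∀ s : ℕ, law k q s * (((s : ℝ) - μ) ^ 2 * Real.exp (1 / 4 * |(s : ℝ) - μ|))
      ≤ Real.exp (B / 4) * (8 * (law k q s * (s * 2 ^ s)) + 2 * μ * B * (law k q s * 2 ^ s)) := by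
    intro s
    have hs0 : (0 : ℝ) ≤ s := Nat.cast_nonneg s
    have h1 : Real.exp (1 / 4 * |(s : ℝ) - μ|) ≤ Real.exp (B / 4) * Real.exp ((s : ℝ) / 4) := by
      rw [← Real.exp_add]
      refine Real.exp_le_exp.2 ?_
      have : |(s : ℝ) - μ| ≤ s + μ := by rw [abs_le]; constructor <;> linarith
      linarith
    have h2 : (s : ℝ) ≤ 4 * Real.exp ((s : ℝ) / 4) := by
      have := Real.add_one_le_exp ((s : ℝ) / 4)
      linarith
    have h3 : Real.exp ((s : ℝ) / 4) * Real.exp ((s : ℝ) / 4) ≤ 2 ^ s := by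
      have h4 : Real.exp (1 / 2 : ℝ) ≤ 2 := by
        have h5 : Real.exp (1 / 2 : ℝ) ^ 2 = Real.exp 1 := by rw [← Real.exp_nat_mul]; norm_num
        have h6 := Real.exp_one_lt_d9
        nlinarith [Real.exp_pos (1 / 2 : ℝ)]
      calc _ = Real.exp (1 / 2 : ℝ) ^ s := by
            rw [← Real.exp_add, ← Real.exp_nat_mul]; ring_nf
        _ ≤ _ := by gcongr
    have h4 : Real.exp ((s : ℝ) / 4) ≤ 2 ^ s := by
      refine le_trans ?_ h3
      have : 1 ≤ Real.exp ((s : ℝ) / 4) := Real.one_le_exp (by positivity)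
      nlinarith
    have h5 : ((s : ℝ) - μ) ^ 2 * Real.exp ((s : ℝ) / 4) ≤ 8 * (s * 2 ^ s) + 2 * μ * B * 2 ^ s := by
      have h6 : ((s : ℝ) - μ) ^ 2 ≤ 2 * (s * s) + 2 * (μ * μ) := by nlinarith [sq_nonneg ((s : ℝ) + μ)]
      have h7 : (s : ℝ) * Real.exp ((s : ℝ) / 4) ≤ 4 * 2 ^ s := by
        calc _ ≤ 4 * Real.exp ((s : ℝ) / 4) * Real.exp ((s : ℝ) / 4) := by gcongr
          _ ≤ _ := by linarith
      calc _ ≤ (2 * (s * s) + 2 * (μ * μ)) * Real.exp ((s : ℝ) / 4) := by gcongr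
        _ = 2 * s * (s * Real.exp ((s : ℝ) / 4)) + 2 * μ * μ * Real.exp ((s : ℝ) / 4) := by ring
        _ ≤ 2 * s * (4 * 2 ^ s) + 2 * μ * B * 2 ^ s := by gcongr
        _ = _ := by ring
    calc _ ≤ law k q s * (((s : ℝ) - μ) ^ 2 * (Real.exp (B / 4) * Real.exp ((s : ℝ) / 4))) := by
          have := h.law_nonneg hq0.le hq1 s
          gcongr
      _ = Real.exp (B / 4) * (law k q s * (((s : ℝ) - μ) ^ 2 * Real.exp ((s : ℝ) / 4))) := by ring
      _ ≤ Real.exp (B / 4) * (law k q s * (8 * (s * 2 ^ s) + 2 * μ * B * 2 ^ s)) := by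
          have := h.law_nonneg hq0.le hq1 s
          gcongr
      _ = _ := by ring
  have hS : Summable fun s => law k q s * (((s : ℝ) - μ) ^ 2 * Real.exp (1 / 4 * |(s : ℝ) - μ|)) :=
    Summable.of_nonneg_of_le (fun s => mul_nonneg (h.law_nonneg hq0.le hq1 s) (by positivity)) hle
      hR.summable
  refine tsum_exp_le_of_sq (h.law_nonneg hq0.le hq1) (h.hasSum_law hq0.le hq1) hm hS ?_ hl
  refine (hasSum_le hle hS.hasSum hR).trans ?_
  calc _ ≤ Real.exp (B / 4) * (8 * (2 ^ l₀ * (1 + 2 * B * (2 + 2 * l₀)) * μ) + 2 * μ * B * (2 * B)) := by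
        gcongr
    _ = _ := by ring

end

/-! ### The tilted laws satisfy the uniform estimates when the tilt stays in a compact set -/

/-- The increments `s - 1` of the walk. -/
def stp (s : ℕ) : ℤ := s - 1

/-- The tilted law with values in `ℝ≥0∞`. -/
noncomputable def elaw (k : ℕ → ℝ) (q : ℝ) (s : ℕ) : ℝ≥0∞ := ENNReal.ofReal (law k q s)

theorem stp_mono : Monotone stp := fun a b h => by unfold stp; omega

theorem cen_stp (μ : ℝ) (s : ℕ) : cen stp (μ - 1) s = s - μ := by
  simp [cen, stp]

theorem hsum_stp (l : List ℕ) : hsum stp l = hsum (fun s => (s : ℤ)) l - l.length := by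
  induction l with
  | nil => simp
  | cons s l ih => rw [hsum_cons, hsum_cons, ih]; simp only [stp, List.length_cons]; push_cast; ring

section

variable {k : ℕ → ℝ} {B : ℝ} {l₀ : ℕ} {q μ : ℝ}

theorem Wt.tsum_elaw (h : Wt k B l₀) (hq : 0 ≤ q) (hq1 : q < 1) : ∑' s, elaw k q s = 1 := by
  unfold elaw
  rw [← ENNReal.ofReal_tsum_of_nonneg (h.law_nonneg hq hq1) (h.hasSum_law hq hq1).summable,
    (h.hasSum_law hq hq1).tsum_eq, ENNReal.ofReal_one]

/-- From `l₀` on the weights lie between `1 / 2` and `B`, so the tail is almost geometric. The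
series with ratio `q * exp lam` is compared with the single atom at `⌈u⌉ + l₀`. -/
theorem Wt.overshoot_le (h : Wt k B l₀) (hq : 0 < q) (hq1 : q < 1) {lam : ℝ} (hl : 0 ≤ lam)
    (hl' : lam ≤ (1 - q) / 4) {u : ℝ} (hu : 0 ≤ u) :
    ∑' s, elaw k q s * (one (u ≤ s) * ENNReal.ofReal (Real.exp (lam * (s - u))))
      ≤ ENNReal.ofReal (4 * Real.exp 1 * B * (1 - q)⁻¹ / q ^ l₀) * ∑' s, elaw k q s * one (u ≤ s) := by
  have hB := h.one_le
  have hd : 0 < 1 - q := by linarith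
  have hg := h.gen_pos hq.le hq1
  set v := ⌈u⌉₊ with hv
  have huv : u ≤ v := Nat.le_ceil u
  have hvu : (v : ℝ) < u + 1 := Nat.ceil_lt_add_one hu
  set r := q * Real.exp lam with hr
  have hr0 : 0 ≤ r := by positivity
  have hr1 : r ≤ (1 + q) / 2 := by
    refine le_trans ?_ (mul_exp_quarter_le hq.le)
    rw [hr]
    gcongr
    linarith
  have hr1' : r < 1 := by linarith
  set K := Real.exp 1 * (B * q ^ v / gen k q) with hK
  have hK0 : 0 ≤ K := by positivity
  have hlhs : ∑' s, elaw k q s * (one (u ≤ s) * ENNReal.ofReal (Real.exp (lam * (s - u))))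
      ≤ ENNReal.ofReal (K * (1 - r)⁻¹) := by
    rw [← ENNReal.summable.sum_add_tsum_nat_add' (k := v)]
    have h0 : ∑ s ∈ Finset.range v,
        elaw k q s * (one (u ≤ s) * ENNReal.ofReal (Real.exp (lam * (s - u)))) = 0 := by
      refine Finset.sum_eq_zero fun s hs => ?_
      have : ¬ u ≤ s := by
        rw [not_le]
        exact Nat.lt_ceil.1 (Finset.mem_range.1 hs)
      rw [one_false this]
      simp
    rw [h0, zero_add, ← tsum_geometric_of_lt_one hr0 hr1', ← tsum_mul_left,
      ENNReal.ofReal_tsum_of_nonneg (fun s => by positivity)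
        ((summable_geometric_of_lt_one hr0 hr1').mul_left K)]
    refine ENNReal.tsum_le_tsum fun s => ?_
    calc _ ≤ elaw k q (s + v) * (1 * ENNReal.ofReal (Real.exp (lam * (((s + v : ℕ) : ℝ) - u)))) :=
          mul_le_mul' le_rfl (mul_le_mul' (WalkBridge.one_le _) le_rfl)
      _ = ENNReal.ofReal (law k q (s + v) * Real.exp (lam * (((s + v : ℕ) : ℝ) - u))) := by
          rw [one_mul, elaw, ENNReal.ofReal_mul (h.law_nonneg hq.le hq1 _)]
      _ ≤ _ := by
          refine ENNReal.ofReal_le_ofReal ?_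
          have h1 := h.law_le hq.le hq1 (s + v)
          have h2 : Real.exp (lam * (((s + v : ℕ) : ℝ) - u)) ≤ Real.exp 1 * Real.exp lam ^ s := by
            rw [← Real.exp_nat_mul, ← Real.exp_add]
            refine Real.exp_le_exp.2 ?_
            push_cast
            nlinarith
          calc _ ≤ B * q ^ (s + v) / gen k q * (Real.exp 1 * Real.exp lam ^ s) := by
                have := h.law_nonneg hq.le hq1 (s + v)
                gcongr
            _ = _ := by rw [hK, hr, mul_pow, pow_add]; ring
  have hrhs : ENNReal.ofReal (1 / 2 * q ^ (v + l₀) / gen k q) ≤ ∑' s, elaw k q s * one (u ≤ s) := by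
    refine le_trans ?_ (ENNReal.le_tsum (v + l₀))
    rw [one_true (by push_cast; linarith [(Nat.cast_nonneg l₀ : (0:ℝ) ≤ l₀)]), mul_one]
    exact ENNReal.ofReal_le_ofReal (h.le_law hq.le hq1 (by omega))
  refine hlhs.trans (le_trans ?_ (mul_le_mul' le_rfl hrhs))
  rw [← ENNReal.ofReal_mul (by positivity)]
  refine ENNReal.ofReal_le_ofReal ?_
  have h2 : (1 - r)⁻¹ ≤ 2 * (1 - q)⁻¹ := by
    rw [← one_div, ← div_eq_mul_inv, div_le_div_iff₀ (by linarith) hd]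
    linarith
  calc K * (1 - r)⁻¹ ≤ K * (2 * (1 - q)⁻¹) := by gcongr
    _ = _ := by rw [hK, pow_add]; field_simp; ring

theorem cube_le_exp_add_exp {lam : ℝ} (hl : 0 < lam) (u : ℝ) :
    |u| ^ 3 ≤ 6 / lam ^ 3 * (Real.exp (lam * u) + Real.exp (-lam * u)) := by
  have h1 : (lam * |u|) ^ 3 ≤ 6 * Real.exp (lam * |u|) := by
    have := Real.pow_div_factorial_le_exp (lam * |u|) (by positivity) 3
    rw [div_le_iff₀ (by positivity)] at this
    norm_num [Nat.factorial] at this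
    linarith
  have h2 : Real.exp (lam * |u|) ≤ Real.exp (lam * u) + Real.exp (-lam * u) := by
    rcases abs_cases u with ⟨h, _⟩ | ⟨h, _⟩ <;> rw [h]
    · linarith [Real.exp_pos (-lam * u)]
    · rw [mul_neg, ← neg_mul]; linarith [Real.exp_pos (lam * u)]
  rw [div_mul_eq_mul_div, le_div_iff₀ (by positivity)]
  rw [mul_pow] at h1
  linarith

end

/-- Uniformity over `q₀ ≤ q ≤ q₁`: the range of `λ`, the variance factor, the third moment and the
atoms at `l₀` and `l₀ + 1` are controlled by `B`, `l₀`, `q₀` and `q₁`. -/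
theorem exists_good (B : ℝ) (l₀ : ℕ) {q₀ q₁ : ℝ} (hq₀ : 0 < q₀) (hq₁ : q₁ < 1) :
    ∃ lam0 > (0 : ℝ), ∃ C ≥ (0 : ℝ), ∃ Co ≥ (1 : ℝ), ∃ CU ≥ (0 : ℝ), ∃ cL : ℝ → ℝ,
      (∀ A, 0 < cL A) ∧ ∃ nL : ℝ → ℕ, ∀ k q μ, Wt k B l₀ → q₀ ≤ q → q ≤ q₁ → IsMean k q μ →
      Good (elaw k q) stp (μ - 1) lam0 C Co CU ∧ Good (elaw k q) (-stp) (-(μ - 1)) lam0 C Co CU ∧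
      ∀ A, Low (elaw k q) stp (μ - 1) A (cL A) (nL A) := by
  obtain ⟨C₁, hC₁, hmgf⟩ := exists_mgf_large B l₀ hq₀
  set lam0 := (1 - q₁) / 4 with hlam0
  have hd₁ : 0 < 1 - q₁ := by linarith
  have hl0 : 0 < lam0 := by positivity
  set C := C₁ * ((1 - q₁)⁻¹) ^ 2 with hC
  have hC0 : 0 ≤ C := by positivity
  set c := 1 / 2 * q₀ ^ (l₀ + 1) / (|B| * (1 - q₁)⁻¹ + 1) with hc
  have hc0 : 0 < c := by positivity
  set M := 6 / lam0 ^ 3 * (2 * Real.exp (C * lam0 ^ 2)) with hM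
  obtain ⟨CU, hCU, cL, hcL, nL, hLL⟩ := exists_local_limit (M := M) hc0
  set Co := 1 + 4 * Real.exp 1 * |B| * (1 - q₁)⁻¹ / q₀ ^ l₀
    + Real.exp (lam0 * (2 * |B| * (1 - q₁)⁻¹ / q₀ ^ l₀)) with hCo
  have hp1 : 0 ≤ 4 * Real.exp 1 * |B| * (1 - q₁)⁻¹ / q₀ ^ l₀ := by positivity
  have hp2 := Real.exp_pos (lam0 * (2 * |B| * (1 - q₁)⁻¹ / q₀ ^ l₀))
  refine ⟨lam0, hl0, C, hC0, Co, by rw [hCo]; linarith, CU, hCU, cL, hcL, nL, ?_⟩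
  intro k q μ h hq hq' hm
  have hB := h.one_le
  have hq0 : 0 < q := hq₀.trans_le hq
  have hq1 : q < 1 := hq'.trans_lt hq₁
  have hd : 0 < 1 - q := by linarith
  have hq₁0 : 0 < q₁ := hq0.trans_le hq'
  have hBa : |B| = B := abs_of_pos (by linarith)
  rw [hBa] at hp1 hp2
  have hinv : (1 - q)⁻¹ ≤ (1 - q₁)⁻¹ := inv_anti₀ hd₁ (by linarith)
  have hμ0 := h.mean_nonneg hq0 hq1 hm
  have hlaw0 := h.law_nonneg hq0.le hq1
  have hmgf' : ∀ lam, |lam| ≤ lam0 →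
      Summable (fun s => law k q s * Real.exp (lam * ((s : ℝ) - μ))) ∧
      ∑' s, law k q s * Real.exp (lam * ((s : ℝ) - μ)) ≤ Real.exp (C * lam ^ 2) := by
    intro lam hl
    obtain ⟨h1, h2⟩ := hmgf k q μ h hq hq1 hm lam (hl.trans (by rw [hlam0]; linarith))
    refine ⟨h1, h2.trans (Real.exp_le_exp.2 ?_)⟩
    rw [hC]
    gcongr
  have hE : ∀ lam, |lam| ≤ lam0 →
      ∑' s, elaw k q s * ENNReal.ofReal (Real.exp (lam * ((s : ℝ) - μ)))
        ≤ ENNReal.ofReal (Real.exp (C * lam ^ 2)) := by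
    intro lam hl
    obtain ⟨h1, h2⟩ := hmgf' lam hl
    unfold elaw
    rw [tsum_ofReal_mul_ofReal hlaw0 (fun s => (Real.exp_pos _).le) h1]
    exact ENNReal.ofReal_le_ofReal h2
  -- the third moment
  obtain ⟨hs1, ht1⟩ := hmgf' lam0 (abs_of_pos hl0).le
  obtain ⟨hs2, ht2⟩ := hmgf' (-lam0) (by rw [abs_neg, abs_of_pos hl0])
  have hR := (hs1.hasSum.add hs2.hasSum).mul_left (6 / lam0 ^ 3)
  have hle3 : ∀ s : ℕ, law k q s * |(s : ℝ) - μ| ^ 3 ≤ 6 / lam0 ^ 3 *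
      (law k q s * Real.exp (lam0 * ((s : ℝ) - μ)) + law k q s * Real.exp (-lam0 * ((s : ℝ) - μ))) := by
    intro s
    have := mul_le_mul_of_nonneg_left (cube_le_exp_add_exp hl0 ((s : ℝ) - μ)) (hlaw0 s)
    linarith
  have hS3 : Summable fun s : ℕ => law k q s * |(s : ℝ) - μ| ^ 3 :=
    Summable.of_nonneg_of_le (fun s => mul_nonneg (hlaw0 s) (by positivity)) hle3 hR.summable
  have hS2 : Summable fun s : ℕ => law k q s * ((s : ℝ) - μ) ^ 2 := by
    refine Summable.of_nonneg_of_le (fun s => mul_nonneg (hlaw0 s) (sq_nonneg _)) (fun s => ?_)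
      ((h.hasSum_law hq0.le hq1).summable.add hS3)
    have : ((s : ℝ) - μ) ^ 2 ≤ 1 + |(s : ℝ) - μ| ^ 3 := by
      rw [← sq_abs]
      have h0 := abs_nonneg ((s : ℝ) - μ)
      nlinarith [mul_nonneg h0 (sq_nonneg (|(s : ℝ) - μ| - 1)), sq_nonneg (|(s : ℝ) - μ| - 1)]
    have := mul_le_mul_of_nonneg_left this (hlaw0 s)
    linarith
  have hm3 : ∑' s : ℕ, law k q s * |(s : ℝ) - μ| ^ 3 ≤ M := by
    refine (hasSum_le hle3 hS3.hasSum hR).trans ?_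
    rw [neg_sq] at ht2
    rw [hM, two_mul]
    gcongr
  have hgc : gen k q ≤ |B| * (1 - q₁)⁻¹ + 1 := by
    have := h.gen_le hq0.le hq1
    rw [hBa]
    have : B * (1 - q)⁻¹ ≤ B * (1 - q₁)⁻¹ := by gcongr
    linarith
  have hcl : ∀ s, l₀ ≤ s → s ≤ l₀ + 1 → c ≤ law k q s := by
    intro s hs hs'
    refine le_trans ?_ (h.le_law hq0.le hq1 hs)
    have hg := h.gen_pos hq0.le hq1
    have h1 : q₀ ^ (l₀ + 1) ≤ q ^ s := by
      calc q₀ ^ (l₀ + 1) ≤ q ^ (l₀ + 1) := by gcongr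
        _ ≤ q ^ s := pow_le_pow_of_le_one hq0.le hq1.le hs'
    rw [hc]
    gcongr
  obtain ⟨hconc, hlow⟩ := hLL (law k q) μ _ _ l₀ hlaw0 (h.hasSum_law hq0.le hq1) hm hS2.hasSum
    hS3.hasSum hm3 (hcl _ le_rfl (by omega)) (hcl _ (by omega) le_rfl)
  have hEx : ∀ (n : ℕ) (d : ℤ), Ex (elaw k q) n (fun l => one (hsum stp l = d))
      = Ex (fun s => ENNReal.ofReal (law k q s)) n
        (fun l => one (hsum (fun s => (s : ℤ)) l = d + n)) := by
    intro n d
    refine Ex_congr _ fun l hl => one_congr ?_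
    rw [hsum_stp, hl]
    constructor <;> intro <;> linarith
  have hcenN : ∀ s, cen (-stp) (-(μ - 1)) s = -((s : ℝ) - μ) := fun s => by
    rw [cen_neg, ← cen_stp]
  refine ⟨⟨h.tsum_elaw hq0.le hq1, ?_, ?_, ?_⟩, ⟨h.tsum_elaw hq0.le hq1, ?_, ?_, ?_⟩, ?_⟩
  · intro lam hl
    simp only [cen_stp]
    exact hE lam hl
  · intro t ht
    simp only [cen_stp]
    have e1 : ∀ s : ℕ, (t ≤ (s : ℝ) - μ) = (μ + t ≤ s) := fun s => by
      rw [eq_iff_iff]; constructor <;> intro <;> linarith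
    have e2 : ∀ s : ℕ, lam0 * ((s : ℝ) - μ - t) = lam0 * (s - (μ + t)) := fun s => by ring
    simp only [e1, e2]
    refine (h.overshoot_le hq0 hq1 hl0.le (by rw [hlam0]; linarith)
      (by linarith : 0 ≤ μ + t)).trans (mul_le_mul' (ENNReal.ofReal_le_ofReal ?_) le_rfl)
    have : 4 * Real.exp 1 * B * (1 - q)⁻¹ / q ^ l₀ ≤ 4 * Real.exp 1 * B * (1 - q₁)⁻¹ / q₀ ^ l₀ := by
      gcongr
    rw [hCo, hBa]
    linarith
  · intro n hn d
    rw [hEx]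
    exact hconc n hn _
  · intro lam hl
    simp only [hcenN, mul_neg, ← neg_mul]
    have := hE (-lam) (by rwa [abs_neg])
    rwa [neg_sq] at this
  -- For the reversed step `-(s - μ)` the overshoot is at most `μ`, as `s ≥ 0`.
  · intro t ht
    simp only [hcenN]
    rw [← ENNReal.tsum_mul_left]
    refine ENNReal.tsum_le_tsum fun s => ?_
    have h1 : Real.exp (lam0 * (-((s : ℝ) - μ) - t)) ≤ Co := by
      have h2 : lam0 * (-((s : ℝ) - μ) - t) ≤ lam0 * (2 * B * (1 - q₁)⁻¹ / q₀ ^ l₀) := by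
        refine mul_le_mul_of_nonneg_left ?_ hl0.le
        have h3 := h.mean_mul_le hq0 hq1 hm
        have h4 : μ ≤ 2 * B * (1 - q₁)⁻¹ / q₀ ^ l₀ := by
          rw [le_div_iff₀ (by positivity)]
          calc μ * q₀ ^ l₀ ≤ μ * q ^ l₀ := by gcongr
            _ ≤ _ := h3.trans (by gcongr)
        linarith [(Nat.cast_nonneg s : (0:ℝ) ≤ s)]
      have := Real.exp_le_exp.2 h2
      rw [hCo, hBa]
      linarith
    calc _ ≤ elaw k q s * (one (t ≤ -((s : ℝ) - μ)) * ENNReal.ofReal Co) :=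
          mul_le_mul' le_rfl (mul_le_mul' le_rfl (ENNReal.ofReal_le_ofReal h1))
      _ = _ := by ring
  · intro n hn d
    have : ∀ l, (hsum (-stp) l = d) = (hsum stp l = -d) := fun l => by
      rw [hsum_neg, eq_iff_iff]; constructor <;> intro <;> linarith
    simp only [this]
    rw [hEx]
    exact hconc n hn _
  · intro A n hn d hd
    rw [hEx]
    refine hlow A n hn _ ?_
    convert hd using 2
    push_cast
    ring

/-! ### Lower bounds for bridge probabilities through one correcting jump -/

theorem add_one_le_Mx_of_not_surv (f : ℕ → ℤ) {x : ℤ} {l : List ℕ} (h : ¬ Surv f x l) :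
    (x : ℝ) + 1 ≤ Mx (fun s => -(f s : ℝ)) l := by
  have hneg : ∀ {z : ℤ}, ¬ 0 ≤ z → (z : ℝ) + 1 ≤ 0 := fun {z} hz => by
    have : z + 1 ≤ 0 := by omega
    exact_mod_cast this
  induction l generalizing x with
  | nil => exact hneg h
  | cons s l ih =>
    by_cases hx : 0 ≤ x
    · have h2 := ih (x := x + f s) (fun h' => h ⟨hx, h'⟩)
      push_cast at h2
      exact le_max_of_le_right (by linarith)
    · exact (hneg hx).trans (Mx_nonneg _ _)

/-- If the walk drifts upwards strongly and its position can be corrected by one jump of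
probability at least `w`, bridges are not much less likely than `w`. -/
theorem mul_half_le_Pb {p : ℕ → ℝ≥0∞} {f : ℕ → ℤ} (hp : ∑' s, p s = 1)
    (hE : ∑' s, p s * ENNReal.ofReal (Real.exp (Real.log 32 * -(f s : ℝ))) ≤ 2⁻¹)
    {n : ℕ} {x y : ℤ} (hx : 0 ≤ x) (hy : 0 ≤ y) {Q : List ℕ → Prop}
    (hQ : Ex p n (fun l => one (¬ Q l)) ≤ ENNReal.ofReal (1 / 4)) {w : ℝ≥0∞}
    (hj : ∀ l, l.length = n → Q l → ∃ s, x + hsum f l + f s = y ∧ w ≤ p s) :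
    ENNReal.ofReal (1 / 2) * w ≤ Pb p f (n + 1) x y := by
  -- Becoming negative requires a descent of at least one; with exponent `log 32` this has
  -- probability at most `2 / 32`.
  have hS : Ex p n (fun l => one (¬ Surv f x l)) ≤ ENNReal.ofReal (1 / 16) := by
    have h0 : (0 : ℝ) ≤ x := by exact_mod_cast hx
    calc _ ≤ Ex p n (fun l => one (1 ≤ Mx (fun s => -(f s : ℝ)) l)) :=
          Ex_mono p fun l _ => one_mono fun h => by linarith [add_one_le_Mx_of_not_surv f h]
      _ ≤ ENNReal.ofReal (Real.exp (-(Real.log 32 * 1))) * 2 :=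
          Ex_one_le_exp (Real.log_nonneg (by norm_num)) (Ex_exp_Mx_le_two hp hE n)
      _ = _ := by
          rw [mul_one, Real.exp_neg, Real.exp_log (by norm_num),
            show (2 : ℝ≥0∞) = ENNReal.ofReal 2 by simp, ← ENNReal.ofReal_mul (by norm_num)]
          norm_num
  have hgood : ENNReal.ofReal (1 / 2) ≤ Ex p n (fun l => one (Surv f x l ∧ Q l)) := by
    have h1 := Ex_one_not p hp n (fun l => Surv f x l ∧ Q l)
    have h2 : Ex p n (fun l => one (¬ (Surv f x l ∧ Q l))) ≤ ENNReal.ofReal (1 / 2) := by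
      calc _ ≤ Ex p n (fun l => one (¬ Surv f x l) + one (¬ Q l)) :=
            Ex_mono p fun l _ => by
              rw [one_congr (not_and_or (a := Surv f x l) (b := Q l))]
              exact one_or_le _ _
        _ ≤ ENNReal.ofReal (1 / 16) + ENNReal.ofReal (1 / 4) := by
            rw [Ex_add]
            exact add_le_add hS hQ
        _ ≤ _ := by
            rw [← ENNReal.ofReal_add (by norm_num) (by norm_num)]
            exact ENNReal.ofReal_le_ofReal (by norm_num)
    have h3 : ENNReal.ofReal (1 / 2) + ENNReal.ofReal (1 / 2) = 1 := by
      rw [← ENNReal.ofReal_add (by norm_num) (by norm_num)]; norm_num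
    by_contra hlt
    rw [not_le] at hlt
    have := ENNReal.add_lt_add_of_lt_of_le (by exact ne_top_of_le_ne_top ENNReal.ofReal_ne_top h2)
      hlt h2
    rw [h1, h3] at this
    exact lt_irrefl _ this
  calc _ ≤ Ex p n (fun l => one (Surv f x l ∧ Q l)) * w := mul_le_mul' hgood le_rfl
    _ = Ex p n (fun l => one (Surv f x l ∧ Q l) * w) := (Ex_mul_const p _ _ _).symm
    -- The correcting jump is the last step; it ends at `y ≥ 0`, so survival up to time `n`
    -- suffices.
    _ ≤ Ex p n (fun l => ∑' s, p s * one (Br f x y (l ++ [s]))) := by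
        refine Ex_mono p fun l hl => ?_
        by_cases h : Surv f x l ∧ Q l
        · rw [one_true h, one_mul]
          obtain ⟨s, hs, hw⟩ := hj l hl h.2
          refine hw.trans (le_trans (le_of_eq ?_) (ENNReal.le_tsum s))
          rw [one_true, mul_one]
          refine ⟨(surv_append _ _ _ _).2 ⟨h.1, ?_⟩, ?_⟩
          · have h2 : 0 ≤ x + hsum f l := by
              have h3 := (surv_append f x l []).1 (by simpa using h.1)
              exact h3.2
            exact ⟨h2, by rw [hs]; exact hy⟩
          · rw [hsum_append, hsum_cons, hsum_nil]
            linarith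
        · rw [one_false h, zero_mul]
          exact zero_le
    _ = _ := by
        unfold Pb
        rw [Ex_snoc, Ex_tsum]
        simp only [Ex_const_mul]

/-- A two-sided Chernoff bound. -/
theorem Ex_not_abs_le {p : ℕ → ℝ≥0∞} {μ V lam : ℝ} (hl : 0 ≤ lam)
    (h1 : ∑' s, p s * ENNReal.ofReal (Real.exp (lam * ((s : ℝ) - μ)))
      ≤ ENNReal.ofReal (Real.exp V))
    (h2 : ∑' s, p s * ENNReal.ofReal (Real.exp (-lam * ((s : ℝ) - μ)))
      ≤ ENNReal.ofReal (Real.exp V)) (n : ℕ) (A : ℝ) :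
    Ex p n (fun l => one (¬ |(hsum (fun s => (s : ℤ)) l : ℝ) - n * μ| ≤ A))
      ≤ ENNReal.ofReal (2 * Real.exp (n * V - lam * A)) := by
  have hsumE : ∀ l : List ℕ, l.length = n →
      (l.map fun s : ℕ => (s : ℝ) - μ).sum = (hsum (fun s => (s : ℤ)) l : ℝ) - n * μ := by
    intro l hl
    have := sum_cen (fun s => (s : ℤ)) μ l
    rw [hl] at this
    rw [← this]
    congr 2
  have hneg : ∀ l : List ℕ,
      (l.map fun s : ℕ => -((s : ℝ) - μ)).sum = -(l.map fun s : ℕ => (s : ℝ) - μ).sum := by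
    intro l
    induction l with
    | nil => simp
    | cons s l ih => simp only [List.map_cons, List.sum_cons, ih]; ring
  have hpow : ∀ (g : ℕ → ℝ), ∑' s, p s * ENNReal.ofReal (Real.exp (lam * g s))
      ≤ ENNReal.ofReal (Real.exp V) →
      Ex p n (fun l => one (A ≤ (l.map g).sum)) ≤ ENNReal.ofReal (Real.exp (n * V - lam * A)) := by
    intro g hg
    have h3 : Ex p n (fun l => ENNReal.ofReal (Real.exp (lam * (l.map g).sum)))
        ≤ ENNReal.ofReal (Real.exp (n * V)) := by
      rw [Ex_exp_sum, Real.exp_nat_mul, ENNReal.ofReal_pow (Real.exp_pos _).le]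
      gcongr
    refine (Ex_one_le_exp hl h3).trans (le_of_eq ?_)
    rw [← ENNReal.ofReal_mul (Real.exp_pos _).le, ← Real.exp_add]
    ring_nf
  have h4 := hpow (fun s => (s : ℝ) - μ) h1
  have h5 := hpow (fun s => -((s : ℝ) - μ)) (by
    simpa only [mul_neg, neg_mul] using h2)
  calc _ ≤ Ex p n (fun l => one (A ≤ (l.map fun s : ℕ => (s : ℝ) - μ).sum)
        + one (A ≤ (l.map fun s : ℕ => -((s : ℝ) - μ)).sum)) := by
        refine Ex_mono p fun l hl => le_trans (one_mono fun h => ?_) (one_or_le _ _)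
        rw [hneg, hsumE l hl]
        rw [not_le, lt_abs] at h
        exact h.imp le_of_lt le_of_lt
    _ ≤ ENNReal.ofReal (Real.exp (n * V - lam * A)) + ENNReal.ofReal (Real.exp (n * V - lam * A)) := by
        rw [Ex_add]
        exact add_le_add h4 h5
    _ = _ := by rw [← ENNReal.ofReal_add (Real.exp_pos _).le (Real.exp_pos _).le, two_mul]

/-! ### Changing the tilt -/

/-- The weights with values in `ℝ≥0∞`. -/
noncomputable def ewt (k : ℕ → ℝ) (s : ℕ) : ℝ≥0∞ := ENNReal.ofReal (k s)

section

variable {k : ℕ → ℝ} {B : ℝ} {l₀ : ℕ} {q μ : ℝ}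

theorem Wt.Ex_elaw (h : Wt k B l₀) (hq : 0 < q) (hq1 : q < 1) (n : ℕ) (F : List ℕ → ℝ≥0∞) :
    Ex (elaw k q) n F
      = ENNReal.ofReal (gen k q)⁻¹ ^ n * Ex (ewt k) n (fun l => ENNReal.ofReal q ^ l.sum * F l) := by
  have hg := h.gen_pos hq.le hq1
  induction n generalizing F with
  | zero => simp [Ex]
  | succ n ih =>
    simp only [Ex]
    rw [← ENNReal.tsum_mul_left]
    refine tsum_congr fun s => ?_
    rw [ih, elaw, law, ewt, div_eq_mul_inv, ENNReal.ofReal_mul (mul_nonneg (h.nonneg s) (by positivity)),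
      ENNReal.ofReal_mul (h.nonneg s), ENNReal.ofReal_pow hq.le, pow_succ]
    simp only [List.sum_cons, pow_add, mul_assoc, Ex_const_mul]
    ring

theorem hsum_stp_eq (l : List ℕ) : hsum stp l = (l.sum : ℤ) - l.length := by
  rw [hsum_stp]
  congr 1
  induction l with
  | nil => simp
  | cons s l ih => rw [hsum_cons, ih, List.sum_cons]; push_cast; ring

/-- Bounds for bridges do not depend on the tilt. -/
theorem Wt.ewt_le_of_elaw_le (h : Wt k B l₀) (hq : 0 < q) (hq1 : q < 1) {L : ℕ} {x y : ℤ}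
    {F : List ℕ → ℝ≥0∞} {K : ℝ≥0∞}
    (hF : Ex (elaw k q) L (fun l => F l * one (Br stp x y l)) ≤ K * Pb (elaw k q) stp L x y) :
    Ex (ewt k) L (fun l => F l * one (Br stp x y l)) ≤ K * Pb (ewt k) stp L x y := by
  have hg := h.gen_pos hq.le hq1
  -- On bridges the entries add up to `y - x + L`, so the tilted and the plain weights differ by
  -- this constant.
  set c : ℝ≥0∞ := ENNReal.ofReal (gen k q)⁻¹ ^ L * ENNReal.ofReal q ^ (y - x + L).toNat with hc
  have hc0 : c ≠ 0 := by
    rw [hc]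
    refine mul_ne_zero (pow_ne_zero _ ?_) (pow_ne_zero _ ?_) <;>
    · rw [Ne, ENNReal.ofReal_eq_zero, not_le]
      positivity
  have hct : c ≠ ⊤ := by
    rw [hc]
    exact ENNReal.mul_ne_top (ENNReal.pow_ne_top ENNReal.ofReal_ne_top)
      (ENNReal.pow_ne_top ENNReal.ofReal_ne_top)
  have key : ∀ G : List ℕ → ℝ≥0∞, Ex (elaw k q) L (fun l => G l * one (Br stp x y l))
      = c * Ex (ewt k) L (fun l => G l * one (Br stp x y l)) := by
    intro G
    rw [h.Ex_elaw hq hq1, hc, mul_assoc]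
    congr 1
    rw [← Ex_const_mul]
    refine Ex_congr _ fun l hl => ?_
    by_cases hb : Br stp x y l
    · have : l.sum = (y - x + L).toNat := by
        have := hb.2
        rw [hsum_stp_eq, hl] at this
        omega
      rw [this]
    · rw [one_false hb]
      simp
  have key1 : Pb (elaw k q) stp L x y = c * Pb (ewt k) stp L x y := by
    have := key (fun _ => 1)
    simpa only [one_mul, Pb] using this
  rw [key, key1, mul_left_comm] at hF
  exact (ENNReal.mul_le_mul_iff_right hc0 hct).1 hF

end

/-! ### Steep bridges -/

theorem exp_neg_two_mul_le {u : ℝ} (h0 : 0 ≤ u) (h : u ≤ 1 / 2) : Real.exp (-2 * u) ≤ 1 - u := by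
  have h1 := Real.add_one_le_exp (2 * u)
  have h2 : Real.exp (2 * u) * Real.exp (-2 * u) = 1 := by rw [← Real.exp_add]; ring_nf; simp
  nlinarith [Real.exp_pos (-2 * u), mul_le_mul_of_nonneg_right h1 (Real.exp_pos (-2 * u)).le,
    mul_nonneg h0 (sub_nonneg.2 h)]

theorem tsum_mul_one_le {p : ℕ → ℝ≥0∞} {P : ℝ≥0∞} (hP : ∀ s, p s ≤ P) {Q : ℕ → Prop}
    (hQ : ∀ s s', Q s → Q s' → s = s') : ∑' s, p s * one (Q s) ≤ P := by
  by_cases h : ∃ s, Q s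
  · obtain ⟨s, hs⟩ := h
    rw [tsum_eq_single s (fun s' h' => by rw [one_false (fun h2 => h' (hQ _ _ h2 hs)), mul_zero]),
      one_true hs, mul_one]
    exact hP s
  · simp only [not_exists] at h
    simp [one_false (h _)]

theorem neg_hsum_eq (f : ℕ → ℤ) (l : List ℕ) :
    -(hsum f l : ℝ) = (l.map fun s => -(f s : ℝ)).sum := by
  induction l with
  | nil => simp
  | cons s l ih => rw [hsum_cons, List.map_cons, List.sum_cons, ← ih]; push_cast; ring

theorem neg_hsum_block_le {f : ℕ → ℤ} (l : List ℕ) {X T Y : ℕ} (hXT : X ≤ T) (hTY : T ≤ Y) :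
    -(hsum f (block X T l) : ℝ) ≤ Mx (fun s => -(f s : ℝ)) (block X Y l) := by
  rw [neg_hsum_eq, sum_block]
  exact sum_Ico_le_Mx hXT hTY

/-- Separates the last step, which serves as the correcting jump. A step is at least `-1`, so it
adds at most one to a descent. -/
theorem neg_hsum_block_snoc_le {l : List ℕ} {n : ℕ} (hl : l.length = n) (s : ℕ) {X T Y : ℕ}
    (hXT : X ≤ T) (hTY : T ≤ Y) (hY : Y ≤ n + 1) :
    -(hsum stp (block X T (l ++ [s])) : ℝ)
      ≤ Mx (fun s => -(stp s : ℝ)) (block (min X n) (min Y n) l) + 1 := by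
  have hM := Mx_nonneg (fun s => -(stp s : ℝ)) (block (min X n) (min Y n) l)
  rcases Nat.lt_or_ge n T with hT | hT
  · rcases Nat.lt_or_ge n X with hX | hX
    · rw [block_empty _ _ _ (by omega)]
      simp
      linarith
    · have e : block X T (l ++ [s]) = block X n l ++ [s] := by
        have : T = n + 1 := by omega
        subst this
        simp only [block]
        rw [List.drop_append_of_le_length (by omega), List.take_of_length_le (by simp; omega),
          List.take_of_length_le (by simp; omega)]
      rw [e, hsum_append, hsum_cons, hsum_nil]
      have h1 := neg_hsum_block_le (f := stp) l hX (le_refl n)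
      rw [min_eq_left hX, min_eq_right (by omega)]
      have h2 : (-1 : ℝ) ≤ stp s := by
        have : -1 ≤ stp s := by unfold stp; omega
        exact_mod_cast this
      push_cast
      linarith
  · have e : block X T (l ++ [s]) = block X T l := by
      simp only [block]
      rw [List.drop_append_of_le_length (by omega), List.take_append_of_le_length (by simp; omega)]
    rw [e, min_eq_left (by omega : X ≤ n)]
    have := neg_hsum_block_le (f := stp) l hXT (by omega : T ≤ min Y n)
    linarith

section

variable {k : ℕ → ℝ} {B : ℝ} {l₀ : ℕ} {q μ : ℝ}

/-- The moment equals `exp lam * gen k (q * exp (-lam)) / gen k q`. The numerator stays bounded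
while `gen k q` is large for `q` near `1`: downward steps become rare. -/
theorem Wt.tsum_exp_neg_stp_le (h : Wt k B l₀) (hq : 0 < q) (hq1 : q < 1) {lam : ℝ}
    (hl : Real.log 2 ≤ lam) (hg : 4 * B * Real.exp lam ≤ gen k q) :
    ∑' s, elaw k q s * ENNReal.ofReal (Real.exp (lam * -(stp s : ℝ))) ≤ 2⁻¹ := by
  have hw0 := Real.exp_pos (-lam)
  have hg0 := h.gen_pos hq.le hq1
  have hw : Real.exp (-lam) ≤ 1 / 2 := by
    rw [Real.exp_neg, one_div]
    refine inv_anti₀ (by norm_num) ?_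
    rwa [← Real.log_le_iff_le_exp (by norm_num)]
  have hqw : q * Real.exp (-lam) ≤ 1 / 2 := by nlinarith
  have hs := (h.hasSum_law_mul_pow hw0.le hq.le (by linarith : q * Real.exp (-lam) < 1)).mul_left
    (Real.exp lam)
  have e : ∀ s : ℕ, law k q s * Real.exp (lam * -(stp s : ℝ))
      = Real.exp lam * (law k q s * Real.exp (-lam) ^ s) := by
    intro s
    have : lam * -(stp s : ℝ) = lam + s * -lam := by simp only [stp]; push_cast; ring
    rw [this, Real.exp_add, ← Real.exp_nat_mul]
    ring
  have hs' := hasSum_of_eq hs e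
  unfold elaw
  rw [tsum_ofReal_mul_ofReal (h.law_nonneg hq.le hq1) (fun s => (Real.exp_pos _).le) hs'.summable,
    hs'.tsum_eq, show (2⁻¹ : ℝ≥0∞) = ENNReal.ofReal 2⁻¹ by
      rw [ENNReal.ofReal_inv_of_pos (by norm_num)]; simp]
  refine ENNReal.ofReal_le_ofReal ?_
  have hB := h.one_le
  have h1 := h.gen_le (q := q * Real.exp (-lam)) (by positivity) (by linarith)
  have h2 : (1 - q * Real.exp (-lam))⁻¹ ≤ 2 := by
    rw [inv_le_comm₀ (by linarith) (by norm_num)]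
    linarith
  have h3 : gen k (q * Real.exp (-lam)) ≤ B * 2 := h1.trans (by gcongr)
  have h4 := mul_le_mul_of_nonneg_left h3 (Real.exp_pos lam).le
  rw [← mul_div_assoc, div_le_iff₀ hg0]
  linarith

end

set_option maxHeartbeats 1000000 in
/-- For steep bridges the descents have exponential moments, up to a factor `exp (D √L)`. -/
theorem exists_steep (B : ℝ) (l₀ : ℕ) :
    ∃ B₀ ≥ (1 : ℝ), ∃ D ≥ (1 : ℝ), ∀ k, Wt k B l₀ → ∀ L : ℕ, 2 ≤ L → ∀ x y : ℤ, 0 ≤ x → 0 ≤ y →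
      B₀ * L ≤ (y : ℝ) - x + L →
      ∀ (r : ℕ) (X Y : Fin r → ℕ) (T : List ℕ → Fin r → ℕ), (∀ l i, X i ≤ T l i) →
        (∀ l i, T l i ≤ Y i) → (∀ i, Y i ≤ L) → (∀ i j, i ≠ j → Y i ≤ X j ∨ Y j ≤ X i) →
        Ex (ewt k) L (fun l => ENNReal.ofReal (Real.exp (∑ i, -(hsum stp (block (X i) (T l i) l) : ℝ)))
          * one (Br stp x y l))
          ≤ ENNReal.ofReal (D ^ (r + 1) * Real.exp (D * √L)) * Pb (ewt k) stp L x y := by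
  rcases lt_or_ge B 1 with hB | hB
  · exact ⟨1, le_rfl, 1, le_rfl, fun k h => absurd h.one_le (by linarith)⟩
  obtain ⟨C, hC, hmgf⟩ := exists_mgf_large B l₀ (q₀ := 1 / 2) (by norm_num)
  -- The constants of the steep regime: deviations beyond `A₁ m √n` have probability at most `2 exp
  -- (-3) ≤ 1 / 4`; `C₂` compares `μ` with `m = (1 - q)⁻¹` in both directions; `A` makes the
  -- correcting jump at least `l₀`; `M` makes `gen k q` at least `128 B`; `B₀` forces `μ ≥ C₂ M`.
  set A₁ := C / 4 + 12 with hA₁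
  set C₂ := 2 ^ (l₀ + 2) * B with hC₂
  have hC₂1 : 1 ≤ C₂ := by
    have : (1 : ℝ) ≤ 2 ^ (l₀ + 2) := one_le_pow₀ (by norm_num)
    nlinarith
  set A := C₂ * (A₁ + l₀) with hA
  have hA₁0 : 0 ≤ A₁ := by positivity
  have hA0 : 0 ≤ A := by positivity
  set M := 2 ^ (l₀ + 1) * (128 * B) with hM
  have hM1 : 2 ≤ M := by
    have : (1 : ℝ) ≤ 2 ^ (l₀ + 1) := one_le_pow₀ (by norm_num)
    nlinarith
  set B₀ := (1 + A) * (C₂ * M) with hB₀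
  set K := A * C₂ + A₁ with hK
  have hK0 : 0 ≤ K := by positivity
  set D := 2 ^ (l₀ + 3) * B ^ 2 + 6 + 2 * K with hD
  refine ⟨B₀, ?_, D, ?_, ?_⟩
  · have : 1 ≤ C₂ * M := by nlinarith
    nlinarith
  · have : 0 ≤ 2 ^ (l₀ + 3) * B ^ 2 := by positivity
    rw [hD]; linarith
  intro k h L hL x y hx hy hS r X Y T hXT hTY hYL hdisj
  obtain ⟨n, rfl⟩ : ∃ n, L = n + 1 := ⟨L - 1, by omega⟩
  have hn : (1 : ℝ) ≤ n := by exact_mod_cast (by omega : 1 ≤ n)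
  set S := (y : ℝ) - x + (n + 1 : ℕ) with hSd
  have hsn1 : 1 ≤ √(n : ℝ) := Real.one_le_sqrt.2 hn
  have hsnn : √(n : ℝ) ≤ n := by
    rw [Real.sqrt_le_left (by linarith)]
    nlinarith
  have hden : 0 < n + A * √n := by positivity
  have hC₂M : 2 ≤ C₂ * M := by
    have := mul_le_mul_of_nonneg_left hM1 (by linarith : 0 ≤ C₂)
    linarith
  have hS0 : 0 < S := by
    have : 0 < B₀ * ((n + 1 : ℕ) : ℝ) := by rw [hB₀]; positivity
    linarith
  -- The mean is taken slightly below the slope, so that `n` steps typically fall short of the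
  -- target by order `m √n`. The last jump must then be between `l₀` and `K √n m`.
  obtain ⟨q, hq0, hq1, hm⟩ := h.exists_mean (t := S / (n + A * √n)) (by positivity)
  set μ := S / (n + A * √n) with hμ
  have hμS : n * μ + A * √n * μ = S := by
    rw [hμ]; field_simp
  have hd : 0 < 1 - q := by linarith
  set m := (1 - q)⁻¹ with hmd
  have hm1 : 1 ≤ m := by rw [hmd]; exact (one_le_inv₀ hd).2 (by linarith)
  have hμ0 : 0 < μ := by positivity
  have hμB : C₂ * M ≤ μ := by
    rw [hμ, le_div_iff₀ hden]
    have h1 : n + A * √n ≤ (1 + A) * ((n + 1 : ℕ) : ℝ) := by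
      have := mul_le_mul_of_nonneg_left hsnn hA0
      push_cast
      linarith
    calc C₂ * M * (n + A * √n) ≤ C₂ * M * ((1 + A) * ((n + 1 : ℕ) : ℝ)) := by gcongr
      _ = B₀ * ((n + 1 : ℕ) : ℝ) := by rw [hB₀]; ring
      _ ≤ S := hS
  have hq2 : 1 / 2 ≤ q := by
    by_contra hlt
    rw [not_le] at hlt
    have h1 := h.mean_le_mul hq0 hlt.le hm
    have h2 : 2 * B ≤ C₂ := by
      rw [hC₂]
      have : (2 : ℝ) ≤ 2 ^ (l₀ + 2) := by
        calc (2 : ℝ) = 2 ^ 1 := by norm_num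
          _ ≤ _ := pow_le_pow_right₀ (by norm_num) (by omega)
      gcongr
    have h3 := mul_le_mul_of_nonneg_left hlt.le (by linarith : 0 ≤ 4 * B)
    have h4 := mul_le_mul_of_nonneg_left hM1 (by linarith : 0 ≤ C₂)
    linarith
  have hpow : (1 / 2 : ℝ) ^ l₀ ≤ q ^ l₀ := by gcongr
  have hμm : μ ≤ C₂ * m := by
    have h1 := h.mean_mul_le hq0 hq1 hm
    have h2 : μ * (1 / 2 : ℝ) ^ l₀ ≤ 2 * B * m := le_trans (by gcongr) h1
    rw [one_div, inv_pow, ← div_eq_mul_inv, div_le_iff₀ (by positivity)] at h2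
    refine h2.trans ?_
    rw [hC₂, pow_add]
    have : 0 ≤ 2 ^ l₀ * B * m := by positivity
    linarith
  have hmμ : m ≤ C₂ * μ := by
    have h1 := h.le_mean hq0 hq1 hm
    have h2 : (1 / 2 : ℝ) ^ (l₀ + 1) * m ≤ 2 * B * μ := by
      refine le_trans ?_ h1
      gcongr
    rw [one_div, inv_pow, inv_mul_le_iff₀ (by positivity)] at h2
    refine h2.trans (le_of_eq ?_)
    rw [hC₂, pow_succ 2 (l₀ + 1)]
    ring
  have hmM : M ≤ m := by
    have := hμB.trans hμm
    exact le_of_mul_le_mul_left this (by linarith)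
  have hgen : m / 2 ^ (l₀ + 1) ≤ gen k q := by
    refine le_trans ?_ (h.le_gen hq0.le hq1)
    calc m / 2 ^ (l₀ + 1) = (1 / 2 : ℝ) ^ l₀ / 2 * m := by
          rw [one_div, inv_pow, pow_succ]; field_simp
      _ ≤ _ := by gcongr
  have hgenB : 128 * B ≤ gen k q := by
    refine le_trans ?_ hgen
    rw [le_div_iff₀ (by positivity)]
    linarith
  have hgen0 := h.gen_pos hq0.le hq1
  have hgenle : gen k q ≤ B * m := h.gen_le hq0.le hq1
  have hp := h.tsum_elaw hq0.le hq1
  -- the lower bound for the bridge probability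
  set w := Real.exp (-2 * (K * √n)) / (2 * B * m) with hw
  have hlow : ENNReal.ofReal (1 / 2) * ENNReal.ofReal w ≤ Pb (elaw k q) stp (n + 1) x y := by
    refine mul_half_le_Pb hp (h.tsum_exp_neg_stp_le hq0 hq1 ?_ ?_) hx hy
      (Q := fun l => |(hsum (fun s => (s : ℤ)) l : ℝ) - n * μ| ≤ A₁ * m * √n) ?_ ?_
    · exact Real.log_le_log (by norm_num) (by norm_num)
    · rw [Real.exp_log (by norm_num)]
      linarith
    · set lam := 1 / (4 * m * √n) with hlam
      have hlam0 : 0 ≤ lam := by positivity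
      have hlam1 : |lam| ≤ (1 - q) / 4 := by
        rw [abs_of_nonneg hlam0, hlam]
        have e : (1 - q) / 4 = 1 / (4 * m) := by rw [hmd]; field_simp
        rw [e]
        exact one_div_le_one_div_of_le (by positivity) (le_mul_of_one_le_right (by positivity) hsn1)
      have hV : C * m ^ 2 * lam ^ 2 = C / (16 * n) := by
        rw [hlam, div_pow, mul_pow, Real.sq_sqrt (by linarith)]
        field_simp
        norm_num
      have hE : ∀ lam' : ℝ, lam' ^ 2 = lam ^ 2 → |lam'| ≤ (1 - q) / 4 →
          ∑' s, elaw k q s * ENNReal.ofReal (Real.exp (lam' * ((s : ℝ) - μ)))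
            ≤ ENNReal.ofReal (Real.exp (C / (16 * n))) := by
        intro lam' h2 h3
        obtain ⟨h4, h5⟩ := hmgf k q μ h hq2 hq1 hm lam' h3
        unfold elaw
        rw [tsum_ofReal_mul_ofReal (h.law_nonneg hq0.le hq1) (fun s => (Real.exp_pos _).le) h4]
        rw [h2, hV] at h5
        exact ENNReal.ofReal_le_ofReal h5
      refine (Ex_not_abs_le hlam0 (hE lam rfl hlam1) (hE (-lam) (neg_sq _) (by rwa [abs_neg])) n
        _).trans (ENNReal.ofReal_le_ofReal ?_)
      have e1 : n * (C / (16 * n)) - lam * (A₁ * m * √n) = -3 := by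
        rw [hlam, hA₁]
        field_simp
        ring
      rw [e1]
      have h8 : Real.exp (-3) * Real.exp 3 = 1 := by rw [← Real.exp_add]; simp
      have h10 : (8 : ℝ) ≤ Real.exp 3 := by
        have := Real.quadratic_le_exp_of_nonneg (x := 3) (by norm_num)
        linarith
      have h11 := mul_le_mul_of_nonneg_left h10 (Real.exp_pos (-3)).le
      linarith
    · intro l hl hQ
      have hcast : (hsum (fun s => (s : ℤ)) l : ℝ) = (hsum stp l : ℝ) + n := by
        rw [hsum_stp, hl]; push_cast; ring
      rw [abs_le] at hQ
      have hmμ' := mul_le_mul_of_nonneg_left hmμ (by positivity : 0 ≤ (A₁ + l₀) * √n)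
      have hAm : (A₁ + l₀) * √n * m ≤ A * √n * μ := by
        calc _ ≤ (A₁ + l₀) * √n * (C₂ * μ) := hmμ'
          _ = _ := by rw [hA]; ring
      have hlo : (l₀ : ℝ) ≤ S - hsum (fun s => (s : ℤ)) l := by
        have h1 : (l₀ : ℝ) * 1 ≤ l₀ * (√n * m) := by
          have : 1 ≤ √n * m := one_le_mul_of_one_le_of_one_le hsn1 hm1
          gcongr
        linarith [hQ.2]
      have hhi : S - hsum (fun s => (s : ℤ)) l ≤ K * √n * m := by
        have h1 := mul_le_mul_of_nonneg_left hμm (by positivity : 0 ≤ A * √n)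
        have h2 : K * √n * m = A * √n * (C₂ * m) + A₁ * m * √n := by rw [hK]; ring
        linarith [hQ.1]
      set z : ℤ := y - x + (n + 1 : ℕ) - hsum (fun s => (s : ℤ)) l with hz
      have hzS : (z : ℝ) = S - hsum (fun s => (s : ℤ)) l := by rw [hz, hSd]; push_cast; ring
      rw [← hzS] at hlo hhi
      have hz0 : (l₀ : ℤ) ≤ z := by exact_mod_cast hlo
      have hzt : ((z.toNat : ℕ) : ℤ) = z := Int.toNat_of_nonneg (by omega)
      refine ⟨z.toNat, ?_, ?_⟩
      · have h3 : hsum stp l = hsum (fun s => (s : ℤ)) l - n := by rw [hsum_stp, hl]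
        rw [h3]
        simp only [stp]
        rw [hzt, hz]
        push_cast
        ring
      · refine ENNReal.ofReal_le_ofReal (le_trans ?_ (h.le_law hq0.le hq1 (by omega)))
        have h4 : Real.exp (-2 * (K * √n)) ≤ q ^ z.toNat := by
          have h5 : Real.exp (-2 * (1 - q)) ≤ q := by
            have := exp_neg_two_mul_le hd.le (by linarith : 1 - q ≤ 1 / 2)
            linarith
          calc _ ≤ Real.exp (-2 * (1 - q)) ^ z.toNat := by
                rw [← Real.exp_nat_mul]
                refine Real.exp_le_exp.2 ?_
                have h6 : ((z.toNat : ℕ) : ℝ) = z := by exact_mod_cast hzt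
                rw [h6]
                have h7 := mul_le_mul_of_nonneg_right hhi hd.le
                have h8 : K * √n * m * (1 - q) = K * √n := by rw [hmd]; field_simp
                linarith
            _ ≤ _ := by gcongr
        rw [hw]
        calc _ = 1 / 2 * Real.exp (-2 * (K * √n)) / (B * m) := by field_simp
          _ ≤ 1 / 2 * q ^ z.toNat / gen k q := by gcongr
  -- the numerator
  set P := 2 ^ (l₀ + 1) * B / m with hP
  have hPle : ∀ s, elaw k q s ≤ ENNReal.ofReal P := by
    intro s
    refine ENNReal.ofReal_le_ofReal ((h.law_le hq0.le hq1 s).trans ?_)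
    have h1 : q ^ s ≤ 1 := pow_le_one₀ hq0.le hq1.le
    calc B * q ^ s / gen k q ≤ B * 1 / (m / 2 ^ (l₀ + 1)) := by gcongr
      _ = _ := by rw [hP]; field_simp
  have he3 : Real.exp 1 ≤ 3 := by linarith [Real.exp_one_lt_d9]
  have hE1 := h.tsum_exp_neg_stp_le hq0 hq1 (lam := 1)
    (by rw [Real.log_le_iff_le_exp (by norm_num)]; linarith [Real.add_one_le_exp (1 : ℝ)])
    (by have := mul_le_mul_of_nonneg_left he3 (by linarith : 0 ≤ 4 * B); linarith)
  -- Strong upward drift: each block has exponential moment at most `2` whatever its length. With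
  -- `exp 1 ≤ 3` per block for the last step this yields `6 ^ r`.
  have hblocks := Ex_exp_blocks_le (C := 0) (lam := 1) hp le_rfl
    (h := fun s => -(stp s : ℝ)) (fun n => by
      have := Ex_exp_Mx_le_two hp hE1 n
      simpa using this) n (fun i => min (X i) n) (fun i => min (Y i) n)
    (fun i => by have := (hXT [] i).trans (hTY [] i); show min (X i) n ≤ min (Y i) n; omega)
    (fun i => min_le_right _ _)
    (fun i j hij => by
      have := hdisj i j hij
      show min (Y i) n ≤ min (X j) n ∨ min (Y j) n ≤ min (X i) n
      omega)
  simp only [zero_mul, Real.exp_zero, mul_one, one_mul] at hblocks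
  set Φ : List ℕ → ℝ≥0∞ := fun l => ENNReal.ofReal (Real.exp
    (∑ i, Mx (fun s => -(stp s : ℝ)) (block (min (X i) n) (min (Y i) n) l))) with hΦ
  have hnum : Ex (elaw k q) (n + 1) (fun l =>
      ENNReal.ofReal (Real.exp (∑ i, -(hsum stp (block (X i) (T l i) l) : ℝ))) * one (Br stp x y l))
      ≤ ENNReal.ofReal (6 ^ r * P) := by
    calc _ ≤ ∑' s, elaw k q s * Ex (elaw k q) n (fun l => ENNReal.ofReal (3 ^ r) * Φ l
            * one (x + hsum stp l + stp s = y)) := by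
          rw [Ex_snoc]
          refine ENNReal.tsum_le_tsum fun s => mul_le_mul' le_rfl (Ex_mono _ fun l hl => ?_)
          refine mul_le_mul' ?_ (one_mono fun hb => ?_)
          · rw [hΦ, ← ENNReal.ofReal_mul (by positivity)]
            refine ENNReal.ofReal_le_ofReal ?_
            have h1 : ∑ i, -(hsum stp (block (X i) (T (l ++ [s]) i) (l ++ [s])) : ℝ)
                ≤ ∑ i, (Mx (fun s => -(stp s : ℝ)) (block (min (X i) n) (min (Y i) n) l) + 1) :=
              Finset.sum_le_sum fun i _ =>
                neg_hsum_block_snoc_le hl s (hXT _ i) (hTY _ i) (hYL i)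
            rw [Finset.sum_add_distrib] at h1
            refine (Real.exp_le_exp.2 h1).trans ?_
            rw [Real.exp_add, mul_comm]
            refine mul_le_mul_of_nonneg_right ?_ (Real.exp_pos _).le
            simp only [Finset.sum_const, Finset.card_univ, Fintype.card_fin, nsmul_eq_mul]
            rw [Real.exp_nat_mul]
            gcongr
          · have := hb.2
            rw [hsum_append, hsum_cons, hsum_nil] at this
            linarith
      _ = Ex (elaw k q) n (fun l => ENNReal.ofReal (3 ^ r) * Φ l
            * ∑' s, elaw k q s * one (x + hsum stp l + stp s = y)) := by
          simp only [← ENNReal.tsum_mul_left]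
          rw [Ex_tsum]
          refine tsum_congr fun s => ?_
          rw [← Ex_const_mul]
          refine Ex_congr _ fun l _ => by ring
      _ ≤ Ex (elaw k q) n (fun l => ENNReal.ofReal (3 ^ r) * Φ l * ENNReal.ofReal P) := by
          refine Ex_mono _ fun l _ => mul_le_mul' le_rfl (tsum_mul_one_le hPle fun s s' h1 h2 => ?_)
          simp only [stp] at h1 h2
          omega
      _ ≤ ENNReal.ofReal (3 ^ r) * ENNReal.ofReal (2 ^ r) * ENNReal.ofReal P := by
          rw [Ex_mul_const, Ex_const_mul]
          gcongr
      _ = _ := by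
          rw [← ENNReal.ofReal_mul (by positivity), ← ENNReal.ofReal_mul (by positivity), ← mul_pow]
          norm_num
  refine h.ewt_le_of_elaw_le hq0 hq1 (hnum.trans ?_)
  refine le_trans ?_ (mul_le_mul' le_rfl hlow)
  rw [← ENNReal.ofReal_mul (by norm_num), ← ENNReal.ofReal_mul (by positivity)]
  refine ENNReal.ofReal_le_ofReal ?_
  have hD6 : 6 ≤ D := by
    have : 0 ≤ 2 ^ (l₀ + 3) * B ^ 2 := by positivity
    rw [hD]; linarith
  have hD8 : 2 ^ (l₀ + 3) * B ^ 2 ≤ D := by rw [hD]; linarith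
  have hDK : 2 * K ≤ D := by
    have : 0 ≤ 2 ^ (l₀ + 3) * B ^ 2 := by positivity
    rw [hD]; linarith
  have h1 : (6 : ℝ) ^ r ≤ D ^ r := by gcongr
  have h2 : 1 ≤ Real.exp (D * √((n + 1 : ℕ) : ℝ)) * Real.exp (-2 * (K * √n)) := by
    rw [← Real.exp_add]
    refine Real.one_le_exp ?_
    have h3 : √(n : ℝ) ≤ √((n + 1 : ℕ) : ℝ) := Real.sqrt_le_sqrt (by push_cast; linarith)
    have : 2 * K * √n ≤ D * √((n + 1 : ℕ) : ℝ) := by gcongr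
    linarith
  calc 6 ^ r * P ≤ D ^ r * P := by gcongr
    _ = D ^ r * (2 ^ (l₀ + 3) * B ^ 2) * (1 / (4 * B * m)) := by
        rw [hP, pow_add 2 l₀ 1, pow_add 2 l₀ 3]; field_simp; norm_num
    _ ≤ D ^ r * D * (1 / (4 * B * m)) * 1 := by rw [mul_one]; gcongr
    _ ≤ D ^ r * D * (1 / (4 * B * m))
        * (Real.exp (D * √((n + 1 : ℕ) : ℝ)) * Real.exp (-2 * (K * √n))) := by gcongr
    _ = _ := by rw [hw]; field_simp; ring

/-! ### Bridges of slope close to the minimal one -/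

section

variable {k : ℕ → ℝ} {B : ℝ} {l₀ : ℕ} {q μ : ℝ}

theorem Wt.gen_le_one_add (h : Wt k B l₀) (hq : 0 ≤ q) (hq1 : q ≤ 1 / 2) :
    gen k q ≤ 1 + 2 * B * q := by
  have hB := h.one_le
  have hs := h.summable hq (by linarith)
  have hgeo := summable_geometric_of_lt_one hq (by linarith : q < 1)
  rw [gen, ← hs.sum_add_tsum_nat_add 1]
  simp only [Finset.range_one, Finset.sum_singleton, pow_zero, mul_one, h.zero]
  refine add_le_add le_rfl ?_
  calc ∑' s, k (s + 1) * q ^ (s + 1) ≤ ∑' s, B * q * q ^ s := by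
        refine Summable.tsum_le_tsum (fun s => ?_) ((summable_nat_add_iff 1).2 hs) (hgeo.mul_left _)
        rw [pow_succ]
        have := mul_le_mul_of_nonneg_right (h.le (s + 1)) (by positivity : 0 ≤ q ^ s * q)
        linarith
    _ = B * q * (1 - q)⁻¹ := by rw [tsum_mul_left, tsum_geometric_of_lt_one hq (by linarith)]
    _ ≤ B * q * 2 := by
        have : (1 - q)⁻¹ ≤ 2 := by
          rw [inv_le_comm₀ (by linarith) (by norm_num)]
          linarith
        gcongr
    _ = _ := by ring

theorem Wt.tsum_exp_stp_le (h : Wt k B l₀) (hq : 0 < q) (hq1 : q < 1) {lam : ℝ}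
    (hl : 2 * B * (q * Real.exp lam) ≤ 1) :
    ∑' s, elaw k q s * ENNReal.ofReal (Real.exp (lam * (stp s : ℝ)))
      ≤ ENNReal.ofReal (2 * Real.exp (-lam)) := by
  have hB := h.one_le
  have hw0 := Real.exp_pos lam
  have hu0 : 0 < q * Real.exp lam := by positivity
  have hu : q * Real.exp lam ≤ 1 / 2 := by nlinarith
  have hs := (h.hasSum_law_mul_pow hw0.le hq.le (by linarith : q * Real.exp lam < 1)).mul_left
    (Real.exp (-lam))
  have e : ∀ s : ℕ, law k q s * Real.exp (lam * (stp s : ℝ))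
      = Real.exp (-lam) * (law k q s * Real.exp lam ^ s) := by
    intro s
    have : lam * (stp s : ℝ) = -lam + s * lam := by simp only [stp]; push_cast; ring
    rw [this, Real.exp_add, ← Real.exp_nat_mul]
    ring
  have hs' := hasSum_of_eq hs e
  unfold elaw
  rw [tsum_ofReal_mul_ofReal (h.law_nonneg hq.le hq1) (fun s => (Real.exp_pos _).le) hs'.summable,
    hs'.tsum_eq]
  refine ENNReal.ofReal_le_ofReal ?_
  rw [mul_comm 2]
  refine mul_le_mul_of_nonneg_left ?_ (Real.exp_pos _).le
  rw [div_le_iff₀ (h.gen_pos hq.le hq1)]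
  linarith [h.gen_le_one_add hu0.le hu, h.one_le_gen hq.le hq1]

end

set_option maxHeartbeats 1000000 in
/-- For bridges of slope close to the minimal one, increments have exponential moments, up to a
factor `exp (D √L)`. -/
theorem exists_flat (B : ℝ) (l₀ : ℕ) :
    ∃ ε₀ > (0 : ℝ), ε₀ ≤ 1 / 2 ∧ ∃ S₀ ≥ (1 : ℝ), ∃ D ≥ (1 : ℝ), ∀ k, Wt k B l₀ → ∀ L : ℕ,
      ∀ x y : ℤ, 0 ≤ x → 0 ≤ y → S₀ ≤ (y : ℝ) - x + L → (y : ℝ) - x + L ≤ ε₀ * L →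
      ∀ X T : ℕ, X ≤ T → T ≤ L →
        Ex (ewt k) L (fun l => ENNReal.ofReal (Real.exp (hsum stp (block X T l) : ℝ))
          * one (Br stp x y l))
          ≤ ENNReal.ofReal (D * Real.exp (D * √L)) * Pb (ewt k) stp L x y := by
  rcases lt_or_ge B 1 with hB | hB
  · exact ⟨1 / 2, by norm_num, le_rfl, 1, le_rfl, 1, le_rfl,
      fun k h => absurd h.one_le (by linarith)⟩
  obtain ⟨C, hC, hmgf⟩ := exists_mgf_small B l₀
  set A₁ := C / 4 + 12 with hA₁
  have hA₁0 : 0 ≤ A₁ := by positivity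
  set ε₁ := 1 / (64 * B) with hε₁
  have hε₁0 : 0 < ε₁ := by positivity
  have hε₁B : 64 * B * ε₁ = 1 := by rw [hε₁]; field_simp
  have hε₁1 : ε₁ ≤ 1 / 64 := by
    rw [hε₁]
    exact one_div_le_one_div_of_le (by norm_num) (by linarith)
  -- A mean at most `2 ε₀` forces `q ^ (l₀ + 1) ≤ 4 B ε₀ = ε₁ ^ (l₀ + 1)`, hence `64 B q ≤ 1`.
  set ε₀ := ε₁ ^ (l₀ + 1) / (4 * B) with hε₀
  have hε₀0 : 0 < ε₀ := by positivity
  have hε₀1 : ε₀ ≤ 1 / 2 := by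
    rw [hε₀, div_le_iff₀ (by positivity)]
    have : ε₁ ^ (l₀ + 1) ≤ 1 := pow_le_one₀ hε₁0.le (by linarith)
    linarith
  -- For `S ≥ R²` the deficit `A₁ √S + l₀` is at most `S / 2`, so the tilt has positive mean. `R √S`
  -- bounds the correcting jump.
  set R := 2 * A₁ + 2 * l₀ + 1 with hR
  have hl₀0 : (0 : ℝ) ≤ l₀ := Nat.cast_nonneg _
  have hR1 : 1 ≤ R := by rw [hR]; linarith
  set K := 2 * √(8 * B) * R with hK
  have hK0 : 0 ≤ K := by positivity
  set D := 8 + K with hD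
  refine ⟨ε₀, hε₀0, hε₀1, R ^ 2, by nlinarith, D, by rw [hD]; linarith, ?_⟩
  intro k h L x y hx hy hS₀ hS X T hXT hTL
  set S := (y : ℝ) - x + L with hSd
  have hS1 : 1 ≤ S := le_trans (by nlinarith) hS₀
  have hL2 : 2 ≤ L := by
    have : (2 : ℝ) ≤ L := by
      have := mul_le_mul_of_nonneg_right hε₀1 (Nat.cast_nonneg L : (0 : ℝ) ≤ L)
      linarith
    exact_mod_cast this
  obtain ⟨n, rfl⟩ : ∃ n, L = n + 1 := ⟨L - 1, by omega⟩
  have hn : (1 : ℝ) ≤ n := by exact_mod_cast (by omega : 1 ≤ n)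
  have hRS : R ≤ √S := Real.le_sqrt_of_sq_le hS₀
  have hsS1 : 1 ≤ √S := hR1.trans hRS
  have hsS : √S * √S = S := Real.mul_self_sqrt (by linarith)
  have hhalf : A₁ * √S + l₀ ≤ S / 2 := by
    have h1 := mul_le_mul_of_nonneg_right hRS (by linarith : 0 ≤ √S)
    have h2 := mul_le_mul_of_nonneg_left hsS1 hl₀0
    rw [hsS, hR] at h1
    linarith
  have hAS : 0 ≤ A₁ * √S := by positivity
  obtain ⟨q, hq0, hq1, hm⟩ := h.exists_mean (t := (S - A₁ * √S - l₀) / n)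
    (div_pos (by linarith) (by linarith))
  set μ := (S - A₁ * √S - l₀) / n with hμ
  have hnμ : n * μ = S - A₁ * √S - l₀ := by rw [hμ]; field_simp
  have hL' : ((n + 1 : ℕ) : ℝ) ≤ 2 * n := by push_cast; linarith
  have hμle : μ ≤ 2 * ε₀ := by
    rw [hμ, div_le_iff₀ (by linarith)]
    have := mul_le_mul_of_nonneg_left hL' hε₀0.le
    linarith
  have hμ0 : 0 < μ := div_pos (by linarith) (by linarith)
  have hd : 0 < 1 - q := by linarith
  have hqε : q ≤ ε₁ := by
    have h1 := h.le_mean hq0 hq1 hm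
    have h2 : 1 ≤ (1 - q)⁻¹ := (one_le_inv₀ hd).2 (by linarith)
    have h3 : q ^ (l₀ + 1) ≤ ε₁ ^ (l₀ + 1) := by
      calc q ^ (l₀ + 1) ≤ q ^ (l₀ + 1) * (1 - q)⁻¹ := le_mul_of_one_le_right (by positivity) h2
        _ ≤ 2 * B * μ := h1
        _ ≤ 2 * B * (2 * ε₀) := by gcongr
        _ = ε₁ ^ (l₀ + 1) := by rw [hε₀]; field_simp; ring
    exact (pow_le_pow_iff_left₀ hq0.le hε₁0.le (by omega)).1 h3
  have hBq : 64 * B * q ≤ 1 := by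
    rw [← hε₁B]
    gcongr
  have hp := h.tsum_elaw hq0.le hq1
  -- `q ≥ 1 / v ≥ exp (-2 √v)`, and `√v * √S` is a multiple of `√L`: a jump of size up to `R √S`
  -- costs only `exp (-K √L)`.
  set v := 8 * B * ((n + 1 : ℕ) : ℝ) / S with hv
  have hv0 : 0 < v := by positivity
  have hqv : Real.exp (-(2 * √v)) ≤ q := by
    have h1 : v ≤ Real.exp (2 * √v) := by
      have h2 := Real.quadratic_le_exp_of_nonneg (x := 2 * √v) (by positivity)
      have h3 := Real.sq_sqrt hv0.le
      have h4 := Real.sqrt_nonneg v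
      rw [mul_pow, h3] at h2
      linarith
    have h2 := h.mean_le_mul hq0 (by linarith) hm
    have h3 : S / 2 ≤ n * μ := by linarith
    have h4 : S ≤ 8 * B * ((n + 1 : ℕ) : ℝ) * q := by
      have h5 := mul_le_mul_of_nonneg_left h2 (by linarith : (0 : ℝ) ≤ n)
      have h6 : 0 ≤ 8 * B * q := by positivity
      push_cast
      linarith
    rw [Real.exp_neg, inv_le_comm₀ (Real.exp_pos _) hq0]
    refine le_trans ?_ h1
    rw [hv, inv_eq_one_div, div_le_div_iff₀ hq0 (by linarith)]
    linarith
  set w := Real.exp (-(K * √((n + 1 : ℕ) : ℝ))) / 4 with hw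
  -- Forward steps are mostly `-1`, so the reversed walk from `y` drifts upwards and the one-jump
  -- bound applies to it.
  have hlow : ENNReal.ofReal (1 / 2) * ENNReal.ofReal w ≤ Pb (elaw k q) stp (n + 1) x y := by
    rw [Pb_reverse]
    refine mul_half_le_Pb hp ?_ hy hx
      (Q := fun l => |(hsum (fun s => (s : ℤ)) l : ℝ) - n * μ| ≤ A₁ * √S) ?_ ?_
    · have h1 := h.tsum_exp_stp_le hq0 hq1 (lam := Real.log 32)
        (by rw [Real.exp_log (by norm_num)]; linarith)
      simp only [Pi.neg_apply, Int.cast_neg, neg_neg]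
      refine h1.trans ?_
      rw [Real.exp_neg, Real.exp_log (by norm_num), show (2⁻¹ : ℝ≥0∞) = ENNReal.ofReal 2⁻¹ by
        rw [ENNReal.ofReal_inv_of_pos (by norm_num)]; simp]
      exact ENNReal.ofReal_le_ofReal (by norm_num)
    · set lam := 1 / (4 * √S) with hlam
      have hlam0 : 0 ≤ lam := by positivity
      have hlam1 : |lam| ≤ 1 / 4 := by
        rw [abs_of_nonneg hlam0, hlam]
        exact one_div_le_one_div_of_le (by norm_num) (by linarith)
      have hE : ∀ lam' : ℝ, lam' ^ 2 = lam ^ 2 → |lam'| ≤ 1 / 4 →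
          ∑' s, elaw k q s * ENNReal.ofReal (Real.exp (lam' * ((s : ℝ) - μ)))
            ≤ ENNReal.ofReal (Real.exp (C * μ * lam ^ 2)) := by
        intro lam' h2 h3
        obtain ⟨h4, h5⟩ := hmgf k q μ h hq0 (by linarith) hm lam' h3
        unfold elaw
        rw [tsum_ofReal_mul_ofReal (h.law_nonneg hq0.le hq1) (fun s => (Real.exp_pos _).le) h4]
        rw [h2] at h5
        exact ENNReal.ofReal_le_ofReal h5
      refine (Ex_not_abs_le hlam0 (hE lam rfl hlam1) (hE (-lam) (neg_sq _) (by rwa [abs_neg])) n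
        _).trans (ENNReal.ofReal_le_ofReal ?_)
      have e1 : n * (C * μ * lam ^ 2) - lam * (A₁ * √S) ≤ -3 := by
        have h1 : lam ^ 2 = 1 / (16 * S) := by
          rw [hlam, div_pow, mul_pow, Real.sq_sqrt (by linarith)]; norm_num
        have h2 : lam * (A₁ * √S) = A₁ / 4 := by rw [hlam]; field_simp
        have h3 : n * (C * μ * lam ^ 2) ≤ C / 16 := by
          rw [h1]
          have h4 : n * μ ≤ S := by linarith
          have h5 := mul_le_mul_of_nonneg_left h4 hC
          calc _ = C * (n * μ) / (16 * S) := by ring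
            _ ≤ C * S / (16 * S) := by gcongr
            _ = _ := by field_simp
        rw [h2]
        linarith
      have h8 : Real.exp (-3) * Real.exp 3 = 1 := by rw [← Real.exp_add]; simp
      have h10 : (8 : ℝ) ≤ Real.exp 3 := by
        have := Real.quadratic_le_exp_of_nonneg (x := 3) (by norm_num)
        linarith
      have h11 := mul_le_mul_of_nonneg_left h10 (Real.exp_pos (-3)).le
      have h12 := Real.exp_le_exp.2 e1
      linarith
    · intro l hl hQ
      rw [abs_le] at hQ
      set z : ℤ := y - x + (n + 1 : ℕ) - hsum (fun s => (s : ℤ)) l with hz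
      have hzS : (z : ℝ) = S - hsum (fun s => (s : ℤ)) l := by rw [hz, hSd]; push_cast; ring
      have hlo : (l₀ : ℝ) ≤ z := by rw [hzS]; linarith [hQ.2]
      have hhi : (z : ℝ) ≤ R * √S := by
        have h1 : (z : ℝ) ≤ 2 * (A₁ * √S) + l₀ := by rw [hzS]; linarith [hQ.1]
        have h2 := mul_le_mul_of_nonneg_left hsS1 hl₀0
        rw [hR]
        have h3 : 0 ≤ l₀ * √S := by positivity
        linarith
      have hz0 : (l₀ : ℤ) ≤ z := by exact_mod_cast hlo
      have hzt : ((z.toNat : ℕ) : ℤ) = z := Int.toNat_of_nonneg (by omega)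
      refine ⟨z.toNat, ?_, ?_⟩
      · have h3 : hsum stp l = hsum (fun s => (s : ℤ)) l - n := by rw [hsum_stp, hl]
        rw [hsum_neg, h3]
        simp only [Pi.neg_apply, stp]
        rw [hzt, hz]
        push_cast
        ring
      · refine ENNReal.ofReal_le_ofReal (le_trans ?_ (h.le_law hq0.le hq1 (by omega)))
        have h4 : Real.exp (-(K * √((n + 1 : ℕ) : ℝ))) ≤ q ^ z.toNat := by
          calc _ ≤ Real.exp (-(2 * √v)) ^ z.toNat := by
                rw [← Real.exp_nat_mul]
                refine Real.exp_le_exp.2 ?_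
                have h6 : ((z.toNat : ℕ) : ℝ) = z := by exact_mod_cast hzt
                rw [h6, hv, Real.sqrt_div (by positivity), Real.sqrt_mul (by positivity), hK]
                have h7 := mul_le_mul_of_nonneg_left hhi
                  (by positivity : 0 ≤ 2 * (√(8 * B) * √((n + 1 : ℕ) : ℝ) / √S))
                have h8 : 2 * (√(8 * B) * √((n + 1 : ℕ) : ℝ) / √S) * (R * √S)
                  = 2 * √(8 * B) * R * √((n + 1 : ℕ) : ℝ) := by field_simp
                linarith
            _ ≤ _ := by gcongr
        have h5 : gen k q ≤ 2 := by
          have := h.gen_le_one_add hq0.le (by linarith)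
          linarith
        have h6 := h.gen_pos hq0.le hq1
        rw [hw]
        calc _ = 1 / 2 * Real.exp (-(K * √((n + 1 : ℕ) : ℝ))) / 2 := by ring
          _ ≤ 1 / 2 * q ^ z.toNat / gen k q := by gcongr
  -- Each step has exponential moment at most `2 / exp 1 ≤ 1`, so the numerator needs neither
  -- survival nor the end point.
  have hnum : Ex (elaw k q) (n + 1) (fun l => ENNReal.ofReal (Real.exp (hsum stp (block X T l) : ℝ))
      * one (Br stp x y l)) ≤ 1 := by
    have hE := h.tsum_exp_stp_le hq0 hq1 (lam := 1) (by
      have : Real.exp 1 ≤ 3 := by linarith [Real.exp_one_lt_d9]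
      have := mul_le_mul_of_nonneg_left this (by positivity : 0 ≤ 2 * B * q)
      linarith)
    have hE1 : ∑' s, elaw k q s * ENNReal.ofReal (Real.exp (1 * (stp s : ℝ))) ≤ 1 := by
      refine hE.trans ?_
      rw [ENNReal.ofReal_le_one, Real.exp_neg, ← div_eq_mul_inv, div_le_one (Real.exp_pos _)]
      linarith [Real.add_one_le_exp (1 : ℝ)]
    have hprod := Ex_prod_block hp ({()} : Finset Unit) (n + 1) (fun _ => X) (fun _ => T)
      (fun _ _ => hXT) (fun _ _ => hTL) (fun i _ j _ hij => absurd rfl hij)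
      (fun _ l => ENNReal.ofReal (Real.exp (1 * (l.map fun s => (stp s : ℝ)).sum)))
    simp only [Finset.prod_singleton] at hprod
    rw [Ex_exp_sum] at hprod
    have hcast : ∀ l : List ℕ, (hsum stp l : ℝ) = 1 * (l.map fun s => (stp s : ℝ)).sum := by
      intro l
      induction l with
      | nil => simp
      | cons s l ih => rw [hsum_cons, List.map_cons, List.sum_cons]; push_cast; rw [ih]; ring
    calc _ ≤ Ex (elaw k q) (n + 1) (fun l =>
          ENNReal.ofReal (Real.exp (1 * ((block X T l).map fun s => (stp s : ℝ)).sum))) := by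
          refine Ex_mono _ fun l _ => ?_
          rw [hcast]
          exact mul_le_of_le_one_right' (WalkBridge.one_le _)
      _ ≤ 1 := by
          rw [hprod]
          exact pow_le_one' hE1 _
  refine h.ewt_le_of_elaw_le hq0 hq1 (hnum.trans ?_)
  refine le_trans ?_ (mul_le_mul' le_rfl hlow)
  rw [← ENNReal.ofReal_mul (by norm_num), ← ENNReal.ofReal_mul (by positivity),
    ← ENNReal.ofReal_one]
  refine ENNReal.ofReal_le_ofReal ?_
  have h2 : 1 ≤ Real.exp (D * √((n + 1 : ℕ) : ℝ)) * Real.exp (-(K * √((n + 1 : ℕ) : ℝ))) := by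
    rw [← Real.exp_add]
    refine Real.one_le_exp ?_
    have : 0 ≤ 8 * √((n + 1 : ℕ) : ℝ) := by positivity
    rw [hD]
    linarith
  have hD8 : 8 ≤ D := by rw [hD]; linarith
  calc (1 : ℝ) ≤ D / 8 * 1 := by linarith
    _ ≤ D / 8 * (Real.exp (D * √((n + 1 : ℕ) : ℝ)) * Real.exp (-(K * √((n + 1 : ℕ) : ℝ)))) := by
        gcongr
    _ = _ := by rw [hw]; ring

/-! ### Exponential estimates for all bridges -/

/-- The walk exceeds both its endpoints by more than `d`, upwards or downwards; positions are
relative to the starting point and `e` is the relative end point. -/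
def Exc (L : ℕ) (e : ℤ) (d : ℝ) (l : List ℕ) : Prop :=
  ∃ t ≤ L, max 0 (e : ℝ) + d < hsum stp (l.take t) ∨ (hsum stp (l.take t) : ℝ) < min 0 (e : ℝ) - d

/-- Exponential bounds for the descents over disjoint intervals of the nonnegative bridges. -/
def DescentBound (k : ℕ → ℝ) (L : ℕ) (x y : ℤ) (D lam₁ : ℝ) : Prop :=
  ∀ lam, 0 ≤ lam → lam ≤ lam₁ →
    ∀ (r : ℕ) (X Y : Fin r → ℕ) (T : List ℕ → Fin r → ℕ), (∀ l i, X i ≤ T l i) →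
      (∀ l i, T l i ≤ Y i) → (∀ i, Y i ≤ L) → (∀ i j, i ≠ j → Y i ≤ X j ∨ Y j ≤ X i) →
      Ex (ewt k) L (fun l =>
          ENNReal.ofReal (Real.exp (lam * ∑ i, -(hsum stp (block (X i) (T l i) l) : ℝ)))
          * one (Br stp x y l))
        ≤ ENNReal.ofReal (D ^ (r + 1) * Real.exp (D * (lam ^ 2 * L + lam * max (x - y : ℝ) 0)))
          * Pb (ewt k) stp L x y

/-- Gaussian bounds for the excursions of the nonnegative bridges away from their end points. -/
def ExcursionBound (k : ℕ → ℝ) (L : ℕ) (x y : ℤ) (D c : ℝ) : Prop :=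
  ∀ h : ℝ, 0 < h → Ex (ewt k) L (fun l => one (Exc L (y - x) (h * √L) l) * one (Br stp x y l))
    ≤ ENNReal.ofReal (D * Real.exp (-(c * h ^ 2))) * Pb (ewt k) stp L x y

section

variable {k : ℕ → ℝ} {L : ℕ} {x y : ℤ} {D lam₁ c : ℝ}

theorem DescentBound.mono (h : DescentBound k L x y D lam₁) {D' lam' : ℝ} (hD : 0 ≤ D) (hDD : D ≤ D')
    (hl : lam' ≤ lam₁) : DescentBound k L x y D' lam' := by
  intro lam h0 h1 r X Y T hXT hTY hYL hdisj
  refine (h lam h0 (h1.trans hl) r X Y T hXT hTY hYL hdisj).trans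
    (mul_le_mul' (ENNReal.ofReal_le_ofReal ?_) le_rfl)
  have : 0 ≤ lam ^ 2 * L + lam * max (x - y : ℝ) 0 := by positivity
  have := hD.trans hDD
  gcongr

theorem ExcursionBound.mono (h : ExcursionBound k L x y D c) {D' c' : ℝ} (hD : 0 ≤ D) (hDD : D ≤ D')
    (hc : c' ≤ c) : ExcursionBound k L x y D' c' := by
  intro t ht
  refine (h t ht).trans (mul_le_mul' (ENNReal.ofReal_le_ofReal ?_) le_rfl)
  have : c' * t ^ 2 ≤ c * t ^ 2 := by gcongr
  have := hD.trans hDD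
  gcongr

theorem neg_length_le_hsum (l : List ℕ) : -(l.length : ℤ) ≤ hsum stp l := by
  rw [hsum_stp_eq]; omega

theorem hsum_take_add_block {l : List ℕ} (hl : l.length = L) (t : ℕ) :
    hsum stp (l.take t) + hsum stp (block t L l) = hsum stp l := by
  have : block t L l = l.drop t := by
    rw [block, List.take_of_length_le (by simp; omega)]
  rw [this, ← hsum_append, List.take_append_drop]

theorem block_zero (t : ℕ) (l : List ℕ) : block 0 t l = l.take t := by simp [block]

/-- Excursions are bounded by the length. -/
theorem not_exc {l : List ℕ} (hl : l.length = L) (hb : Br stp x y l) {d : ℝ} (hd : (L : ℝ) ≤ d) :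
    ¬ Exc L (y - x) d l := by
  rintro ⟨t, ht, h⟩
  have h1 := neg_length_le_hsum (l.take t)
  have h2 := neg_length_le_hsum (block t L l)
  have h3 := hsum_take_add_block hl t
  have h4 := hb.2
  rw [block_length hl le_rfl] at h2
  rw [List.length_take, hl, min_eq_left ht] at h1
  have h5 : (hsum stp (l.take t) : ℝ) ≤ ((y - x : ℤ) : ℝ) + L := by
    have : hsum stp (l.take t) ≤ y - x + L := by omega
    exact_mod_cast this
  have h6 : -(L : ℝ) ≤ hsum stp (l.take t) := by
    have : -(L : ℤ) ≤ hsum stp (l.take t) := by omega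
    exact_mod_cast this
  rcases h with h | h
  · linarith [le_max_right 0 ((y - x : ℤ) : ℝ)]
  · linarith [min_le_left 0 ((y - x : ℤ) : ℝ)]

theorem Ex_mul_one_br_eq_zero {p : ℕ → ℝ≥0∞} {P : List ℕ → Prop}
    (h : ∀ l, l.length = L → Br stp x y l → ¬ P l) :
    Ex p L (fun l => one (P l) * one (Br stp x y l)) = 0 := by
  have : Ex p L (fun l => one (P l) * one (Br stp x y l)) = Ex p L (fun _ => 0 * 0) := by
    refine Ex_congr p fun l hl => ?_
    by_cases hb : Br stp x y l
    · rw [one_false (h l hl hb)]; simp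
    · rw [one_false hb]; simp
  rw [this, Ex_const_mul, zero_mul]

/-- Excursion bounds are only needed for `h₀ ≤ h ≤ √L`. -/
theorem excursionBound_of {h₀ : ℝ} (hc : 0 ≤ c) (hD : Real.exp (c * h₀ ^ 2) ≤ D)
    (H : ∀ h : ℝ, 0 < h → h₀ ≤ h → h ≤ √L →
      Ex (ewt k) L (fun l => one (Exc L (y - x) (h * √L) l) * one (Br stp x y l))
        ≤ ENNReal.ofReal (D * Real.exp (-(c * h ^ 2))) * Pb (ewt k) stp L x y) :
    ExcursionBound k L x y D c := by
  intro h hh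
  rcases lt_or_ge (√(L : ℝ)) h with h1 | h1
  · rw [Ex_mul_one_br_eq_zero fun l hl hb => not_exc hl hb ?_]
    · exact zero_le
    · calc (L : ℝ) = √L * √L := (Real.mul_self_sqrt (Nat.cast_nonneg L)).symm
        _ ≤ h * √L := by gcongr
  rcases le_or_gt h₀ h with h2 | h2
  · exact H h hh h2 h1
  · calc _ ≤ Ex (ewt k) L (fun l => one (Br stp x y l)) :=
          Ex_mono _ fun l _ => mul_le_of_le_one_left' (WalkBridge.one_le _)
      _ = 1 * Pb (ewt k) stp L x y := by rw [one_mul, Pb]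
      _ ≤ _ := by
          refine mul_le_mul' ?_ le_rfl
          rw [← ENNReal.ofReal_one]
          refine ENNReal.ofReal_le_ofReal ?_
          calc (1 : ℝ) = Real.exp (c * h ^ 2) * Real.exp (-(c * h ^ 2)) := by
                rw [← Real.exp_add]; simp
            _ ≤ D * Real.exp (-(c * h ^ 2)) := by
                refine mul_le_mul_of_nonneg_right (le_trans (Real.exp_le_exp.2 ?_) hD)
                  (Real.exp_pos _).le
                gcongr

theorem sum_neg_hsum_le {l : List ℕ} (hl : l.length = L) {r : ℕ} {X T Y : Fin r → ℕ}
    (hTY : ∀ i, T i ≤ Y i) (hYL : ∀ i, Y i ≤ L)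
    (hdisj : ∀ i j, i ≠ j → Y i ≤ X j ∨ Y j ≤ X i) :
    ∑ i, -(hsum stp (block (X i) (T i) l) : ℝ) ≤ L := by
  have h1 := sum_length_le Finset.univ L X T (fun i _ => (hTY i).trans (hYL i))
    (fun i _ j _ hij => (hdisj i j hij).imp (fun h => (hTY i).trans h) (fun h => (hTY j).trans h))
  calc _ ≤ ∑ i, ((T i - X i : ℕ) : ℝ) := by
        refine Finset.sum_le_sum fun i _ => ?_
        have h2 := neg_length_le_hsum (block (X i) (T i) l)
        rw [block_length hl ((hTY i).trans (hYL i))] at h2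
        have : -hsum stp (block (X i) (T i) l) ≤ ((T i - X i : ℕ) : ℤ) := by linarith
        exact_mod_cast this
    _ ≤ _ := by exact_mod_cast h1

/-- A pointwise bound on the descents gives an exponential bound. -/
theorem descentBound_of_le (hD : 1 ≤ D)
    (H : ∀ lam, 0 ≤ lam → lam ≤ lam₁ →
      Real.exp (lam * L) ≤ D * Real.exp (D * (lam ^ 2 * L + lam * max (x - y : ℝ) 0))) :
    DescentBound k L x y D lam₁ := by
  intro lam h0 h1 r X Y T hXT hTY hYL hdisj
  unfold Pb
  rw [← Ex_const_mul]
  refine Ex_mono _ fun l hl => mul_le_mul' (ENNReal.ofReal_le_ofReal ?_) le_rfl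
  have h2 := mul_le_mul_of_nonneg_left (sum_neg_hsum_le hl (hTY l) hYL hdisj) h0
  refine (Real.exp_le_exp.2 h2).trans ((H lam h0 h1).trans ?_)
  refine mul_le_mul_of_nonneg_right ?_ (Real.exp_pos _).le
  exact le_self_pow₀ hD (by omega)

/-- Bounded lengths allow only bounded descents and excursions, so a large constant suffices. -/
theorem exists_bounds_short (L₀ : ℕ) :
    ∃ D ≥ (1 : ℝ), ∀ k, ∀ L ≤ L₀, ∀ x y : ℤ,
      DescentBound k L x y D 1 ∧ ExcursionBound k L x y D 1 := by
  refine ⟨Real.exp L₀, Real.one_le_exp (Nat.cast_nonneg _), fun k L hL x y => ⟨?_, ?_⟩⟩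
  · refine descentBound_of_le (Real.one_le_exp (Nat.cast_nonneg _)) fun lam h0 h1 => ?_
    have h2 : Real.exp (lam * L) ≤ Real.exp L₀ := by
      refine Real.exp_le_exp.2 ?_
      calc lam * L ≤ 1 * L := by gcongr
        _ ≤ _ := by rw [one_mul]; exact_mod_cast hL
    have h3 : 0 ≤ Real.exp (L₀ : ℝ) * (lam ^ 2 * L + lam * max (x - y : ℝ) 0) := by positivity
    exact h2.trans (le_mul_of_one_le_right (Real.exp_pos _).le (Real.one_le_exp h3))
  · refine excursionBound_of (h₀ := √L₀) zero_le_one ?_ fun h hh h1 h2 => ?_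
    · rw [one_mul, Real.sq_sqrt (Nat.cast_nonneg _)]
    · have h3 : √(L : ℝ) ≤ √(L₀ : ℝ) := Real.sqrt_le_sqrt (by exact_mod_cast hL)
      have h4 : h ^ 2 = L₀ := by
        rw [le_antisymm (h2.trans h3) h1, Real.sq_sqrt (Nat.cast_nonneg _)]
      rw [one_mul, h4, ← Real.exp_add, add_neg_cancel, Real.exp_zero, ENNReal.ofReal_one, one_mul]
      exact Ex_mono _ fun l _ => mul_le_of_le_one_left' (WalkBridge.one_le _)

theorem one_exists_le_sum (L : ℕ) (P : ℕ → Prop) :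
    one (∃ t ≤ L, P t) ≤ ∑ t ∈ Finset.range (L + 1), one (P t) := by
  by_cases h : ∃ t ≤ L, P t
  · obtain ⟨t, ht, hP⟩ := h
    rw [one_true ⟨t, ht, hP⟩, ← one_true hP]
    exact Finset.single_le_sum (f := fun t => one (P t)) (fun _ _ => zero_le)
      (Finset.mem_range.2 (by omega))
  · rw [one_false h]
    exact zero_le

/-- A crude exponential bound for one-block functionals, lossy by `exp (D √L)`, gives Gaussian
bounds for excursions that force a large value of one of these functionals. -/
theorem Ex_one_exists_le (σ : ℝ) (hD : 1 ≤ D)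
    (H : ∀ X T : ℕ, X ≤ T → T ≤ L →
      Ex (ewt k) L (fun l => ENNReal.ofReal (Real.exp (σ * hsum stp (block X T l)))
        * one (Br stp x y l)) ≤ ENNReal.ofReal (D * Real.exp (D * √L)) * Pb (ewt k) stp L x y)
    {h : ℝ} (hh : 0 < h) (hh0 : 2 * (D + 2) ≤ h) (hhL : h ≤ √L) :
    Ex (ewt k) L (fun l => one (∃ t ≤ L, h * √L ≤ σ * hsum stp (block 0 t l)
        ∨ h * √L ≤ σ * hsum stp (block t L l)) * one (Br stp x y l))
      ≤ ENNReal.ofReal (2 * D * Real.exp (-(1 / 2 * h ^ 2))) * Pb (ewt k) stp L x y := by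
  have h1 : ∀ X T : ℕ, X ≤ T → T ≤ L →
      Ex (ewt k) L (fun l => one (h * √L ≤ σ * hsum stp (block X T l)) * one (Br stp x y l))
        ≤ ENNReal.ofReal (D * Real.exp (D * √L - h * √L)) * Pb (ewt k) stp L x y := by
    intro X T hXT hTL
    calc _ ≤ Ex (ewt k) L (fun l => ENNReal.ofReal (Real.exp (-(1 * (h * √L))))
          * (ENNReal.ofReal (Real.exp (σ * hsum stp (block X T l))) * one (Br stp x y l))) := by
          refine Ex_mono _ fun l _ => ?_
          rw [← mul_assoc]
          refine mul_le_mul' ?_ le_rfl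
          have := one_le_exp_mul_exp (lam := 1) (T := h * √L) (M := σ * hsum stp (block X T l))
            zero_le_one
          rwa [one_mul (σ * _)] at this
      _ ≤ ENNReal.ofReal (Real.exp (-(1 * (h * √L))))
          * (ENNReal.ofReal (D * Real.exp (D * √L)) * Pb (ewt k) stp L x y) := by
          rw [Ex_const_mul]
          exact mul_le_mul' le_rfl (H X T hXT hTL)
      _ = _ := by
          rw [← mul_assoc, ← ENNReal.ofReal_mul (Real.exp_pos _).le]
          congr 2
          rw [sub_eq_add_neg, Real.exp_add, one_mul]
          ring
  calc _ ≤ Ex (ewt k) L (fun l => ∑ t ∈ Finset.range (L + 1),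
        (one (h * √L ≤ σ * hsum stp (block 0 t l)) * one (Br stp x y l)
          + one (h * √L ≤ σ * hsum stp (block t L l)) * one (Br stp x y l))) := by
        refine Ex_mono _ fun l _ => ?_
        simp only [← add_mul]
        rw [← Finset.sum_mul]
        refine mul_le_mul' ((one_exists_le_sum L _).trans (Finset.sum_le_sum fun t _ =>
          one_or_le _ _)) le_rfl
    _ ≤ ∑ t ∈ Finset.range (L + 1),
        (ENNReal.ofReal (2 * D * Real.exp (D * √L - h * √L)) * Pb (ewt k) stp L x y) := by
        rw [Ex_finset_sum]
        refine Finset.sum_le_sum fun t ht => ?_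
        have ht' : t ≤ L := by have := Finset.mem_range.1 ht; omega
        rw [Ex_add]
        refine (add_le_add (h1 0 t (Nat.zero_le _) ht') (h1 t L ht' le_rfl)).trans (le_of_eq ?_)
        rw [← add_mul, ← ENNReal.ofReal_add (by positivity) (by positivity)]
        ring_nf
    _ = ENNReal.ofReal ((L + 1) * (2 * D * Real.exp (D * √L - h * √L)))
          * Pb (ewt k) stp L x y := by
        rw [Finset.sum_const, Finset.card_range, nsmul_eq_mul, ← mul_assoc,
          ENNReal.ofReal_mul (by positivity : (0 : ℝ) ≤ L + 1)]
        congr 2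
        rw [← Nat.cast_succ, ENNReal.ofReal_natCast]
    _ ≤ _ := by
        refine mul_le_mul' (ENNReal.ofReal_le_ofReal ?_) le_rfl
        have hs := Real.sqrt_nonneg (L : ℝ)
        -- The union bound and the loss cost `exp ((D + 2) √L)`. Since `h ≥ 2 (D + 2)`, this uses
        -- half of `h √L`, and the other half is at least `h² / 2`.
        have h2 : (L : ℝ) + 1 ≤ Real.exp (2 * √L) := by
          have h3 := Real.quadratic_le_exp_of_nonneg (x := 2 * √L) (by positivity)
          rw [mul_pow, Real.sq_sqrt (Nat.cast_nonneg _)] at h3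
          have : (0 : ℝ) ≤ L := Nat.cast_nonneg _
          linarith
        have h3 : 2 * √L + (D * √L - h * √L) ≤ -(1 / 2 * h ^ 2) := by
          have h4 := mul_le_mul_of_nonneg_right hh0 hs
          have h5 := mul_le_mul_of_nonneg_left hhL hh.le
          rw [sq]
          linarith
        calc _ ≤ Real.exp (2 * √L) * (2 * D * Real.exp (D * √L - h * √L)) := by gcongr
          _ = 2 * D * Real.exp (2 * √L + (D * √L - h * √L)) := by rw [Real.exp_add]; ring
          _ ≤ _ := by gcongr

end

/-- The loss `exp (D √L)` matters only when the descents exceed `2 D √L`, and there `λ ≤ 1 / 2`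
compensates it; smaller descents give `2 λ √L ≤ 1 + λ² L`. As `y ≥ x`, an excursion below `x` is a
descent from the start, and one above `y` a descent to the end. -/
theorem exists_bounds_steep (B : ℝ) (l₀ : ℕ) :
    ∃ B₀ ≥ (1 : ℝ), ∃ D ≥ (1 : ℝ), ∀ k, Wt k B l₀ → ∀ L : ℕ, 2 ≤ L → ∀ x y : ℤ, 0 ≤ x → 0 ≤ y →
      B₀ * L ≤ (y : ℝ) - x + L →
      DescentBound k L x y D (1 / 2) ∧ ExcursionBound k L x y D (1 / 2) := by
  obtain ⟨B₀, hB₀, D, hD, H⟩ := exists_steep B l₀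
  set E := D ^ 2 with hE
  have hE1 : 1 ≤ E := one_le_pow₀ hD
  have hDE : D ≤ E := by rw [hE]; nlinarith
  set h₀ := 2 * (E + 2) with hh₀
  set D' := 2 * Real.exp D + 2 * E + Real.exp (1 / 2 * h₀ ^ 2) with hD'
  have hp1 := Real.exp_pos D
  have hp2 := Real.exp_pos (1 / 2 * h₀ ^ 2)
  refine ⟨B₀, hB₀, D', by rw [hD']; linarith, ?_⟩
  intro k h L hL x y hx hy hS
  have hS' := H k h L hL x y hx hy hS
  have hyx : (0 : ℝ) ≤ y - x := by
    have : (0 : ℝ) ≤ L := Nat.cast_nonneg _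
    nlinarith
  constructor
  · intro lam h0 h1 r X Y T hXT hTY hYL hdisj
    set Sg : List ℕ → ℝ := fun l => ∑ i, -(hsum stp (block (X i) (T l i) l) : ℝ) with hSg
    have hpt : ∀ l, Real.exp (lam * Sg l)
        ≤ Real.exp (lam * (2 * D * √L)) + Real.exp (-(D * √L)) * Real.exp (Sg l) := by
      intro l
      have hDL : 0 ≤ D * √L := by positivity
      rcases le_or_gt (Sg l) (2 * D * √L) with h2 | h2
      · have : lam * Sg l ≤ lam * (2 * D * √L) := by gcongr
        have := Real.exp_le_exp.2 this
        have := mul_pos (Real.exp_pos (-(D * √L))) (Real.exp_pos (Sg l))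
        linarith
      · rw [← Real.exp_add]
        have : lam * Sg l ≤ -(D * √L) + Sg l := by
          have := mul_le_mul_of_nonneg_right h1 (by linarith : 0 ≤ Sg l)
          linarith
        have := Real.exp_le_exp.2 this
        have := Real.exp_pos (lam * (2 * D * √L))
        linarith
    calc _ ≤ Ex (ewt k) L (fun l => ENNReal.ofReal (Real.exp (lam * (2 * D * √L)))
            * one (Br stp x y l) + ENNReal.ofReal (Real.exp (-(D * √L)))
            * (ENNReal.ofReal (Real.exp (Sg l)) * one (Br stp x y l))) := by
          refine Ex_mono _ fun l _ => ?_
          rw [← mul_assoc (ENNReal.ofReal (Real.exp (-(D * √L)))), ← add_mul]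
          refine mul_le_mul' ?_ le_rfl
          rw [← ENNReal.ofReal_mul (Real.exp_pos _).le,
            ← ENNReal.ofReal_add (Real.exp_pos _).le (by positivity)]
          exact ENNReal.ofReal_le_ofReal (hpt l)
      _ ≤ ENNReal.ofReal (Real.exp (lam * (2 * D * √L))) * Pb (ewt k) stp L x y
          + ENNReal.ofReal (Real.exp (-(D * √L)))
            * (ENNReal.ofReal (D ^ (r + 1) * Real.exp (D * √L)) * Pb (ewt k) stp L x y) := by
          rw [Ex_add, Ex_const_mul, Ex_const_mul]
          exact add_le_add le_rfl (mul_le_mul' le_rfl (hS' r X Y T hXT hTY hYL hdisj))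
      _ = ENNReal.ofReal (Real.exp (lam * (2 * D * √L)) + D ^ (r + 1)) * Pb (ewt k) stp L x y := by
          rw [← mul_assoc (ENNReal.ofReal (Real.exp (-(D * √L)))),
            ← ENNReal.ofReal_mul (Real.exp_pos _).le, ← add_mul, ← ENNReal.ofReal_add (Real.exp_pos _).le (by positivity)]
          congr 3
          rw [mul_left_comm, ← Real.exp_add]
          simp
      _ ≤ _ := by
          refine mul_le_mul' (ENNReal.ofReal_le_ofReal ?_) le_rfl
          set u := lam ^ 2 * L + lam * max (x - y : ℝ) 0 with hu
          have hu0 : 0 ≤ u := by positivity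
          have h2 : lam * (2 * D * √L) ≤ D + D * u := by
            have h3 : 2 * (lam * √L) ≤ 1 + lam ^ 2 * L := by
              have := sq_nonneg (lam * √L - 1)
              have h4 : (lam * √L) ^ 2 = lam ^ 2 * L := by
                rw [mul_pow, Real.sq_sqrt (Nat.cast_nonneg _)]
              nlinarith
            have h5 : lam ^ 2 * L ≤ u := by
              rw [hu]
              have : 0 ≤ lam * max (x - y : ℝ) 0 := by positivity
              linarith
            have := mul_le_mul_of_nonneg_left (h3.trans (add_le_add le_rfl h5))
              (by linarith : 0 ≤ D)
            linarith
          have h3 : Real.exp (lam * (2 * D * √L)) ≤ Real.exp D * Real.exp (D * u) := by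
            rw [← Real.exp_add]
            exact Real.exp_le_exp.2 h2
          have h4 : 1 ≤ Real.exp (D * u) := Real.one_le_exp (by positivity)
          have h5 : Real.exp D ≤ Real.exp D ^ (r + 1) :=
            le_self_pow₀ (Real.one_le_exp (by linarith)) (by omega)
          have h6 : D ^ (r + 1) ≤ Real.exp D ^ (r + 1) := by
            have := Real.add_one_le_exp D
            gcongr
            linarith
          have h7 : 2 * Real.exp D ^ (r + 1) ≤ D' ^ (r + 1) := by
            calc _ ≤ 2 ^ (r + 1) * Real.exp D ^ (r + 1) := by
                  gcongr
                  exact le_self_pow₀ (by norm_num) (by omega)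
              _ = (2 * Real.exp D) ^ (r + 1) := (mul_pow _ _ _).symm
              _ ≤ _ := by
                  gcongr
                  rw [hD']; linarith
          have hDD' : D ≤ D' := by rw [hD']; linarith
          calc _ ≤ Real.exp D ^ (r + 1) * Real.exp (D * u) + Real.exp D ^ (r + 1) * Real.exp (D * u) := by
                refine add_le_add (h3.trans (by gcongr)) (h6.trans ?_)
                exact le_mul_of_one_le_right (by positivity) h4
            _ = 2 * Real.exp D ^ (r + 1) * Real.exp (D * u) := by ring
            _ ≤ _ := by gcongr
  · refine excursionBound_of (h₀ := h₀) (by norm_num) (by rw [hD']; linarith) fun h hh h1 h2 => ?_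
    have hone : ∀ X T : ℕ, X ≤ T → T ≤ L →
        Ex (ewt k) L (fun l => ENNReal.ofReal (Real.exp (-1 * hsum stp (block X T l)))
          * one (Br stp x y l)) ≤ ENNReal.ofReal (E * Real.exp (E * √L)) * Pb (ewt k) stp L x y := by
      intro X T hXT hTL
      have := hS' 1 (fun _ => X) (fun _ => T) (fun _ _ => T) (fun _ _ => hXT) (fun _ _ => le_rfl)
        (fun _ => hTL) (fun i j hij => absurd (Subsingleton.elim i j) hij)
      simp only [Finset.univ_unique, Finset.sum_const, Finset.card_singleton, one_smul] at this
      simp only [neg_one_mul]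
      refine this.trans (mul_le_mul' (ENNReal.ofReal_le_ofReal ?_) le_rfl)
      norm_num only
      rw [← hE]
      gcongr
    calc _ ≤ Ex (ewt k) L (fun l => one (∃ t ≤ L, h * √L ≤ (-1 : ℝ) * hsum stp (block 0 t l)
            ∨ h * √L ≤ (-1 : ℝ) * hsum stp (block t L l)) * one (Br stp x y l)) := by
          refine Ex_mono _ fun l hl => ?_
          by_cases hb : Br stp x y l
          · refine mul_le_mul' (one_mono fun hexc => ?_) le_rfl
            obtain ⟨t, ht, hx⟩ := hexc
            refine ⟨t, ht, ?_⟩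
            have h3 := hsum_take_add_block hl t
            have h4 := hb.2
            have h5 : (hsum stp (l.take t) : ℝ) + hsum stp (block t L l) = y - x := by
              have : hsum stp (l.take t) + hsum stp (block t L l) = y - x := by omega
              exact_mod_cast this
            rw [block_zero]
            push_cast at hx
            rw [max_eq_right hyx, min_eq_left hyx] at hx
            rcases hx with hx | hx
            · right; linarith
            · left; linarith
          · rw [one_false hb, mul_zero]
            exact zero_le
      _ ≤ _ := Ex_one_exists_le (-1) hE1 hone hh (by rw [← hh₀]; exact h1) h2
      _ ≤ _ := by
          refine mul_le_mul' (ENNReal.ofReal_le_ofReal ?_) le_rfl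
          have : 2 * E ≤ D' := by rw [hD']; linarith
          gcongr

/-- Here `x - y ≥ L / 2`, so the trivial bound `L` on the descents suffices. An excursion above `x`
or below `y` forces an ascent, which has the exponential moments of `exists_flat`. -/
theorem exists_bounds_flat (B : ℝ) (l₀ : ℕ) :
    ∃ ε₀ > (0 : ℝ), ∃ L₀ : ℕ, ∃ D ≥ (1 : ℝ), ∀ k, Wt k B l₀ → ∀ L : ℕ, L₀ ≤ L → ∀ x y : ℤ,
      0 ≤ x → 0 ≤ y → (y : ℝ) - x + L ≤ ε₀ * L →
      DescentBound k L x y D 1 ∧ ExcursionBound k L x y D (1 / 2) := by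
  obtain ⟨ε₀, hε₀, hε₀1, S₀, hS₀, E, hE1, H⟩ := exists_flat B l₀
  set h₀ := 2 * (E + 2) with hh₀
  set D := 2 * E + Real.exp (1 / 2 * h₀ ^ 2) with hD
  have hp2 := Real.exp_pos (1 / 2 * h₀ ^ 2)
  refine ⟨ε₀, hε₀, ⌈S₀ ^ 2⌉₊, D, by rw [hD]; linarith, ?_⟩
  intro k hk L hL x y hx hy hS
  have hL0 : (0 : ℝ) ≤ L := Nat.cast_nonneg _
  have hhalf : (y : ℝ) - x ≤ -(L / 2) := by
    have := mul_le_mul_of_nonneg_right hε₀1 hL0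
    linarith
  have hyx : (y : ℝ) - x ≤ 0 := by linarith
  constructor
  · refine descentBound_of_le (by rw [hD]; linarith) fun lam h0 h1 => ?_
    have hDp : 1 ≤ D := by rw [hD]; linarith
    have h2 : Real.exp (lam * L) ≤ Real.exp (D * (lam ^ 2 * L + lam * max (x - y : ℝ) 0)) := by
      refine Real.exp_le_exp.2 ?_
      have h3 : (L : ℝ) / 2 ≤ max (x - y : ℝ) 0 := le_max_of_le_left (by linarith)
      have h4 := mul_le_mul_of_nonneg_left h3 h0
      have h5 : 0 ≤ lam ^ 2 * L := by positivity
      have h6 : 2 ≤ D := by rw [hD]; linarith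
      calc lam * L ≤ 2 * (lam ^ 2 * L + lam * max (x - y : ℝ) 0) := by linarith
        _ ≤ _ := by gcongr
    exact h2.trans (le_mul_of_one_le_left (Real.exp_pos _).le hDp)
  · refine excursionBound_of (h₀ := h₀) (by norm_num) (by rw [hD]; linarith) fun h hh h1 h2 => ?_
    have hexc : ∀ l, l.length = L → Br stp x y l → Exc L (y - x) (h * √L) l →
        ∃ t ≤ L, h * √L < hsum stp (block 0 t l) ∨ h * √L < hsum stp (block t L l) := by
      rintro l hl hb ⟨t, ht, hx⟩
      refine ⟨t, ht, ?_⟩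
      have h3 := hsum_take_add_block hl t
      have h4 := hb.2
      have h5 : (hsum stp (l.take t) : ℝ) + hsum stp (block t L l) = y - x := by
        have : hsum stp (l.take t) + hsum stp (block t L l) = y - x := by omega
        exact_mod_cast this
      rw [block_zero]
      push_cast at hx
      rw [max_eq_left hyx, min_eq_right hyx] at hx
      rcases hx with hx | hx
      · left; linarith
      · right; linarith
    -- No ascent exceeds `y - x + L`. If this is below `S₀ ≤ √L`, no excursion of the required size
    -- exists.
    rcases lt_or_ge ((y : ℝ) - x + L) S₀ with hlt | hge
    · rw [Ex_mul_one_br_eq_zero]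
      · exact zero_le
      intro l hl hb hex
      obtain ⟨t, ht, h3⟩ := hexc l hl hb hex
      have hSL : S₀ ≤ √L := by
        refine Real.le_sqrt_of_sq_le ((Nat.le_ceil _).trans ?_)
        exact_mod_cast hL
      have hbig : (y : ℝ) - x + L < h * √L := by
        have : 1 ≤ h := by linarith
        have := mul_le_mul_of_nonneg_right this (Real.sqrt_nonneg (L : ℝ))
        linarith
      have h4 := hsum_take_add_block hl t
      have h5 := hb.2
      have h6 := neg_length_le_hsum (block t L l)
      have h7 := neg_length_le_hsum (l.take t)
      rw [block_length hl le_rfl] at h6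
      rw [List.length_take, hl, min_eq_left ht] at h7
      rw [block_zero] at h3
      have h8 : (hsum stp (l.take t) : ℝ) ≤ y - x + L := by
        have : hsum stp (l.take t) ≤ y - x + L := by omega
        exact_mod_cast this
      have h9 : (hsum stp (block t L l) : ℝ) ≤ y - x + L := by
        have : hsum stp (block t L l) ≤ y - x + L := by omega
        exact_mod_cast this
      rcases h3 with h3 | h3 <;> linarith
    · have hone := H k hk L x y hx hy hge hS
      calc _ ≤ Ex (ewt k) L (fun l => one (∃ t ≤ L, h * √L ≤ (1 : ℝ) * hsum stp (block 0 t l)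
              ∨ h * √L ≤ (1 : ℝ) * hsum stp (block t L l)) * one (Br stp x y l)) := by
            refine Ex_mono _ fun l hl => ?_
            by_cases hb : Br stp x y l
            · refine mul_le_mul' (one_mono fun hex => ?_) le_rfl
              obtain ⟨t, ht, h3⟩ := hexc l hl hb hex
              refine ⟨t, ht, ?_⟩
              rw [one_mul, one_mul]
              exact h3.imp le_of_lt le_of_lt
            · rw [one_false hb, mul_zero]
              exact zero_le
        _ ≤ _ := Ex_one_exists_le 1 hE1 (by simpa only [one_mul] using hone) hh
            (by rw [← hh₀]; exact h1) h2
        _ ≤ _ := by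
            refine mul_le_mul' (ENNReal.ofReal_le_ofReal ?_) le_rfl
            have : 2 * E ≤ D := by rw [hD]; linarith
            gcongr

/-- The tilt with mean `(y - x + L) / L` turns the bridge into one whose end points lie exactly on
the drift line, and the mean bounds confine it to a compact range. -/
theorem exists_bounds_central (B : ℝ) (l₀ : ℕ) {ε₀ : ℝ} (hε₀ : 0 < ε₀) (B₀ : ℝ) :
    ∃ L₀ : ℕ, ∃ D ≥ (1 : ℝ), ∃ c > (0 : ℝ), ∀ k, Wt k B l₀ → ∀ L : ℕ, L₀ ≤ L → ∀ x y : ℤ,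
      0 ≤ x → 0 ≤ y → ε₀ * L ≤ (y : ℝ) - x + L → (y : ℝ) - x + L ≤ B₀ * L →
      DescentBound k L x y D c ∧ ExcursionBound k L x y D c := by
  rcases lt_or_ge B 1 with hB | hB
  · exact ⟨0, 1, le_rfl, 1, one_pos, fun k h => absurd h.one_le (by linarith)⟩
  set q₀ := min (1 / 2) (ε₀ / (4 * B)) with hq₀
  have hq₀0 : 0 < q₀ := lt_min (by norm_num) (by positivity)
  set m₁ := 2 * B * |B₀| / q₀ ^ (l₀ + 1) + 1 with hm₁
  have hm₁0 : 0 < m₁ := by positivity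
  set q₁ := 1 - m₁⁻¹ with hq₁
  have hq₁1 : q₁ < 1 := by
    have : 0 < m₁⁻¹ := by positivity
    linarith
  obtain ⟨lam0, hlam0, C, hC, Co, hCo, CU, hCU, cL, hcL, nL, hgood⟩ :=
    exists_good B l₀ hq₀0 hq₁1
  obtain ⟨D, hD, lam₁, hlam₁, L₀, hcen⟩ := exists_central hlam0 hC hCo hCU cL nL hcL
  -- With `D c ≤ 1 / 2` and `λ = c t / √L` below, `D λ² L - λ t √L` is at most `-c t² / 2`; `t ≤ √L`
  -- keeps `λ` admissible.
  set c := min lam₁ (1 / (2 * (D + 1))) with hc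
  have hc0 : 0 < c := lt_min hlam₁ (by positivity)
  have hcD : D * c ≤ 1 / 2 := by
    have : c ≤ 1 / (2 * (D + 1)) := min_le_right _ _
    rw [le_div_iff₀ (by positivity)] at this
    nlinarith
  set D' := (D + 2) * Real.exp D with hD'
  have heD : 1 ≤ Real.exp D := Real.one_le_exp hD
  have hD'2 : D + 2 ≤ D' := le_mul_of_one_le_right (by linarith) heD
  refine ⟨max L₀ 1, D', by linarith, c / 2, by positivity, ?_⟩
  intro k h L hL x y hx hy hlo hhi
  have hL1 : 1 ≤ L := (le_max_right _ _).trans hL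
  have hLp : (0 : ℝ) < L := by exact_mod_cast hL1
  set μ := ((y : ℝ) - x + L) / L with hμ
  have hμlo : ε₀ ≤ μ := by rw [hμ, le_div_iff₀ hLp]; exact hlo
  have hμhi : μ ≤ B₀ := by rw [hμ, div_le_iff₀ hLp]; exact hhi
  have hμ0 : 0 < μ := hε₀.trans_le hμlo
  obtain ⟨q, hq0, hq1, hm⟩ := h.exists_mean hμ0
  have hd : 0 < 1 - q := by linarith
  have hqlo : q₀ ≤ q := by
    rcases le_or_gt q (1 / 2) with h1 | h1
    · refine (min_le_right _ _).trans ?_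
      rw [div_le_iff₀ (by positivity)]
      have := h.mean_le_mul hq0 h1 hm
      linarith
    · exact (min_le_left _ _).trans h1.le
  have hqhi : q ≤ q₁ := by
    have h1 := h.le_mean hq0 hq1 hm
    have h2 : q₀ ^ (l₀ + 1) * (1 - q)⁻¹ ≤ 2 * B * |B₀| := by
      calc _ ≤ q ^ (l₀ + 1) * (1 - q)⁻¹ := by gcongr
        _ ≤ 2 * B * μ := h1
        _ ≤ _ := by
            have := hμhi.trans (le_abs_self B₀)
            gcongr
    have h3 : (1 - q)⁻¹ ≤ m₁ := by
      rw [hm₁]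
      have : (1 - q)⁻¹ ≤ 2 * B * |B₀| / q₀ ^ (l₀ + 1) := by
        rw [le_div_iff₀ (by positivity)]; linarith
      linarith
    have h4 : m₁⁻¹ ≤ 1 - q := by rwa [inv_le_comm₀ hm₁0 hd]
    linarith
  obtain ⟨hG, hGn, hLow⟩ := hgood k q μ h hqlo hqhi hm
  have hβ : (y : ℝ) - x = L * (μ - 1) := by rw [hμ]; field_simp; ring
  have hcen' := hcen (elaw k q) stp (μ - 1) hG hGn hLow stp_mono L ((le_max_left _ _).trans hL)
    x y hx hy hβ
  constructor
  · intro lam h0 h1 r X Y T hXT hTY hYL hdisj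
    have hlamle : lam ≤ lam₁ := by
      have : c ≤ lam₁ := min_le_left _ _
      linarith
    refine h.ewt_le_of_elaw_le hq0 hq1 (((hcen' lam h0 hlamle).1 r X Y T hXT hTY hYL hdisj).trans
      (mul_le_mul' (ENNReal.ofReal_le_ofReal ?_) le_rfl))
    set M := max (x - y : ℝ) 0 with hM
    have hM0 : 0 ≤ M := le_max_right _ _
    have h2 : D * (1 + lam ^ 2 * L) + lam * M ≤ D + D' * (lam ^ 2 * L + lam * M) := by
      have h3 : D * (lam ^ 2 * L) ≤ D' * (lam ^ 2 * L) := by gcongr; linarith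
      have h4 : 1 * (lam * M) ≤ D' * (lam * M) := by gcongr; linarith
      linarith
    calc D * 2 ^ r * Real.exp (D * (1 + lam ^ 2 * L) + lam * M)
        ≤ D * 2 ^ r * (Real.exp D * Real.exp (D' * (lam ^ 2 * L + lam * M))) := by
          rw [← Real.exp_add]
          gcongr
      _ = (D * Real.exp D) * 2 ^ r * Real.exp (D' * (lam ^ 2 * L + lam * M)) := by ring
      _ ≤ D' * D' ^ r * Real.exp (D' * (lam ^ 2 * L + lam * M)) := by
          have h3 : D * Real.exp D ≤ D' := by rw [hD']; gcongr; linarith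
          have h4 : 2 ≤ D' := by linarith
          gcongr
      _ = _ := by rw [pow_succ]; ring
  · refine excursionBound_of (h₀ := 0) (by positivity) (by simp; linarith) fun t ht _ htL => ?_
    have hsL : 0 < √(L : ℝ) := Real.sqrt_pos.2 hLp
    set lam := c * t / √L with hlam
    have hlam0' : 0 ≤ lam := by positivity
    have hlamle : lam ≤ lam₁ := by
      calc lam ≤ c * √L / √L := by rw [hlam]; gcongr
        _ = c := by field_simp
        _ ≤ _ := min_le_left _ _
    refine h.ewt_le_of_elaw_le hq0 hq1 (le_trans (Ex_mono _ fun l hl => ?_)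
      (((hcen' lam hlam0' hlamle).2 (t * √L)).trans
        (mul_le_mul' (ENNReal.ofReal_le_ofReal ?_) le_rfl)))
    · refine mul_le_mul' (one_mono ?_) le_rfl
      rintro ⟨s, hs, hor⟩
      refine ⟨s, hs, ?_⟩
      have hsL' : (s : ℝ) ≤ L := by exact_mod_cast hs
      have hs0 : (0 : ℝ) ≤ s := Nat.cast_nonneg _
      push_cast at hor
      rw [hβ] at hor
      have h1 : s * (μ - 1) ≤ max 0 (L * (μ - 1)) := by
        rcases le_total 0 (μ - 1) with h2 | h2
        · exact le_max_of_le_right (by gcongr)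
        · exact le_max_of_le_left (mul_nonpos_of_nonneg_of_nonpos hs0 h2)
      have h1' : min 0 (L * (μ - 1)) ≤ s * (μ - 1) := by
        rcases le_total 0 (μ - 1) with h2 | h2
        · exact (min_le_left _ _).trans (mul_nonneg hs0 h2)
        · exact (min_le_right _ _).trans (mul_le_mul_of_nonpos_right hsL' h2)
      rw [le_abs]
      rcases hor with h3 | h3
      · left; linarith
      · right; linarith
    · have e1 : lam ^ 2 * L = c ^ 2 * t ^ 2 := by
        rw [hlam, div_pow, Real.sq_sqrt hLp.le]; field_simp
      have e2 : lam * (t * √L) = c * t ^ 2 := by rw [hlam]; field_simp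
      rw [e1, e2]
      have h2 : D * (1 + c ^ 2 * t ^ 2) - c * t ^ 2 ≤ D + -(c / 2 * t ^ 2) := by
        have := mul_le_mul_of_nonneg_right hcD (by positivity : 0 ≤ c * t ^ 2)
        nlinarith
      calc _ ≤ D * (Real.exp D * Real.exp (-(c / 2 * t ^ 2))) := by
            rw [← Real.exp_add]
            gcongr
        _ = D * Real.exp D * Real.exp (-(c / 2 * t ^ 2)) := by ring
        _ ≤ _ := by
            rw [hD']
            gcongr
            linarith

/-- Uniform exponential bounds for all nonnegative bridges. -/
theorem exists_bounds (B : ℝ) (l₀ : ℕ) :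
    ∃ D ≥ (1 : ℝ), ∃ c > (0 : ℝ), c ≤ 1 ∧ ∀ k, Wt k B l₀ → ∀ L : ℕ, ∀ x y : ℤ, 0 ≤ x → 0 ≤ y →
      DescentBound k L x y D c ∧ ExcursionBound k L x y D c := by
  obtain ⟨B₀, hB₀, D₁, hD₁, H₁⟩ := exists_bounds_steep B l₀
  obtain ⟨ε₀, hε₀, L₂, D₂, hD₂, H₂⟩ := exists_bounds_flat B l₀
  obtain ⟨L₃, D₃, hD₃, c₃, hc₃, H₃⟩ := exists_bounds_central B l₀ hε₀ B₀
  obtain ⟨D₄, hD₄, H₄⟩ := exists_bounds_short (L₂ + L₃ + 2)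
  set c := min c₃ (1 / 2) with hc
  have hcc₃ : c ≤ c₃ := min_le_left _ _
  have hc2 : c ≤ 1 / 2 := min_le_right _ _
  set D := D₁ + D₂ + D₃ + D₄ with hD
  refine ⟨D, by linarith, c, lt_min hc₃ (by norm_num), by linarith, ?_⟩
  intro k h L x y hx hy
  rcases Nat.lt_or_ge (L₂ + L₃ + 2) L with hL | hL
  · rcases le_or_gt (B₀ * L) ((y : ℝ) - x + L) with h1 | h1
    · obtain ⟨ha, hb⟩ := H₁ k h L (by omega) x y hx hy h1
      exact ⟨ha.mono (by linarith) (by linarith) hc2, hb.mono (by linarith) (by linarith) hc2⟩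
    rcases le_or_gt ((y : ℝ) - x + L) (ε₀ * L) with h2 | h2
    · obtain ⟨ha, hb⟩ := H₂ k h L (by omega) x y hx hy h2
      exact ⟨ha.mono (by linarith) (by linarith) (by linarith),
        hb.mono (by linarith) (by linarith) hc2⟩
    · obtain ⟨ha, hb⟩ := H₃ k h L (by omega) x y hx hy h2.le h1.le
      exact ⟨ha.mono (by linarith) (by linarith) hcc₃, hb.mono (by linarith) (by linarith) hcc₃⟩
  · obtain ⟨ha, hb⟩ := H₄ k L hL x y
    exact ⟨ha.mono (by linarith) (by linarith) (by linarith),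
      hb.mono (by linarith) (by linarith) (by linarith)⟩

/-! ### Bridges as lists of steps -/

theorem Ex_eq_tsum (p : ℕ → ℝ≥0∞) (n : ℕ) (F : List ℕ → ℝ≥0∞) :
    Ex p n F = ∑' v : Fin n → ℕ, (∏ i, p (v i)) * F (List.ofFn v) := by
  induction n generalizing F with
  | zero => simp [Ex]
  | succ n ih =>
    rw [← (Fin.consEquiv fun _ : Fin (n + 1) => ℕ).tsum_eq, ENNReal.tsum_prod']
    simp only [Ex]
    refine tsum_congr fun s => ?_
    rw [ih, ← ENNReal.tsum_mul_left]
    refine tsum_congr fun v => ?_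
    simp [Fin.consEquiv, Fin.prod_univ_succ, List.ofFn_succ, mul_assoc]

theorem surv_iff (f : ℕ → ℤ) (x : ℤ) (l : List ℕ) :
    Surv f x l ↔ ∀ t ≤ l.length, 0 ≤ x + hsum f (l.take t) := by
  induction l generalizing x with
  | nil => simp [Surv]
  | cons s l ih =>
    simp only [Surv, ih, List.length_cons]
    constructor
    · rintro ⟨h0, h⟩ t ht
      cases t with
      | zero => simpa using h0
      | succ t =>
        have := h t (by omega)
        rw [List.take_succ_cons, hsum_cons]
        linarith
    · intro h
      refine ⟨by simpa using h 0 (by omega), fun t ht => ?_⟩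
      have := h (t + 1) (by omega)
      rw [List.take_succ_cons, hsum_cons] at this
      linarith

/-- The path from `x` with steps `s - 1`, for `s` in the list `l`. -/
def toPath (L : ℕ) (x : ℤ) (l : List ℕ) (t : Fin (L + 1)) : ℤ := x + hsum stp (l.take t)

/-- The increments of a path, shifted by one. -/
def steps {L : ℕ} (W : Fin (L + 1) → ℤ) (t : Fin L) : ℕ := (W t.succ - W t.castSucc + 1).toNat

theorem hsum_take_succ (f : ℕ → ℤ) {L : ℕ} (v : Fin L → ℕ) (t : Fin L) :
    hsum f ((List.ofFn v).take (t + 1)) = hsum f ((List.ofFn v).take t) + f (v t) := by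
  rw [List.take_add_one, hsum_append, List.getElem?_eq_getElem (by simp)]
  simp

section

variable {x y L : ℕ}

theorem mem_bridges {W : Fin (L + 1) → ℤ} : W ∈ bridges x y L ↔ W 0 = x ∧ W (Fin.last L) = y ∧
    (∀ t, 0 ≤ W t) ∧ ∀ t : Fin L, -1 ≤ W t.succ - W t.castSucc := by
  simp [bridges, bridgeSet]

theorem toPath_steps {W : Fin (L + 1) → ℤ} (hW : W ∈ bridges x y L) :
    toPath L x (List.ofFn (steps W)) = W := by
  obtain ⟨h0, -, -, hs⟩ := mem_bridges.1 hW
  funext t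
  induction t using Fin.induction with
  | zero => simp [toPath, h0]
  | succ t ih =>
    have h1 := hs t
    have h2 := hsum_take_succ stp (steps W) t
    simp only [toPath, Fin.val_succ, Fin.val_castSucc] at ih ⊢
    rw [h2, ← add_assoc, ih]
    simp only [stp, steps]
    omega

theorem br_steps {W : Fin (L + 1) → ℤ} (hW : W ∈ bridges x y L) :
    Br stp x y (List.ofFn (steps W)) := by
  have hp := toPath_steps hW
  obtain ⟨-, hy, h0, -⟩ := mem_bridges.1 hW
  constructor
  · rw [surv_iff]
    intro t ht
    rw [List.length_ofFn] at ht
    have h1 := congrFun hp ⟨t, by omega⟩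
    simp only [toPath] at h1
    rw [h1]
    exact h0 _
  · have h1 := congrFun hp (Fin.last L)
    simp only [toPath, Fin.val_last] at h1
    rwa [List.take_of_length_le (by simp), hy] at h1

theorem toPath_mem {v : Fin L → ℕ} (hv : Br stp x y (List.ofFn v)) :
    toPath L x (List.ofFn v) ∈ bridges x y L := by
  obtain ⟨h1, h2⟩ := hv
  rw [surv_iff] at h1
  refine mem_bridges.2 ⟨by simp [toPath], ?_, fun t => ?_, fun t => ?_⟩
  · simp only [toPath, Fin.val_last]
    rwa [List.take_of_length_le (by simp)]
  · exact h1 t (by simp; omega)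
  · simp only [toPath, Fin.val_succ, Fin.val_castSucc]
    rw [hsum_take_succ, stp]
    omega

theorem steps_toPath (v : Fin L → ℕ) : steps (toPath L x (List.ofFn v)) = v := by
  funext t
  simp only [steps, toPath, Fin.val_succ, Fin.val_castSucc]
  rw [hsum_take_succ, stp]
  omega

/-- Recording the steps is a bijection from bridges to the lists satisfying `Br`, so the series has
finitely many nonzero terms. -/
theorem Ex_br_eq_sum (p : ℕ → ℝ≥0∞) (F : (Fin (L + 1) → ℤ) → ℝ≥0∞) :
    Ex p L (fun l => F (toPath L x l) * one (Br stp x y l))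
      = ∑ W ∈ bridges x y L, (∏ i, p (steps W i)) * F W := by
  have hinj : Set.InjOn (steps (L := L)) (bridges x y L) := fun W hW W' hW' h => by
    rw [← toPath_steps hW, ← toPath_steps hW', h]
  rw [Ex_eq_tsum, tsum_eq_sum (s := (bridges x y L).image steps), Finset.sum_image hinj]
  · refine Finset.sum_congr rfl fun W hW => ?_
    rw [toPath_steps hW, one_true (br_steps hW), mul_one]
  · intro v hv
    rw [one_false, mul_zero, mul_zero]
    intro hb
    exact hv (Finset.mem_image.2 ⟨_, toPath_mem hb, steps_toPath v⟩)

theorem sum_steps {W : Fin (L + 1) → ℤ} (hW : W ∈ bridges x y L) :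
    ∑ t, steps W t = ((y : ℤ) - x + L).toNat := by
  have h := (br_steps hW).2
  rw [hsum_stp_eq, List.length_ofFn, List.sum_ofFn] at h
  omega

/-- The weight of a path in terms of normalized weights. -/
theorem exists_weight_eq {κ k : ℕ → ℝ} {z a : ℝ} (hz : 0 < z) (ha : 0 < a)
    (hκ : ∀ l, 1 ≤ l → 0 ≤ κ l) (hk0 : k 0 = 1) (hk : ∀ l, 1 ≤ l → k l = κ l / a ^ l)
    (x y L : ℕ) : ∃ c > 0, ∀ W ∈ bridges x y L, weight κ z W = c * ∏ t, k (steps W t) := by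
  have hV : 0 < voiculescu κ z := by
    have : 0 ≤ ∑' l : ℕ, κ (l + 1) * z ^ l :=
      tsum_nonneg fun l => mul_nonneg (hκ _ (by omega)) (by positivity)
    have h1 : 0 < 1 / z := by positivity
    unfold voiculescu
    linarith
  have hstep : ∀ s : ℕ, stepProb κ z ((s : ℤ) - 1) = 1 / (voiculescu κ z * z) * (a * z) ^ s * k s := by
    intro s
    cases s with
    | zero => simp [stepProb, hk0]
    | succ s =>
      have h1 : ((s + 1 : ℕ) : ℤ) - 1 = s := by push_cast; ring
      rw [h1, stepProb, if_neg (by omega), if_pos (by omega), Int.toNat_natCast, hk _ (by omega),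
        mul_pow, pow_succ z]
      field_simp
  -- The powers of `a * z` multiply to a fixed power, because the shifted steps add up to `y - x +
  -- L`.
  refine ⟨(1 / (voiculescu κ z * z)) ^ L * (a * z) ^ ((y : ℤ) - x + L).toNat, by positivity,
    fun W hW => ?_⟩
  obtain ⟨-, -, -, hs⟩ := mem_bridges.1 hW
  have h1 : weight κ z W
      = ∏ t, (1 / (voiculescu κ z * z) * (a * z) ^ steps W t * k (steps W t)) := by
    refine Finset.prod_congr rfl fun t _ => ?_
    rw [← hstep]
    congr 1
    have := hs t
    simp only [steps]
    omega
  rw [h1, Finset.prod_mul_distrib, Finset.prod_mul_distrib, Finset.prod_const, Finset.card_univ,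
    Fintype.card_fin, Finset.prod_pow_eq_pow_sum, sum_steps hW]

/-- The common factor of all path weights cancels in the quotient, so unnormalized inequalities for
`k` bound the conditional expectation. -/
theorem bridgeExp_le {κ k : ℕ → ℝ} {z a : ℝ} (hz : 0 < z) (ha : 0 < a)
    (hκ : ∀ l, 1 ≤ l → 0 ≤ κ l) (hk0 : k 0 = 1) (hk : ∀ l, 1 ≤ l → k l = κ l / a ^ l)
    (hZ : 0 < partitionFn κ z x y L) {F : (Fin (L + 1) → ℤ) → ℝ} (hF : ∀ W ∈ bridges x y L, 0 ≤ F W)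
    {K : ℝ} (hK : 0 ≤ K)
    (h : Ex (ewt k) L (fun l => ENNReal.ofReal (F (toPath L x l)) * one (Br stp x y l))
      ≤ ENNReal.ofReal K * Pb (ewt k) stp L x y) :
    bridgeExp κ z x y L F ≤ K := by
  have hkn : ∀ l, 0 ≤ k l := fun l => by
    cases l with
    | zero => rw [hk0]; norm_num
    | succ l => rw [hk _ (by omega)]; exact div_nonneg (hκ _ (by omega)) (by positivity)
  obtain ⟨c, hc, hw⟩ := exists_weight_eq hz ha hκ hk0 hk x y L
  have hnn : ∀ W : Fin (L + 1) → ℤ, 0 ≤ ∏ t, k (steps W t) := fun W =>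
    Finset.prod_nonneg fun t _ => hkn _
  have hprod : ∀ W : Fin (L + 1) → ℤ,
      ∏ t, ewt k (steps W t) = ENNReal.ofReal (∏ t, k (steps W t)) := fun W =>
    (ENNReal.ofReal_prod_of_nonneg fun t _ => hkn _).symm
  have hnum : Ex (ewt k) L (fun l => ENNReal.ofReal (F (toPath L x l)) * one (Br stp x y l))
      = ENNReal.ofReal (∑ W ∈ bridges x y L, (∏ t, k (steps W t)) * F W) := by
    have := Ex_br_eq_sum (x := x) (y := y) (ewt k) (fun W => ENNReal.ofReal (F W))
    rw [this, ENNReal.ofReal_sum_of_nonneg fun W hW => mul_nonneg (hnn W) (hF W hW)]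
    refine Finset.sum_congr rfl fun W _ => ?_
    rw [hprod, ENNReal.ofReal_mul (hnn W)]
  have hden : Pb (ewt k) stp L x y
      = ENNReal.ofReal (∑ W ∈ bridges x y L, ∏ t, k (steps W t)) := by
    have := Ex_br_eq_sum (x := x) (y := y) (L := L) (ewt k) (fun _ => 1)
    simp only [one_mul, mul_one] at this
    rw [Pb, this, ENNReal.ofReal_sum_of_nonneg fun W _ => hnn W]
    exact Finset.sum_congr rfl fun W _ => hprod W
  have hsum0 : 0 ≤ ∑ W ∈ bridges x y L, ∏ t, k (steps W t) := Finset.sum_nonneg fun W _ => hnn W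
  rw [hnum, hden, ← ENNReal.ofReal_mul hK, ENNReal.ofReal_le_ofReal_iff (mul_nonneg hK hsum0)] at h
  have hZe : partitionFn κ z x y L = c * ∑ W ∈ bridges x y L, ∏ t, k (steps W t) := by
    rw [partitionFn, Finset.mul_sum]
    exact Finset.sum_congr rfl hw
  have hNe : ∑ W ∈ bridges x y L, weight κ z W * F W
      = c * ∑ W ∈ bridges x y L, (∏ t, k (steps W t)) * F W := by
    rw [Finset.mul_sum]
    refine Finset.sum_congr rfl fun W hW => ?_
    rw [hw W hW, mul_assoc]
  rw [bridgeExp, div_le_iff₀ hZ, hNe, hZe, mul_left_comm]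
  exact mul_le_mul_of_nonneg_left h hc.le

end

/-! ### Moments of depths -/

section

variable {L : ℕ} {x : ℤ} {l : List ℕ}

theorem exists_depth_eq (W : Fin (L + 1) → ℤ) {X Y : Fin (L + 1)} (h : X ≤ Y) :
    ∃ T, X ≤ T ∧ T ≤ Y ∧ depth W X Y = W X - W T + 1 := by
  have hne : (W '' Set.Icc X Y).Nonempty := ⟨W X, X, ⟨le_rfl, h⟩, rfl⟩
  have hfin : (W '' Set.Icc X Y).Finite := (Set.toFinite _).image _
  obtain ⟨T, hT, hTe⟩ := Int.csInf_mem hne hfin.bddBelow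
  exact ⟨T, hT.1, hT.2, by rw [depth, hTe]⟩

theorem one_le_depth (W : Fin (L + 1) → ℤ) {X Y : Fin (L + 1)} (h : X ≤ Y) : 1 ≤ depth W X Y := by
  have hfin : (W '' Set.Icc X Y).Finite := (Set.toFinite _).image _
  have := csInf_le hfin.bddBelow (⟨X, ⟨le_rfl, h⟩, rfl⟩ : W X ∈ W '' Set.Icc X Y)
  rw [depth]
  omega

theorem take_append_block {X T : ℕ} (h : X ≤ T) : l.take X ++ block X T l = l.take T := by
  rw [block, ← List.take_add]
  congr 1
  omega

/-- The time of the minimum over an interval, as a function of the steps. -/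
theorem exists_depth_toPath (L : ℕ) (x : ℤ) {r : ℕ} (X Y : Fin r → Fin (L + 1))
    (h : ∀ i, X i ≤ Y i) : ∃ T : List ℕ → Fin r → ℕ, (∀ l i, (X i : ℕ) ≤ T l i) ∧
      (∀ l i, T l i ≤ (Y i : ℕ)) ∧ ∀ l i, (depth (toPath L x l) (X i) (Y i) : ℝ)
        = 1 + -(hsum stp (block (X i) (T l i) l) : ℝ) := by
  choose T h1 h2 h3 using fun (l : List ℕ) (i : Fin r) => exists_depth_eq (toPath L x l) (h i)
  refine ⟨fun l i => T l i, fun l i => h1 l i, fun l i => h2 l i, fun l i => ?_⟩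
  have h4 : depth (toPath L x l) (X i) (Y i) = 1 + -hsum stp (block (X i) (T l i) l) := by
    rw [h3, toPath, toPath, ← take_append_block (l := l) (h1 l i : (X i : ℕ) ≤ T l i), hsum_append]
    ring
  rw [h4]
  push_cast
  ring

theorem exc_of_walkMax {x y : ℕ} {d : ℝ} (h : (walkMax (toPath L x l) : ℝ) > max (x : ℝ) y + d) :
    Exc L ((y : ℤ) - x) d l := by
  obtain ⟨t, -, ht⟩ := Finset.exists_mem_eq_sup' Finset.univ_nonempty (toPath L x l)
  rw [walkMax, ht, toPath] at h
  refine ⟨t, by omega, Or.inl ?_⟩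
  push_cast at h ⊢
  have h1 : max (x : ℝ) y = x + max 0 ((y : ℝ) - x) := by rw [← max_add_add_left]; simp
  rw [h1] at h
  linarith

theorem exc_of_walkMin {x y : ℕ} {d : ℝ} (h : (walkMin (toPath L x l) : ℝ) < min (x : ℝ) y - d) :
    Exc L ((y : ℤ) - x) d l := by
  obtain ⟨t, -, ht⟩ := Finset.exists_mem_eq_inf' Finset.univ_nonempty (toPath L x l)
  rw [walkMin, ht, toPath] at h
  refine ⟨t, by omega, Or.inr ?_⟩
  push_cast at h ⊢
  have h1 : min (x : ℝ) y = x + min 0 ((y : ℝ) - x) := by rw [← min_add_add_left]; simp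
  rw [h1] at h
  linarith

end

/-- `∏ V ^ a / a! ≤ λ ^ (- ∑ a) exp (λ ∑ V)`. -/
theorem prod_pow_div_factorial_le {r : ℕ} {V : Fin r → ℝ} (hV : ∀ i, 0 ≤ V i) (a : Fin r → ℕ)
    {lam : ℝ} (hl : 0 < lam) :
    ∏ i, V i ^ a i / (a i).factorial ≤ (lam⁻¹) ^ (∑ i, a i) * Real.exp (lam * ∑ i, V i) := by
  rw [Finset.mul_sum, Real.exp_sum, ← Finset.prod_pow_eq_pow_sum, ← Finset.prod_mul_distrib]
  refine Finset.prod_le_prod (fun i _ => div_nonneg (pow_nonneg (hV i) _) (Nat.cast_nonneg _))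
    fun i _ => ?_
  have h1 := Real.pow_div_factorial_le_exp (lam * V i) (mul_nonneg hl.le (hV i)) (a i)
  calc V i ^ a i / (a i).factorial = lam⁻¹ ^ a i * ((lam * V i) ^ a i / (a i).factorial) := by
        rw [mul_pow, inv_pow]; field_simp
    _ ≤ _ := by gcongr

/-- The bound for the moments of the depths, up to exponential factors. -/
noncomputable def momBound (L A : ℕ) (M : ℝ) : ℝ := √((L : ℝ) / A) ^ A + (M / A) ^ A

theorem momBound_mono {L A : ℕ} {M M' : ℝ} (h0 : 0 ≤ M) (h : M ≤ M') :
    momBound L A M ≤ momBound L A M' := by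
  unfold momBound
  gcongr

theorem momBound_pos {L A : ℕ} (hL : 1 ≤ L) (hA : 1 ≤ A) {M : ℝ} (h0 : 0 ≤ M) :
    0 < momBound L A M := by
  have h1 : (0 : ℝ) < L := by exact_mod_cast hL
  have h2 : (0 : ℝ) < A := by exact_mod_cast hA
  unfold momBound
  positivity

/-- Optimizes the exponential bound over `λ`. Since the number of intervals is at most the total
exponent `A`, factors exponential in it are absorbed in `K ^ A`. -/
theorem exists_moment_bound (B : ℝ) (l₀ : ℕ) :
    ∃ K ≥ (1 : ℝ), ∀ k, Wt k B l₀ → ∀ L : ℕ, 1 ≤ L → ∀ x y : ℤ, 0 ≤ x → 0 ≤ y →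
      ∀ (r : ℕ) (X Y : Fin r → Fin (L + 1)), (∀ i, X i < Y i) →
      (∀ i j, i ≠ j → Y i ≤ X j ∨ Y j ≤ X i) → ∀ a : Fin r → ℕ, (∀ i, 0 < a i) → 1 ≤ ∑ i, a i →
      Ex (ewt k) L (fun l => ENNReal.ofReal
          (∏ i, (depth (toPath L x l) (X i) (Y i) : ℝ) ^ a i / (a i).factorial)
          * one (Br stp x y l))
        ≤ ENNReal.ofReal (K ^ (∑ i, a i) * momBound L (∑ i, a i) (max (x - y : ℝ) 0))
          * Pb (ewt k) stp L x y := by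
  obtain ⟨D, hD, c, hc, hc1, H⟩ := exists_bounds B l₀
  set K := Real.exp 2 + c⁻¹ * Real.exp 1 * D ^ 2 * Real.exp (2 * D) with hK
  have hK1 : 1 ≤ K := by
    have h1 : 1 ≤ Real.exp 2 := Real.one_le_exp (by norm_num)
    have h2 : 0 ≤ c⁻¹ * Real.exp 1 * D ^ 2 * Real.exp (2 * D) := by positivity
    linarith
  refine ⟨K, hK1, ?_⟩
  intro k h L hL x y hx hy r X Y hXY hdisj a ha hA
  set A := ∑ i, a i with hAd
  set M := max (x - y : ℝ) 0 with hM
  have hM0 : 0 ≤ M := le_max_right _ _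
  obtain ⟨T, hT1, hT2, hT3⟩ := exists_depth_toPath L x X Y fun i => (hXY i).le
  have hdisj' : ∀ i j, i ≠ j → (Y i : ℕ) ≤ X j ∨ (Y j : ℕ) ≤ X i := fun i j hij => hdisj i j hij
  have hYL : ∀ i, (Y i : ℕ) ≤ L := fun i => by omega
  have hrA : r ≤ A := by
    calc r = ∑ i : Fin r, 1 := by simp
      _ ≤ _ := Finset.sum_le_sum fun i _ => ha i
  have hrL : r ≤ L := by
    have h1 := sum_length_le Finset.univ L (fun i => (X i : ℕ)) (fun i => (Y i : ℕ))
      (fun i _ => hYL i) (fun i _ j _ hij => hdisj' i j hij)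
    refine le_trans ?_ h1
    calc r = ∑ i : Fin r, 1 := by simp
      _ ≤ _ := Finset.sum_le_sum fun i _ => by
          have : (X i : ℕ) < Y i := hXY i
          show 1 ≤ (Y i : ℕ) - X i
          omega
  have hLp : (0 : ℝ) < L := by exact_mod_cast hL
  have hAp : (0 : ℝ) < A := by exact_mod_cast hA
  have hV0 : ∀ l i, (0 : ℝ) ≤ depth (toPath L x l) (X i) (Y i) := fun l i => by
    have := one_le_depth (toPath L x l) (hXY i).le
    have : (0 : ℤ) ≤ depth (toPath L x l) (X i) (Y i) := by omega
    exact_mod_cast this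
  have hVsum : ∀ l, ∑ i, (depth (toPath L x l) (X i) (Y i) : ℝ)
      = r + ∑ i, -(hsum stp (block (X i) (T l i) l) : ℝ) := fun l => by
    rw [Finset.sum_congr rfl fun i _ => hT3 l i, Finset.sum_add_distrib]
    simp
  rcases Nat.lt_or_ge L A with hLA | hLA
  · -- many factors: the descents are bounded by the length
    have hLA' : (L : ℝ) ≤ A := by exact_mod_cast hLA.le
    -- Then `λ ^ (-A)` is the first term of `momBound`, and `λ L ≤ A`.
    set lam := √((A : ℝ) / L) with hlam
    have hlam0 : 0 < lam := Real.sqrt_pos.2 (by positivity)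
    have hlamL : lam * L ≤ A := by
      have h1 : lam * L = √A * √L := by
        rw [hlam, Real.sqrt_div hAp.le, div_mul_eq_mul_div, div_eq_iff (Real.sqrt_pos.2 hLp).ne',
          mul_assoc, Real.mul_self_sqrt hLp.le]
      rw [h1]
      calc √A * √L ≤ √A * √A := by gcongr
        _ = A := Real.mul_self_sqrt hAp.le
    have hinv : lam⁻¹ = √((L : ℝ) / A) := by rw [hlam, ← Real.sqrt_inv, inv_div]
    unfold Pb
    rw [← Ex_const_mul]
    refine Ex_mono _ fun l hl => mul_le_mul' (ENNReal.ofReal_le_ofReal ?_) le_rfl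
    refine (prod_pow_div_factorial_le (hV0 l) a hlam0).trans ?_
    have h2 : lam * ∑ i, (depth (toPath L x l) (X i) (Y i) : ℝ) ≤ A * 2 := by
      rw [hVsum]
      have h3 := sum_neg_hsum_le (X := fun i => (X i : ℕ)) (T := T l) (Y := fun i => (Y i : ℕ)) hl
        (hT2 l) hYL hdisj'
      have h4 : (r : ℝ) ≤ L := by exact_mod_cast hrL
      calc _ ≤ lam * (L + L) := by gcongr
        _ ≤ _ := by linarith
    have h3 : Real.exp (lam * ∑ i, (depth (toPath L x l) (X i) (Y i) : ℝ)) ≤ K ^ A := by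
      calc _ ≤ Real.exp (A * 2) := Real.exp_le_exp.2 h2
        _ = Real.exp 2 ^ A := Real.exp_nat_mul 2 A
        _ ≤ _ := by
            have h2 : 0 ≤ c⁻¹ * Real.exp 1 * D ^ 2 * Real.exp (2 * D) := by positivity
            gcongr
            linarith
    calc _ ≤ √((L : ℝ) / A) ^ A * K ^ A := by
          rw [hinv]
          gcongr
      _ ≤ momBound L A M * K ^ A := by
          unfold momBound
          gcongr
          exact le_add_of_nonneg_right (by positivity)
      _ = _ := mul_comm _ _
  · have hLA' : (A : ℝ) ≤ L := by exact_mod_cast hLA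
    -- Balances the terms: `λ = c / m` keeps both `λ² L` and `λ M` below `A`, and `m ^ A` is at most
    -- `momBound`. As `A ≤ L`, `m ≥ 1` and `λ ≤ c` is admissible.
    set m := max √((L : ℝ) / A) (M / A) with hm
    have hm1 : 1 ≤ m := le_max_of_le_left (Real.one_le_sqrt.2 ((one_le_div hAp).2 hLA'))
    have hm0 : 0 < m := by linarith
    set lam := c / m with hlam
    have hlam0 : 0 < lam := by positivity
    have hlamc : lam ≤ c := div_le_self hc.le hm1
    have hlam1 : lam ≤ 1 := hlamc.trans hc1
    have hlm : lam * m = c := by rw [hlam]; field_simp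
    have hlL : lam ^ 2 * L ≤ A := by
      have h1 : (L : ℝ) / A ≤ m ^ 2 := by
        have : √((L : ℝ) / A) ≤ m := le_max_left _ _
        calc (L : ℝ) / A = √((L : ℝ) / A) ^ 2 := (Real.sq_sqrt (by positivity)).symm
          _ ≤ _ := by gcongr
      rw [div_le_iff₀ hAp] at h1
      calc lam ^ 2 * L ≤ lam ^ 2 * (m ^ 2 * A) := by gcongr
        _ = (lam * m) ^ 2 * A := by ring
        _ ≤ 1 * A := by
            rw [hlm]
            gcongr
            exact pow_le_one₀ hc.le hc1
        _ = A := one_mul _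
    have hlM : lam * M ≤ A := by
      have h1 : M / A ≤ m := le_max_right _ _
      rw [div_le_iff₀ hAp] at h1
      calc lam * M ≤ lam * (m * A) := by gcongr
        _ = (lam * m) * A := by ring
        _ ≤ 1 * A := by rw [hlm]; gcongr
        _ = A := one_mul _
    have hb := (H k h L x y hx hy).1 lam hlam0.le hlamc r (fun i => X i) (fun i => Y i) T hT1 hT2
      hYL hdisj'
    calc _ ≤ Ex (ewt k) L (fun l => ENNReal.ofReal (lam⁻¹ ^ A * Real.exp (lam * r)) *
          (ENNReal.ofReal (Real.exp (lam * ∑ i, -(hsum stp (block (X i) (T l i) l) : ℝ)))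
            * one (Br stp x y l))) := by
          refine Ex_mono _ fun l _ => ?_
          rw [← mul_assoc, ← ENNReal.ofReal_mul (by positivity)]
          refine mul_le_mul' (ENNReal.ofReal_le_ofReal ?_) le_rfl
          refine (prod_pow_div_factorial_le (hV0 l) a hlam0).trans (le_of_eq ?_)
          rw [hVsum, mul_add, Real.exp_add, mul_assoc]
      _ ≤ ENNReal.ofReal (lam⁻¹ ^ A * Real.exp (lam * r)) *
          (ENNReal.ofReal (D ^ (r + 1) * Real.exp (D * (lam ^ 2 * L + lam * M)))
            * Pb (ewt k) stp L x y) := by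
          rw [Ex_const_mul]
          exact mul_le_mul' le_rfl hb
      _ ≤ _ := by
          rw [← mul_assoc, ← ENNReal.ofReal_mul (by positivity)]
          refine mul_le_mul' (ENNReal.ofReal_le_ofReal ?_) le_rfl
          have h1 : Real.exp (lam * r) ≤ Real.exp 1 ^ A := by
            rw [← Real.exp_nat_mul, mul_one]
            refine Real.exp_le_exp.2 ?_
            have : (r : ℝ) ≤ A := by exact_mod_cast hrA
            calc lam * r ≤ 1 * A := by gcongr
              _ = A := one_mul _
          have h2 : D ^ (r + 1) ≤ (D ^ 2) ^ A := by
            rw [← pow_mul]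
            exact pow_le_pow_right₀ hD (by omega)
          have h3 : Real.exp (D * (lam ^ 2 * L + lam * M)) ≤ Real.exp (2 * D) ^ A := by
            rw [← Real.exp_nat_mul]
            refine Real.exp_le_exp.2 ?_
            calc D * (lam ^ 2 * L + lam * M) ≤ D * (A + A) := by gcongr
              _ = _ := by ring
          have h4 : lam⁻¹ ^ A ≤ c⁻¹ ^ A * momBound L A M := by
            have : lam⁻¹ = c⁻¹ * m := by rw [hlam, inv_div]; field_simp
            rw [this, mul_pow]
            refine mul_le_mul_of_nonneg_left ?_ (by positivity)
            unfold momBound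
            rcases max_choice √((L : ℝ) / A) (M / A) with h5 | h5 <;> rw [hm, h5]
            · exact le_add_of_nonneg_right (by positivity)
            · exact le_add_of_nonneg_left (by positivity)
          have hmb := momBound_pos hL hA hM0
          calc _ ≤ c⁻¹ ^ A * momBound L A M * Real.exp 1 ^ A
                * ((D ^ 2) ^ A * Real.exp (2 * D) ^ A) := by gcongr
            _ = (c⁻¹ * Real.exp 1 * D ^ 2 * Real.exp (2 * D)) ^ A * momBound L A M := by
                simp only [mul_pow]; ring
            _ ≤ _ := by
                refine mul_le_mul_of_nonneg_right ?_ hmb.le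
                have := Real.exp_pos 2
                gcongr
                linarith

/-- Equivalent to the central binomial bound `(2 a)! ≤ 4 ^ a (a!)²`; it lets the moment bound with
doubled exponents control the second moment. -/
theorem sq_div_factorial_le {u : ℝ} (hu : 0 ≤ u) (a : ℕ) :
    (u ^ a / a.factorial) ^ 2 ≤ 4 ^ a * (u ^ (2 * a) / (2 * a).factorial) := by
  have h1 : (2 * a).factorial ≤ 4 ^ a * (a.factorial * a.factorial) := by
    have h2 := Nat.add_choose_mul_factorial_mul_factorial a a
    have h3 : (a + a).choose a ≤ 4 ^ a := by
      have := Nat.choose_le_two_pow (a + a) a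
      calc _ ≤ 2 ^ (a + a) := this
        _ = 4 ^ a := by rw [← two_mul, pow_mul]; norm_num
    rw [two_mul, ← h2, mul_assoc]
    exact Nat.mul_le_mul_right _ h3
  have h2 : ((2 * a).factorial : ℝ) ≤ 4 ^ a * (a.factorial * a.factorial) := by exact_mod_cast h1
  have hf : (0 : ℝ) < a.factorial := by exact_mod_cast a.factorial_pos
  have hf2 : (0 : ℝ) < (2 * a).factorial := by exact_mod_cast (2 * a).factorial_pos
  rw [div_pow, ← pow_mul, mul_comm a 2, ← mul_div_assoc, div_le_div_iff₀ (by positivity) hf2]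
  have := mul_le_mul_of_nonneg_left h2 (by positivity : 0 ≤ u ^ (2 * a))
  calc _ ≤ _ := this
    _ = _ := by ring

/-- Cauchy–Schwarz between the second moment of the product and the probability of the excursion,
carried out pointwise as a weighted arithmetic-geometric mean inequality to stay in `ℝ≥0∞`. -/
theorem exists_moment_excursion_bound (B : ℝ) (l₀ : ℕ) :
    ∃ K ≥ (1 : ℝ), ∃ c > (0 : ℝ), ∀ k, Wt k B l₀ → ∀ L : ℕ, 1 ≤ L → ∀ x y : ℤ, 0 ≤ x → 0 ≤ y →
      ∀ (r : ℕ) (X Y : Fin r → Fin (L + 1)), (∀ i, X i < Y i) →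
      (∀ i j, i ≠ j → Y i ≤ X j ∨ Y j ≤ X i) → ∀ a : Fin r → ℕ, (∀ i, 0 < a i) → 1 ≤ ∑ i, a i →
      ∀ h : ℝ, 0 < h →
      Ex (ewt k) L (fun l => ENNReal.ofReal
          (∏ i, (depth (toPath L x l) (X i) (Y i) : ℝ) ^ a i / (a i).factorial)
          * one (Exc L (y - x) (h * √L) l) * one (Br stp x y l))
        ≤ ENNReal.ofReal (K ^ (∑ i, a i) * momBound L (∑ i, a i) (max (x - y : ℝ) 0)
          * Real.exp (-c * h ^ 2)) * Pb (ewt k) stp L x y := by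
  obtain ⟨K, hK, HK⟩ := exists_moment_bound B l₀
  obtain ⟨D, hD, c, hc, hc1, H⟩ := exists_bounds B l₀
  refine ⟨2 * K * D, by nlinarith, c / 2, by positivity, ?_⟩
  intro k hk L hL x y hx hy r X Y hXY hdisj a ha hA h hh
  set A := ∑ i, a i with hAd
  set M := max (x - y : ℝ) 0 with hM
  have hM0 : 0 ≤ M := le_max_right _ _
  have hLp : (0 : ℝ) < L := by exact_mod_cast hL
  have hAp : (0 : ℝ) < A := by exact_mod_cast hA
  have hmb := momBound_pos hL hA hM0
  have hV0 : ∀ l i, (0 : ℝ) ≤ depth (toPath L x l) (X i) (Y i) := fun l i => by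
    have := one_le_depth (toPath L x l) (hXY i).le
    have : (0 : ℤ) ≤ depth (toPath L x l) (X i) (Y i) := by omega
    exact_mod_cast this
  set F : List ℕ → ℝ := fun l =>
    ∏ i, (depth (toPath L x l) (X i) (Y i) : ℝ) ^ a i / (a i).factorial with hF
  have hF0 : ∀ l, 0 ≤ F l := fun l =>
    Finset.prod_nonneg fun i _ => div_nonneg (pow_nonneg (hV0 l i) _) (Nat.cast_nonneg _)
  -- second moments
  set U := (2 * K) ^ A * momBound L A M with hU
  have hU0 : 0 < U := by positivity
  have hsq : Ex (ewt k) L (fun l => ENNReal.ofReal (F l ^ 2) * one (Br stp x y l))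
      ≤ ENNReal.ofReal (U ^ 2) * Pb (ewt k) stp L x y := by
    have h2A : ∑ i, 2 * a i = 2 * A := by rw [← Finset.mul_sum]
    have hb := HK k hk L hL x y hx hy r X Y hXY hdisj (fun i => 2 * a i)
      (fun i => by have := ha i; show 0 < 2 * a i; omega) (by rw [h2A]; omega)
    rw [h2A] at hb
    calc _ ≤ Ex (ewt k) L (fun l => ENNReal.ofReal (4 ^ A) * (ENNReal.ofReal
          (∏ i, (depth (toPath L x l) (X i) (Y i) : ℝ) ^ (2 * a i) / (2 * a i).factorial)
          * one (Br stp x y l))) := by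
          refine Ex_mono _ fun l _ => ?_
          rw [← mul_assoc, ← ENNReal.ofReal_mul (by positivity)]
          refine mul_le_mul' (ENNReal.ofReal_le_ofReal ?_) le_rfl
          rw [hF, hAd, ← Finset.prod_pow, ← Finset.prod_pow_eq_pow_sum, ← Finset.prod_mul_distrib]
          exact Finset.prod_le_prod (fun i _ => sq_nonneg _)
            fun i _ => sq_div_factorial_le (hV0 l i) (a i)
      _ ≤ ENNReal.ofReal (4 ^ A) * (ENNReal.ofReal (K ^ (2 * A) * momBound L (2 * A) M)
          * Pb (ewt k) stp L x y) := by
          rw [Ex_const_mul]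
          exact mul_le_mul' le_rfl hb
      _ ≤ _ := by
          rw [← mul_assoc, ← ENNReal.ofReal_mul (by positivity)]
          refine mul_le_mul' (ENNReal.ofReal_le_ofReal ?_) le_rfl
          have h1 : momBound L (2 * A) M ≤ momBound L A M ^ 2 := by
            unfold momBound
            have h3 : (A : ℝ) ≤ ((2 * A : ℕ) : ℝ) := by push_cast; linarith
            have h4 : √((L : ℝ) / ((2 * A : ℕ) : ℝ)) ≤ √((L : ℝ) / A) :=
              Real.sqrt_le_sqrt (by gcongr)
            have h5 : M / ((2 * A : ℕ) : ℝ) ≤ M / A := by gcongr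
            calc _ ≤ √((L : ℝ) / A) ^ (2 * A) + (M / A) ^ (2 * A) := by gcongr
              _ = (√((L : ℝ) / A) ^ A) ^ 2 + ((M / A) ^ A) ^ 2 := by
                  rw [← pow_mul, ← pow_mul, mul_comm 2 A]
              _ ≤ _ := by
                  have h6 : 0 ≤ √((L : ℝ) / A) ^ A := by positivity
                  have h7 : 0 ≤ (M / A) ^ A := by positivity
                  nlinarith [mul_nonneg h6 h7]
          calc 4 ^ A * (K ^ (2 * A) * momBound L (2 * A) M)
              ≤ 4 ^ A * (K ^ (2 * A) * momBound L A M ^ 2) := by gcongr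
            _ = U ^ 2 := by
                rw [hU, mul_pow, ← pow_mul, mul_pow, mul_comm A 2, pow_mul 2 2 A]
                norm_num
                ring
  have hex := (H k hk L x y hx hy).2 h hh
  -- weighted arithmetic-geometric mean
  set v := D * Real.exp (-(c / 2 * h ^ 2)) with hv
  have hv0 : 0 < v := by positivity
  have hv2 : D * Real.exp (-(c * h ^ 2)) ≤ v ^ 2 := by
    rw [hv, mul_pow, ← Real.exp_nat_mul]
    have : ((2 : ℕ) : ℝ) * -(c / 2 * h ^ 2) = -(c * h ^ 2) := by push_cast; ring
    rw [this]
    refine mul_le_mul_of_nonneg_right ?_ (Real.exp_pos _).le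
    nlinarith
  -- The weights are chosen so that both terms contribute `U v / 2`.
  have hamgm : ∀ l, F l ≤ v / (2 * U) * F l ^ 2 + U / (2 * v) := by
    intro l
    have h1 : 0 ≤ (v * F l - U) ^ 2 / (2 * U * v) := by positivity
    have h2 : v / (2 * U) * F l ^ 2 + U / (2 * v) - F l = (v * F l - U) ^ 2 / (2 * U * v) := by
      field_simp
      ring
    linarith
  calc _ ≤ Ex (ewt k) L (fun l => ENNReal.ofReal (v / (2 * U)) *
          (ENNReal.ofReal (F l ^ 2) * one (Br stp x y l))
        + ENNReal.ofReal (U / (2 * v)) *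
          (one (Exc L (y - x) (h * √L) l) * one (Br stp x y l))) := by
        refine Ex_mono _ fun l _ => ?_
        by_cases he : Exc L (y - x) (h * √L) l
        · rw [one_true he, mul_one, one_mul, ← mul_assoc (ENNReal.ofReal (v / (2 * U))), ← add_mul,
            ← ENNReal.ofReal_mul (by positivity),
            ← ENNReal.ofReal_add (mul_nonneg (by positivity) (sq_nonneg _)) (by positivity)]
          exact mul_le_mul' (ENNReal.ofReal_le_ofReal (hamgm l)) le_rfl
        · rw [one_false he, mul_zero, zero_mul]
          exact zero_le
    _ ≤ ENNReal.ofReal (v / (2 * U)) * (ENNReal.ofReal (U ^ 2) * Pb (ewt k) stp L x y)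
        + ENNReal.ofReal (U / (2 * v)) * (ENNReal.ofReal (v ^ 2) * Pb (ewt k) stp L x y) := by
        rw [Ex_add, Ex_const_mul, Ex_const_mul]
        refine add_le_add (mul_le_mul' le_rfl hsq) (mul_le_mul' le_rfl (hex.trans ?_))
        exact mul_le_mul' (ENNReal.ofReal_le_ofReal hv2) le_rfl
    _ = ENNReal.ofReal (v * U) * Pb (ewt k) stp L x y := by
        rw [← mul_assoc (ENNReal.ofReal (v / (2 * U))), ← mul_assoc (ENNReal.ofReal (U / (2 * v))),
          ← add_mul, ← ENNReal.ofReal_mul (by positivity),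
          ← ENNReal.ofReal_mul (by positivity), ← ENNReal.ofReal_add (by positivity) (by positivity)]
        congr 2
        field_simp
        ring
    _ ≤ _ := by
        refine mul_le_mul' (ENNReal.ofReal_le_ofReal ?_) le_rfl
        have h1 : D ≤ D ^ A := le_self_pow₀ hD (by omega)
        calc v * U = (2 * K) ^ A * D * momBound L A M * Real.exp (-(c / 2 * h ^ 2)) := by
              rw [hv, hU]; ring
          _ ≤ (2 * K) ^ A * D ^ A * momBound L A M * Real.exp (-(c / 2 * h ^ 2)) := by gcongr
          _ = _ := by rw [mul_pow _ D, neg_mul]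

/-! ### The normalized weights -/

/-- The cumulants, normalized by the powers of the largest parameter. -/
noncomputable def nkappa {K : ℕ} (δ : ℝ) (α : Fin (K + 1) → ℝ) (Lag : Fin (K + 1) → ℕ → ℕ)
    (N l : ℕ) : ℝ :=
  if l = 0 then 1 else kappa δ α Lag N l / α 0 ^ l

/-- After division by `α 0 ^ l` the first summand is `Lag 0 N / N ≥ 1`, while the others decay
geometrically in `l`, uniformly in `N` because convergent sequences are bounded. -/
theorem exists_wt {K : ℕ} {δ : ℝ} (hδ : 0 ≤ δ) {α : Fin (K + 1) → ℝ}
    (hα : StrictAnti fun i => |α i|) (hα_pos : 0 < α 0)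
    {Lag : Fin (K + 1) → ℕ → ℕ} (hLag : ∀ i N, 1 ≤ N → N ≤ Lag i N) {γ : Fin (K + 1) → ℝ}
    (hγ : ∀ i, Filter.Tendsto (fun N : ℕ => (Lag i N : ℝ) / N) Filter.atTop (nhds (γ i)))
    (hκ : ∀ N l : ℕ, 1 ≤ N → 1 ≤ l → 0 ≤ kappa δ α Lag N l) :
    ∃ B l₀, ∀ N, 1 ≤ N → Wt (nkappa δ α Lag N) B l₀ := by
  have hbdd : ∀ i, ∃ b : ℝ, ∀ N, (Lag i N : ℝ) / N ≤ b := fun i => by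
    obtain ⟨b, hb⟩ := (hγ i).bddAbove_range
    exact ⟨b, fun N => hb ⟨N, rfl⟩⟩
  choose b hb using hbdd
  have hb0 : ∀ i, 0 ≤ b i := fun i => le_trans (by positivity) (hb i 0)
  set ρ : Fin (K + 1) → ℝ := fun i => α i / α 0 with hρ
  have hρ0 : ρ 0 = 1 := div_self hα_pos.ne'
  have hρle : ∀ i, |ρ i| ≤ 1 := fun i => by
    have h1 : |α i| ≤ |α 0| := hα.antitone (Fin.zero_le i)
    rw [hρ, abs_div, div_le_one (abs_pos.2 hα_pos.ne')]
    exact h1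
  have hρlt : ∀ i, i ≠ 0 → |ρ i| < 1 := fun i hi => by
    have h1 : |α i| < |α 0| := hα (Fin.pos_of_ne_zero hi)
    rw [hρ, abs_div, div_lt_one (abs_pos.2 hα_pos.ne')]
    exact h1
  have hlim : Filter.Tendsto (fun l : ℕ => ∑ i ∈ Finset.univ.erase (0 : Fin (K + 1)), |ρ i| ^ l * b i)
      Filter.atTop (nhds 0) := by
    have : Filter.Tendsto
        (fun l : ℕ => ∑ i ∈ Finset.univ.erase (0 : Fin (K + 1)), |ρ i| ^ l * b i)
        Filter.atTop (nhds (∑ i ∈ Finset.univ.erase (0 : Fin (K + 1)), 0 * b i)) :=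
      tendsto_finsetSum _ fun i hi =>
        (tendsto_pow_atTop_nhds_zero_of_lt_one (abs_nonneg _)
          (hρlt i (Finset.ne_of_mem_erase hi))).mul_const _
    simpa using this
  -- Beyond `l₁` the other parameters subtract at most `1 / 2`, whatever their signs; the term with
  -- `δ` only helps.
  obtain ⟨l₁, hl₁⟩ := Filter.eventually_atTop.1
    (hlim.eventually (gt_mem_nhds (by norm_num : (0 : ℝ) < 1 / 2)))
  have hform : ∀ N l, 1 ≤ l → nkappa δ α Lag N l
      = (if l = 2 then δ else 0) / α 0 ^ l + ∑ i, ρ i ^ l * ((Lag i N : ℝ) / N) := by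
    intro N l hl
    rw [nkappa, if_neg (by omega), kappa, add_div, Finset.sum_div]
    congr 1
    refine Finset.sum_congr rfl fun i _ => ?_
    rw [hρ, div_pow]
    ring
  have hd0 : ∀ l, 0 ≤ (if l = 2 then δ else 0) / α 0 ^ l := fun l => by
    split_ifs <;> positivity
  refine ⟨1 + (δ / α 0 ^ 2 + ∑ i, b i), l₁ + 1, fun N hN => ⟨by simp [nkappa], ?_, ?_, ?_, by omega⟩⟩
  · intro l
    rcases Nat.eq_zero_or_pos l with h | h
    · subst h; simp [nkappa]
    · rw [nkappa, if_neg (by omega)]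
      exact div_nonneg (hκ N l hN h) (by positivity)
  · intro l
    have hs : 0 ≤ ∑ i, b i := Finset.sum_nonneg fun i _ => hb0 i
    have hd : 0 ≤ δ / α 0 ^ 2 := by positivity
    rcases Nat.eq_zero_or_pos l with h | h
    · subst h
      rw [nkappa, if_pos rfl]
      linarith
    · rw [hform N l h]
      have h1 : (if l = 2 then δ else 0) / α 0 ^ l ≤ δ / α 0 ^ 2 := by
        split_ifs with h2
        · rw [h2]
        · rw [zero_div]; exact hd
      have h2 : ∑ i, ρ i ^ l * ((Lag i N : ℝ) / N) ≤ ∑ i, b i := by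
        refine Finset.sum_le_sum fun i _ => ?_
        have h3 : ρ i ^ l ≤ 1 := by
          refine (le_abs_self _).trans ?_
          rw [abs_pow]
          exact pow_le_one₀ (abs_nonneg _) (hρle i)
        have h4 : (0 : ℝ) ≤ (Lag i N : ℝ) / N := by positivity
        calc _ ≤ 1 * ((Lag i N : ℝ) / N) := by gcongr
          _ ≤ _ := by rw [one_mul]; exact hb i N
      linarith
  · intro l hl
    rw [hform N l (by omega), ← Finset.add_sum_erase _ _ (Finset.mem_univ (0 : Fin (K + 1))), hρ0,
      one_pow, one_mul]
    have h1 : (1 : ℝ) ≤ (Lag 0 N : ℝ) / N := by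
      rw [one_le_div (by exact_mod_cast hN)]
      exact_mod_cast hLag 0 N hN
    have h2 := hl₁ l (by omega)
    have h3 : -∑ i ∈ Finset.univ.erase (0 : Fin (K + 1)), |ρ i| ^ l * b i
        ≤ ∑ i ∈ Finset.univ.erase (0 : Fin (K + 1)), ρ i ^ l * ((Lag i N : ℝ) / N) := by
      rw [← Finset.sum_neg_distrib]
      refine Finset.sum_le_sum fun i _ => ?_
      have h4 : (0 : ℝ) ≤ (Lag i N : ℝ) / N := by positivity
      have h5 : -(|ρ i| ^ l) ≤ ρ i ^ l := by rw [← abs_pow]; exact neg_abs_le _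
      have h6 := mul_le_mul_of_nonneg_right h5 h4
      have h7 := mul_le_mul_of_nonneg_left (hb i N) (pow_nonneg (abs_nonneg (ρ i)) l)
      linarith
    have := hd0 l
    linarith

theorem momBound_eq {L A : ℕ} (hA : 1 ≤ A) (M : ℝ) :
    (A : ℝ) ^ (-(A : ℝ) / 2) * (L : ℝ) ^ ((A : ℝ) / 2) + (A : ℝ) ^ (-(A : ℝ)) * M ^ A
      = momBound L A M := by
  have hAp : (0 : ℝ) < A := by exact_mod_cast hA
  have hLp : (0 : ℝ) ≤ L := Nat.cast_nonneg _
  unfold momBound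
  congr 1
  · rw [Real.sqrt_eq_rpow, ← Real.rpow_natCast, ← Real.rpow_mul (by positivity),
      Real.div_rpow hLp hAp.le, neg_div, Real.rpow_neg hAp.le, one_div_mul_eq_div]
    ring
  · rw [Real.rpow_neg hAp.le, Real.rpow_natCast, div_pow]
    ring

/-- Absorbs the logarithm, which is at least `log 2 > 1 / 2`, and makes the inequality strict. -/
theorem lt_const_log_pow {C K A : ℝ} {n : ℕ} (hn : 1 ≤ n) (hK : 0 ≤ K) (hC : 2 * (K + 1) ≤ C) :
    K ^ n < C ^ n * Real.log (max A 2) ^ n := by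
  have h1 : (1 : ℝ) / 2 ≤ Real.log (max A 2) := by
    have h2 : Real.log 2 ≤ Real.log (max A 2) := Real.log_le_log (by norm_num) (le_max_right _ _)
    linarith [Real.log_two_gt_d9]
  rw [← mul_pow]
  refine pow_lt_pow_left₀ ?_ hK (by omega)
  calc K < 2 * (K + 1) * (1 / 2) := by linarith
    _ ≤ _ := mul_le_mul hC h1 (by norm_num) (by linarith)

theorem ind_add_ind_le {L x y : ℕ} {d : ℝ} (l : List ℕ) :
    ENNReal.ofReal (ind ((walkMax (toPath L x l) : ℝ) > max (x : ℝ) y + d)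
      + ind ((walkMin (toPath L x l) : ℝ) < min (x : ℝ) y - d))
      ≤ 2 * one (Exc L ((y : ℤ) - x) d l) := by
  by_cases he : Exc L ((y : ℤ) - x) d l
  · rw [one_true he, mul_one, show (2 : ℝ≥0∞) = ENNReal.ofReal 2 by simp]
    refine ENNReal.ofReal_le_ofReal ?_
    unfold ind
    split_ifs <;> norm_num
  · have h1 := fun h => he (exc_of_walkMax (L := L) (x := x) (y := y) (l := l) (d := d) h)
    have h2 := fun h => he (exc_of_walkMin (L := L) (x := x) (y := y) (l := l) (d := d) h)
    rw [ind, ind, if_neg h1, if_neg h2]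
    simp

end WalkBridge

/-! ### The moment bounds for the conditioned walk -/

open WalkBridge in
theorem lemma6p4 {K : ℕ} (δ : ℝ) (hδ : 0 ≤ δ)
    (α : Fin (K + 1) → ℝ) (hα : StrictAnti fun i => |α i|) (hα_ne : ∀ i, α i ≠ 0)
    (hα_pos : 0 < α 0)
    (Lag : Fin (K + 1) → ℕ → ℕ) (hLag : ∀ i N, 1 ≤ N → N ≤ Lag i N)
    (γ : Fin (K + 1) → ℝ)
    (hγ : ∀ i, Filter.Tendsto (fun N : ℕ => (Lag i N : ℝ) / N) Filter.atTop (nhds (γ i)))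
    (hκ : ∀ N l : ℕ, 1 ≤ N → 1 ≤ l → 0 ≤ kappa δ α Lag N l) :
    ∃ C > (0 : ℝ), ∃ c > (0 : ℝ),
      ∀ (N : ℕ), 1 ≤ N →
      ∀ z : ℝ, IsCriticalPoint (kappa δ α Lag N) (1 / α 0) z →
      ∀ (x y L : ℕ), 1 ≤ L → 0 < partitionFn (kappa δ α Lag N) z x y L →
      ∀ (k : ℕ), 1 ≤ k → ∀ (X Y : Fin k → Fin (L + 1)), (∀ i, X i < Y i) →
      (∀ i j, i ≠ j → Y i ≤ X j ∨ Y j ≤ X i) →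
      ∀ (a : Fin k → ℕ), (∀ i, 0 < a i) → ∀ A : ℕ, A = ∑ i, a i →
        bridgeExp (kappa δ α Lag N) z x y L
            (fun W => ∏ i, (depth W (X i) (Y i) : ℝ) ^ a i / (a i).factorial)
          < C ^ A * Real.log (max (A : ℝ) 2) ^ A *
            ((A : ℝ) ^ (-(A : ℝ) / 2) * (L : ℝ) ^ ((A : ℝ) / 2)
              + (A : ℝ) ^ (-(A : ℝ)) * max ((x : ℝ) - y) 0 ^ A)
        ∧ ∀ h : ℝ, 0 < h →
          bridgeExp (kappa δ α Lag N) z x y L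
              (fun W => (∏ i, (depth W (X i) (Y i) : ℝ) ^ a i / (a i).factorial) *
                (ind ((walkMax W : ℝ) > max (x : ℝ) y + h * √(L : ℝ))
                  + ind ((walkMin W : ℝ) < min (x : ℝ) y - h * √(L : ℝ))))
            < C ^ A * Real.log (max (A : ℝ) 2) ^ A *
              ((A : ℝ) ^ (-(A : ℝ) / 2) * (L : ℝ) ^ ((A : ℝ) / 2)
                + (A : ℝ) ^ (-(A : ℝ)) * (max ((x : ℝ) - y) 0 + h * √(L : ℝ)) ^ A)
              * Real.exp (-c * h ^ 2) := by
  obtain ⟨B, l₀, hW⟩ := exists_wt hδ hα hα_pos hLag hγ hκ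
  obtain ⟨K₁, hK₁, H₁⟩ := exists_moment_bound B l₀
  obtain ⟨K₂, hK₂, c, hc, H₂⟩ := exists_moment_excursion_bound B l₀
  -- Large enough for `lt_const_log_pow` with base `K₁` and with base `2 * K₂`.
  refine ⟨2 * (K₁ + 2 * K₂ + 1), by positivity, c, hc, ?_⟩
  rintro N hN z ⟨hz, -, -⟩ x y L hL hZ k hk X Y hXY hdisj a ha A rfl
  have hA : 1 ≤ ∑ i, a i :=
    (ha ⟨0, hk⟩).trans_le (Finset.single_le_sum (fun i _ => Nat.zero_le (a i)) (Finset.mem_univ _))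
  have hF0 : ∀ W : Fin (L + 1) → ℤ,
      0 ≤ ∏ i, (depth W (X i) (Y i) : ℝ) ^ a i / (a i).factorial := fun W =>
    Finset.prod_nonneg fun i _ => by
      have h1 : (0 : ℝ) ≤ depth W (X i) (Y i) := by
        exact_mod_cast zero_le_one.trans (one_le_depth W (hXY i).le)
      positivity
  have hk0 : nkappa δ α Lag N 0 = 1 := if_pos rfl
  have hkl : ∀ l, 1 ≤ l → nkappa δ α Lag N l = kappa δ α Lag N l / α 0 ^ l :=
    fun l hl => if_neg (by omega)
  have hx : (0 : ℤ) ≤ (x : ℤ) := Int.natCast_nonneg x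
  have hy : (0 : ℤ) ≤ (y : ℤ) := Int.natCast_nonneg y
  set M : ℝ := max ((x : ℝ) - y) 0 with hM
  have hM0 : 0 ≤ M := le_max_right _ _
  refine ⟨?_, fun h hh => ?_⟩
  · rw [momBound_eq hA]
    have hm := momBound_pos hL hA hM0
    have hb := H₁ _ (hW N hN) L hL x y hx hy k X Y hXY hdisj a ha hA
    rw [Int.cast_natCast, Int.cast_natCast, ← hM] at hb
    refine (bridgeExp_le hz hα_pos (fun l hl => hκ N l hN hl) hk0 hkl hZ (fun W _ => hF0 W)
      (by positivity) hb).trans_lt ?_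
    exact mul_lt_mul_of_pos_right (lt_const_log_pow hA (by linarith) (by linarith)) hm
  · have hd : 0 ≤ h * √(L : ℝ) := by positivity
    rw [momBound_eq hA]
    have hm := momBound_pos hL hA hM0
    have hm' := momBound_pos hL hA (add_nonneg hM0 hd)
    have hb := H₂ _ (hW N hN) L hL x y hx hy k X Y hXY hdisj a ha hA h hh
    rw [Int.cast_natCast, Int.cast_natCast, ← hM] at hb
    have hind : ∀ p, 0 ≤ ind p := fun p => by unfold ind; split_ifs <;> norm_num
    refine (bridgeExp_le (K := 2 * (K₂ ^ (∑ i, a i) * momBound L (∑ i, a i) M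
        * Real.exp (-c * h ^ 2))) hz hα_pos (fun l hl => hκ N l hN hl) hk0 hkl hZ
      (fun W _ => mul_nonneg (hF0 W) (add_nonneg (hind _) (hind _)))
      (by positivity) ?_).trans_lt ?_
    · calc _ ≤ Ex (ewt (nkappa δ α Lag N)) L (fun l => 2 * (ENNReal.ofReal
            (∏ i, (depth (toPath L x l) (X i) (Y i) : ℝ) ^ a i / (a i).factorial)
            * one (Exc L ((y : ℤ) - x) (h * √L) l) * one (Br stp x y l))) := by
            refine Ex_mono _ fun l _ => ?_
            rw [ENNReal.ofReal_mul (hF0 _), ← mul_assoc, mul_left_comm]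
            exact mul_le_mul' (mul_le_mul' le_rfl (ind_add_ind_le l)) le_rfl
        _ ≤ 2 * (ENNReal.ofReal (K₂ ^ (∑ i, a i) * momBound L (∑ i, a i) M
              * Real.exp (-c * h ^ 2)) * Pb (ewt (nkappa δ α Lag N)) stp L x y) := by
            rw [Ex_const_mul]
            exact mul_le_mul' le_rfl hb
        _ = _ := by
            rw [← mul_assoc, ENNReal.ofReal_mul (by norm_num : (0 : ℝ) ≤ 2), ENNReal.ofReal_ofNat]
    · have h2 : (2 : ℝ) ≤ 2 ^ ∑ i, a i := le_self_pow₀ (by norm_num) (by omega)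
      -- The factor `2` from the two indicators goes into `2 ^ A`. The bound already holds with `M`,
      -- and adding `h √L` only weakens it.
      calc 2 * (K₂ ^ (∑ i, a i) * momBound L (∑ i, a i) M * Real.exp (-c * h ^ 2))
          ≤ 2 ^ (∑ i, a i) * (K₂ ^ (∑ i, a i) * momBound L (∑ i, a i) (M + h * √(L : ℝ))
            * Real.exp (-c * h ^ 2)) := by
            gcongr
            exact momBound_mono hM0 (by linarith)
        _ = (2 * K₂) ^ (∑ i, a i) * momBound L (∑ i, a i) (M + h * √(L : ℝ))
            * Real.exp (-c * h ^ 2) := by rw [mul_pow]; ring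
        _ < _ := by
            refine mul_lt_mul_of_pos_right (mul_lt_mul_of_pos_right ?_ hm') (Real.exp_pos _)
            exact lt_const_log_pow hA (by linarith) (by linarith)
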